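/- **Setting.** Let $g_1,\dots,g_N$ be entire functions on $\mathbb{C}^2$ that are real on $\mathbb{R}^2$ and satisfy $\nabla g_k\neq0$ on $\sigma_k=\{g_k=0\}$; put $\sigma=\bigcup_k\sigma_k$ and $\sigma_k'=\sigma_k\cap\mathbb{R}^2$. An integration surface over $D\subseteq\mathbb{R}^2$ is a surface $\{\xi^r+i\eta(\xi^r):\xi^r\in D\}$, with $\eta$ a locally Lipschitz real vector field (e.g. continuous and piecewise smooth) that is nowhere zero or tangent along the traces $\sigma_k'$, and which is flattable: $\xi^r+i\varepsilon\eta(\xi^r)\notin\sigma$ for all $0<\varepsilon\le1$, $\xi^r\in D$. Let $\Gamma$ be an integration surface over $\mathbb{R}^2$, with field $\eta$, and let $\tilde x\in\mathbb{R}^2$, $|\tilde x|=1$, $x=r\tilde x$. A point $\xi\in\mathbb{R}^2$ is inactive if, near $\xi$, $\Gamma$ can be continuously deformed through integration surfaces into one whose field $\eta'$ satisfies $\tilde x\cdot\eta'(\xi)<0$; otherwise it is active. A point $\xi^\star\in\sigma_j'$ is a saddle on the singularity $\sigma_j$ (SOS) with respect to $\tilde x$ if $\frac{d}{d\psi}e^{-ix\cdot\xi(\psi)}=0$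 at $\xi^\star$ for a local holomorphic parametrisation $\xi(\psi)$ of $\sigma_j$. Let $\xi^\star\in\sigma_j'$ lie on no other $\sigma_k$, and let it be an active SOS on $\sigma_j$ with respect to $\tilde x$, with no other active point near it. Put $(a^\star,b^\star)=\nabla g_j(\xi^\star)$, $n^\star=(a^\star,b^\star)/\sqrt{a^{\star2}+b^{\star2}}$, $r^\star=r/\sqrt{a^{\star2}+b^{\star2}}$, $\zeta_1=b^\star(\xi_1-\xi_1^\star)-a^\star(\xi_2-\xi_2^\star)$, $\zeta_2=g_j(\xi)$, $\Lambda=a^\star(\xi_1-\xi_1^\star)+b^\star(\xi_2-\xi_2^\star)$, and let $\alpha\in\mathbb{R}$ be the coefficient with $\zeta_2=\Lambda-\alpha\zeta_1^2+O(\zeta_2^2+\zeta_1\zeta_2+\text{terms of order }3)$ as $\xi\to\xi^\star$. Assume $\alpha\ne0$. Let $s_\Gamma=\operatorname{sign}(n^\star\cdot\eta(\xi^\star))=\pm1$, so that $\Gamma$ bypasses $\sigma_j$ at $\xi^\star$ in the direction $n^\star$ from above ($+1$) or below ($-1$). Let $U\subseteq\mathbb{C}^2$ be an open neighbourhood of $\xi^\star$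 and $\Omega=\{\xi\in U: g_j(\xi)\notin -is_\Gamma[0,\infty)\}$. Assume that the branch of $F$ on $\Omega$ is $F=F_1+F_2$ with $F_2$ holomorphic on $U$ and $F_1$ holomorphic on $\Omega$, and, for constants $A,\mu\in\mathbb{C}$, $F_1(\xi)=(A+o(1))\,g_j(\xi)^{-\mu}$ as $\xi\to\xi^\star$ in $\Omega$. Here $z^{-\mu}$ is the branch on $\mathbb{C}\setminus(-is_\Gamma[0,\infty))$ that equals $e^{-\mu\log z}$, $\log z\in\mathbb R$, for $z>0$. A local deformed surface $\Gamma'_{\rm loc}$ over a compact neighbourhood $B^\star$ of $\xi^\star$ is an integration surface over $B^\star$, with field $\eta'$, that has the same bridge configuration as $\Gamma$ (for every $k$, $\nabla g_k\cdot\eta'$ and $\nabla g_k\cdot\eta$ have the same sign on $\sigma_k'\cap B^\star$), is contained in $\Omega$ together with its scaled surfaces $\varepsilon\eta'$, $0<\varepsilon\le1$, and satisfies $\eta'\cdot\tilde x<0$ over $\partial B^\star$; moreover $B^\star$ contains no active point other than $\xi^\star$. Put $$u_{\rm loc}(x)=\iint_{\Gamma'_{\rm loc}}F(\xi)e^{-ix\cdot\xi}\,d\xi_1\wedge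 d\xi_2 .$$ **Statement.** (1) For real $a\neq0$ the improper integral $\mathcal I(a)=\int_{\mathbb R}e^{-iaz^2}dz$ converges, and equals $e^{-i\pi/4}\sqrt{\pi/a}$ if $a>0$ and $e^{i\pi/4}\sqrt{-\pi/a}$ if $a<0$. (2) For real $a\ne0$, $s=\pm1$, $\operatorname{Re}\mu>0$ and every $\epsilon>0$, the improper integral $\mathcal J(\mu,a;s)=\int_{\mathbb R+is\epsilon}z^{-\mu}e^{-isaz}dz$ (with the branch of $z^{-\mu}$ above, for this $s$) converges, and equals $2\pi e^{-is\mu\pi/2}a^{\mu-1}/\Gamma(\mu)$ if $a>0$ and $0$ if $a<0$. These values are entire in $\mu$ and define $\mathcal J$ for all $\mu\in\mathbb C$ by analytic continuation. (3) $\tilde x=s\,n^\star$ with $s=s_\Gamma\in\{1,-1\}$; local deformed surfaces exist over arbitrarily small neighbourhoods of $\xi^\star$; and for all local deformed surfaces over sufficiently small $B^\star$, as $r\to\infty$, $$u_{\rm loc}(x)=\frac{Ae^{-ix\cdot\xi^\star}}{a^{\star2}+b^{\star2}}\,\mathcal I(sr^\star\alpha)\,\mathcal J(\mu,r^\star;s)+o\big(r^{\operatorname{Re}\mu-3/2}\big),$$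 where the leading term equals $$\frac{2\pi A e^{-ix\cdot\xi^\star}\sqrt\pi\,e^{-is\mu\pi/2}}{(a^{\star2}+b^{\star2})\Gamma(\mu)}\Big(\frac r{\sqrt{a^{\star2}+b^{\star2}}}\Big)^{\mu-3/2}\times\begin{cases}e^{-i\pi/4}/\sqrt{s\alpha}&s\alpha>0\\ e^{i\pi/4}/\sqrt{-s\alpha}&s\alpha<0.\end{cases}$$ (4) If $A\neq0$ and $\mu\notin\{0,-1,-2,\dots\}$, then $u_{\rm loc}(x)$ is asymptotically equivalent to this leading term, $|u_{\rm loc}(x)|$ is of exact order $r^{\operatorname{Re}\mu-3/2}$, and $u_{\rm loc}$ is not exponentially small: $\xi^\star$ is contributing. -/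

import Mathlib

open Filter Topology MeasureTheory Set Asymptotics

noncomputable section

/-- The inclusion of the real plane `ℝ²` in `ℂ²`. -/
def toC (p : ℝ × ℝ) : ℂ × ℂ := ((p.1 : ℂ), (p.2 : ℂ))

/-- Scalar product of two real vectors. -/
def dotR (x y : ℝ × ℝ) : ℝ := x.1 * y.1 + x.2 * y.2

/-- `x · ξ` for `x ∈ ℝ²` and `ξ ∈ ℂ²`. -/
def dotC (x : ℝ × ℝ) (ξ : ℂ × ℂ) : ℂ := (x.1 : ℂ) * ξ.1 + (x.2 : ℂ) * ξ.2

/-- The defining function `g` is entire, its zero set has no singular point, and it is real on the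
real plane. -/
structure HasRealProperty (g : ℂ × ℂ → ℂ) : Prop where
  entire : Differentiable ℂ g
  regular : ∀ ξ, g ξ = 0 → fderiv ℂ g ξ ≠ 0
  real : ∀ p : ℝ × ℝ, (g (toC p)).im = 0

/-- The singularity set `σ = ⋃ σ_j`, with `σ_j = {g_j = 0}`. -/
def singSet {ι : Type*} (g : ι → ℂ × ℂ → ℂ) : Set (ℂ × ℂ) := {ξ | ∃ j, g j ξ = 0}

/-- `(∂g/∂ξ₁, ∂g/∂ξ₂)` at a real point; the derivatives are real there for a function with the real
property. -/
def realGrad (g : ℂ × ℂ → ℂ) (p : ℝ × ℝ) : ℝ × ℝ :=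
  ((fderiv ℂ g (toC p) (1, 0)).re, (fderiv ℂ g (toC p) (0, 1)).re)

/-- `a² + b²`, where `(a, b)` is the gradient of `g` at `p`. -/
def gradSq (g : ℂ × ℂ → ℂ) (p : ℝ × ℝ) : ℝ := (realGrad g p).1 ^ 2 + (realGrad g p).2 ^ 2

/-- The unit normal `n = (a, b) / √(a² + b²)` to the real trace of `{g = 0}` at `p`. -/
def unitNormal (g : ℂ × ℂ → ℂ) (p : ℝ × ℝ) : ℝ × ℝ := (Real.sqrt (gradSq g p))⁻¹ • realGrad g p

/-- The surface described by the vector field `η`: the point `p + i η(p)` above `p ∈ ℝ²`. -/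
def surf (η : ℝ × ℝ → ℝ × ℝ) (p : ℝ × ℝ) : ℂ × ℂ :=
  ((p.1 : ℂ) + Complex.I * ((η p).1 : ℂ), (p.2 : ℂ) + Complex.I * ((η p).2 : ℂ))

/-- The complex Jacobian determinant of `p ↦ p + i η(p)`, so that `dξ₁ ∧ dξ₂` pulls back to
`surfJac η p dp₁ dp₂`. -/
def surfJac (η : ℝ × ℝ → ℝ × ℝ) (p : ℝ × ℝ) : ℂ :=
  (1 + Complex.I * ((fderiv ℝ η p (1, 0)).1 : ℂ)) * (1 + Complex.I * ((fderiv ℝ η p (0, 1)).2 : ℂ))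
    - (Complex.I * ((fderiv ℝ η p (0, 1)).1 : ℂ)) * (Complex.I * ((fderiv ℝ η p (1, 0)).2 : ℂ))

/-- The vector fields that describe integration surfaces over `D ⊆ ℝ²`: locally Lipschitz (this
covers the continuous piecewise smooth fields), flattable with respect to the singularity set, and
nowhere zero or tangent along the real traces. -/
structure IsAdmissible {ι : Type*} (g : ι → ℂ × ℂ → ℂ) (D : Set (ℝ × ℝ)) (η : ℝ × ℝ → ℝ × ℝ) :
    Prop where
  lipschitz : LocallyLipschitz η
  flattable : ∀ ε : ℝ, 0 < ε → ε ≤ 1 → ∀ p ∈ D, surf (ε • η) p ∉ singSet g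
  nontangent : ∀ j, ∀ p ∈ D, g j (toC p) = 0 → dotR (realGrad (g j) p) (η p) ≠ 0

/-- The point `p` is inactive for the surface `Γ` (given by `η`) and the direction `x`: near `p`,
`Γ` can be deformed continuously, through integration surfaces that do not meet the singularities,
into a surface with field `η'` such that `x · η'(p) < 0`. -/
def IsInactive {ι : Type*} (g : ι → ℂ × ℂ → ℂ) (η : ℝ × ℝ → ℝ × ℝ) (x p : ℝ × ℝ) : Prop :=
  ∃ V ∈ 𝓝 p, ∃ H : ℝ → ℝ × ℝ → ℝ × ℝ,
    ContinuousOn (fun q : ℝ × (ℝ × ℝ) => H q.1 q.2) (Icc (0 : ℝ) 1 ×ˢ V) ∧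
    (∀ q ∈ V, H 0 q = η q) ∧
    (∀ t ∈ Icc (0 : ℝ) 1, IsAdmissible g V (H t)) ∧
    dotR x (H 1 p) < 0

/-- A point that is not inactive is active. -/
def IsActive {ι : Type*} (g : ι → ℂ × ℂ → ℂ) (η : ℝ × ℝ → ℝ × ℝ) (x p : ℝ × ℝ) : Prop :=
  ¬ IsInactive g η x p

/-- `p` is a saddle on the singularity `{g = 0}` (SOS) with respect to the direction `x`: for a
local holomorphic parametrisation `φ` of `{g = 0}` with `φ z = p`, and every `r > 0`, the derivative
of `w ↦ exp (-i r x · φ(w))` vanishes at `z`. -/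
def IsSOS (g : ℂ × ℂ → ℂ) (x p : ℝ × ℝ) : Prop :=
  ∃ (φ : ℂ → ℂ × ℂ) (z : ℂ), AnalyticAt ℂ φ z ∧ φ z = toC p ∧ deriv φ z ≠ 0 ∧
    (∀ᶠ w in 𝓝 z, g (φ w) = 0) ∧
    ∀ r : ℝ, 0 < r → deriv (fun w => Complex.exp (-(Complex.I * dotC (r • x) (φ w)))) z = 0

/-- `ζ₁ = b (ξ₁ - p₁) - a (ξ₂ - p₂)`. -/
def zetaOne (g : ℂ × ℂ → ℂ) (p : ℝ × ℝ) (ξ : ℂ × ℂ) : ℂ :=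
  ((realGrad g p).2 : ℂ) * (ξ.1 - p.1) - ((realGrad g p).1 : ℂ) * (ξ.2 - p.2)

/-- `Λ = a (ξ₁ - p₁) + b (ξ₂ - p₂)`. -/
def linPart (g : ℂ × ℂ → ℂ) (p : ℝ × ℝ) (ξ : ℂ × ℂ) : ℂ :=
  ((realGrad g p).1 : ℂ) * (ξ.1 - p.1) + ((realGrad g p).2 : ℂ) * (ξ.2 - p.2)

/-- `α` is the curvature coefficient at `p`: with `ζ₂ = g(ξ)`,
`ζ₂ = Λ - α ζ₁² + O(ζ₂² + ζ₁ ζ₂ + terms of order 3)` as `ξ → p`. -/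
def IsCurvatureCoeff (g : ℂ × ℂ → ℂ) (p : ℝ × ℝ) (α : ℝ) : Prop :=
  (fun ξ : ℂ × ℂ => g ξ - (linPart g p ξ - (α : ℂ) * zetaOne g p ξ ^ 2)) =O[𝓝 (toC p)]
    (fun ξ : ℂ × ℂ => ‖g ξ‖ ^ 2 + ‖zetaOne g p ξ‖ * ‖g ξ‖ + ‖ξ - toC p‖ ^ 3)

/-- The side on which the surface given by `η` bypasses `{g = 0}` at `p`, in the direction of the
normal `n`: `1` for "from above", `-1` for "from below". -/
def bridgeSign (g : ℂ × ℂ → ℂ) (η : ℝ × ℝ → ℝ × ℝ) (p : ℝ × ℝ) : ℝ :=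
  Real.sign (dotR (realGrad g p) (η p))

/-- For `s = ± 1`, the half-line `-i s [0, ∞)`. -/
def cut (s : ℝ) : Set ℂ := {z | z.re = 0 ∧ s * z.im ≤ 0}

/-- For `s = ± 1`, the branch of `z ^ ν` on `ℂ ∖ cut s` that is positive (`|z| ^ ν`) for `z > 0` (and
`ν` real); it is reached from the real axis by bypassing `0` from above if `s = 1`, from below if
`s = -1`. -/
def branchPow (s : ℝ) (z ν : ℂ) : ℂ :=
  Complex.exp (ν * (Complex.I * s * (Real.pi / 2))) * (z / (Complex.I * s)) ^ ν

/-- The part of `U` on which the branch of the integrand is defined: the points whose `g`-value is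
not on the half-line that starts at the singularity and leaves it on the side opposite to the
surface. -/
def slitDomain (g : ℂ × ℂ → ℂ) (s : ℝ) (U : Set (ℂ × ℂ)) : Set (ℂ × ℂ) := {ξ ∈ U | g ξ ∉ cut s}

/-- The local deformed surface `Γ'_loc` over the compact neighbourhood `B` of `p`, with field `η'`:
it is an integration surface with the same bridge configuration as `Γ` (given by `η`), it lies with
all its flattenings in the domain `Ω` of the integrand, no other point of `B` is active, and
`η' · x < 0` over the boundary of `B`. -/
structure IsLocalSurface {ι : Type*} (g : ι → ℂ × ℂ → ℂ) (η : ℝ × ℝ → ℝ × ℝ) (Ω : Set (ℂ × ℂ))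
    (x p : ℝ × ℝ) (B : Set (ℝ × ℝ)) (η' : ℝ × ℝ → ℝ × ℝ) : Prop where
  compact : IsCompact B
  mem_interior : p ∈ interior B
  admissible : IsAdmissible g B η'
  same_bridge : ∀ j, ∀ q ∈ B, g j (toC q) = 0 → bridgeSign (g j) η' q = bridgeSign (g j) η q
  in_domain : ∀ ε : ℝ, 0 < ε → ε ≤ 1 → ∀ q ∈ B, surf (ε • η') q ∈ Ω
  no_other_active : ∀ q ∈ B, q ≠ p → ¬ IsActive g η x q
  boundary : ∀ q ∈ frontier B, dotR (η' q) x < 0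

/-- `F(ξ) e^{-i x·ξ} dξ₁ ∧ dξ₂` pulled back to the real plane by `p ↦ p + i η'(p)`. -/
def localIntegrand (F : ℂ × ℂ → ℂ) (η' : ℝ × ℝ → ℝ × ℝ) (x q : ℝ × ℝ) : ℂ :=
  F (surf η' q) * Complex.exp (-(Complex.I * dotC x (surf η' q))) * surfJac η' q

/-- `u_loc(x) = ∬_{Γ'_loc} F(ξ) e^{-i x·ξ} dξ₁ ∧ dξ₂`. -/
def uLoc (F : ℂ × ℂ → ℂ) (B : Set (ℝ × ℝ)) (η' : ℝ × ℝ → ℝ × ℝ) (x : ℝ × ℝ) : ℂ :=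
  ∫ q in B, localIntegrand F η' x q

/-- `v` is the value of the improper integral `𝓘(a) = ∫_ℝ e^{-i a z²} dz`. -/
def HasIntegralI (a : ℝ) (v : ℂ) : Prop :=
  Tendsto (fun R : ℝ × ℝ => ∫ z in (-R.1)..R.2, Complex.exp (-(Complex.I * a * (z : ℂ) ^ 2)))
    (atTop ×ˢ atTop) (𝓝 v)

/-- `v` is the value of the improper integral `𝓙(μ, a; s)` of `z ^ (-μ) e^{-i s a z}` along the line
`ℝ + i s ε`. -/
def HasIntegralJ (μ : ℂ) (a s ε : ℝ) (v : ℂ) : Prop :=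
  Tendsto (fun R : ℝ × ℝ => ∫ t in (-R.1)..R.2,
      branchPow s ((t : ℂ) + Complex.I * s * ε) (-μ) *
        Complex.exp (-(Complex.I * s * a * ((t : ℂ) + Complex.I * s * ε))))
    (atTop ×ˢ atTop) (𝓝 v)

/-- The closed form of `𝓘(a)`, `a ≠ 0`. -/
def closedI (a : ℝ) : ℂ :=
  if 0 < a then Complex.exp (-(Complex.I * Real.pi / 4)) * (Real.sqrt (Real.pi / a) : ℂ)
  else Complex.exp (Complex.I * Real.pi / 4) * (Real.sqrt (-Real.pi / a) : ℂ)

/-- The closed form of `𝓙(μ, a; s)`, `a ≠ 0`; at the poles of `Γ` Mathlib's conventions give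
`1 / Γ(μ) = 0`, which is the correct value of the entire function `1 / Γ`. -/
def closedJ (μ : ℂ) (a s : ℝ) : ℂ :=
  if 0 < a then
    2 * Real.pi * Complex.exp (-(Complex.I * s * μ * Real.pi / 2)) * (a : ℂ) ^ (μ - 1)
      / Complex.Gamma μ
  else 0

/-- `r⋆ = r / √(a² + b²)`. -/
def rStar (g : ℂ × ℂ → ℂ) (p : ℝ × ℝ) (r : ℝ) : ℝ := r / Real.sqrt (gradSq g p)

/-- `A e^{-i x·ξ⋆} / (a² + b²) · 𝓘(s r⋆ α) · 𝓙(μ, r⋆; s)` at `x = r x̃`. -/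
def leadingIJ (g : ℂ × ℂ → ℂ) (x p : ℝ × ℝ) (A μ : ℂ) (α s r : ℝ) : ℂ :=
  A * Complex.exp (-(Complex.I * dotC (r • x) (toC p))) / (gradSq g p : ℂ)
    * closedI (s * rStar g p r * α) * closedJ μ (rStar g p r) s

/-- The same term, written out in powers of `r`. -/
def leadingExplicit (g : ℂ × ℂ → ℂ) (x p : ℝ × ℝ) (A μ : ℂ) (α s r : ℝ) : ℂ :=
  2 * Real.pi * A * Complex.exp (-(Complex.I * dotC (r • x) (toC p))) * (Real.sqrt Real.pi : ℂ)
      * Complex.exp (-(Complex.I * s * μ * Real.pi / 2)) / ((gradSq g p : ℂ) * Complex.Gamma μ)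
    * ((r / Real.sqrt (gradSq g p) : ℝ) : ℂ) ^ (μ - 3 / 2)
    * (if 0 < s * α then Complex.exp (-(Complex.I * Real.pi / 4)) / (Real.sqrt (s * α) : ℂ)
       else Complex.exp (Complex.I * Real.pi / 4) / (Real.sqrt (-(s * α)) : ℂ))

/-- `u(r)` vanishes exponentially as `r → ∞`. -/
def IsExpSmall (u : ℝ → ℂ) : Prop :=
  ∃ c : ℝ, 0 < c ∧ u =O[atTop] (fun r => Real.exp (-(c * r)))

end

/-!
The asymptotics of a two-dimensional oscillatory integral at a saddle on a singularity.

*Direction.* At a saddle on `{g = 0}` the observation direction `x` is normal to the trace. At an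
active point the field of the surface satisfies `x · η ≥ 0`, since otherwise the constant deformation
would show that the point is inactive. So `x` is the unit normal on the side on which the surface
passes the singularity (`eq_bridgeSign_smul_unitNormal`).

*Normal coordinates.* In the coordinates `(z, w) = (ζ₁, Λ)` at the saddle (`fromNormal`) the phase is
`e^{-i s ρ w}` with `ρ = r⋆`, and the defining function is `w - α z² + …`, with error bounds for the
values and for the first derivatives (`exists_normalFormBound`). An explicit surface, `model`, turns
`z` by the angle `± π / 4` and lets `w` run along a broken line that passes the origin at a small
height and bends into the region of decay. Its flattenings avoid the cut (`exists_modelRegion`).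

*Deformation.* Cauchy's theorem holds for Lipschitz surfaces (`setIntegral_surf_add_eq`): the
derivative of the integral along a deformation is the integral of an exact form, and the wedge product
of the differentials of two Lipschitz functions, one of them with compact support, has integral zero
even though second derivatives need not exist. The fields of a local surface and of the model cross
the trace in the same direction; after sufficient flattening they can therefore be joined by convex
combinations inside the domain of the integrand. This deforms every local surface to one that is the
model surface near the saddle and stays in the region of decay elsewhere
(`exists_deformation_to_model`).

*Limit.* The part away from the saddle is exponentially small, and so is the whole contribution of
the holomorphic component of the integrand, for which the surface can be pushed across the singularity
(`exists_regular_bound`). Near the saddle the height of the model surface is lowered to `1 / ρ`, and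
the scaling `z ~ ρ^{-1/2}`, `w ~ ρ^{-1}` turns the integral into one that converges by dominated
convergence (`tendsto_integral_innerIntegrand`). The limit factors into a Gaussian integral, which is
the Fresnel integral after rotation, and Hankel's integral on a broken line (`integral_limitDensity`,
`integral_hankel`). On the broken line it converges absolutely for every exponent, so no restriction
on `μ` is needed.

*Existence and values.* The model surface over a small square in normal coordinates is itself a local
deformed surface (`exists_isLocalSurface`). The Fresnel integral is found by rotation of the contour
(`hasIntegralI_closedI`). The Hankel integral is an inverse Laplace transform, by Fourier inversion
for `Re μ > 1` and by an integration by parts for `Re μ > 0` (`hasIntegralJ_closedJ`).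
-/

noncomputable section

/-! ### Contour integrals along segments -/

lemma exists_primitive {S : Set ℂ} (hc : Convex ℝ S) (ho : IsOpen S) {f : ℂ → ℂ}
    (hf : DifferentiableOn ℂ f S) : ∃ Φ : ℂ → ℂ, ∀ z ∈ S, HasDerivAt Φ (f z) z := by
  obtain ⟨Φ, h⟩ := hc.exists_forall_hasDerivWithinAt hf
  exact ⟨Φ, fun z hz => (h z hz).hasDerivAt (ho.mem_nhds hz)⟩

/-- The fundamental theorem of calculus along the segment from `z` to `z + R d`. -/
lemma integral_segment_eq {S : Set ℂ} {f Φ : ℂ → ℂ} (hf : ContinuousOn f S)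
    (hΦ : ∀ z ∈ S, HasDerivAt Φ (f z) z) (z d : ℂ) (R : ℝ)
    (h : ∀ t ∈ Set.uIcc 0 R, z + d * (t : ℂ) ∈ S) :
    ∫ t in (0 : ℝ)..R, f (z + d * (t : ℂ)) * d = Φ (z + d * R) - Φ z := by
  have h1 : ∀ t ∈ Set.uIcc 0 R,
      HasDerivAt (fun t : ℝ => Φ (z + d * (t : ℂ))) (f (z + d * (t : ℂ)) * d) t := by
    intro t ht
    have h2 : HasDerivAt (fun t : ℝ => z + d * (t : ℂ)) d t := by
      simpa using ((Complex.ofRealCLM.hasDerivAt (x := t)).const_mul d).const_add z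
    exact (hΦ _ (h t ht)).comp_of_eq t h2 rfl
  rw [intervalIntegral.integral_eq_sub_of_hasDerivAt h1]
  · simp
  · apply ContinuousOn.intervalIntegrable
    exact (hf.comp (by fun_prop) h).mul continuousOn_const

lemma integral_exp_neg_mul_le {b : ℝ} (hb : 0 < b) :
    ∫ t in (0 : ℝ)..1, Real.exp (-(b * t)) ≤ 1 / b := by
  have h1 : ∀ t ∈ Set.uIcc (0 : ℝ) 1,
      HasDerivAt (fun t : ℝ => -Real.exp (-(b * t)) / b) (Real.exp (-(b * t))) t := by
    intro t _
    have := (((hasDerivAt_id t).const_mul b).neg.exp.neg).div_const b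
    refine this.congr_deriv ?_
    simp only [id, Pi.neg_apply]
    field_simp
  rw [intervalIntegral.integral_eq_sub_of_hasDerivAt h1
    (by apply Continuous.intervalIntegrable; fun_prop)]
  simp
  have : 0 < Real.exp (-b) / b := by positivity
  rw [neg_div, neg_div, inv_eq_one_div]
  linarith

/-- A segment along which the integrand decays like `exp (-b t)` contributes at most `C / b`. -/
lemma norm_integral_segment_le {f : ℝ → ℂ} {C b : ℝ} (hb : 0 < b) (hC : 0 ≤ C)
    (h : ∀ t ∈ Set.Icc (0 : ℝ) 1, ‖f t‖ ≤ C * Real.exp (-(b * t))) :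
    ‖∫ t in (0 : ℝ)..1, f t‖ ≤ C / b := by
  have h2 := intervalIntegral.norm_integral_le_of_norm_le (μ := volume) (f := f)
    (g := fun t => C * Real.exp (-(b * t))) zero_le_one
    (Filter.Eventually.of_forall fun t ht => h t ⟨ht.1.le, ht.2⟩)
    (by apply Continuous.intervalIntegrable; fun_prop)
  refine h2.trans ?_
  rw [intervalIntegral.integral_const_mul, div_eq_mul_one_div]
  exact mul_le_mul_of_nonneg_left (integral_exp_neg_mul_le hb) hC

/-! ### The Fresnel integral -/

lemma exp_neg_I_pi_div_four : Complex.exp (-(Complex.I * Real.pi / 4))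
    = (1 - Complex.I) / (Real.sqrt 2 : ℂ) := by
  have h : -(Complex.I * Real.pi / 4) = ((-(Real.pi / 4) : ℝ) : ℂ) * Complex.I := by
    push_cast; ring
  rw [h, Complex.exp_mul_I, ← Complex.ofReal_cos, ← Complex.ofReal_sin, Real.cos_neg,
    Real.sin_neg, Real.cos_pi_div_four, Real.sin_pi_div_four]
  have h2 : ((Real.sqrt 2 : ℝ) : ℂ) ≠ 0 := by
    simp
  have h3 : ((Real.sqrt 2 : ℝ) : ℂ) * (Real.sqrt 2 : ℝ) = 2 := by
    rw [← Complex.ofReal_mul]; simp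
  field_simp
  push_cast
  linear_combination (1 - Complex.I) / 2 * h3

lemma exp_I_pi_div_four : Complex.exp (Complex.I * Real.pi / 4)
    = (1 + Complex.I) / (Real.sqrt 2 : ℂ) := by
  have h : (Complex.I * Real.pi / 4) = ((Real.pi / 4 : ℝ) : ℂ) * Complex.I := by
    push_cast; ring
  rw [h, Complex.exp_mul_I, ← Complex.ofReal_cos, ← Complex.ofReal_sin,
    Real.cos_pi_div_four, Real.sin_pi_div_four]
  have h2 : ((Real.sqrt 2 : ℝ) : ℂ) ≠ 0 := by
    simp
  have h3 : ((Real.sqrt 2 : ℝ) : ℂ) * (Real.sqrt 2 : ℝ) = 2 := by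
    rw [← Complex.ofReal_mul]; simp
  field_simp
  push_cast
  linear_combination (1 + Complex.I) / 2 * h3

/-- The closed form of the Fresnel integral as the Gaussian integral along the line of steepest
descent, whose direction is `1 - i sign a`. -/
lemma closedI_eq {a τ : ℝ} (hτ : τ = 1 ∨ τ = -1) (ha : 0 < τ * a) :
    closedI a = (1 - Complex.I * τ) * (Real.sqrt (Real.pi / (2 * (τ * a))) : ℂ) := by
  have h2 : ((Real.sqrt 2 : ℝ) : ℂ) ≠ 0 := by simp
  have key : ∀ b : ℝ, 0 < b → Real.sqrt (Real.pi / (2 * b)) = Real.sqrt (Real.pi / b) / Real.sqrt 2 := by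
    intro b hb
    rw [← Real.sqrt_div (by positivity)]
    congr 1; field_simp
  rw [key _ ha]
  unfold closedI
  rcases hτ with rfl | rfl
  · rw [if_pos (by linarith), exp_neg_I_pi_div_four]
    push_cast
    simp only [one_mul]
    field_simp
  · rw [if_neg (by linarith), exp_I_pi_div_four]
    have : Real.pi / (-1 * a) = -Real.pi / a := by
      rw [neg_one_mul, div_neg, neg_div]
    rw [this]
    push_cast
    field_simp
    ring

/-- The half-line is rotated to the direction `1 - i τ`, along which `e^{-i a z²}` is a Gaussian; the
vertical segment that closes the triangle contributes `O(1 / R)`. -/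
lemma tendsto_fresnel_half {a τ : ℝ} (hτ : τ = 1 ∨ τ = -1) (ha : 0 < τ * a) :
    Tendsto (fun R : ℝ => ∫ z in (0 : ℝ)..R, Complex.exp (-(Complex.I * a * (z : ℂ) ^ 2)))
      atTop (𝓝 (closedI a / 2)) := by
  set f : ℂ → ℂ := fun z => Complex.exp (-(Complex.I * a * z ^ 2)) with hfdef
  have hfd : Differentiable ℂ f := by fun_prop
  obtain ⟨Φ, hΦ⟩ := exists_primitive convex_univ isOpen_univ hfd.differentiableOn
  have hfc : ContinuousOn f univ := hfd.continuous.continuousOn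
  have hττ : τ * τ = 1 := by rcases hτ with rfl | rfl <;> norm_num
  have hττC : (τ : ℂ) * τ = 1 := by exact_mod_cast hττ
  set d : ℂ := 1 - Complex.I * τ with hd
  have hd2 : d ^ 2 = -2 * Complex.I * τ := by
    rw [hd]; linear_combination (τ:ℂ)*τ*Complex.I_sq - hττC
  -- the rotated ray
  have h1 : Tendsto (fun R : ℝ => ∫ t in (0 : ℝ)..R, f (0 + d * (t : ℂ)) * d) atTop
      (𝓝 (closedI a / 2)) := by
    have hval : ∀ t : ℝ, f (0 + d * (t : ℂ)) = ((Real.exp (-(2 * (τ * a)) * t ^ 2) : ℝ) : ℂ) := by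
      intro t
      simp only [hfdef, zero_add, mul_pow, hd2]
      push_cast
      congr 1
      linear_combination (2 * τ * a * t^2 : ℂ) * Complex.I_sq
    have hint : IntegrableOn (fun t : ℝ => f (0 + d * (t : ℂ)) * d) (Ioi 0) := by
      apply Integrable.mul_const
      simp_rw [hval]
      exact ((integrable_exp_neg_mul_sq (by linarith : 0 < 2 * (τ * a))).ofReal).integrableOn
    have := intervalIntegral_tendsto_integral_Ioi 0 hint tendsto_id
    convert this using 2
    · rfl
    rw [integral_mul_const]
    simp_rw [hval]
    rw [integral_complex_ofReal, integral_gaussian_Ioi, closedI_eq hτ ha, ← hd]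
    push_cast
    ring
  -- the connecting segment
  have h2 : Tendsto (fun R : ℝ => ∫ t in (0 : ℝ)..1, f (R + (-(Complex.I * τ * R)) * (t : ℂ))
      * (-(Complex.I * τ * R))) atTop (𝓝 0) := by
    have hb : ∀ R : ℝ, 0 < R → ‖∫ t in (0 : ℝ)..1, f (R + (-(Complex.I * τ * R)) * (t : ℂ))
      * (-(Complex.I * τ * R))‖ ≤ 1 / (2 * (τ * a)) * R⁻¹ := by
      intro R hR
      have := norm_integral_segment_le (f := fun t : ℝ => f (R + (-(Complex.I * τ * R)) * (t : ℂ))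
        * (-(Complex.I * τ * R))) (C := R) (b := 2 * (τ * a) * R ^ 2) (by positivity) hR.le ?_
      · refine this.trans (le_of_eq ?_)
        field_simp
      · intro t ht
        have hn : ‖(-(Complex.I * τ * R) : ℂ)‖ = R := by
          rcases hτ with rfl | rfl <;> simp [abs_of_pos hR]
        rw [norm_mul, hn, mul_comm]
        refine mul_le_mul_of_nonneg_left ?_ hR.le
        simp only [hfdef, Complex.norm_exp]
        apply le_of_eq
        congr 1
        have : -(Complex.I * a * (R + (-(Complex.I * τ * R)) * (t : ℂ)) ^ 2)
          = ((-(2 * (τ * a) * R ^ 2 * t) : ℝ) : ℂ)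
            + ((-(a * (R ^ 2 - R ^ 2 * t ^ 2)) : ℝ) : ℂ) * Complex.I := by
          push_cast
          linear_combination (2*τ*a*R^2*t - Complex.I*a*τ*τ*R^2*t^2)*Complex.I_sq
            + Complex.I*a*R^2*t^2*hττC
        rw [this, Complex.add_re, Complex.re_ofReal_mul, Complex.ofReal_re, Complex.I_re]
        ring
    refine squeeze_zero_norm' ((eventually_gt_atTop 0).mono hb) ?_
    simpa using tendsto_inv_atTop_zero.const_mul (1 / (2 * (τ * a)))
  have h3 := h1.sub h2
  rw [sub_zero] at h3
  refine h3.congr fun R => ?_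
  rw [integral_segment_eq hfc hΦ _ _ _ (fun _ _ => mem_univ _),
    integral_segment_eq hfc hΦ _ _ _ (fun _ _ => mem_univ _)]
  have h4 := integral_segment_eq hfc hΦ 0 1 R (fun _ _ => mem_univ _)
  simp only [mul_one, one_mul, zero_add] at h4
  change _ = ∫ z in (0 : ℝ)..R, f z
  rw [h4, hd]
  simp only [Complex.ofReal_one, mul_one, zero_add]
  ring_nf

lemma hasIntegralI_closedI {a : ℝ} (ha : a ≠ 0) : HasIntegralI a (closedI a) := by
  obtain ⟨τ, hτ, hτa⟩ : ∃ τ : ℝ, (τ = 1 ∨ τ = -1) ∧ 0 < τ * a := by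
    rcases ha.lt_or_gt with h | h
    · exact ⟨-1, Or.inr rfl, by linarith⟩
    · exact ⟨1, Or.inl rfl, by linarith⟩
  have h := tendsto_fresnel_half hτ hτa
  have h2 := (h.comp tendsto_fst).add (h.comp (tendsto_snd (f := (atTop : Filter ℝ))))
  rw [add_halves] at h2
  refine h2.congr fun R => ?_
  have hc : ∀ u v : ℝ, IntervalIntegrable
      (fun z : ℝ => Complex.exp (-(Complex.I * a * (z : ℂ) ^ 2))) volume u v := fun u v => by
    apply Continuous.intervalIntegrable; fun_prop
  rw [← intervalIntegral.integral_add_adjacent_intervals (hc (-R.1) 0) (hc 0 R.2)]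
  simp only [Function.comp]
  congr 1
  have := intervalIntegral.integral_comp_neg (a := -R.1) (b := 0)
    (fun z : ℝ => Complex.exp (-(Complex.I * a * (z : ℂ) ^ 2)))
  simp only [neg_zero, neg_neg, Complex.ofReal_neg, neg_sq] at this
  exact this.symm

/-! ### The Hankel integral -/

lemma norm_cpow_le_rpow_mul_exp (z w : ℂ) :
    ‖z ^ w‖ ≤ ‖z‖ ^ w.re * Real.exp (Real.pi * |w.im|) := by
  refine (Complex.norm_cpow_le z w).trans ?_
  rw [div_eq_mul_inv, ← Real.exp_neg]
  refine mul_le_mul_of_nonneg_left (Real.exp_le_exp.mpr ?_) (by positivity)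
  calc -(z.arg * w.im) ≤ |z.arg * w.im| := neg_le_abs _
    _ = |z.arg| * |w.im| := abs_mul _ _
    _ ≤ _ := mul_le_mul_of_nonneg_right (Complex.abs_arg_le_pi z) (abs_nonneg _)

/-- The Laplace transform of `t ^ (ν - 1)` at a complex `r`. Mathlib has it for real `r`; both sides
are holomorphic in the right half-plane. -/
lemma laplace_cpow {ν : ℂ} (hν : 0 < ν.re) {r : ℂ} (hr : 0 < r.re) :
    ∫ t in Ioi (0 : ℝ), (t : ℂ) ^ (ν - 1) * Complex.exp (-(r * t)) = r ^ (-ν) * Complex.Gamma ν := by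
  set H : Set ℂ := {r : ℂ | 0 < r.re} with hH
  have hHo : IsOpen H := isOpen_lt continuous_const Complex.continuous_re
  have hHc : Convex ℝ H := convex_halfSpace_re_gt 0
  have hbound : ∀ p : ℝ, -1 < p → ∀ b : ℝ, 0 < b →
      IntegrableOn (fun t : ℝ => t ^ p * Real.exp (-b * t)) (Ioi 0) := by
    intro p hp b hb
    simpa using integrableOn_rpow_mul_exp_neg_mul_rpow hp zero_lt_one hb
  have hmeas : ∀ (q r : ℂ), AEStronglyMeasurable
      (fun t : ℝ => (t : ℂ) ^ q * Complex.exp (-(r * t))) (volume.restrict (Ioi 0)) := by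
    intro q r
    apply ContinuousOn.aestronglyMeasurable _ measurableSet_Ioi
    intro t ht
    apply ContinuousAt.continuousWithinAt
    refine ContinuousAt.mul ?_ (by fun_prop)
    exact (Complex.continuousAt_ofReal_cpow_const _ _ (Or.inr (ne_of_gt ht)))
  have hnorm : ∀ (q r : ℂ) (t : ℝ), 0 < t → ‖(t : ℂ) ^ q * Complex.exp (-(r * t))‖
      = t ^ q.re * Real.exp (-r.re * t) := by
    intro q r t ht
    rw [norm_mul, Complex.norm_cpow_eq_rpow_re_of_pos ht, Complex.norm_exp]
    simp
  -- differentiation under the integral sign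
  have hdiff : ∀ r ∈ H, HasDerivAt
      (fun r : ℂ => ∫ t in Ioi (0 : ℝ), (t : ℂ) ^ (ν - 1) * Complex.exp (-(r * t)))
      (∫ t in Ioi (0 : ℝ), -((t : ℂ) ^ ν * Complex.exp (-(r * t)))) r := by
    intro r0 hr0
    have hr0' : 0 < r0.re := hr0
    refine (hasDerivAt_integral_of_dominated_loc_of_deriv_le (s := Metric.ball r0 (r0.re / 2))
      (bound := fun t : ℝ => t ^ ν.re * Real.exp (-(r0.re / 2) * t))
      (F' := fun r (t : ℝ) => -((t : ℂ) ^ ν * Complex.exp (-(r * t)))) (Metric.ball_mem_nhds _ (by linarith))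
      (Eventually.of_forall fun r => hmeas _ _) ?_ (hmeas _ _).neg ?_ (hbound _ (by linarith) _ (by linarith)) ?_).2
    · refine (hbound (ν.re - 1) (by linarith) r0.re hr0').mono' (hmeas _ _) ?_
      filter_upwards [ae_restrict_mem measurableSet_Ioi] with t ht
      rw [hnorm _ _ _ ht]; simp
    · filter_upwards [ae_restrict_mem measurableSet_Ioi] with t ht r hr
      rw [norm_neg, hnorm _ _ _ ht]
      refine mul_le_mul_of_nonneg_left (Real.exp_le_exp.mpr ?_) (Real.rpow_nonneg (le_of_lt ht) _)
      have h1 : |(r - r0).re| ≤ ‖r - r0‖ := Complex.abs_re_le_norm _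
      have h2 : ‖r - r0‖ < r0.re / 2 := by simpa [dist_eq_norm] using hr
      have h3 := (abs_lt.mp (h1.trans_lt h2)).1
      rw [Complex.sub_re] at h3
      have : (0:ℝ) < t := ht
      nlinarith
    · filter_upwards [ae_restrict_mem measurableSet_Ioi] with t ht r hr
      have h0 : (t : ℂ) ≠ 0 := by exact_mod_cast (ne_of_gt ht)
      have h1 : HasDerivAt (fun r : ℂ => Complex.exp (-(r * t))) (Complex.exp (-(r * t)) * (-(t:ℂ))) r := by
        have := ((hasDerivAt_id r).mul_const (t : ℂ)).neg.cexp
        simpa using this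
      refine (h1.const_mul ((t : ℂ) ^ (ν - 1))).congr_deriv ?_
      rw [Complex.cpow_sub _ _ h0, Complex.cpow_one]
      field_simp
  have hA : AnalyticOnNhd ℂ (fun r : ℂ => ∫ t in Ioi (0 : ℝ),
      (t : ℂ) ^ (ν - 1) * Complex.exp (-(r * t))) H :=
    DifferentiableOn.analyticOnNhd (fun r hr => (hdiff r hr).differentiableAt.differentiableWithinAt) hHo
  have hB : AnalyticOnNhd ℂ (fun r : ℂ => r ^ (-ν) * Complex.Gamma ν) H := by
    apply DifferentiableOn.analyticOnNhd _ hHo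
    intro r hr
    apply DifferentiableAt.differentiableWithinAt
    exact ((differentiableAt_id.cpow_const (Or.inl hr)).mul_const _)
  -- the identity theorem, from the values at real `r` near `1`
  refine hA.eqOn_of_preconnected_of_frequently_eq hB hHc.isPreconnected (z₀ := 1)
    (by simp [hH]) ?_ hr
  have hseq : Tendsto (fun x : ℝ => (x : ℂ)) (𝓝[≠] (1:ℝ)) (𝓝[≠] (1 : ℂ)) := by
    apply tendsto_nhdsWithin_of_tendsto_nhds_of_eventually_within
    · exact (Complex.continuous_ofReal.tendsto' 1 1 (by simp)).mono_left nhdsWithin_le_nhds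
    · filter_upwards [self_mem_nhdsWithin] with x hx
      simpa using hx
  refine hseq.frequently (Eventually.frequently ?_)
  filter_upwards [nhdsWithin_le_nhds (lt_mem_nhds (zero_lt_one (α := ℝ)))] with x hx
  rw [Complex.integral_cpow_mul_exp_neg_mul_Ioi hν hx]
  congr 1
  rw [one_div, Complex.inv_cpow _ _ (by rw [Complex.arg_ofReal_of_nonneg hx.le]; exact Real.pi_pos.ne),
    Complex.cpow_neg]

lemma norm_add_I_mul_ge (c τ : ℝ) (hc : 0 < c) :
    min (c / 2) (1 / 2) * (1 + |τ|) ≤ ‖(c : ℂ) + Complex.I * τ‖ := by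
  have h1 : |c| ≤ ‖(c : ℂ) + Complex.I * τ‖ := by
    simpa using Complex.abs_re_le_norm ((c : ℂ) + Complex.I * τ)
  have h2 : |τ| ≤ ‖(c : ℂ) + Complex.I * τ‖ := by
    simpa using Complex.abs_im_le_norm ((c : ℂ) + Complex.I * τ)
  rw [abs_of_pos hc] at h1
  have h3 := min_le_left (c / 2) (1 / 2 : ℝ)
  have h4 := min_le_right (c / 2) (1 / 2 : ℝ)
  nlinarith [abs_nonneg τ]

lemma add_I_mul_mem_slitPlane {c : ℝ} (hc : 0 < c) (τ : ℝ) :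
    (c : ℂ) + Complex.I * τ ∈ Complex.slitPlane := Or.inl (by simpa using hc)

lemma integrable_cpow_vertical {ν : ℂ} (hν : 1 < ν.re) {c : ℝ} (hc : 0 < c) :
    Integrable (fun τ : ℝ => ((c : ℂ) + Complex.I * τ) ^ (-ν)) := by
  have hm : 0 < min (c / 2) (1 / 2 : ℝ) := by positivity
  have h1 := (integrable_one_add_norm (E := ℝ) (μ := volume) (r := ν.re) (by simpa using hν)).const_mul
    (min (c / 2) (1 / 2 : ℝ) ^ (-ν.re) * Real.exp (Real.pi * |(-ν).im|))
  refine h1.mono' ?_ (Eventually.of_forall fun τ => ?_)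
  · apply Continuous.aestronglyMeasurable
    rw [continuous_iff_continuousAt]
    intro τ
    exact ContinuousAt.cpow (by fun_prop) continuousAt_const (add_I_mul_mem_slitPlane hc τ)
  · refine (norm_cpow_le_rpow_mul_exp _ _).trans ?_
    have h2 := norm_add_I_mul_ge c τ hc
    have h3 : ‖(c : ℂ) + Complex.I * τ‖ ^ (-ν.re) ≤ (min (c / 2) (1 / 2) * (1 + |τ|)) ^ (-ν.re) :=
      Real.rpow_le_rpow_of_nonpos (by positivity) h2 (by linarith)
    rw [Real.mul_rpow hm.le (by positivity)] at h3
    simp only [Complex.neg_re, Real.norm_eq_abs]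
    calc _ ≤ (min (c / 2) (1 / 2) ^ (-ν.re) * (1 + |τ|) ^ (-ν.re)) * Real.exp (Real.pi * |(-ν).im|) :=
          mul_le_mul_of_nonneg_right h3 (Real.exp_pos _).le
      _ = _ := by ring

/-- The inverse Laplace transform of `w ^ (-ν)` at `a`, times `2π`. At the poles of `Γ` the convention
`1 / Γ(ν) = 0` gives the value of the entire function `1 / Γ`. -/
def bromwich (ν : ℂ) (a : ℝ) : ℂ :=
  if 0 < a then 2 * Real.pi * (a : ℂ) ^ (ν - 1) / Complex.Gamma ν else 0

open FourierTransform in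
/-- Fourier inversion for the function `t ^ (ν - 1) e^{-ct}` on the half-line `t > 0`. -/
lemma integral_cpow_mul_exp_vertical {ν : ℂ} (hν : 1 < ν.re) {c a : ℝ} (hc : 0 < c) (ha : a ≠ 0) :
    ∫ τ : ℝ, ((c : ℂ) + Complex.I * τ) ^ (-ν) * Complex.exp (a * ((c : ℂ) + Complex.I * τ))
      = bromwich ν a := by
  set f : ℝ → ℂ := (Ioi (0 : ℝ)).indicator
    (fun t : ℝ => (t : ℂ) ^ (ν - 1) * Complex.exp (-(c * t))) with hf
  have hΓ : Complex.Gamma ν ≠ 0 := Complex.Gamma_ne_zero_of_re_pos (by linarith)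
  have hcontOn : ContinuousOn (fun t : ℝ => (t : ℂ) ^ (ν - 1) * Complex.exp (-(c * t))) (Ioi 0) := by
    intro t ht
    apply ContinuousAt.continuousWithinAt
    refine ContinuousAt.mul ?_ (by fun_prop)
    exact (Complex.continuousAt_ofReal_cpow_const _ _ (Or.inr (ne_of_gt ht)))
  have hfi : Integrable f := by
    rw [hf, integrable_indicator_iff measurableSet_Ioi]
    have h0 := integrableOn_rpow_mul_exp_neg_mul_rpow (s := ν.re - 1) (p := 1) (by linarith) zero_lt_one hc
    refine h0.mono' (hcontOn.aestronglyMeasurable measurableSet_Ioi) ?_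
    filter_upwards [ae_restrict_mem measurableSet_Ioi] with t ht
    rw [norm_mul, Complex.norm_cpow_eq_rpow_re_of_pos ht, Complex.norm_exp]
    simp
  -- the Fourier transform of `f` is the Laplace transform on the line `Re = c`
  have hF : ∀ w : ℝ, 𝓕 f w = ((c : ℂ) + Complex.I * ((2 * Real.pi * w : ℝ) : ℂ)) ^ (-ν) * Complex.Gamma ν := by
    intro w
    rw [Real.fourier_eq', ← laplace_cpow (by linarith) (by simpa using hc),
      ← integral_indicator measurableSet_Ioi]
    congr 1
    ext t
    by_cases ht : t ∈ Ioi (0 : ℝ)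
    · simp only [hf, indicator_of_mem ht, smul_eq_mul]
      rw [mul_left_comm, ← Complex.exp_add]
      congr 2
      simp only [RCLike.inner_apply, conj_trivial]
      push_cast
      ring
    · simp [hf, indicator_of_notMem ht]
  have hFi : Integrable (𝓕 f) := by
    have h1 := (integrable_cpow_vertical hν hc).comp_mul_left' (R := 2 * Real.pi) (by positivity)
    refine (h1.mul_const (Complex.Gamma ν)).congr (Eventually.of_forall fun w => ?_)
    simp only [hF w]
  -- `a ≠ 0` keeps away from the only possible discontinuity of `f`
  have hca : ContinuousAt f a := by
    rcases ha.lt_or_gt with h | h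
    · have : f =ᶠ[𝓝 a] fun _ => 0 := by
        filter_upwards [gt_mem_nhds h] with t ht
        exact indicator_of_notMem (by simpa using ht.le) _
      exact continuousAt_const.congr this.symm
    · have : f =ᶠ[𝓝 a] (fun t : ℝ => (t : ℂ) ^ (ν - 1) * Complex.exp (-(c * t))) := by
        filter_upwards [lt_mem_nhds h] with t ht
        exact indicator_of_mem ht _
      exact (hcontOn.continuousAt (Ioi_mem_nhds h)).congr this.symm
  have hinv := hfi.fourierInv_fourier_eq hFi hca
  rw [Real.fourierInv_eq'] at hinv
  have hsub := Measure.integral_comp_mul_left (fun τ : ℝ => ((c : ℂ) + Complex.I * τ) ^ (-ν)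
    * Complex.exp (a * ((c : ℂ) + Complex.I * τ))) (2 * Real.pi)
  have h3 : ∀ w : ℝ, Complex.exp (↑(2 * Real.pi * inner ℝ w a) * Complex.I) • 𝓕 f w
      = (Complex.Gamma ν * Complex.exp (-(c * a))) * (((c : ℂ) + Complex.I * ((2 * Real.pi * w : ℝ) : ℂ)) ^ (-ν)
      * Complex.exp (a * ((c : ℂ) + Complex.I * ((2 * Real.pi * w : ℝ) : ℂ)))) := by
    intro w
    rw [hF, smul_eq_mul]
    have : Complex.exp (↑(2 * Real.pi * inner ℝ w a) * Complex.I)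
       = Complex.exp (-(c * a)) * Complex.exp (a * ((c : ℂ) + Complex.I * ((2 * Real.pi * w : ℝ) : ℂ))) := by
      rw [← Complex.exp_add]
      congr 1
      simp only [RCLike.inner_apply, conj_trivial]
      push_cast
      ring
    rw [this]; ring
  simp_rw [h3] at hinv
  rw [integral_const_mul, hsub] at hinv
  have hpi : (0:ℝ) < 2 * Real.pi := by positivity
  rw [abs_of_pos (inv_pos.mpr hpi)] at hinv
  have he := Complex.exp_ne_zero (-(c * a : ℂ))
  have hpiC : (Real.pi : ℂ) ≠ 0 := by exact_mod_cast Real.pi_pos.ne'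
  unfold bromwich
  rw [Complex.real_smul] at hinv
  push_cast at hinv
  split_ifs with h
  · rw [hf, indicator_of_mem (by exact h)] at hinv
    field_simp at hinv ⊢
    rw [mul_comm]
    linear_combination hinv
  · rw [hf, indicator_of_notMem (by exact h)] at hinv
    simpa [hΓ, he, hpiC] using hinv

/-- The functional equation of `Γ`, as the recursion that integration by parts gives for the
integral. -/
lemma bromwich_eq_mul_bromwich_add_one (ν : ℂ) {a : ℝ} (ha : a ≠ 0) :
    bromwich ν a = ν / a * bromwich (ν + 1) a := by
  unfold bromwich
  split_ifs with h
  · have haC : (a : ℂ) ≠ 0 := by exact_mod_cast ha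
    by_cases hν : ν = 0
    · simp [hν]
    · rw [Complex.Gamma_add_one _ hν, add_sub_cancel_right, Complex.cpow_sub _ _ haC,
        Complex.cpow_one]
      by_cases hG : Complex.Gamma ν = 0
      · simp [hG]
      · field_simp
  · simp

lemma hasDerivAt_cpow_mul_exp (ν : ℂ) (a : ℝ) {w : ℂ} (hw : w ∈ Complex.slitPlane) :
    HasDerivAt (fun w : ℂ => w ^ (-ν) * Complex.exp (a * w))
      (-ν * (w ^ (-(ν + 1)) * Complex.exp (a * w)) + a * (w ^ (-ν) * Complex.exp (a * w))) w := by
  have h1 := ((hasDerivAt_id w).cpow_const (c := -ν) hw).mul (((hasDerivAt_id w).const_mul (a : ℂ)).cexp)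
  refine h1.congr_deriv ?_
  simp only [id, mul_one]
  rw [show -(ν + 1) = -ν - 1 by ring]
  ring

lemma tendsto_norm_cpow_mul_exp_vertical {ν : ℂ} (hν : 0 < ν.re) {c : ℝ} (a : ℝ)
    {l : Filter ℝ} (hl : Tendsto (fun τ : ℝ => |τ|) l atTop) :
    Tendsto (fun τ : ℝ => ((c : ℂ) + Complex.I * τ) ^ (-ν) *
      Complex.exp (a * ((c : ℂ) + Complex.I * τ))) l (𝓝 0) := by
  have h1 : Tendsto (fun τ : ℝ => |τ| ^ (-ν.re) * (Real.exp (Real.pi * |(-ν).im|) * Real.exp (a * c))) l (𝓝 0) := by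
    simpa using ((tendsto_rpow_neg_atTop hν).comp hl).mul_const (Real.exp (Real.pi * |(-ν).im|) * Real.exp (a * c))
  refine squeeze_zero_norm' ?_ h1
  filter_upwards [hl.eventually (eventually_gt_atTop 0)] with τ hτ
  rw [norm_mul, Complex.norm_exp, ← mul_assoc]
  have h2 : |τ| ≤ ‖(c : ℂ) + Complex.I * τ‖ := by
    simpa using Complex.abs_im_le_norm ((c : ℂ) + Complex.I * τ)
  have h3 : (a * ((c : ℂ) + Complex.I * τ)).re = a * c := by simp
  rw [h3]
  refine mul_le_mul_of_nonneg_right ((norm_cpow_le_rpow_mul_exp _ _).trans ?_) (Real.exp_pos _).le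
  refine mul_le_mul_of_nonneg_right ?_ (Real.exp_pos _).le
  exact Real.rpow_le_rpow_of_nonpos hτ h2 (by simpa using hν.le)

lemma continuous_cpow_mul_exp_vertical (ν : ℂ) {c : ℝ} (a : ℝ) (hc : 0 < c) :
    Continuous (fun τ : ℝ => ((c : ℂ) + Complex.I * τ) ^ (-ν) *
      Complex.exp (a * ((c : ℂ) + Complex.I * τ))) := by
  rw [continuous_iff_continuousAt]
  intro τ
  exact ContinuousAt.mul (ContinuousAt.cpow (by fun_prop) continuousAt_const
    (add_I_mul_mem_slitPlane hc τ)) (by fun_prop)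

/-- For exponents with real part in `(0, 1]`, where the integral converges only conditionally,
an integration by parts raises the exponent by one. -/
lemma tendsto_integral_vertical {ν : ℂ} (hν : 0 < ν.re) {c a : ℝ} (hc : 0 < c) (ha : a ≠ 0) :
    Tendsto (fun R : ℝ × ℝ => ∫ τ in (-R.1)..R.2, ((c : ℂ) + Complex.I * τ) ^ (-ν) *
      Complex.exp (a * ((c : ℂ) + Complex.I * τ))) (atTop ×ˢ atTop) (𝓝 (bromwich ν a)) := by
  set F : ℂ → ℝ → ℂ := fun ν τ => ((c : ℂ) + Complex.I * τ) ^ (-ν) *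
      Complex.exp (a * ((c : ℂ) + Complex.I * τ)) with hF
  have haC : (a : ℂ) ≠ 0 := by exact_mod_cast ha
  have hb : Tendsto (fun R : ℝ × ℝ => -R.1) (atTop ×ˢ atTop) atBot :=
    tendsto_neg_atTop_atBot.comp tendsto_fst
  have ht : Tendsto (fun R : ℝ × ℝ => R.2) (atTop ×ˢ atTop) atTop := tendsto_snd
  have hint : Integrable (F (ν + 1)) := by
    refine ((integrable_cpow_vertical (ν := ν + 1) (by simpa using hν) hc).norm.mul_const
      (Real.exp (a * c))).mono' (continuous_cpow_mul_exp_vertical _ _ hc).aestronglyMeasurable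
      (Eventually.of_forall fun τ => ?_)
    simp [hF, Complex.norm_exp]
  have h1 := intervalIntegral_tendsto_integral hint hb ht
  rw [integral_cpow_mul_exp_vertical (by simpa using hν) hc ha] at h1
  have h2 : Tendsto (fun R : ℝ × ℝ => F ν R.2 - F ν (-R.1)) (atTop ×ˢ atTop) (𝓝 0) := by
    have e1 := (tendsto_norm_cpow_mul_exp_vertical (c := c) hν a tendsto_abs_atTop_atTop).comp ht
    have e2 := (tendsto_norm_cpow_mul_exp_vertical (c := c) hν a tendsto_abs_atBot_atTop).comp hb
    simpa [hF] using e1.sub e2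
  have h3 := (h1.const_mul (ν / a)).add (h2.const_mul (1 / (Complex.I * a)))
  rw [← bromwich_eq_mul_bromwich_add_one ν ha, mul_zero, add_zero] at h3
  refine h3.congr fun R => ?_
  -- integration by parts on the segment
  have hd : ∀ τ ∈ Set.uIcc (-R.1) R.2, HasDerivAt (F ν)
      ((-ν * F (ν + 1) τ + a * F ν τ) * Complex.I) τ := by
    intro τ _
    have e1 : HasDerivAt (fun τ : ℝ => (c : ℂ) + Complex.I * τ) Complex.I τ := by
      simpa using ((Complex.ofRealCLM.hasDerivAt (x := τ)).const_mul Complex.I).const_add (c : ℂ)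
    exact (hasDerivAt_cpow_mul_exp ν a (add_I_mul_mem_slitPlane hc τ)).comp_of_eq τ e1 rfl
  have hcF : ∀ ν, Continuous (F ν) := fun ν => continuous_cpow_mul_exp_vertical ν a hc
  have h4 := intervalIntegral.integral_eq_sub_of_hasDerivAt hd
    (by apply Continuous.intervalIntegrable; have := hcF ν; have := hcF (ν + 1); fun_prop)
  rw [intervalIntegral.integral_mul_const, intervalIntegral.integral_add
    (((hcF _).intervalIntegrable _ _).const_mul _) (((hcF _).intervalIntegrable _ _).const_mul _),
    intervalIntegral.integral_const_mul, intervalIntegral.integral_const_mul] at h4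
  rw [← h4]
  have := Complex.I_ne_zero
  field_simp
  ring

lemma branchPow_eq {s : ℝ} (z ν : ℂ) : branchPow s z (-ν) =
    Complex.exp (-(Complex.I * s * ν * Real.pi / 2)) * (z / (Complex.I * s)) ^ (-ν) := by
  unfold branchPow
  congr 2; ring

lemma closedJ_eq (ν : ℂ) (a s : ℝ) : closedJ ν a s =
    Complex.exp (-(Complex.I * s * ν * Real.pi / 2)) * bromwich ν a := by
  unfold closedJ bromwich
  split_ifs
  · ring
  · simp

/-- With `z = i s w`, the line `ℝ + i s ε` becomes the vertical line `Re w = ε`. -/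
lemma hasIntegralJ_closedJ {a s : ℝ} (ha : a ≠ 0) (hs : s = 1 ∨ s = -1) {ν : ℂ} (hν : 0 < ν.re)
    {ε : ℝ} (hε : 0 < ε) : HasIntegralJ ν a s ε (closedJ ν a s) := by
  unfold HasIntegralJ
  rw [closedJ_eq]
  have hss : s * s = 1 := by rcases hs with rfl | rfl <;> norm_num
  have hssC : (s : ℂ) * s = 1 := by exact_mod_cast hss
  have hsC : (s : ℂ) ≠ 0 := by rintro h; simp [h] at hssC
  have hlim := tendsto_integral_vertical hν hε ha
  have hdiv : ∀ t : ℝ, ((t : ℂ) + Complex.I * s * ε) / (Complex.I * s)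
      = (ε : ℂ) + Complex.I * ((-s * t : ℝ) : ℂ) := by
    intro t
    have := Complex.I_ne_zero
    field_simp
    push_cast
    linear_combination (s^2*t : ℂ) * Complex.I_sq + (-t:ℂ) * hssC
  have hexp : ∀ t : ℝ, -(Complex.I * s * a * ((t : ℂ) + Complex.I * s * ε))
      = a * ((ε : ℂ) + Complex.I * ((-s * t : ℝ) : ℂ)) := by
    intro t
    push_cast
    linear_combination (-a*s^2*ε : ℂ) * Complex.I_sq + (a * ε :ℂ) * hssC
  simp_rw [branchPow_eq, hdiv, hexp, mul_assoc, intervalIntegral.integral_const_mul]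
  refine Tendsto.const_mul _ ?_
  rcases hs with rfl | rfl
  · have h2 := hlim.comp (tendsto_snd.prodMk tendsto_fst)
    refine h2.congr fun R => ?_
    simp only [Function.comp]
    have := intervalIntegral.integral_comp_neg (a := -R.1) (b := R.2)
      (fun t : ℝ => ((ε : ℂ) + Complex.I * t) ^ (-ν) * Complex.exp (a * ((ε : ℂ) + Complex.I * t)))
    rw [neg_neg] at this
    simpa using this.symm
  · simpa using hlim

lemma differentiable_closedJ {a : ℝ} (s : ℝ) : Differentiable ℂ (fun ν => closedJ ν a s) := by
  unfold closedJ
  split_ifs with h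
  · have haC : (a : ℂ) ≠ 0 := by exact_mod_cast h.ne'
    simp_rw [div_eq_mul_inv _ (Complex.Gamma _)]
    refine Differentiable.mul ?_ Complex.differentiable_one_div_Gamma
    refine Differentiable.mul (by fun_prop) ?_
    exact Differentiable.const_cpow (by fun_prop) (Or.inl haC)
  · exact differentiable_const 0

/-! ### Hankel's formula on a broken line -/

/-- A bound for `X ^ p` that does not depend on the sign of `p`, from a lower bound `m` and an upper
bound `M Y` for `X`. -/
lemma rpow_le_mul_rpow_abs {m M X Y p : ℝ} (hm : 0 < m) (hM : 0 ≤ M) (hX : m ≤ X) (hXY : X ≤ M * Y)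
    (hY : 1 ≤ Y) : X ^ p ≤ (m ^ p + M ^ |p|) * Y ^ |p| := by
  have hY1 : 1 ≤ Y ^ |p| := Real.one_le_rpow hY (abs_nonneg p)
  have hmp : 0 ≤ m ^ p := Real.rpow_nonneg hm.le p
  have hMp : 0 ≤ M ^ |p| := Real.rpow_nonneg hM _
  rcases le_or_gt 0 p with hp | hp
  · have h1 : X ^ p ≤ (M * Y) ^ p := Real.rpow_le_rpow (by linarith) hXY hp
    rw [Real.mul_rpow hM (by linarith)] at h1
    rw [abs_of_nonneg hp] at *
    nlinarith
  · have h1 : X ^ p ≤ m ^ p := Real.rpow_le_rpow_of_nonpos hm hX hp.le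
    nlinarith

lemma isBigO_rpow_mul_exp (q : ℝ) {b : ℝ} (hb : 0 < b) :
    (fun t : ℝ => (1 + t) ^ q * Real.exp (-(b * t))) =O[atTop] fun t => Real.exp (-(b / 2) * t) := by
  have h1 : (fun t : ℝ => t ^ q) =o[atTop] fun t => Real.exp (b / 2 * t) :=
    isLittleO_rpow_exp_pos_mul_atTop q (half_pos hb)
  have h2 := (h1.comp_tendsto (tendsto_atTop_add_const_left atTop 1 tendsto_id)).isBigO
  have h3 : (fun t : ℝ => Real.exp (b / 2 * (1 + t))) =O[atTop] fun t => Real.exp (b / 2 * t) := by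
    have : (fun t : ℝ => Real.exp (b / 2 * (1 + t))) = fun t => Real.exp (b/2) * Real.exp (b / 2 * t) := by
      ext t; rw [← Real.exp_add]; ring_nf
    rw [this]
    exact (isBigO_refl _ _).const_mul_left _
  have h4 := (h2.trans h3).mul (isBigO_refl (fun t => Real.exp (-(b * t))) atTop)
  refine h4.congr (fun t => rfl) fun t => ?_
  rw [← Real.exp_add]; ring_nf

/-- The half-plane that contains the ray from `c` in the direction `-κ + i e`, together with the
vertical ray from `c`. -/
def rayHalfPlane (e : ℝ) : Set ℂ := {w | 0 < w.re + e * w.im}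

lemma isOpen_rayHalfPlane (e : ℝ) : IsOpen (rayHalfPlane e) :=
  isOpen_lt continuous_const (by fun_prop)

lemma convex_rayHalfPlane (e : ℝ) : Convex ℝ (rayHalfPlane e) := by
  intro x hx y hy a b ha hb hab
  simp only [rayHalfPlane, mem_ofPred_eq] at *
  simp only [Complex.add_re, Complex.add_im, Complex.smul_re, Complex.smul_im, smul_eq_mul]
  have : a * x.re + b * y.re + e * (a * x.im + b * y.im)
    = a * (x.re + e * x.im) + b * (y.re + e * y.im) := by ring
  rw [this]
  rcases ha.eq_or_lt with rfl | ha
  · have : b = 1 := by linarith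
    subst this; simpa using hy
  · have := mul_pos ha hx
    have := mul_nonneg hb hy.le
    linarith

lemma rayHalfPlane_subset (e : ℝ) : rayHalfPlane e ⊆ Complex.slitPlane := by
  intro w hw
  rw [Complex.mem_slitPlane_iff]
  by_cases h : w.im = 0
  · left; simpa [rayHalfPlane, h] using hw
  · right; exact h

section ray

variable {κ c e : ℝ}

lemma ray_re_add (he : e = 1 ∨ e = -1) (κ c t : ℝ) : ((c : ℂ) + (-κ + Complex.I * e) * (t : ℂ)).re
    + e * ((c : ℂ) + (-κ + Complex.I * e) * (t : ℂ)).im = c + (1 - κ) * t := by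
  have hee : e * e = 1 := by rcases he with rfl | rfl <;> norm_num
  simp
  linear_combination t * hee

lemma ray_mem (he : e = 1 ∨ e = -1) (hκ1 : κ < 1) (hc : 0 < c) {t : ℝ}
    (ht : 0 ≤ t) : (c : ℂ) + (-κ + Complex.I * e) * (t : ℂ) ∈ rayHalfPlane e := by
  rw [rayHalfPlane, mem_ofPred_eq, ray_re_add he]
  nlinarith

lemma ray_norm_ge (he : e = 1 ∨ e = -1) (hκ1 : κ < 1) {t : ℝ}
    (ht : 0 ≤ t) : c / 2 ≤ ‖(c : ℂ) + (-κ + Complex.I * e) * (t : ℂ)‖ := by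
  have h := ray_re_add he κ c t
  set w := (c : ℂ) + (-κ + Complex.I * e) * (t : ℂ)
  have h1 := (abs_le.mp (Complex.abs_re_le_norm w))
  have h2 := (abs_le.mp (Complex.abs_im_le_norm w))
  have h3 : 0 ≤ (1 - κ) * t := mul_nonneg (by linarith) ht
  rcases he with rfl | rfl <;> linarith [h1.1, h1.2, h2.1, h2.2]

lemma ray_norm_le (he : e = 1 ∨ e = -1) (hκ : 0 < κ) (hκ1 : κ < 1) (hc : 0 < c) {t : ℝ}
    (ht : 0 ≤ t) : ‖(c : ℂ) + (-κ + Complex.I * e) * (t : ℂ)‖ ≤ (c + 2) * (1 + t) := by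
  have h1 : ‖(-κ + Complex.I * e : ℂ)‖ ≤ 2 := by
    refine (norm_add_le _ _).trans ?_
    rcases he with rfl | rfl <;> simp [abs_of_pos hκ] <;> linarith
  calc _ ≤ ‖(c : ℂ)‖ + ‖(-κ + Complex.I * e : ℂ) * (t : ℂ)‖ := norm_add_le _ _
    _ ≤ c + 2 * t := by
      rw [norm_mul]
      simp only [Complex.norm_real, Real.norm_eq_abs, abs_of_pos hc, abs_of_nonneg ht]
      nlinarith
    _ ≤ _ := by nlinarith

lemma norm_ray_integrand_le (he : e = 1 ∨ e = -1) (hκ : 0 < κ) (hκ1 : κ < 1) (hc : 0 < c) (ν : ℂ)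
    {t : ℝ} (ht : 0 ≤ t) :
    ‖((c : ℂ) + (-κ + Complex.I * e) * (t : ℂ)) ^ (-ν) *
      Complex.exp ((1 : ℝ) * ((c : ℂ) + (-κ + Complex.I * e) * (t : ℂ)))‖
    ≤ (((c / 2) ^ (-ν.re) + (c + 2) ^ |-ν.re|) * Real.exp (Real.pi * |(-ν).im|) * Real.exp c) *
      ((1 + t) ^ |-ν.re| * Real.exp (-(κ * t))) := by
  rw [norm_mul, Complex.norm_exp]
  have h1 := norm_cpow_le_rpow_mul_exp ((c : ℂ) + (-κ + Complex.I * e) * (t : ℂ)) (-ν)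
  have h2 := rpow_le_mul_rpow_abs (p := -ν.re) (half_pos hc) (by linarith) (ray_norm_ge (κ := κ) he hκ1 ht)
    (ray_norm_le he hκ hκ1 hc ht) (by linarith)
  have h3 : ((1 : ℝ) * ((c : ℂ) + (-κ + Complex.I * e) * (t : ℂ))).re = c + -(κ * t) := by simp
  rw [h3, Real.exp_add]
  rw [Complex.neg_re] at h1
  calc _ ≤ ((((c / 2) ^ (-ν.re) + (c + 2) ^ |-ν.re|) * (1 + t) ^ |-ν.re|)
        * Real.exp (Real.pi * |(-ν).im|)) * (Real.exp c * Real.exp (-(κ * t))) := by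
        refine mul_le_mul_of_nonneg_right (h1.trans ?_) (by positivity)
        exact mul_le_mul_of_nonneg_right h2 (by positivity)
    _ = _ := by ring

lemma continuousOn_ray_integrand (he : e = 1 ∨ e = -1) (hκ1 : κ < 1) (hc : 0 < c)
    (ν : ℂ) : ContinuousOn (fun t : ℝ => ((c : ℂ) + (-κ + Complex.I * e) * (t : ℂ)) ^ (-ν) *
      Complex.exp ((1 : ℝ) * ((c : ℂ) + (-κ + Complex.I * e) * (t : ℂ)))) (Ici 0) := by
  intro t ht
  apply ContinuousAt.continuousWithinAt
  exact ContinuousAt.mul (ContinuousAt.cpow (by fun_prop) continuousAt_const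
    (rayHalfPlane_subset e (ray_mem he hκ1 hc ht))) (by fun_prop)

lemma isBigO_ray_integrand (he : e = 1 ∨ e = -1) (hκ : 0 < κ) (hκ1 : κ < 1) (hc : 0 < c)
    (ν : ℂ) : (fun t : ℝ => ((c : ℂ) + (-κ + Complex.I * e) * (t : ℂ)) ^ (-ν) *
      Complex.exp ((1 : ℝ) * ((c : ℂ) + (-κ + Complex.I * e) * (t : ℂ))))
      =O[atTop] fun t => Real.exp (-(κ / 2) * t) := by
  refine IsBigO.trans (IsBigO.of_bound (((c / 2) ^ (-ν.re) + (c + 2) ^ |-ν.re|) *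
    Real.exp (Real.pi * |(-ν).im|) * Real.exp c) ?_) (isBigO_rpow_mul_exp |-ν.re| hκ)
  filter_upwards [eventually_ge_atTop 0] with t ht
  refine (norm_ray_integrand_le he hκ hκ1 hc ν ht).trans (le_of_eq ?_)
  congr 1
  exact (Real.norm_of_nonneg (by positivity)).symm

lemma integrableOn_ray_integrand (he : e = 1 ∨ e = -1) (hκ : 0 < κ) (hκ1 : κ < 1) (hc : 0 < c)
    (ν : ℂ) : IntegrableOn (fun t : ℝ => ((c : ℂ) + (-κ + Complex.I * e) * (t : ℂ)) ^ (-ν) *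
      Complex.exp ((1 : ℝ) * ((c : ℂ) + (-κ + Complex.I * e) * (t : ℂ)))) (Ioi 0) :=
  (integrable_norm_iff (((continuousOn_ray_integrand he hκ1 hc ν).mono
    Ioi_subset_Ici_self).aestronglyMeasurable measurableSet_Ioi)).mp
    (integrable_of_isBigO_exp_neg (half_pos hκ) (continuousOn_ray_integrand he hκ1 hc ν).norm
      (isBigO_ray_integrand he hκ hκ1 hc ν).norm_left)

/-- The integral of `w ^ (-ν) e^w` along the ray from `c` in the direction `-κ + i e`, traversed
upwards. -/
def rayIntegral (κ c e : ℝ) (ν : ℂ) : ℂ :=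
  ∫ t in Ioi (0 : ℝ), ((c : ℂ) + (-κ + Complex.I * e) * (t : ℂ)) ^ (-ν) *
      Complex.exp ((1 : ℝ) * ((c : ℂ) + (-κ + Complex.I * e) * (t : ℂ))) * ((-κ + Complex.I * e) * e)

/-- Integration by parts along the ray. The boundary terms at `c` of the two rays `e = ± 1` are
opposite to each other. -/
lemma rayIntegral_rec (he : e = 1 ∨ e = -1) (hκ : 0 < κ) (hκ1 : κ < 1) (hc : 0 < c) (ν : ℂ) :
    rayIntegral κ c e ν = ν * rayIntegral κ c e (ν + 1) - e * ((c : ℂ) ^ (-ν) * Complex.exp c) := by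
  set F : ℂ → ℝ → ℂ := fun ν t => ((c : ℂ) + (-κ + Complex.I * e) * (t : ℂ)) ^ (-ν) *
      Complex.exp ((1 : ℝ) * ((c : ℂ) + (-κ + Complex.I * e) * (t : ℂ))) with hF
  have hd : ∀ t ∈ Ioi (0 : ℝ), HasDerivAt (F ν)
      ((-ν * F (ν + 1) t + (1 : ℝ) * F ν t) * (-κ + Complex.I * e)) t := by
    intro t ht
    have e1 : HasDerivAt (fun t : ℝ => (c : ℂ) + (-κ + Complex.I * e) * (t : ℂ)) (-κ + Complex.I * e) t := by
      simpa using ((Complex.ofRealCLM.hasDerivAt (x := t)).const_mul (-κ + Complex.I * e : ℂ)).const_add (c : ℂ)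
    exact (hasDerivAt_cpow_mul_exp ν 1
      (rayHalfPlane_subset e (ray_mem he hκ1 hc (le_of_lt ht)))).comp_of_eq t e1 rfl
  have hi : ∀ ν, IntegrableOn (F ν) (Ioi 0) := fun ν => integrableOn_ray_integrand he hκ hκ1 hc ν
  have hlim : Tendsto (F ν) atTop (𝓝 0) := by
    refine (isBigO_ray_integrand he hκ hκ1 hc ν).trans_tendsto ?_
    exact Real.tendsto_exp_atBot.comp ((tendsto_id.const_mul_atTop_of_neg (by linarith)))
  have h := integral_Ioi_of_hasDerivAt_of_tendsto
    ((continuousOn_ray_integrand he hκ1 hc ν).continuousWithinAt self_mem_Ici) hd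
    ((((hi (ν + 1)).const_mul (-ν)).add ((hi ν).const_mul _)).mul_const _) hlim
  rw [integral_mul_const, integral_add ((hi (ν + 1)).const_mul (-ν)) ((hi ν).const_mul _),
    integral_const_mul, integral_const_mul] at h
  have h0 : F ν 0 = (c : ℂ) ^ (-ν) * Complex.exp c := by simp [hF]
  unfold rayIntegral
  rw [integral_mul_const, integral_mul_const]
  change (∫ t in Ioi (0 : ℝ), F ν t) * _ = ν * ((∫ t in Ioi (0 : ℝ), F (ν + 1) t) * _) - _
  simp only [hF] at h h0 ⊢
  rw [h0] at h
  push_cast at h ⊢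
  linear_combination (e : ℂ) * h

/-- For `Re ν > 0` the broken line can be straightened to a vertical line. -/
lemma tendsto_vertical_sub_ray (he : e = 1 ∨ e = -1) (hκ : 0 < κ) (hκ1 : κ < 1) (hc : 0 < c)
    {ν : ℂ} (hν : 0 < ν.re) :
    Tendsto (fun R : ℝ => (∫ t in (0 : ℝ)..R, ((c : ℂ) + (Complex.I * e) * (t : ℂ)) ^ (-ν) *
      Complex.exp ((1 : ℝ) * ((c : ℂ) + (Complex.I * e) * (t : ℂ))) * (Complex.I * e)) * e)
      atTop (𝓝 (rayIntegral κ c e ν)) := by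
  set f : ℂ → ℂ := fun w => w ^ (-ν) * Complex.exp ((1 : ℝ) * w) with hf
  have hfd : DifferentiableOn ℂ f (rayHalfPlane e) := fun w hw =>
    (hasDerivAt_cpow_mul_exp ν 1 (rayHalfPlane_subset e hw)).differentiableAt.differentiableWithinAt
  obtain ⟨Φ, hΦ⟩ := exists_primitive (convex_rayHalfPlane e) (isOpen_rayHalfPlane e) hfd
  have hfc := hfd.continuousOn
  have hee : e * e = 1 := by rcases he with rfl | rfl <;> norm_num
  have h1 := (intervalIntegral_tendsto_integral_Ioi 0 ((integrableOn_ray_integrand he hκ hκ1 hc ν).mul_const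
    ((-κ + Complex.I * e) * e)) tendsto_id)
  have hmem : ∀ R t : ℝ, 0 ≤ R → t ∈ Icc (0 : ℝ) 1 →
      ((c : ℂ) + (Complex.I * e) * R) + (-(κ * R : ℝ) : ℂ) * (t : ℂ) ∈ rayHalfPlane e := by
    intro R t hR ht
    simp only [rayHalfPlane, mem_ofPred_eq]
    simp
    have : e * (e * R) = R := by rw [← mul_assoc, hee, one_mul]
    rw [this]
    have h5 : κ * R * t ≤ R := by
      have := mul_le_mul hκ1.le ht.2 ht.1 zero_le_one
      nlinarith
    linarith
  -- the horizontal segment from the end of the vertical segment to the end of the ray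
  have h2 : Tendsto (fun R : ℝ => ∫ t in (0 : ℝ)..1,
      f (((c : ℂ) + (Complex.I * e) * R) + (-(κ * R : ℝ) : ℂ) * (t : ℂ)) * (-(κ * R : ℝ) : ℂ)) atTop (𝓝 0) := by
    have hb : ∀ R : ℝ, 0 < R → ‖∫ t in (0 : ℝ)..1,
        f (((c : ℂ) + (Complex.I * e) * R) + (-(κ * R : ℝ) : ℂ) * (t : ℂ)) * (-(κ * R : ℝ) : ℂ)‖
        ≤ R ^ (-ν.re) * (Real.exp (Real.pi * |(-ν).im|) * Real.exp c) := by
      intro R hR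
      have hκR : 0 < κ * R := by positivity
      have := norm_integral_segment_le (f := fun t : ℝ =>
        f (((c : ℂ) + (Complex.I * e) * R) + (-(κ * R : ℝ) : ℂ) * (t : ℂ)) * (-(κ * R : ℝ) : ℂ))
        (C := κ * R * (R ^ (-ν.re) * (Real.exp (Real.pi * |(-ν).im|) * Real.exp c)))
        (b := κ * R) hκR (by positivity) ?_
      · refine this.trans (le_of_eq ?_)
        field_simp
      · intro t ht
        have hn : ‖(-(κ * R : ℝ) : ℂ)‖ = κ * R := by
          rw [norm_neg, Complex.norm_real, Real.norm_of_nonneg hκR.le]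
        set w := ((c : ℂ) + (Complex.I * e) * R) + (-(κ * R : ℝ) : ℂ) * (t : ℂ) with hw
        have hwim : R ≤ ‖w‖ := by
          have := Complex.abs_im_le_norm w
          have h6 : |w.im| = R := by
            rcases he with rfl | rfl <;> simp [hw, abs_of_pos hR]
          linarith
        have hwre : ((1 : ℝ) * w).re = c + -(κ * R * t) := by simp [hw]
        simp only [hf, norm_mul, hn, Complex.norm_exp, hwre, Real.exp_add]
        have h7 := norm_cpow_le_rpow_mul_exp w (-ν)
        have h8 : ‖w‖ ^ (-ν).re ≤ R ^ (-ν.re) :=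
          Real.rpow_le_rpow_of_nonpos hR hwim (by simpa using hν.le)
        calc _ ≤ (R ^ (-ν.re) * Real.exp (Real.pi * |(-ν).im|)) * (Real.exp c * Real.exp (-(κ * R * t))) * (κ * R) := by
              refine mul_le_mul_of_nonneg_right (mul_le_mul_of_nonneg_right (h7.trans ?_) (by positivity)) hκR.le
              exact mul_le_mul_of_nonneg_right h8 (by positivity)
          _ = _ := by ring
    refine squeeze_zero_norm' ((eventually_gt_atTop 0).mono hb) ?_
    simpa using (tendsto_rpow_neg_atTop hν).mul_const (Real.exp (Real.pi * |(-ν).im|) * Real.exp c)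
  have h3 := h1.sub (h2.mul_const (e : ℂ))
  rw [zero_mul, sub_zero] at h3
  refine h3.congr' ?_
  filter_upwards [eventually_ge_atTop 0] with R hR
  have i1 := integral_segment_eq hfc hΦ c (-κ + Complex.I * e) R
    (fun t ht => by rw [uIcc_of_le hR] at ht; exact ray_mem he hκ1 hc ht.1)
  have i2 := integral_segment_eq hfc hΦ c (Complex.I * e) R
    (fun t ht => by
      rw [uIcc_of_le hR] at ht
      have := ray_mem (κ := 0) he (by norm_num) hc ht.1
      simpa using this)
  have i3 := integral_segment_eq hfc hΦ ((c : ℂ) + (Complex.I * e) * R) (-(κ * R : ℝ) : ℂ) 1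
    (fun t ht => by rw [uIcc_of_le zero_le_one] at ht; exact hmem R t hR ht)
  rw [i3]
  simp only [id]
  simp_rw [← mul_assoc _ (-κ + Complex.I * e : ℂ) (e : ℂ)]
  rw [intervalIntegral.integral_mul_const]
  change (∫ t in (0 : ℝ)..R, f ((c : ℂ) + (-κ + Complex.I * e) * (t : ℂ)) * (-κ + Complex.I * e)) * _ - _
    = (∫ t in (0 : ℝ)..R, f ((c : ℂ) + (Complex.I * e) * (t : ℂ)) * (Complex.I * e)) * _
  rw [i1, i2, ← sub_mul]
  congr 1
  push_cast
  ring_nf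

/-- Hankel's formula `(2πi)⁻¹ ∫ w ^ (-ν) e^w dw = 1 / Γ(ν)`. For `Re ν > 0` the broken line is
straightened; the recursion in `ν` extends the result to all `ν`. -/
lemma rayIntegral_add (hκ : 0 < κ) (hκ1 : κ < 1) (hc : 0 < c) (ν : ℂ) :
    rayIntegral κ c 1 ν + rayIntegral κ c (-1) ν = Complex.I * bromwich ν 1 := by
  have base : ∀ ν : ℂ, 0 < ν.re →
      rayIntegral κ c 1 ν + rayIntegral κ c (-1) ν = Complex.I * bromwich ν 1 := by
    intro ν hν
    have h1 := (tendsto_vertical_sub_ray (Or.inl rfl) hκ hκ1 hc hν).add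
      (tendsto_vertical_sub_ray (Or.inr rfl) hκ hκ1 hc hν)
    have h2 := ((tendsto_integral_vertical hν hc one_ne_zero).comp
      (tendsto_id.prodMk tendsto_id)).const_mul Complex.I
    refine tendsto_nhds_unique h1 (h2.congr fun R => ?_)
    have hcont := continuous_cpow_mul_exp_vertical ν 1 hc
    simp only [Function.comp, id]
    rw [← intervalIntegral.integral_add_adjacent_intervals (hcont.intervalIntegrable (-R) 0)
      (hcont.intervalIntegrable 0 R)]
    have h3 := intervalIntegral.integral_comp_neg (a := 0) (b := R)
      (fun t : ℝ => ((c : ℂ) + Complex.I * t) ^ (-ν) * Complex.exp ((1 : ℝ) * ((c : ℂ) + Complex.I * t)))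
    rw [neg_zero] at h3
    rw [← h3, intervalIntegral.integral_mul_const, intervalIntegral.integral_mul_const]
    push_cast
    simp only [mul_neg, mul_one, neg_mul]
    ring
  have step : ∀ n : ℕ, ∀ ν : ℂ, -(n : ℝ) < ν.re →
      rayIntegral κ c 1 ν + rayIntegral κ c (-1) ν = Complex.I * bromwich ν 1 := by
    intro n
    induction n with
    | zero => intro ν hν; exact base ν (by simpa using hν)
    | succ n ih =>
      intro ν hν
      have h := ih (ν + 1) (by push_cast at hν; simp; linarith)
      rw [rayIntegral_rec (Or.inl rfl) hκ hκ1 hc, rayIntegral_rec (Or.inr rfl) hκ hκ1 hc,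
        bromwich_eq_mul_bromwich_add_one ν one_ne_zero]
      push_cast
      linear_combination ν * h
  obtain ⟨n, hn⟩ := exists_nat_gt (-ν.re)
  exact step n ν (by linarith)

end ray

/-- The integral of `z ^ (-ν) e^{-i s z}` along the broken line `y ↦ y + i s (c - κ |y|)`. Since the
line bends towards the region of decay, the integral converges absolutely for every `ν`, whereas on
a horizontal line it does so only for `Re ν > 1`. -/
lemma integral_hankel {κ c s : ℝ} (hs : s = 1 ∨ s = -1) (hκ : 0 < κ) (hκ1 : κ < 1) (hc : 0 < c)
    (ν : ℂ) : ∫ y : ℝ, branchPow s ((y : ℂ) + Complex.I * s * ((c - κ * |y| : ℝ) : ℂ)) (-ν) *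
      Complex.exp (-(Complex.I * s * ((y : ℂ) + Complex.I * s * ((c - κ * |y| : ℝ) : ℂ)))) *
      (1 - Complex.I * s * κ * ((SignType.sign y : ℝ) : ℂ)) = closedJ ν 1 s := by
  have hss : s * s = 1 := by rcases hs with rfl | rfl <;> norm_num
  have hssC : (s : ℂ) * s = 1 := by exact_mod_cast hss
  have hsC : (s : ℂ) ≠ 0 := by rintro h; simp [h] at hssC
  have hI := Complex.I_ne_zero
  set E := Complex.exp (-(Complex.I * s * ν * Real.pi / 2)) with hE
  set g : ℝ → ℂ := fun y => branchPow s ((y : ℂ) + Complex.I * s * ((c - κ * |y| : ℝ) : ℂ)) (-ν) *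
      Complex.exp (-(Complex.I * s * ((y : ℂ) + Complex.I * s * ((c - κ * |y| : ℝ) : ℂ)))) *
      (1 - Complex.I * s * κ * ((SignType.sign y : ℝ) : ℂ)) with hg
  -- after division by `i s`, each half of the broken line is one of the two rays
  have hside : ∀ τ : ℝ, τ = 1 ∨ τ = -1 → ∀ t : ℝ, 0 < t → g (τ * t) = E * Complex.I⁻¹ *
      (((c : ℂ) + (-κ + Complex.I * (-s * τ : ℝ)) * (t : ℂ)) ^ (-ν) *
      Complex.exp ((1 : ℝ) * ((c : ℂ) + (-κ + Complex.I * (-s * τ : ℝ)) * (t : ℂ))) *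
        ((-κ + Complex.I * (-s * τ : ℝ)) * (-s * τ : ℝ))) := by
    intro τ hτ t ht
    have hττ : τ * τ = 1 := by rcases hτ with rfl | rfl <;> norm_num
    have hττC : (τ : ℂ) * τ = 1 := by exact_mod_cast hττ
    have habs : |τ * t| = t := by rcases hτ with rfl | rfl <;> simp [abs_of_pos ht]
    have hsgn : ((SignType.sign (τ * t) : SignType) : ℝ) = τ := by
      rcases hτ with rfl | rfl <;> simp [ht]
    simp only [hg, habs, hsgn, branchPow_eq, ← hE]
    have h1 : (((τ * t : ℝ) : ℂ) + Complex.I * s * ((c - κ * t : ℝ) : ℂ)) / (Complex.I * s)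
        = (c : ℂ) + (-κ + Complex.I * (-s * τ : ℝ)) * (t : ℂ) := by
      field_simp
      push_cast
      linear_combination (s^2*τ*t : ℂ) * Complex.I_sq - (τ*t:ℂ) * hssC
    have h2 : -(Complex.I * s * (((τ * t : ℝ) : ℂ) + Complex.I * s * ((c - κ * t : ℝ) : ℂ)))
        = (1 : ℝ) * ((c : ℂ) + (-κ + Complex.I * (-s * τ : ℝ)) * (t : ℂ)) := by
      push_cast
      linear_combination (-s^2*(c-κ*t) : ℂ) * Complex.I_sq + ((c-κ*t):ℂ) * hssC
    have h3 : (1 - Complex.I * s * κ * (τ : ℂ)) = Complex.I⁻¹ *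
        ((-κ + Complex.I * (-s * τ : ℝ)) * (-s * τ : ℝ)) := by
      field_simp
      push_cast
      linear_combination (-s*κ*τ : ℂ) * Complex.I_sq - Complex.I * τ ^ 2 * hssC - Complex.I * hττC
    rw [h1, h2, h3]
    ring
  have hint : ∀ τ : ℝ, τ = 1 ∨ τ = -1 → IntegrableOn (fun t => g (τ * t)) (Ioi 0) := by
    intro τ hτ
    have he : (-s * τ = 1 ∨ -s * τ = -1) := by
      rcases hs with rfl | rfl <;> rcases hτ with rfl | rfl <;> norm_num
    refine (((integrableOn_ray_integrand he hκ hκ1 hc ν).mul_const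
      ((-κ + Complex.I * (-s * τ : ℝ)) * (-s * τ : ℝ))).const_mul (E * Complex.I⁻¹)).congr ?_
    filter_upwards [ae_restrict_mem measurableSet_Ioi] with t ht
    exact (hside τ hτ t ht).symm
  have hval : ∀ τ : ℝ, τ = 1 ∨ τ = -1 → ∫ t in Ioi (0 : ℝ), g (τ * t) =
      E * Complex.I⁻¹ * rayIntegral κ c (-s * τ) ν := by
    intro τ hτ
    rw [rayIntegral, ← integral_const_mul]
    exact setIntegral_congr_fun measurableSet_Ioi fun t ht => hside τ hτ t ht
  have i1 : IntegrableOn g (Ioi 0) := by simpa using hint 1 (Or.inl rfl)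
  have i2 : IntegrableOn g (Iic 0) := by
    have := (Measure.measurePreserving_neg (volume : Measure ℝ)).integrableOn_comp_preimage
      (Homeomorph.neg ℝ).measurableEmbedding (f := g) (s := Iio 0)
    rw [integrableOn_Iic_iff_integrableOn_Iio, ← this]
    simpa [Function.comp_def] using hint (-1) (Or.inr rfl)
  rw [← intervalIntegral.integral_Iic_add_Ioi i2 i1]
  have h1 := hval 1 (Or.inl rfl)
  have h2 := hval (-1) (Or.inr rfl)
  simp only [one_mul, neg_mul, mul_one, mul_neg, neg_neg] at h1 h2
  have h3 := integral_comp_neg_Ioi (0 : ℝ) g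
  rw [neg_zero] at h3
  rw [← h3, h1, h2, closedJ_eq, ← hE, ← mul_add]
  have h4 : rayIntegral κ c s ν + rayIntegral κ c (-s) ν = Complex.I * bromwich ν 1 := by
    rw [← rayIntegral_add hκ hκ1 hc ν]
    rcases hs with rfl | rfl
    · rfl
    · rw [neg_neg, add_comm]
  rw [h4]
  field_simp

/-! ### Locally Lipschitz functions and null Lagrangians -/

lemma LocallyLipschitz.fun_smul {E F : Type*} [NormedAddCommGroup E] [NormedAddCommGroup F]
    [NormedSpace ℝ F] {f : E → ℝ} {g : E → F} (hf : LocallyLipschitz f)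
    (hg : LocallyLipschitz g) : LocallyLipschitz fun x => f x • g x :=
  (ContDiff.locallyLipschitz (𝕂 := ℝ) (f := fun p : ℝ × F => p.1 • p.2)
    (contDiff_fst.smul contDiff_snd)).comp (hf.prodMk hg)

lemma LocallyLipschitz.lipschitzWith_of_hasCompactSupport {E F : Type*} [NormedAddCommGroup E]
    [NormedSpace ℝ E] [FiniteDimensional ℝ E] [NormedAddCommGroup F] {f : E → F} (hf : LocallyLipschitz f)
    (hc : HasCompactSupport f) : ∃ C, LipschitzWith C f := by
  obtain ⟨R, hR⟩ := hc.isCompact.isBounded.subset_closedBall (0 : E)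
  obtain ⟨C, hC⟩ := (hf.locallyLipschitzOn
    (s := Metric.closedBall (0 : E) (R + 1))).exists_lipschitzOnWith_of_compact (isCompact_closedBall _ _)
  obtain ⟨M, hM⟩ := hc.exists_bound_of_continuous hf.continuous
  have h0 : ∀ x, x ∉ Metric.closedBall (0 : E) R → f x = 0 := fun x hx =>
    image_eq_zero_of_notMem_tsupport fun h => hx (hR h)
  have hM0 : 0 ≤ M := (norm_nonneg _).trans (hM 0)
  have key : ∀ x y, x ∈ Metric.closedBall (0 : E) R → ‖f x - f y‖ ≤ (C + M) * ‖x - y‖ := by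
    intro x y hx
    by_cases hy : y ∈ Metric.closedBall (0 : E) (R + 1)
    · have := hC.norm_sub_le (Metric.closedBall_subset_closedBall (by linarith) hx) hy
      refine this.trans (mul_le_mul_of_nonneg_right (by linarith) (norm_nonneg _))
    · rw [h0 y fun h => hy (Metric.closedBall_subset_closedBall (by linarith) h), sub_zero]
      have h1 : 1 ≤ ‖x - y‖ := by
        rw [mem_closedBall_zero_iff] at hx hy
        have := norm_sub_norm_le y x
        rw [norm_sub_rev] at this
        linarith
      have := hM x
      have : 0 ≤ (C : ℝ) * ‖x - y‖ := by positivity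
      nlinarith
  refine ⟨⟨C + M, by positivity⟩, LipschitzWith.of_dist_le_mul fun x y => ?_⟩
  rw [dist_eq_norm, dist_eq_norm]
  change _ ≤ ((C : ℝ) + M) * _
  by_cases hx : x ∈ Metric.closedBall (0 : E) R
  · exact key x y hx
  · by_cases hy : y ∈ Metric.closedBall (0 : E) R
    · rw [norm_sub_rev, norm_sub_rev x y]; exact key y x hy
    · rw [h0 x hx, h0 y hy, sub_zero, norm_zero]; positivity

section lip

variable {E F : Type*} [NormedAddCommGroup E] [NormedSpace ℝ E] [FiniteDimensional ℝ E]
  [NormedAddCommGroup F] [NormedSpace ℝ F]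

/-- A locally Lipschitz function agrees near a compact set with a compactly supported Lipschitz
function. -/
lemma LocallyLipschitz.exists_lipschitzWith_eventuallyEq {f : E → F} (hf : LocallyLipschitz f)
    {K : Set E} (hK : IsCompact K) : ∃ C, ∃ g : E → F, LipschitzWith C g ∧ HasCompactSupport g ∧
      ∀ x ∈ K, g =ᶠ[𝓝 x] f := by
  obtain ⟨R, hR0, hR⟩ := hK.isBounded.subset_ball_lt 0 (0 : E)
  let χ : ContDiffBump (0 : E) := ⟨R, R + 1, hR0, by linarith⟩
  have hχ : LocallyLipschitz χ := (χ.contDiff (n := 1)).locallyLipschitz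
  have hsupp : HasCompactSupport fun x => χ x • f x := χ.hasCompactSupport.smul_right
  obtain ⟨C, hC⟩ := (hχ.fun_smul hf).lipschitzWith_of_hasCompactSupport hsupp
  refine ⟨C, _, hC, hsupp, fun x hx => ?_⟩
  filter_upwards [Metric.isOpen_ball.mem_nhds (hR hx)] with y hy
  rw [χ.one_of_mem_closedBall (Metric.ball_subset_closedBall hy), one_smul]

lemma LocallyLipschitz.exists_norm_fderiv_le {f : E → F} (hf : LocallyLipschitz f)
    {K : Set E} (hK : IsCompact K) : ∃ C, 0 ≤ C ∧ ∀ x ∈ K, ‖fderiv ℝ f x‖ ≤ C := by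
  obtain ⟨C, g, hg, -, h⟩ := hf.exists_lipschitzWith_eventuallyEq hK
  refine ⟨C, C.2, fun x hx => ?_⟩
  rw [← (h x hx).fderiv_eq]
  exact norm_fderiv_le_of_lipschitz ℝ hg

lemma LocallyLipschitz.ae_differentiableAt [FiniteDimensional ℝ F] [MeasurableSpace E]
    [BorelSpace E] {f : E → F} (hf : LocallyLipschitz f) (μ : Measure E) [μ.IsAddHaarMeasure] :
    ∀ᵐ x ∂μ, DifferentiableAt ℝ f x := by
  have h : ∀ n : ℕ, ∀ᵐ x ∂μ, x ∈ Metric.closedBall (0 : E) n → DifferentiableAt ℝ f x := by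
    intro n
    obtain ⟨C, g, hg, -, h⟩ :=
      hf.exists_lipschitzWith_eventuallyEq (isCompact_closedBall (0 : E) n)
    filter_upwards [hg.ae_differentiableAt (μ := μ)] with x hx hxn
    exact hx.congr_of_eventuallyEq (h x hxn).symm
  filter_upwards [ae_all_iff.mpr h] with x hx
  obtain ⟨n, hn⟩ := exists_nat_ge ‖x‖
  exact hx n (by simpa using hn)

end lip

lemma lineDeriv_comp_add_right {E F : Type*} [NormedAddCommGroup E] [NormedSpace ℝ E]
    [NormedAddCommGroup F] [NormedSpace ℝ F] (f : E → F) (a x v : E) :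
    lineDeriv ℝ (fun y => f (y + a)) x v = lineDeriv ℝ f (x + a) v := by
  unfold lineDeriv
  congr 1; ext t; rw [add_right_comm]

lemma LipschitzWith.integrable_lineDeriv {f : ℝ × ℝ → ℝ} {C : NNReal} (hf : LipschitzWith C f)
    (hc : HasCompactSupport f) (v : ℝ × ℝ) : Integrable fun x => lineDeriv ℝ f x v := by
  have h0 : ∀ x, x ∉ tsupport f → lineDeriv ℝ f x v = 0 := by
    intro x hx
    have : f =ᶠ[𝓝 x] fun _ => 0 := notMem_tsupport_iff_eventuallyEq.mp hx
    rw [this.lineDeriv_eq]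
    simp [lineDeriv]
  have h1 : Integrable ((tsupport f).indicator fun _ => (C : ℝ) * ‖v‖) :=
    (integrable_indicator_iff hc.isCompact.measurableSet).mpr
      (integrableOn_const hc.isCompact.measure_lt_top.ne)
  refine h1.mono' (aestronglyMeasurable_lineDeriv hf.continuous _) (Eventually.of_forall fun x => ?_)
  by_cases hx : x ∈ tsupport f
  · rw [indicator_of_mem hx]
    exact norm_lineDeriv_le_of_lipschitz ℝ hf
  · rw [indicator_of_notMem hx, h0 x hx, norm_zero]

/-- The Jacobian determinant of two compactly supported Lipschitz functions has integral zero.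
A difference quotient takes the place of the second derivatives, which need not exist. -/
lemma integral_lineDeriv_mul_sub_eq_zero {f h : ℝ × ℝ → ℝ} {C D : NNReal} (hf : LipschitzWith C f)
    (hfc : HasCompactSupport f) (hh : LipschitzWith D h) (hhc : HasCompactSupport h) (v w : ℝ × ℝ) :
    ∫ x, lineDeriv ℝ f x w * lineDeriv ℝ h x v = ∫ x, lineDeriv ℝ h x w * lineDeriv ℝ f x v := by
  have A := hf.integral_inv_smul_sub_mul_tendsto_integral_lineDeriv_mul
    (hh.integrable_lineDeriv hhc v) w (μ := volume)
  have B := hh.integral_inv_smul_sub_mul_tendsto_integral_lineDeriv_mul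
    (hf.integrable_lineDeriv hfc (-v)) (-w) (μ := volume)
  simp_rw [lineDeriv_neg, neg_mul_neg] at B
  refine tendsto_nhds_unique A (B.congr fun t => ?_)
  -- the `v`-derivative is moved to the other factor, and the shift by `a` with it
  have key : ∀ a : ℝ × ℝ, ∫ x, lineDeriv ℝ h x v * f (x + a)
      = ∫ x, - lineDeriv ℝ f x v * h (x + (-a)) := by
    intro a
    have hha : LipschitzWith D fun x => h (x + (-a)) := by
      have := hh.comp (LipschitzWith.id.add (LipschitzWith.const (-a)))
      rwa [add_zero, mul_one] at this
    have h1 := hha.integral_lineDeriv_mul_eq hf hfc v (μ := volume)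
    simp_rw [lineDeriv_neg, lineDeriv_comp_add_right] at h1
    rw [← h1, ← integral_add_right_eq_self (fun x => lineDeriv ℝ h (x + -a) v * f x) a]
    simp [add_assoc]
  have hint1 : ∀ a : ℝ × ℝ, Integrable fun x => lineDeriv ℝ h x v * f (x + a) := by
    intro a
    obtain ⟨M, hM⟩ := hfc.exists_bound_of_continuous hf.continuous
    exact (hh.integrable_lineDeriv hhc v).mul_bdd
      ((hf.continuous.comp (continuous_add_const a)).aestronglyMeasurable)
      (Eventually.of_forall fun x => hM _)
  have hint2 : ∀ a : ℝ × ℝ, Integrable fun x => -lineDeriv ℝ f x v * h (x + a) := by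
    intro a
    obtain ⟨M, hM⟩ := hhc.exists_bound_of_continuous hh.continuous
    exact (hf.integrable_lineDeriv hfc v).neg.mul_bdd
      ((hh.continuous.comp (continuous_add_const a)).aestronglyMeasurable)
      (Eventually.of_forall fun x => hM _)
  have e1 : ∫ x, (t⁻¹ • (f (x + t • w) - f x)) * lineDeriv ℝ h x v
      = t⁻¹ * (∫ x, (lineDeriv ℝ h x v * f (x + t • w) - lineDeriv ℝ h x v * f (x + 0))) := by
    rw [← integral_const_mul]
    congr 1; ext x; rw [add_zero, smul_eq_mul]; ring
  have e2 : ∫ x, (t⁻¹ • (h (x + t • -w) - h x)) * -lineDeriv ℝ f x v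
      = t⁻¹ * (∫ x, (-lineDeriv ℝ f x v * h (x + t • -w) - -lineDeriv ℝ f x v * h (x + 0))) := by
    rw [← integral_const_mul]
    congr 1; ext x; rw [add_zero, smul_eq_mul]; ring
  rw [e1, e2, integral_sub (hint1 _) (hint1 _), integral_sub (hint2 _) (hint2 _), key, key,
    smul_neg, neg_zero]

/-- The complex version: `∫ dh ∧ df = 0` for locally Lipschitz functions, `h` with compact
support. -/
lemma integral_wedge_eq_zero {f h : ℝ × ℝ → ℂ} (hf : LocallyLipschitz f) (hh : LocallyLipschitz h)
    (hhc : HasCompactSupport h) :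
    Integrable (fun q => fderiv ℝ h q (1, 0) * fderiv ℝ f q (0, 1)
      - fderiv ℝ h q (0, 1) * fderiv ℝ f q (1, 0)) ∧
    ∫ q, (fderiv ℝ h q (1, 0) * fderiv ℝ f q (0, 1) - fderiv ℝ h q (0, 1) * fderiv ℝ f q (1, 0))
      = 0 := by
  -- only the values of `f` near the support of `h` matter
  obtain ⟨C, g, hg, hgc, hgf⟩ := hf.exists_lipschitzWith_eventuallyEq hhc.isCompact
  obtain ⟨D, hD⟩ := hh.lipschitzWith_of_hasCompactSupport hhc
  have hrew : ∀ q, fderiv ℝ h q (1, 0) * fderiv ℝ f q (0, 1) - fderiv ℝ h q (0, 1) * fderiv ℝ f q (1, 0)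
      = fderiv ℝ h q (1, 0) * fderiv ℝ g q (0, 1) - fderiv ℝ h q (0, 1) * fderiv ℝ g q (1, 0) := by
    intro q
    by_cases hq : q ∈ tsupport h
    · rw [(hgf q hq).fderiv_eq]
    · have : h =ᶠ[𝓝 q] fun _ => 0 := notMem_tsupport_iff_eventuallyEq.mp hq
      rw [this.fderiv_eq]; simp
  simp_rw [hrew]
  -- real and imaginary parts
  have hre : LipschitzWith 1 Complex.re := by
    have := Complex.reCLM.lipschitz; simp only [Complex.reCLM_nnnorm] at this; exact this
  have him : LipschitzWith 1 Complex.im := by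
    have := Complex.imCLM.lipschitz; simp only [Complex.imCLM_nnnorm] at this; exact this
  have lre : ∀ {u : ℝ × ℝ → ℂ} {K}, LipschitzWith K u → LipschitzWith K fun q => (u q).re := by
    intro u K hu; have := hre.comp hu; rwa [one_mul] at this
  have lim : ∀ {u : ℝ × ℝ → ℂ} {K}, LipschitzWith K u → LipschitzWith K fun q => (u q).im := by
    intro u K hu; have := him.comp hu; rwa [one_mul] at this
  have cre : ∀ {u : ℝ × ℝ → ℂ}, HasCompactSupport u → HasCompactSupport fun q => (u q).re :=
    fun hu => hu.comp_left (g := Complex.re) rfl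
  have cim : ∀ {u : ℝ × ℝ → ℂ}, HasCompactSupport u → HasCompactSupport fun q => (u q).im :=
    fun hu => hu.comp_left (g := Complex.im) rfl
  have dre : ∀ {u : ℝ × ℝ → ℂ} {q}, DifferentiableAt ℝ u q → ∀ v, fderiv ℝ u q v
      = ((lineDeriv ℝ (fun q => (u q).re) q v : ℝ) : ℂ)
        + ((lineDeriv ℝ (fun q => (u q).im) q v : ℝ) : ℂ) * Complex.I := by
    intro u q hu v
    have h1 := (Complex.reCLM.hasFDerivAt.comp q hu.hasFDerivAt).hasLineDerivAt v
    have h2 := (Complex.imCLM.hasFDerivAt.comp q hu.hasFDerivAt).hasLineDerivAt v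
    have h1' := h1.lineDeriv
    have h2' := h2.lineDeriv
    simp only [Function.comp_def, Complex.reCLM_apply, Complex.imCLM_apply,
      ContinuousLinearMap.comp_apply] at h1' h2'
    rw [h1', h2', Complex.re_add_im]
  have hint : ∀ {a b : ℝ × ℝ → ℝ} {K L}, LipschitzWith K a → HasCompactSupport a → LipschitzWith L b →
      ∀ v w, Integrable fun q => lineDeriv ℝ a q v * lineDeriv ℝ b q w := by
    intro a b K L ha hac hb v w
    exact (ha.integrable_lineDeriv hac v).mul_bdd
      (aestronglyMeasurable_lineDeriv hb.continuous _)
      (Eventually.of_forall fun x => norm_lineDeriv_le_of_lipschitz ℝ hb)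
  have key : ∀ {a b : ℝ × ℝ → ℝ} {K L}, LipschitzWith K a → HasCompactSupport a → LipschitzWith L b →
      HasCompactSupport b → Integrable (fun q => lineDeriv ℝ a q (1, 0) * lineDeriv ℝ b q (0, 1)
        - lineDeriv ℝ a q (0, 1) * lineDeriv ℝ b q (1, 0)) ∧
      ∫ q, (lineDeriv ℝ a q (1, 0) * lineDeriv ℝ b q (0, 1)
        - lineDeriv ℝ a q (0, 1) * lineDeriv ℝ b q (1, 0)) = 0 := by
    intro a b K L ha hac hb hbc
    refine ⟨(hint ha hac hb _ _).sub (hint ha hac hb _ _), ?_⟩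
    rw [integral_sub (hint ha hac hb _ _) (hint ha hac hb _ _),
      integral_lineDeriv_mul_sub_eq_zero ha hac hb hbc (0, 1) (1, 0)]
    simp_rw [mul_comm (lineDeriv ℝ b _ _)]
    simp
  obtain ⟨i1, z1⟩ := key (lre hD) (cre hhc) (lre hg) (cre hgc)
  obtain ⟨i2, z2⟩ := key (lim hD) (cim hhc) (lim hg) (cim hgc)
  obtain ⟨i3, z3⟩ := key (lre hD) (cre hhc) (lim hg) (cim hgc)
  obtain ⟨i4, z4⟩ := key (lim hD) (cim hhc) (lre hg) (cre hgc)
  have hae : (fun q => fderiv ℝ h q (1, 0) * fderiv ℝ g q (0, 1) - fderiv ℝ h q (0, 1) * fderiv ℝ g q (1, 0))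
      =ᵐ[volume] fun q => (((lineDeriv ℝ (fun q => (h q).re) q (1, 0) * lineDeriv ℝ (fun q => (g q).re) q (0, 1)
        - lineDeriv ℝ (fun q => (h q).re) q (0, 1) * lineDeriv ℝ (fun q => (g q).re) q (1, 0) : ℝ) : ℂ)
        - ((lineDeriv ℝ (fun q => (h q).im) q (1, 0) * lineDeriv ℝ (fun q => (g q).im) q (0, 1)
        - lineDeriv ℝ (fun q => (h q).im) q (0, 1) * lineDeriv ℝ (fun q => (g q).im) q (1, 0) : ℝ) : ℂ))
        + (((lineDeriv ℝ (fun q => (h q).re) q (1, 0) * lineDeriv ℝ (fun q => (g q).im) q (0, 1)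
        - lineDeriv ℝ (fun q => (h q).re) q (0, 1) * lineDeriv ℝ (fun q => (g q).im) q (1, 0) : ℝ) : ℂ)
        + ((lineDeriv ℝ (fun q => (h q).im) q (1, 0) * lineDeriv ℝ (fun q => (g q).re) q (0, 1)
        - lineDeriv ℝ (fun q => (h q).im) q (0, 1) * lineDeriv ℝ (fun q => (g q).re) q (1, 0) : ℝ) : ℂ))
        * Complex.I := by
    filter_upwards [hD.ae_differentiableAt (μ := volume), hg.ae_differentiableAt (μ := volume)] with q h1 h2
    rw [dre h1, dre h1, dre h2, dre h2]
    push_cast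
    linear_combination (((lineDeriv ℝ (fun q => (h q).im) q (1, 0) : ℝ) : ℂ)
        * ((lineDeriv ℝ (fun q => (g q).im) q (0, 1) : ℝ) : ℂ)
        - ((lineDeriv ℝ (fun q => (h q).im) q (0, 1) : ℝ) : ℂ)
        * ((lineDeriv ℝ (fun q => (g q).im) q (1, 0) : ℝ) : ℂ)) * Complex.I_sq
  have comb : ∀ {u₁ u₂ u₃ u₄ : ℝ × ℝ → ℝ}, Integrable u₁ → Integrable u₂ → Integrable u₃ →
      Integrable u₄ → ∫ q, u₁ q = 0 → ∫ q, u₂ q = 0 → ∫ q, u₃ q = 0 → ∫ q, u₄ q = 0 →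
      Integrable (fun q => (((u₁ q : ℝ) : ℂ) - (u₂ q : ℝ)) + (((u₃ q : ℝ) : ℂ) + (u₄ q : ℝ))
        * Complex.I) ∧
      ∫ q, (((u₁ q : ℝ) : ℂ) - (u₂ q : ℝ)) + (((u₃ q : ℝ) : ℂ) + (u₄ q : ℝ)) * Complex.I = 0 := by
    intro u₁ u₂ u₃ u₄ i1 i2 i3 i4 z1 z2 z3 z4
    have e1 : Integrable fun q => ((u₁ q : ℝ) : ℂ) - (u₂ q : ℝ) := i1.ofReal.sub i2.ofReal
    have e2 : Integrable fun q => ((u₃ q : ℝ) : ℂ) + (u₄ q : ℝ) := i3.ofReal.add i4.ofReal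
    refine ⟨e1.add (e2.mul_const _), ?_⟩
    rw [integral_add e1 (e2.mul_const _), integral_sub i1.ofReal i2.ofReal, integral_mul_const,
      integral_add i3.ofReal i4.ofReal, integral_complex_ofReal, integral_complex_ofReal,
      integral_complex_ofReal, integral_complex_ofReal, z1, z2, z3, z4]
    simp
  rw [integral_congr_ae hae, integrable_congr hae]
  exact comb i1 i2 i3 i4 z1 z2 z3 z4

/-! ### Holomorphic functions of two variables -/

/-- Cauchy's formula on a small circle in the direction `v`, differentiated under the integral sign,
shows that directional derivatives of holomorphic functions of two variables are holomorphic. -/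
lemma differentiableOn_fderiv_apply {O : Set (ℂ × ℂ)} (hO : IsOpen O) {f : ℂ × ℂ → ℂ}
    (hf : DifferentiableOn ℂ f O) (v : ℂ × ℂ) :
    DifferentiableOn ℂ (fun x => fderiv ℂ f x v) O := by
  intro x₀ hx₀
  apply DifferentiableAt.differentiableWithinAt
  obtain ⟨ε₁, hε₁, hb₁⟩ := Metric.isOpen_iff.mp hO x₀ hx₀
  obtain ⟨ε₂, hε₂, hb₂⟩ := Metric.continuousAt_iff.mp ((hf.differentiableAt (hO.mem_nhds hx₀)).continuousAt) 1 one_pos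
  set ε := min ε₁ ε₂ / 3 with hε
  have hεpos : 0 < ε := by positivity
  have hball : Metric.ball x₀ (3 * ε) ⊆ O := fun y hy => hb₁ (Metric.ball_subset_ball
    (by rw [hε]; linarith [min_le_left ε₁ ε₂]) hy)
  have hbd : ∀ y ∈ Metric.ball x₀ (3 * ε), dist (f y) (f x₀) < 1 := fun y hy => hb₂ (by
    rw [Metric.mem_ball] at hy; linarith [min_le_right ε₁ ε₂])
  -- a bound for the derivative, from the bound for `f` on balls of radius `ε`
  have hfd : ∀ y ∈ Metric.ball x₀ (2 * ε), ‖fderiv ℂ f y‖ ≤ 2 / ε := by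
    intro y hy
    have hsub : Metric.ball y ε ⊆ Metric.ball x₀ (3 * ε) :=
      Metric.ball_subset_ball' (by rw [Metric.mem_ball] at hy; linarith)
    refine Complex.norm_fderiv_le_div_of_mapsTo_ball ((hf.mono hball).mono hsub) ?_ hεpos
    intro z hz
    rw [Metric.mem_closedBall]
    have h1 := hbd z (hsub hz)
    have h2 := hbd y (hsub (Metric.mem_ball_self hεpos))
    rw [dist_comm] at h2
    linarith [dist_triangle (f z) (f x₀) (f y)]
  set r := ε / (2 * (‖v‖ + 1)) with hr
  have hrpos : 0 < r := by positivity
  have hrv : r * ‖v‖ < ε := by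
    rw [hr, div_mul_eq_mul_div, div_lt_iff₀ (by positivity)]
    nlinarith [norm_nonneg v]
  have hin : ∀ x ∈ Metric.ball x₀ ε, ∀ ζ : ℂ, ‖ζ‖ ≤ r → x + ζ • v ∈ Metric.ball x₀ (2 * ε) := by
    intro x hx ζ hζ
    rw [Metric.mem_ball, dist_eq_norm] at hx ⊢
    have : ‖ζ • v‖ ≤ r * ‖v‖ := by
      rw [norm_smul]; exact mul_le_mul_of_nonneg_right hζ (norm_nonneg _)
    calc ‖x + ζ • v - x₀‖ = ‖(x - x₀) + ζ • v‖ := by congr 1; abel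
      _ ≤ ‖x - x₀‖ + ‖ζ • v‖ := norm_add_le _ _
      _ < _ := by linarith
  have h23 : Metric.ball x₀ (2 * ε) ⊆ Metric.ball x₀ (3 * ε) :=
    Metric.ball_subset_ball (by linarith)
  have hdf : ∀ y ∈ Metric.ball x₀ (2 * ε), DifferentiableAt ℂ f y := fun y hy =>
    hf.differentiableAt (hO.mem_nhds (hball (h23 hy)))
  have hcirc : ∀ θ : ℝ, ‖circleMap 0 r θ‖ ≤ r := fun θ => by
    rw [norm_circleMap_zero, abs_of_pos hrpos]
  -- Cauchy's formula
  have hrep : ∀ x ∈ Metric.ball x₀ ε, fderiv ℂ f x v = (2 * Real.pi * Complex.I : ℂ)⁻¹ •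
      ∫ θ in (0 : ℝ)..2 * Real.pi, (deriv (circleMap 0 r) θ * (1 / (circleMap 0 r θ) ^ 2)) •
        f (x + circleMap 0 r θ • v) := by
    intro x hx
    have hline : ∀ ζ : ℂ, HasDerivAt (fun ζ : ℂ => x + ζ • v) v ζ := fun ζ => by
      simpa using ((hasDerivAt_id ζ).smul_const v).const_add x
    have hdc : DifferentiableOn ℂ (fun ζ : ℂ => f (x + ζ • v)) (Metric.closedBall 0 r) := by
      intro ζ hζ
      have := hdf _ (hin x hx ζ (by simpa using hζ))
      exact (this.comp ζ (hline ζ).differentiableAt).differentiableWithinAt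
    have h1 := DifferentiableOn.circleIntegral_one_div_sub_center_pow_smul hrpos 1 hdc
    simp only [Nat.reduceAdd, iteratedDeriv_one, Nat.factorial_one, Nat.cast_one, div_one,
      circleIntegral, sub_zero, smul_smul] at h1
    have hd0 : DifferentiableAt ℂ f (x + (0:ℂ) • v) := hdf _ (hin x hx 0 (by simpa using hrpos.le))
    have h2 : deriv (fun ζ : ℂ => f (x + ζ • v)) 0 = fderiv ℂ f x v := by
      have := (hd0.hasFDerivAt.comp_hasDerivAt (0:ℂ) (hline 0)).deriv
      simp only [Function.comp_def] at this
      simpa using this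
    rw [← h2, h1, inv_smul_smul₀]
    simp [Real.pi_ne_zero]
  -- differentiation under the integral sign
  have hmain : HasFDerivAt (fun x => ∫ θ in (0 : ℝ)..2 * Real.pi,
      (deriv (circleMap 0 r) θ * (1 / (circleMap 0 r θ) ^ 2)) • f (x + circleMap 0 r θ • v))
      (∫ θ in (0 : ℝ)..2 * Real.pi, (deriv (circleMap 0 r) θ * (1 / (circleMap 0 r θ) ^ 2)) •
        fderiv ℂ f (x₀ + circleMap 0 r θ • v)) x₀ := by
    have hk : Continuous fun θ => (deriv (circleMap 0 r) θ * (1 / (circleMap 0 r θ) ^ 2)) := by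
      simp only [deriv_circleMap]
      exact ((continuous_circleMap 0 r).mul continuous_const).mul
        (continuous_const.div ((continuous_circleMap 0 r).pow 2)
          fun θ => pow_ne_zero 2 (circleMap_ne_center hrpos.ne'))
    have hfc : ∀ x ∈ Metric.ball x₀ ε, Continuous fun θ => f (x + circleMap 0 r θ • v) := by
      intro x hx
      rw [continuous_iff_continuousAt]
      intro θ
      refine ContinuousAt.comp (f := fun θ => x + circleMap 0 r θ • v) ?_
        (by have := continuous_circleMap 0 r; fun_prop)
      exact (hdf _ (hin x hx _ (hcirc θ))).continuousAt
    refine intervalIntegral.hasFDerivAt_integral_of_dominated_of_fderiv_le (μ := volume)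
      (bound := fun _ => r⁻¹ * (2 / ε)) (s := Metric.ball x₀ ε)
      (F := fun x θ => (deriv (circleMap 0 r) θ * (1 / (circleMap 0 r θ) ^ 2)) •
        f (x + circleMap 0 r θ • v))
      (F' := fun x θ => (deriv (circleMap 0 r) θ * (1 / (circleMap 0 r θ) ^ 2)) •
        fderiv ℂ f (x + circleMap 0 r θ • v))
      (Metric.ball_mem_nhds _ hεpos) ?_ ?_ ?_ ?_ ?_ ?_
    · filter_upwards [Metric.ball_mem_nhds x₀ hεpos] with x hx
      exact (hk.smul (hfc x hx)).aestronglyMeasurable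
    · exact (hk.smul (hfc x₀ (Metric.mem_ball_self hεpos))).intervalIntegrable _ _
    · refine hk.aestronglyMeasurable.smul (Measurable.aestronglyMeasurable ?_)
      exact (measurable_fderiv ℂ f).comp
        (by have := continuous_circleMap 0 r; exact Continuous.measurable (by fun_prop))
    · refine Eventually.of_forall fun θ _ x hx => ?_
      rw [norm_smul]
      have h1 : ‖deriv (circleMap 0 r) θ * (1 / (circleMap 0 r θ) ^ 2)‖ = r⁻¹ := by
        rw [deriv_circleMap, norm_mul, norm_mul, norm_div, norm_pow, norm_circleMap_zero,
          abs_of_pos hrpos, Complex.norm_I, mul_one, norm_one]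
        field_simp
      rw [h1]
      exact mul_le_mul_of_nonneg_left (hfd _ (hin x hx _ (hcirc θ))) (by positivity)
    · exact intervalIntegrable_const
    · refine Eventually.of_forall fun θ _ x hx => ?_
      have h1 := (hdf _ (hin x hx _ (hcirc θ))).hasFDerivAt
      have h2 : HasFDerivAt (fun x : ℂ × ℂ => x + circleMap 0 r θ • v) (ContinuousLinearMap.id ℂ _) x :=
        (hasFDerivAt_id x).add_const _
      exact (h1.comp x h2).fun_const_smul _
  have hev : (fun x => fderiv ℂ f x v) =ᶠ[𝓝 x₀] fun x => (2 * Real.pi * Complex.I : ℂ)⁻¹ •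
      ∫ θ in (0 : ℝ)..2 * Real.pi, (deriv (circleMap 0 r) θ * (1 / (circleMap 0 r θ) ^ 2)) •
        f (x + circleMap 0 r θ • v) := by
    filter_upwards [Metric.ball_mem_nhds x₀ hεpos] with x hx
    exact hrep x hx
  exact (hmain.differentiableAt.fun_const_smul _).congr_of_eventuallyEq hev

lemma fderiv_prod_apply {f : ℂ × ℂ → ℂ} (x v : ℂ × ℂ) :
    fderiv ℂ f x v = v.1 * fderiv ℂ f x (1, 0) + v.2 * fderiv ℂ f x (0, 1) := by
  have : v = v.1 • ((1, 0) : ℂ × ℂ) + v.2 • ((0, 1) : ℂ × ℂ) := by ext <;> simp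
  conv_lhs => rw [this]
  rw [map_add, map_smul, map_smul, smul_eq_mul, smul_eq_mul]

lemma differentiableOn_fderiv_prod {O : Set (ℂ × ℂ)} (hO : IsOpen O) {f : ℂ × ℂ → ℂ}
    (hf : DifferentiableOn ℂ f O) : DifferentiableOn ℂ (fderiv ℂ f) O := by
  have e : fderiv ℂ f = fun x => fderiv ℂ f x (1, 0) • ContinuousLinearMap.fst ℂ ℂ ℂ
      + fderiv ℂ f x (0, 1) • ContinuousLinearMap.snd ℂ ℂ ℂ := by
    ext x <;> simp
  rw [e]
  exact ((differentiableOn_fderiv_apply hO hf _).smul_const _).add ((differentiableOn_fderiv_apply hO hf _).smul_const _)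

lemma contDiffAt_prod_of_differentiableOn {O : Set (ℂ × ℂ)} (hO : IsOpen O) {f : ℂ × ℂ → ℂ}
    (hf : DifferentiableOn ℂ f O) {x : ℂ × ℂ} (hx : x ∈ O) : ContDiffAt ℂ 1 f x := by
  rw [contDiffAt_one_iff]
  exact ⟨fderiv ℂ f, O, hO.mem_nhds hx, (differentiableOn_fderiv_prod hO hf).continuousOn,
    fun y hy => (hf.differentiableAt (hO.mem_nhds hy)).hasFDerivAt⟩

/-! ### Deformation of surfaces -/

lemma measurable_surfJac (η : ℝ × ℝ → ℝ × ℝ) : Measurable (surfJac η) := by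
  have h1 : Measurable fun q => fderiv ℝ η q (1, 0) := measurable_fderiv_apply_const ℝ η _
  have h2 : Measurable fun q => fderiv ℝ η q (0, 1) := measurable_fderiv_apply_const ℝ η _
  unfold surfJac
  fun_prop

lemma continuous_surf {η : ℝ × ℝ → ℝ × ℝ} (hη : Continuous η) : Continuous (surf η) := by
  unfold surf; fun_prop

lemma abs_fst_le_norm (v : ℝ × ℝ) : |v.1| ≤ ‖v‖ := norm_fst_le v
lemma abs_snd_le_norm (v : ℝ × ℝ) : |v.2| ≤ ‖v‖ := norm_snd_le v

lemma norm_fderiv_basis_le {η : ℝ × ℝ → ℝ × ℝ} {q : ℝ × ℝ} {C : ℝ} (h : ‖fderiv ℝ η q‖ ≤ C) :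
    ‖fderiv ℝ η q (1, 0)‖ ≤ C ∧ ‖fderiv ℝ η q (0, 1)‖ ≤ C := by
  constructor
  · refine ((fderiv ℝ η q).le_opNorm _).trans ?_
    simpa [Prod.norm_def] using h
  · refine ((fderiv ℝ η q).le_opNorm _).trans ?_
    simpa [Prod.norm_def] using h

lemma norm_surfJac_le {η : ℝ × ℝ → ℝ × ℝ} {q : ℝ × ℝ} {C : ℝ}
    (h : ‖fderiv ℝ η q‖ ≤ C) : ‖surfJac η q‖ ≤ (1 + C) * (1 + C) + C * C := by
  have hC : 0 ≤ C := (norm_nonneg _).trans h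
  obtain ⟨h1, h2⟩ := norm_fderiv_basis_le h
  have a11 := (abs_fst_le_norm _).trans h1
  have a12 := (abs_snd_le_norm _).trans h1
  have a21 := (abs_fst_le_norm _).trans h2
  have a22 := (abs_snd_le_norm _).trans h2
  have hI : ∀ a : ℝ, |a| ≤ C → ‖Complex.I * (a : ℂ)‖ ≤ C := fun a ha => by simpa using ha
  have hI1 : ∀ a : ℝ, |a| ≤ C → ‖1 + Complex.I * (a : ℂ)‖ ≤ 1 + C := fun a ha =>
    (norm_add_le _ _).trans (by rw [norm_one]; linarith [hI a ha])
  unfold surfJac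
  refine (norm_sub_le _ _).trans (add_le_add ?_ ?_)
  · rw [norm_mul]
    exact mul_le_mul (hI1 _ a11) (hI1 _ a22) (norm_nonneg _) (by linarith)
  · rw [norm_mul]
    exact mul_le_mul (hI _ a21) (hI _ a12) (norm_nonneg _) hC

lemma integrableOn_surf {O : Set (ℂ × ℂ)} {f : ℂ × ℂ → ℂ} (hf : ContinuousOn f O)
    {η : ℝ × ℝ → ℝ × ℝ} (hη : LocallyLipschitz η) {B : Set (ℝ × ℝ)} (hB : IsCompact B)
    (hmem : ∀ q ∈ B, surf η q ∈ O) : IntegrableOn (fun q => f (surf η q) * surfJac η q) B := by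
  obtain ⟨C, -, hC⟩ := hη.exists_norm_fderiv_le hB
  have h1 : IntegrableOn (fun q => f (surf η q)) B :=
    (hf.comp (continuous_surf hη.continuous).continuousOn hmem).integrableOn_compact hB
  refine Integrable.mul_bdd h1 (measurable_surfJac η).aestronglyMeasurable (c := (1 + C) * (1 + C) + C * C) ?_
  filter_upwards [ae_restrict_mem hB.measurableSet] with q hq
  exact norm_surfJac_le (hC q hq)

lemma hasFDerivAt_surf {η : ℝ × ℝ → ℝ × ℝ} {q : ℝ × ℝ} (h : DifferentiableAt ℝ η q) :
    ∃ A : (ℝ × ℝ) →L[ℝ] ℂ × ℂ, HasFDerivAt (surf η) A q ∧ ∀ v : ℝ × ℝ,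
      A v = ((v.1 : ℂ) + Complex.I * ((fderiv ℝ η q v).1 : ℂ),
        (v.2 : ℂ) + Complex.I * ((fderiv ℝ η q v).2 : ℂ)) := by
  have h0 := h.hasFDerivAt
  have c1 : HasFDerivAt (fun q : ℝ × ℝ => (q.1 : ℂ)) _ q :=
    Complex.ofRealCLM.hasFDerivAt.comp q hasFDerivAt_fst
  have c2 : HasFDerivAt (fun q : ℝ × ℝ => (q.2 : ℂ)) _ q :=
    Complex.ofRealCLM.hasFDerivAt.comp q hasFDerivAt_snd
  have d1 : HasFDerivAt (fun q : ℝ × ℝ => ((η q).1 : ℂ)) _ q :=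
    Complex.ofRealCLM.hasFDerivAt.comp q h0.fst
  have d2 : HasFDerivAt (fun q : ℝ × ℝ => ((η q).2 : ℂ)) _ q :=
    Complex.ofRealCLM.hasFDerivAt.comp q h0.snd
  exact ⟨_, (c1.add (d1.const_mul Complex.I)).prodMk (c2.add (d2.const_mul Complex.I)),
    fun v => by simp⟩

/-- A holomorphic function composed with a locally Lipschitz surface and multiplied by a function
that vanishes outside the part of the surface in its domain is locally Lipschitz. -/
lemma locallyLipschitz_comp_surf_mul {O : Set (ℂ × ℂ)} (hO : IsOpen O) {f : ℂ × ℂ → ℂ}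
    (hf : DifferentiableOn ℂ f O) {η : ℝ × ℝ → ℝ × ℝ} (hη : LocallyLipschitz η) {d : ℝ × ℝ → ℂ}
    (hd : LocallyLipschitz d) (hmem : ∀ q ∈ tsupport d, surf η q ∈ O) :
    LocallyLipschitz fun q => f (surf η q) * d q := by
  have hsurf : LocallyLipschitz (surf η) := by
    have e : surf η = (fun p : (ℝ × ℝ) × (ℝ × ℝ) =>
        ((p.1.1 : ℂ) + Complex.I * (p.2.1 : ℂ), (p.1.2 : ℂ) + Complex.I * (p.2.2 : ℂ)))
        ∘ fun q => (q, η q) := rfl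
    rw [e]
    refine (ContDiff.locallyLipschitz (𝕂 := ℝ) ?_).comp (LocallyLipschitz.id.prodMk hη)
    have hc : ContDiff ℝ 1 (fun x : ℝ => (x : ℂ)) := Complex.ofRealCLM.contDiff
    have c11 := hc.comp (contDiff_fst.comp (contDiff_fst (E := ℝ × ℝ) (F := ℝ × ℝ)))
    have c12 := hc.comp (contDiff_snd.comp (contDiff_fst (E := ℝ × ℝ) (F := ℝ × ℝ)))
    have c21 := hc.comp (contDiff_fst.comp (contDiff_snd (E := ℝ × ℝ) (F := ℝ × ℝ)))
    have c22 := hc.comp (contDiff_snd.comp (contDiff_snd (E := ℝ × ℝ) (F := ℝ × ℝ)))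
    exact (c11.add (contDiff_const.mul c21)).prodMk (c12.add (contDiff_const.mul c22))
  intro q
  by_cases hq : q ∈ tsupport d
  · have hfq : ContDiffAt ℝ 1 f (surf η q) :=
      (contDiffAt_prod_of_differentiableOn hO hf (hmem q hq)).restrict_scalars ℝ
    have hm : ContDiffAt ℝ 1 (fun p : (ℂ × ℂ) × ℂ => f p.1 * p.2) (surf η q, d q) :=
      (ContDiffAt.comp (surf η q, d q) hfq contDiffAt_fst).mul contDiffAt_snd
    obtain ⟨K, T, hT, hK⟩ := hm.exists_lipschitzOnWith
    have hX : LocallyLipschitz fun q => (surf η q, d q) := hsurf.prodMk hd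
    set X : ℝ × ℝ → (ℂ × ℂ) × ℂ := fun q => (surf η q, d q) with hXdef
    obtain ⟨K', V, hV, hK'⟩ := hX q
    have hT' : X ⁻¹' T ∈ 𝓝 q := hX.continuous.continuousAt.preimage_mem_nhds hT
    have hcomp := hK.comp (hK'.mono (inter_subset_left (t := X ⁻¹' T))) fun x hx => hx.2
    exact ⟨K * K', V ∩ X ⁻¹' T, inter_mem hV hT', hcomp⟩
  · have h0 : d =ᶠ[𝓝 q] fun _ => 0 := notMem_tsupport_iff_eventuallyEq.mp hq
    refine ⟨0, {x | d x = 0}, h0, ?_⟩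
    intro x hx y hy
    have hx' : d x = 0 := hx
    have hy' : d y = 0 := hy
    simp [hx', hy']

/-- The Jacobian of the surface `η + t δ` at a point where both fields are differentiable. -/
def jacPath (η δ : ℝ × ℝ → ℝ × ℝ) (q : ℝ × ℝ) (t : ℂ) : ℂ :=
  (1 + Complex.I * ((fderiv ℝ η q (1, 0)).1 + t * (fderiv ℝ δ q (1, 0)).1)) *
    (1 + Complex.I * ((fderiv ℝ η q (0, 1)).2 + t * (fderiv ℝ δ q (0, 1)).2)) -
  (Complex.I * ((fderiv ℝ η q (0, 1)).1 + t * (fderiv ℝ δ q (0, 1)).1)) *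
    (Complex.I * ((fderiv ℝ η q (1, 0)).2 + t * (fderiv ℝ δ q (1, 0)).2))

/-- The `t`-derivative of `jacPath`. -/
def jacPathDeriv (η δ : ℝ × ℝ → ℝ × ℝ) (q : ℝ × ℝ) (t : ℂ) : ℂ :=
  (Complex.I * (fderiv ℝ δ q (1, 0)).1) *
    (1 + Complex.I * ((fderiv ℝ η q (0, 1)).2 + t * (fderiv ℝ δ q (0, 1)).2)) +
  (1 + Complex.I * ((fderiv ℝ η q (1, 0)).1 + t * (fderiv ℝ δ q (1, 0)).1)) *
    (Complex.I * (fderiv ℝ δ q (0, 1)).2) -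
  ((Complex.I * (fderiv ℝ δ q (0, 1)).1) *
    (Complex.I * ((fderiv ℝ η q (1, 0)).2 + t * (fderiv ℝ δ q (1, 0)).2)) +
  (Complex.I * ((fderiv ℝ η q (0, 1)).1 + t * (fderiv ℝ δ q (0, 1)).1)) *
    (Complex.I * (fderiv ℝ δ q (1, 0)).2))

lemma surfJac_add_smul {η δ : ℝ × ℝ → ℝ × ℝ} {q : ℝ × ℝ} (hη : DifferentiableAt ℝ η q)
    (hδ : DifferentiableAt ℝ δ q) (t : ℝ) : surfJac (η + t • δ) q = jacPath η δ q t := by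
  unfold surfJac jacPath
  rw [fderiv_add hη (hδ.const_smul t), fderiv_const_smul hδ]
  simp

lemma hasDerivAt_jacPath (η δ : ℝ × ℝ → ℝ × ℝ) (q : ℝ × ℝ) (t : ℝ) :
    HasDerivAt (fun t : ℝ => jacPath η δ q t) (jacPathDeriv η δ q t) t := by
  have h : ∀ a b : ℂ, HasDerivAt (fun t : ℝ => Complex.I * (a + (t : ℂ) * b)) (Complex.I * b) t := by
    intro a b
    have := (((Complex.ofRealCLM.hasDerivAt (x := t)).mul_const b).const_add a).const_mul Complex.I
    simpa using this
  have := (((h (fderiv ℝ η q (1, 0)).1 (fderiv ℝ δ q (1, 0)).1).const_add 1).mul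
    ((h (fderiv ℝ η q (0, 1)).2 (fderiv ℝ δ q (0, 1)).2).const_add 1)).sub
    ((h (fderiv ℝ η q (0, 1)).1 (fderiv ℝ δ q (0, 1)).1).mul
    (h (fderiv ℝ η q (1, 0)).2 (fderiv ℝ δ q (1, 0)).2))
  exact this

lemma measurable_jacPath (η δ : ℝ × ℝ → ℝ × ℝ) :
    Measurable (fun z : (ℝ × ℝ) × ℝ => jacPath η δ z.1 z.2) ∧
    Measurable (fun z : (ℝ × ℝ) × ℝ => jacPathDeriv η δ z.1 z.2) := by
  have h1 : Measurable fun q => fderiv ℝ η q (1, 0) := measurable_fderiv_apply_const ℝ η _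
  have h2 : Measurable fun q => fderiv ℝ η q (0, 1) := measurable_fderiv_apply_const ℝ η _
  have h3 : Measurable fun q => fderiv ℝ δ q (1, 0) := measurable_fderiv_apply_const ℝ δ _
  have h4 : Measurable fun q => fderiv ℝ δ q (0, 1) := measurable_fderiv_apply_const ℝ δ _
  unfold jacPath jacPathDeriv
  constructor <;> fun_prop

lemma norm_jacPath_le {η δ : ℝ × ℝ → ℝ × ℝ} {q : ℝ × ℝ} {C : ℝ} (h : ‖fderiv ℝ η q‖ ≤ C)
    (h' : ‖fderiv ℝ δ q‖ ≤ C) {t : ℝ} (ht : t ∈ Icc (0 : ℝ) 1) :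
    ‖jacPath η δ q t‖ ≤ 8 * (1 + C) ^ 2 ∧ ‖jacPathDeriv η δ q t‖ ≤ 16 * (1 + C) ^ 2 := by
  have hC : 0 ≤ C := (norm_nonneg _).trans h
  obtain ⟨h1, h2⟩ := norm_fderiv_basis_le h
  obtain ⟨h3, h4⟩ := norm_fderiv_basis_le h'
  have hIb : ∀ b : ℝ, |b| ≤ C → ‖Complex.I * (b : ℂ)‖ ≤ 2 * (1 + C) := fun b hb => by
    have : ‖Complex.I * (b : ℂ)‖ = |b| := by simp
    rw [this]; linarith
  have hI : ∀ a b : ℝ, |a| ≤ C → |b| ≤ C → ‖Complex.I * ((a : ℂ) + t * b)‖ ≤ 1 + 2 * C := by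
    intro a b ha hb
    have e : Complex.I * ((a : ℂ) + t * b) = Complex.I * ((a + t * b : ℝ) : ℂ) := by push_cast; ring
    rw [e]
    have : ‖Complex.I * ((a + t * b : ℝ) : ℂ)‖ = |a + t * b| := by
      rw [norm_mul, Complex.norm_I, one_mul, Complex.norm_real, Real.norm_eq_abs]
    rw [this]
    have h5 := abs_add_le a (t * b)
    rw [abs_mul, abs_of_nonneg ht.1] at h5
    have := mul_le_mul ht.2 hb (abs_nonneg b) zero_le_one
    linarith
  have hI' : ∀ a b : ℝ, |a| ≤ C → |b| ≤ C → ‖Complex.I * ((a : ℂ) + t * b)‖ ≤ 2 * (1 + C) := by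
    intro a b ha hb; linarith [hI a b ha hb]
  have hI1 : ∀ a b : ℝ, |a| ≤ C → |b| ≤ C → ‖1 + Complex.I * ((a : ℂ) + t * b)‖ ≤ 2 * (1 + C) := by
    intro a b ha hb
    refine (norm_add_le _ _).trans ?_
    rw [norm_one]; linarith [hI a b ha hb]
  have hm : ∀ u v : ℂ, ‖u‖ ≤ 2 * (1 + C) → ‖v‖ ≤ 2 * (1 + C) → ‖u * v‖ ≤ 4 * (1 + C) ^ 2 := by
    intro u v hu hv
    rw [norm_mul]
    calc _ ≤ (2 * (1 + C)) * (2 * (1 + C)) := mul_le_mul hu hv (norm_nonneg _) (by linarith)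
      _ = _ := by ring
  have a1 := (abs_fst_le_norm _).trans h1
  have a2 := (abs_snd_le_norm _).trans h1
  have b1 := (abs_fst_le_norm _).trans h2
  have b2 := (abs_snd_le_norm _).trans h2
  have c1 := (abs_fst_le_norm _).trans h3
  have c2 := (abs_snd_le_norm _).trans h3
  have d1 := (abs_fst_le_norm _).trans h4
  have d2 := (abs_snd_le_norm _).trans h4
  constructor
  · unfold jacPath
    refine (norm_sub_le _ _).trans ?_
    have := hm _ _ (hI1 _ _ a1 c1) (hI1 _ _ b2 d2)
    have := hm _ _ (hI' _ _ b1 d1) (hI' _ _ a2 c2)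
    linarith
  · unfold jacPathDeriv
    refine (norm_sub_le _ _).trans ((add_le_add (norm_add_le _ _) (norm_add_le _ _)).trans ?_)
    have := hm _ _ (hIb _ c1) (hI1 _ _ b2 d2)
    have := hm _ _ (hI1 _ _ a1 c1) (hIb _ d2)
    have := hm _ _ (hIb _ d1) (hI' _ _ a2 c2)
    have := hm _ _ (hI' _ _ b1 d1) (hIb _ c2)
    linarith

/-- The derivative along `t` of the pulled back form on the surface `η + t δ`. -/
def pathDensity (f : ℂ × ℂ → ℂ) (η δ : ℝ × ℝ → ℝ × ℝ) (q : ℝ × ℝ) (t : ℝ) : ℂ :=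
  fderiv ℂ f (surf (η + t • δ) q) (Complex.I * (δ q).1, Complex.I * (δ q).2) * jacPath η δ q t
    + f (surf (η + t • δ) q) * jacPathDeriv η δ q t

lemma surf_add_smul (η δ : ℝ × ℝ → ℝ × ℝ) (q : ℝ × ℝ) (t : ℝ) :
    surf (η + t • δ) q = surf η q + (t : ℂ) • (Complex.I * (δ q).1, Complex.I * (δ q).2) := by
  simp only [surf, Pi.add_apply, Pi.smul_apply, Prod.fst_add, Prod.smul_fst, Prod.snd_add,
    Prod.smul_snd, smul_eq_mul, Prod.smul_mk, Prod.mk_add_mk]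
  push_cast
  ext <;> simp <;> ring

/-- The density is the coefficient of the exact form `dh₁ ∧ dξ₂ + dξ₁ ∧ dh₂`, where `h = f(ξ) i δ` is
the contraction of `f` with the velocity of the deformation. -/
lemma integral_pathDensity_eq_zero {O : Set (ℂ × ℂ)} (hO : IsOpen O) {f : ℂ × ℂ → ℂ}
    (hf : DifferentiableOn ℂ f O) {η δ : ℝ × ℝ → ℝ × ℝ} (hη : LocallyLipschitz η)
    (hδ : LocallyLipschitz δ) (hc : HasCompactSupport δ) (t : ℝ)
    (hmem : ∀ q ∈ tsupport δ, surf (η + t • δ) q ∈ O) :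
    ∫ q in tsupport δ, pathDensity f η δ q t = 0 := by
  set ζ : ℝ × ℝ → ℝ × ℝ := η + t • δ with hζ
  have hζL : LocallyLipschitz ζ := by
    have e : ζ = fun q => η q + t • δ q := rfl
    rw [e]
    exact (ContDiff.locallyLipschitz (𝕂 := ℝ) (f := fun p : (ℝ × ℝ) × (ℝ × ℝ) => p.1 + t • p.2)
      (contDiff_fst.add (contDiff_snd.const_smul t))).comp (hη.prodMk hδ)
  have hd : ∀ π : ℝ × ℝ →L[ℝ] ℝ, LocallyLipschitz fun q => Complex.I * ((π (δ q) : ℝ) : ℂ) := by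
    intro π
    exact (ContDiff.locallyLipschitz (𝕂 := ℝ) (f := fun p : ℝ × ℝ => Complex.I * ((π p : ℝ) : ℂ))
      (contDiff_const.mul (Complex.ofRealCLM.contDiff.comp π.contDiff))).comp hδ
  have hsub : ∀ π : ℝ × ℝ →L[ℝ] ℝ, tsupport (fun q => Complex.I * ((π (δ q) : ℝ) : ℂ)) ⊆ tsupport δ := by
    intro π
    refine closure_mono fun q hq => ?_
    rw [Function.mem_support] at hq ⊢
    contrapose! hq
    simp [hq]
  have hh : ∀ π : ℝ × ℝ →L[ℝ] ℝ,
      LocallyLipschitz fun q => f (surf ζ q) * (Complex.I * ((π (δ q) : ℝ) : ℂ)) := fun π =>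
    locallyLipschitz_comp_surf_mul hO hf hζL (hd π) fun q hq => hmem q (hsub π hq)
  have hhc : ∀ π : ℝ × ℝ →L[ℝ] ℝ,
      HasCompactSupport fun q => f (surf ζ q) * (Complex.I * ((π (δ q) : ℝ) : ℂ)) := by
    intro π
    exact (hc.mono' ((subset_tsupport _).trans (hsub π))).mul_left
  have hξ : ∀ π : ℂ × ℂ →L[ℝ] ℂ, LocallyLipschitz fun q => π (surf ζ q) := by
    intro π
    have e : (fun q => π (surf ζ q)) = (fun p : (ℝ × ℝ) × (ℝ × ℝ) =>
        π ((p.1.1 : ℂ) + Complex.I * (p.2.1 : ℂ), (p.1.2 : ℂ) + Complex.I * (p.2.2 : ℂ)))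
        ∘ fun q => (q, ζ q) := rfl
    rw [e]
    refine (ContDiff.locallyLipschitz (𝕂 := ℝ) ?_).comp (LocallyLipschitz.id.prodMk hζL)
    have hc : ContDiff ℝ 1 (fun x : ℝ => (x : ℂ)) := Complex.ofRealCLM.contDiff
    have c11 := hc.comp (contDiff_fst.comp (contDiff_fst (E := ℝ × ℝ) (F := ℝ × ℝ)))
    have c12 := hc.comp (contDiff_snd.comp (contDiff_fst (E := ℝ × ℝ) (F := ℝ × ℝ)))
    have c21 := hc.comp (contDiff_fst.comp (contDiff_snd (E := ℝ × ℝ) (F := ℝ × ℝ)))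
    have c22 := hc.comp (contDiff_snd.comp (contDiff_snd (E := ℝ × ℝ) (F := ℝ × ℝ)))
    exact π.contDiff.comp ((c11.add (contDiff_const.mul c21)).prodMk (c12.add (contDiff_const.mul c22)))
  -- the integrals of `dh₁ ∧ dξ₂` and of `dh₂ ∧ dξ₁`
  obtain ⟨i1, w1⟩ := integral_wedge_eq_zero (hξ (ContinuousLinearMap.snd ℝ ℂ ℂ))
    (hh (ContinuousLinearMap.fst ℝ ℝ ℝ)) (hhc _)
  obtain ⟨i2, w2⟩ := integral_wedge_eq_zero (hξ (ContinuousLinearMap.fst ℝ ℂ ℂ))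
    (hh (ContinuousLinearMap.snd ℝ ℝ ℝ)) (hhc _)
  have h3 := integral_sub i1 i2
  rw [w1, w2, sub_zero] at h3
  have hout : ∀ q, q ∉ tsupport δ → δ q = 0 ∧ fderiv ℝ δ q = 0 := fun q hq => by
    have h0 : δ =ᶠ[𝓝 q] fun _ => 0 := notMem_tsupport_iff_eventuallyEq.mp hq
    exact ⟨h0.self_of_nhds, by rw [h0.fderiv_eq]; simp⟩
  rw [setIntegral_eq_integral_of_forall_compl_eq_zero]
  · rw [← h3]
    apply integral_congr_ae
    filter_upwards [hη.ae_differentiableAt volume, hδ.ae_differentiableAt volume] with q hq1 hq2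
    have hζd : DifferentiableAt ℝ ζ q := hq1.add (hq2.const_smul t)
    have hζf : ∀ v, fderiv ℝ ζ q v = fderiv ℝ η q v + t • fderiv ℝ δ q v := fun v => by
      rw [hζ, fderiv_add hq1 (hq2.const_smul t), fderiv_const_smul hq2]; rfl
    obtain ⟨A, hA, hAv⟩ := hasFDerivAt_surf hζd
    have hπ : ∀ (π : ℂ × ℂ →L[ℝ] ℂ) v, fderiv ℝ (fun q => π (surf ζ q)) q v = π (A v) := by
      intro π v
      have := (π.hasFDerivAt.comp q hA).fderiv
      simp only [Function.comp_def] at this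
      rw [this]; rfl
    have hδπ : ∀ π : ℝ × ℝ →L[ℝ] ℝ, HasFDerivAt (fun q => Complex.I * ((π (δ q) : ℝ) : ℂ))
        (Complex.I • (Complex.ofRealCLM.comp (π.comp (fderiv ℝ δ q)))) q := by
      intro π
      have h1 := π.hasFDerivAt.comp q hq2.hasFDerivAt
      exact (Complex.ofRealCLM.hasFDerivAt.comp q h1).const_mul Complex.I
    -- pointwise identity of the density and the exact form
    by_cases hq : q ∈ tsupport δ
    · have hfq : HasFDerivAt f ((fderiv ℂ f (surf ζ q)).restrictScalars ℝ) (surf ζ q) :=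
        (hf.differentiableAt (hO.mem_nhds (hmem q hq))).hasFDerivAt.restrictScalars ℝ
      have hhf : ∀ (π : ℝ × ℝ →L[ℝ] ℝ) v,
          fderiv ℝ (fun q => f (surf ζ q) * (Complex.I * ((π (δ q) : ℝ) : ℂ))) q v
          = f (surf ζ q) * (Complex.I * ((π (fderiv ℝ δ q v) : ℝ) : ℂ))
            + fderiv ℂ f (surf ζ q) (A v) * (Complex.I * ((π (δ q) : ℝ) : ℂ)) := by
        intro π v
        have h1 := ((hfq.comp q hA).mul (hδπ π)).fderiv
        have e : (fun q => f (surf ζ q) * (Complex.I * ((π (δ q) : ℝ) : ℂ)))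
          = (f ∘ surf ζ) * fun q => (Complex.I * ((π (δ q) : ℝ) : ℂ)) := rfl
        rw [e, h1]
        simp
        ring
      rw [hhf, hhf, hhf, hhf, hπ, hπ, hπ, hπ]
      simp only [hAv, ContinuousLinearMap.coe_fst', ContinuousLinearMap.coe_snd']
      unfold pathDensity jacPath jacPathDeriv
      rw [← hζ, fderiv_prod_apply _ (Complex.I * _, Complex.I * _)]
      rw [fderiv_prod_apply _ (((1 : ℝ) : ℂ) + _, _), fderiv_prod_apply _ (((0 : ℝ) : ℂ) + _, _)]
      simp only [hζf, Prod.fst_add, Prod.snd_add, Prod.smul_fst, Prod.smul_snd, smul_eq_mul]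
      push_cast
      ring
    · obtain ⟨h1, h2⟩ := hout q hq
      have h0 : δ =ᶠ[𝓝 q] fun _ => 0 := notMem_tsupport_iff_eventuallyEq.mp hq
      have hz : ∀ (π : ℝ × ℝ →L[ℝ] ℝ),
          fderiv ℝ (fun q => f (surf ζ q) * (Complex.I * ((π (δ q) : ℝ) : ℂ))) q = 0 := by
        intro π
        have : (fun q => f (surf ζ q) * (Complex.I * ((π (δ q) : ℝ) : ℂ))) =ᶠ[𝓝 q] fun _ => 0 := by
          filter_upwards [h0] with y hy
          simp [hy]
        rw [this.fderiv_eq]; simp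
      rw [hz, hz]
      simp [pathDensity, jacPathDeriv, h1, h2, Prod.mk_zero_zero]
  · intro q hq
    obtain ⟨h1, h2⟩ := hout q hq
    simp [pathDensity, jacPathDeriv, h1, h2, Prod.mk_zero_zero]

/-- **Cauchy's theorem for Lipschitz surfaces.** The integral of `f dξ₁ ∧ dξ₂` over a surface does
not change under a compactly supported deformation inside the domain of holomorphy of `f`. -/
theorem setIntegral_surf_add_eq {O : Set (ℂ × ℂ)} (hO : IsOpen O) {f : ℂ × ℂ → ℂ}
    (hf : DifferentiableOn ℂ f O) {η δ : ℝ × ℝ → ℝ × ℝ} (hη : LocallyLipschitz η)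
    (hδ : LocallyLipschitz δ) {B : Set (ℝ × ℝ)} (hB : IsCompact B) (hsupp : tsupport δ ⊆ B)
    (hmem : ∀ t ∈ Icc (0 : ℝ) 1, ∀ q ∈ tsupport δ, surf (η + t • δ) q ∈ O)
    (hmemB : ∀ q ∈ B, surf η q ∈ O) :
    ∫ q in B, f (surf (η + δ) q) * surfJac (η + δ) q = ∫ q in B, f (surf η q) * surfJac η q := by
  set S := tsupport δ with hS
  have hSc : IsCompact S := hB.of_isClosed_subset (isClosed_tsupport _) hsupp
  have hηδ : LocallyLipschitz (η + δ) := by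
    have e : η + δ = fun q => η q + δ q := rfl
    rw [e]
    exact (ContDiff.locallyLipschitz (𝕂 := ℝ) (f := fun p : (ℝ × ℝ) × (ℝ × ℝ) => p.1 + p.2)
      (contDiff_fst.add contDiff_snd)).comp (hη.prodMk hδ)
  have hout : ∀ q, q ∉ S → (η + δ) =ᶠ[𝓝 q] η := fun q hq => by
    have h0 : δ =ᶠ[𝓝 q] fun _ => 0 := notMem_tsupport_iff_eventuallyEq.mp hq
    filter_upwards [h0] with y hy
    simp [hy]
  have hsurf0 : ∀ q, q ∉ S → surf (η + δ) q = surf η q := fun q hq => by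
    simp only [surf, (hout q hq).self_of_nhds]
  have hjac0 : ∀ q, q ∉ S → surfJac (η + δ) q = surfJac η q := fun q hq => by
    simp only [surfJac, (hout q hq).fderiv_eq]
  have hi1 : IntegrableOn (fun q => f (surf (η + δ) q) * surfJac (η + δ) q) B := by
    refine integrableOn_surf hf.continuousOn hηδ hB fun q hq => ?_
    by_cases h : q ∈ S
    · simpa using hmem 1 ⟨zero_le_one, le_rfl⟩ q h
    · rw [hsurf0 q h]; exact hmemB q hq
  have hi0 : IntegrableOn (fun q => f (surf η q) * surfJac η q) B :=
    integrableOn_surf hf.continuousOn hη hB hmemB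
  rw [← sub_eq_zero, ← integral_sub hi1 hi0]
  rw [setIntegral_eq_of_subset_of_forall_sdiff_eq_zero hB.measurableSet hsupp
    (fun q hq => by rw [hsurf0 q hq.2, hjac0 q hq.2, sub_self])]
  -- the density is integrable on `S × [0, 1]`
  have hXc : ContinuousOn (fun z : (ℝ × ℝ) × ℝ => surf (η + z.2 • δ) z.1) (S ×ˢ Icc (0:ℝ) 1) := by
    have e : (fun z : (ℝ × ℝ) × ℝ => surf (η + z.2 • δ) z.1) = fun z : (ℝ × ℝ) × ℝ =>
        surf η z.1 + (z.2 : ℂ) • (Complex.I * ((δ z.1).1 : ℂ), Complex.I * ((δ z.1).2 : ℂ)) := by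
      ext1 z; exact surf_add_smul _ _ _ _
    rw [e]
    have h1 := continuous_surf hη.continuous
    have h2 := hδ.continuous
    exact Continuous.continuousOn (by fun_prop)
  have hXm : MapsTo (fun z : (ℝ × ℝ) × ℝ => surf (η + z.2 • δ) z.1) (S ×ˢ Icc (0:ℝ) 1) O :=
    fun z hz => hmem z.2 hz.2 z.1 hz.1
  have hc0 : ContinuousOn (fun z : (ℝ × ℝ) × ℝ => f (surf (η + z.2 • δ) z.1)) (S ×ˢ Icc (0:ℝ) 1) :=
    hf.continuousOn.comp hXc hXm
  have hc1 : ContinuousOn (fun z : (ℝ × ℝ) × ℝ => fderiv ℂ f (surf (η + z.2 • δ) z.1)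
      (Complex.I * (δ z.1).1, Complex.I * (δ z.1).2)) (S ×ˢ Icc (0:ℝ) 1) := by
    refine ContinuousOn.clm_apply ((differentiableOn_fderiv_prod hO hf).continuousOn.comp hXc hXm) ?_
    have h2 := hδ.continuous
    exact Continuous.continuousOn (by fun_prop)
  have hK : IsCompact (S ×ˢ Icc (0:ℝ) 1) := hSc.prod isCompact_Icc
  obtain ⟨C1, -, hC1⟩ := hη.exists_norm_fderiv_le hSc
  obtain ⟨C2, -, hC2⟩ := hδ.exists_norm_fderiv_le hSc
  have hjb : ∀ z ∈ S ×ˢ Icc (0:ℝ) 1, ‖jacPath η δ z.1 z.2‖ ≤ 8 * (1 + max C1 C2) ^ 2 ∧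
      ‖jacPathDeriv η δ z.1 z.2‖ ≤ 16 * (1 + max C1 C2) ^ 2 := fun z hz =>
    norm_jacPath_le ((hC1 _ hz.1).trans (le_max_left _ _)) ((hC2 _ hz.1).trans (le_max_right _ _)) hz.2
  have hint : IntegrableOn (fun z : (ℝ × ℝ) × ℝ => pathDensity f η δ z.1 z.2) (S ×ˢ Icc (0:ℝ) 1)
      (volume.prod volume) := by
    unfold pathDensity
    refine Integrable.add ?_ ?_
    · refine Integrable.mul_bdd (hc1.integrableOn_compact hK)
        (measurable_jacPath η δ).1.aestronglyMeasurable (c := 8 * (1 + max C1 C2) ^ 2) ?_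
      filter_upwards [ae_restrict_mem hK.measurableSet] with z hz using (hjb z hz).1
    · refine Integrable.mul_bdd (hc0.integrableOn_compact hK)
        (measurable_jacPath η δ).2.aestronglyMeasurable (c := 16 * (1 + max C1 C2) ^ 2) ?_
      filter_upwards [ae_restrict_mem hK.measurableSet] with z hz using (hjb z hz).2
  rw [IntegrableOn, ← Measure.prod_restrict] at hint
  -- fundamental theorem of calculus in `t`
  have hftc : ∀ᵐ q ∂(volume.restrict S), f (surf (η + δ) q) * surfJac (η + δ) q
      - f (surf η q) * surfJac η q = ∫ t in Icc (0:ℝ) 1, pathDensity f η δ q t := by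
    filter_upwards [ae_restrict_mem hSc.measurableSet, ae_restrict_of_ae (hη.ae_differentiableAt volume),
      ae_restrict_of_ae (hδ.ae_differentiableAt volume)] with q hq hq1 hq2
    have hder : ∀ t ∈ Set.uIcc (0:ℝ) 1, HasDerivAt
        (fun t : ℝ => f (surf (η + t • δ) q) * jacPath η δ q t) (pathDensity f η δ q t) t := by
      intro t ht
      rw [uIcc_of_le zero_le_one] at ht
      have hX : HasDerivAt (fun t : ℝ => surf (η + t • δ) q)
          (Complex.I * ((δ q).1 : ℂ), Complex.I * ((δ q).2 : ℂ)) t := by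
        have e : (fun t : ℝ => surf (η + t • δ) q) = fun t : ℝ => surf η q
          + (t : ℂ) • (Complex.I * ((δ q).1 : ℂ), Complex.I * ((δ q).2 : ℂ)) := by
          ext1 t; exact surf_add_smul _ _ _ _
        rw [e]
        simpa using ((Complex.ofRealCLM.hasDerivAt (x := t)).smul_const
          (Complex.I * ((δ q).1 : ℂ), Complex.I * ((δ q).2 : ℂ))).const_add (surf η q)
      have hfq : HasFDerivAt f ((fderiv ℂ f (surf (η + t • δ) q)).restrictScalars ℝ) (surf (η + t • δ) q) :=
        (hf.differentiableAt (hO.mem_nhds (hmem t ht q hq))).hasFDerivAt.restrictScalars ℝ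
      exact (hfq.comp_hasDerivAt t hX).mul (hasDerivAt_jacPath η δ q t)
    have hci : ContinuousOn (fun t => pathDensity f η δ q t) (Icc (0:ℝ) 1) := by
      have hm : MapsTo (fun t : ℝ => (q, t)) (Icc (0:ℝ) 1) (S ×ˢ Icc (0:ℝ) 1) := fun t ht => ⟨hq, ht⟩
      have k1 := hc1.comp (Continuous.continuousOn (by fun_prop : Continuous fun t : ℝ => (q, t))) hm
      have k0 := hc0.comp (Continuous.continuousOn (by fun_prop : Continuous fun t : ℝ => (q, t))) hm
      unfold pathDensity
      refine (k1.mul (Continuous.continuousOn ?_)).add (k0.mul (Continuous.continuousOn ?_))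
      · unfold jacPath; fun_prop
      · unfold jacPathDeriv; fun_prop
    have h1 := intervalIntegral.integral_eq_sub_of_hasDerivAt hder
      (by apply ContinuousOn.intervalIntegrable; rwa [uIcc_of_le zero_le_one])
    rw [intervalIntegral.integral_of_le zero_le_one, ← integral_Icc_eq_integral_Ioc] at h1
    rw [h1, ← surfJac_add_smul hq1 hq2, ← surfJac_add_smul hq1 hq2]
    simp
  rw [integral_congr_ae hftc, integral_integral_swap hint]
  rw [setIntegral_congr_fun measurableSet_Icc (g := fun _ => (0 : ℂ))]
  · simp
  · intro t ht
    exact integral_pathDensity_eq_zero hO hf hη hδ hSc t (hmem t ht)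

/-! ### Normal form near the saddle -/

/-- In the coordinates `(z, w)`, the function `G` is close to its quadratic model `w - α z²`: the
values and both partial derivatives satisfy the error bounds that hold for an analytic function with
Taylor expansion `w - α z² + O(w² + |z w| + |z|³)`. -/
structure NormalFormBound (G : ℂ × ℂ → ℂ) (α C δ : ℝ) : Prop where
  deriv_snd : ∀ z w : ℂ, ‖z‖ ≤ δ → ‖w‖ ≤ δ → ‖fderiv ℂ G (z, w) (0, 1) - 1‖ ≤ C * (‖z‖ + ‖w‖)
  deriv_fst : ∀ z w : ℂ, ‖z‖ ≤ δ → ‖w‖ ≤ δ →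
    ‖fderiv ℂ G (z, w) (1, 0) + 2 * α * z‖ ≤ C * (‖w‖ + ‖z‖ ^ 2)
  value : ∀ z w : ℂ, ‖z‖ ≤ δ → ‖w‖ ≤ δ →
    ‖G (z, w) - (w - α * z ^ 2)‖ ≤ C * (‖w‖ * (‖z‖ + ‖w‖) + ‖z‖ ^ 3)

lemma hasDerivAt_comp_mk_left {G : ℂ × ℂ → ℂ} (hG : Differentiable ℂ G) (z w : ℂ) :
    HasDerivAt (fun z => G (z, w)) (fderiv ℂ G (z, w) (1, 0)) z :=
  (hG (z, w)).hasFDerivAt.comp_hasDerivAt z ((hasDerivAt_id z).prodMk (hasDerivAt_const z w))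

lemma hasDerivAt_comp_mk_right {G : ℂ × ℂ → ℂ} (hG : Differentiable ℂ G) (z w : ℂ) :
    HasDerivAt (fun w => G (z, w)) (fderiv ℂ G (z, w) (0, 1)) w :=
  (hG (z, w)).hasFDerivAt.comp_hasDerivAt w ((hasDerivAt_const w z).prodMk (hasDerivAt_id w))

/-- A holomorphic function that is `O(z³)` has a derivative that is `O(z²)`, by Cauchy's estimate on
the circle of radius `|z|` about `z`. -/
lemma norm_deriv_le_sq_of_norm_le_cube {u : ℂ → ℂ} (hu : Differentiable ℂ u) (h0 : deriv u 0 = 0)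
    {C δ : ℝ} (hC : 0 ≤ C) (h : ∀ z, ‖z‖ ≤ δ → ‖u z‖ ≤ C * ‖z‖ ^ 3) {z : ℂ} (hz : 2 * ‖z‖ ≤ δ) :
    ‖deriv u z‖ ≤ 8 * C * ‖z‖ ^ 2 := by
  rcases eq_or_ne z 0 with rfl | hz0
  · simp [h0]
  have hp : 0 < ‖z‖ := norm_pos_iff.mpr hz0
  have := Complex.norm_deriv_le_of_forall_mem_sphere_norm_le (f := u) (c := z) (R := ‖z‖)
    (C := C * (2 * ‖z‖) ^ 3) hp hu.diffContOnCl ?_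
  · refine this.trans (le_of_eq ?_)
    field_simp
    ring
  · intro w hw
    rw [mem_sphere_iff_norm] at hw
    have h1 : ‖w‖ ≤ 2 * ‖z‖ := by
      have := norm_add_le (w - z) z
      rw [sub_add_cancel] at this; linarith
    refine (h w (h1.trans hz)).trans ?_
    gcongr

/-- A local normal form: if `G(0) = 0`, `∇G(0) = (0, 1)` and
`G = w - α z² + O(G² + |z G| + ‖(z, w)‖³)`, then `G` is close to `w - α z²` with two derivatives. -/
lemma exists_normalFormBound {G : ℂ × ℂ → ℂ} (hG : Differentiable ℂ G) (h0 : G 0 = 0)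
    (hz0 : fderiv ℂ G 0 (1, 0) = 0) (hw0 : fderiv ℂ G 0 (0, 1) = 1) {α : ℝ}
    (hα : (fun ξ : ℂ × ℂ => G ξ - (ξ.2 - (α : ℂ) * ξ.1 ^ 2)) =O[𝓝 0]
      (fun ξ : ℂ × ℂ => ‖G ξ‖ ^ 2 + ‖ξ.1‖ * ‖G ξ‖ + ‖ξ‖ ^ 3)) :
    ∃ C δ : ℝ, 0 < C ∧ 0 < δ ∧ NormalFormBound G α C δ := by
  have hGO : DifferentiableOn ℂ G univ := hG.differentiableOn
  -- `∂G/∂w`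
  have hdw := differentiableOn_fderiv_apply isOpen_univ hGO ((0, 1) : ℂ × ℂ)
  have hdz := differentiableOn_fderiv_apply isOpen_univ hGO ((1, 0) : ℂ × ℂ)
  have hdw0 : DifferentiableAt ℂ (fun ξ => fderiv ℂ G ξ (0, 1)) 0 :=
    hdw.differentiableAt univ_mem
  obtain ⟨C1, hC1⟩ := hdw0.isBigO_sub.bound
  -- `∂G/∂z` is Lipschitz near `0`
  have hdzc := contDiffAt_prod_of_differentiableOn isOpen_univ hdz (mem_univ (0 : ℂ × ℂ))
  obtain ⟨K, S, hS, hK⟩ := hdzc.exists_lipschitzOnWith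
  obtain ⟨C2, hC2⟩ := hα.bound
  have hc0 : Tendsto G (𝓝 0) (𝓝 0) := by simpa [h0] using (hG.continuous.tendsto 0)
  have hsm : ∀ᶠ ξ in 𝓝 (0 : ℂ × ℂ), |C2| * (‖G ξ‖ + ‖ξ.1‖) ≤ 1 / 2 := by
    have h1 : Tendsto (fun ξ : ℂ × ℂ => |C2| * (‖G ξ‖ + ‖ξ.1‖)) (𝓝 0) (𝓝 (|C2| * (0 + 0))) := by
      refine Tendsto.const_mul _ (Tendsto.add (by simpa using hc0.norm) ?_)
      have : Continuous fun ξ : ℂ × ℂ => ‖ξ.1‖ := by fun_prop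
      simpa using this.tendsto 0
    exact h1.eventually_le_const (by norm_num)
  obtain ⟨δ, hδ, hball⟩ := Metric.eventually_nhds_iff.mp (hC1.and (hC2.and (hsm.and hS)))
  set δ' := min (δ / 2) 1 with hδ'
  have hδ'0 : 0 < δ' := by positivity
  have hmem : ∀ z w : ℂ, ‖z‖ ≤ δ' → ‖w‖ ≤ δ' → dist ((z, w) : ℂ × ℂ) 0 < δ := by
    intro z w hz hw
    rw [dist_zero_right, Prod.norm_def]
    have : δ' ≤ δ / 2 := min_le_left _ _
    exact max_lt (by simp; linarith) (by simp; linarith)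
  have hδ'1 : δ' ≤ 1 := min_le_right _ _
  have nle : ∀ z w : ℂ, ‖((z, w) : ℂ × ℂ)‖ ≤ ‖z‖ + ‖w‖ := fun z w => by
    rw [Prod.norm_def]
    exact max_le (by simp) (by simp)
  -- The error term `G² + |z G|` is absorbed on the left, which gives `G(z, 0) = O(z²)` and then
  -- the cubic bound on the axis `w = 0`
  set E : ℝ := 2 * (|α| + |C2|) with hE
  have hA := abs_nonneg C2
  have hαn := abs_nonneg α
  have hE0 : 0 ≤ E := by positivity
  set C3 : ℝ := |C2| * (E ^ 2 + E + 1) with hC3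
  have hC30 : 0 ≤ C3 := by positivity
  have hu : ∀ z : ℂ, ‖z‖ ≤ δ' → ‖G (z, 0) + α * z ^ 2‖ ≤ C3 * ‖z‖ ^ 3 := by
    intro z hz
    obtain ⟨-, h2, h3, -⟩ := hball (hmem z 0 hz (by simpa using hδ'0.le))
    simp only [zero_sub, sub_neg_eq_add] at h2 h3
    have hn : ‖((z, 0) : ℂ × ℂ)‖ = ‖z‖ := by simp [Prod.norm_def]
    rw [hn, Real.norm_of_nonneg (by positivity)] at h2
    have hz1 : ‖z‖ ≤ 1 := hz.trans hδ'1
    have hzz : ‖(α : ℂ) * z ^ 2‖ = |α| * ‖z‖ ^ 2 := by simp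
    set u := ‖G (z, 0)‖ with hu
    have hu0 : 0 ≤ u := norm_nonneg _
    have hz0 := norm_nonneg z
    have h4 : u ≤ ‖G (z, 0) + α * z ^ 2‖ + |α| * ‖z‖ ^ 2 := by
      rw [← hzz, hu]
      have := norm_sub_le (G (z, 0) + α * z ^ 2) (α * z ^ 2)
      simpa using this
    have h5 : C2 * (u ^ 2 + ‖z‖ * u + ‖z‖ ^ 3) ≤ |C2| * (u ^ 2 + ‖z‖ * u + ‖z‖ ^ 3) :=
      mul_le_mul_of_nonneg_right (le_abs_self _) (by positivity)
    have h6 : u ≤ E * ‖z‖ ^ 2 := by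
      have e1 : |C2| * (u ^ 2 + ‖z‖ * u + ‖z‖ ^ 3) = |C2| * (u + ‖z‖) * u + |C2| * ‖z‖ ^ 3 := by ring
      have e2 : |C2| * (u + ‖z‖) * u ≤ 1 / 2 * u := mul_le_mul_of_nonneg_right h3 hu0
      have e3 : |C2| * ‖z‖ ^ 3 ≤ |C2| * ‖z‖ ^ 2 :=
        mul_le_mul_of_nonneg_left (pow_le_pow_of_le_one hz0 hz1 (by norm_num)) hA
      nlinarith
    have h7 : E * ‖z‖ ^ 2 ≤ E * ‖z‖ := by
      refine mul_le_mul_of_nonneg_left ?_ hE0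
      nlinarith
    have h8 : u ^ 2 ≤ E ^ 2 * ‖z‖ ^ 3 := by
      have := mul_le_mul h6 (h6.trans h7) hu0 (by positivity)
      calc u ^ 2 = u * u := by ring
        _ ≤ _ := this
        _ = _ := by ring
    have h9 : ‖z‖ * u ≤ E * ‖z‖ ^ 3 := by
      have := mul_le_mul_of_nonneg_left h6 hz0
      calc ‖z‖ * u ≤ _ := this
        _ = _ := by ring
    calc ‖G (z, 0) + α * z ^ 2‖ ≤ |C2| * (u ^ 2 + ‖z‖ * u + ‖z‖ ^ 3) := h2.trans h5
      _ ≤ |C2| * (E ^ 2 * ‖z‖ ^ 3 + E * ‖z‖ ^ 3 + ‖z‖ ^ 3) := by gcongr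
      _ = C3 * ‖z‖ ^ 3 := by rw [hC3]; ring
  have hU : ∀ z : ℂ, HasDerivAt (fun z => G (z, 0) + α * z ^ 2)
      (fderiv ℂ G (z, 0) (1, 0) + 2 * α * z) z := fun z => by
    have h := (hasDerivAt_comp_mk_left hG z 0).add (((hasDerivAt_id z).pow 2).const_mul (α : ℂ))
    refine h.congr_deriv ?_
    simp; ring
  have hU' : ∀ z : ℂ, ‖z‖ ≤ δ' / 2 → ‖fderiv ℂ G (z, 0) (1, 0) + 2 * α * z‖ ≤ 8 * C3 * ‖z‖ ^ 2 := by
    intro z hz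
    rw [← (hU z).deriv]
    refine norm_deriv_le_sq_of_norm_le_cube (fun z => (hU z).differentiableAt) ?_ hC30 hu (by linarith)
    rw [(hU 0).deriv]
    simpa [Prod.mk_zero_zero] using hz0
  refine ⟨|C1| + K + 8 * C3 + 1, δ' / 2, by positivity, by positivity, ?_, ?_, ?_⟩
  · intro z w hz hw
    obtain ⟨h1, -⟩ := hball (hmem z w (by linarith) (by linarith))
    rw [hw0, sub_zero] at h1
    refine h1.trans ?_
    have hn := nle z w
    calc C1 * ‖((z, w) : ℂ × ℂ)‖ ≤ |C1| * ‖((z, w) : ℂ × ℂ)‖ := by gcongr; exact le_abs_self _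
      _ ≤ (|C1| + K + 8 * C3 + 1) * (‖z‖ + ‖w‖) := by
        gcongr
        have : (0 : ℝ) ≤ K := K.2
        linarith
  · intro z w hz hw
    obtain ⟨-, -, -, hS1⟩ := hball (hmem z w (by linarith) (by linarith))
    obtain ⟨-, -, -, hS2⟩ := hball (hmem z 0 (by linarith) (by simpa using hδ'0.le))
    have h1 := hK.norm_sub_le hS1 hS2
    have h2 := hU' z hz
    have e : ‖((z, w) : ℂ × ℂ) - (z, 0)‖ = ‖w‖ := by simp [Prod.norm_def]
    rw [e] at h1
    have h3 := norm_add_le (fderiv ℂ G (z, w) (1, 0) - fderiv ℂ G (z, 0) (1, 0))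
      (fderiv ℂ G (z, 0) (1, 0) + 2 * α * z)
    have e3 : ∀ x y c : ℂ, x - y + (y + c) = x + c := fun x y c => by ring
    rw [e3] at h3
    refine h3.trans ?_
    have hKn : (0 : ℝ) ≤ K := K.2
    have a1 := abs_nonneg C1
    have b1 := norm_nonneg w
    have b2 := sq_nonneg ‖z‖
    nlinarith [mul_nonneg a1 b1, mul_nonneg a1 b2, mul_nonneg hKn b2, mul_nonneg hC30 b1]
  · intro z w hz hw
    have h1 := hu z (by linarith)
    have h2 : ‖(G (z, w) - w) - (G (z, 0) - 0)‖ ≤ |C1| * (‖z‖ + ‖w‖) * ‖w - 0‖ := by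
      refine Convex.norm_image_sub_le_of_norm_hasDerivWithin_le (𝕜 := ℂ)
        (f := fun w => G (z, w) - w) (f' := fun w => fderiv ℂ G (z, w) (0, 1) - 1)
        (s := Metric.closedBall 0 ‖w‖) (fun y _ => ?_) (fun y hy => ?_)
        (convex_closedBall _ _) (by simp) (by simp)
      · exact ((hasDerivAt_comp_mk_right hG z y).sub (hasDerivAt_id y)).hasDerivWithinAt
      · have hy' : ‖y‖ ≤ ‖w‖ := by simpa using hy
        obtain ⟨h1, -⟩ := hball (hmem z y (by linarith) (by linarith))
        rw [hw0, sub_zero] at h1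
        refine h1.trans ?_
        have hn := nle z y
        calc C1 * ‖((z, y) : ℂ × ℂ)‖ ≤ |C1| * ‖((z, y) : ℂ × ℂ)‖ := by gcongr; exact le_abs_self _
          _ ≤ |C1| * (‖z‖ + ‖w‖) := by gcongr; linarith
    rw [sub_zero w] at h2
    have h3 := norm_add_le ((G (z, w) - w) - (G (z, 0) - 0)) (G (z, 0) + α * z ^ 2)
    have e : (G (z, w) - w) - (G (z, 0) - 0) + (G (z, 0) + α * z ^ 2) = G (z, w) - (w - α * z ^ 2) := by
      ring
    rw [e] at h3
    refine h3.trans ?_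
    have hKn : (0 : ℝ) ≤ K := K.2
    have a1 := abs_nonneg C1
    have b1 : 0 ≤ ‖w‖ * (‖z‖ + ‖w‖) := by positivity
    have b2 : 0 ≤ ‖z‖ ^ 3 := by positivity
    nlinarith [mul_nonneg a1 b1, mul_nonneg a1 b2, mul_nonneg hKn b2, mul_nonneg hC30 b1,
      mul_nonneg hKn b1, mul_nonneg hC30 b2]

/-! ### The model surface -/

/-- The point `q + i v` of `ℂ²`. -/
def cpt (q v : ℝ × ℝ) : ℂ × ℂ :=
  ((q.1 : ℂ) + Complex.I * (v.1 : ℂ), (q.2 : ℂ) + Complex.I * (v.2 : ℂ))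

lemma surf_eq_cpt (η : ℝ × ℝ → ℝ × ℝ) (q : ℝ × ℝ) : surf η q = cpt q (η q) := rfl

lemma cpt_zero (q : ℝ × ℝ) : cpt q 0 = toC q := by simp [cpt, toC]

lemma continuous_cpt : Continuous fun z : (ℝ × ℝ) × (ℝ × ℝ) => cpt z.1 z.2 := by
  unfold cpt; fun_prop

lemma hasDerivAt_cpt_smul (q v : ℝ × ℝ) (ε : ℝ) :
    HasDerivAt (fun ε : ℝ => cpt q (ε • v)) (Complex.I • toC v) ε := by
  have e : (fun ε : ℝ => cpt q (ε • v)) = fun ε : ℝ => toC q + (ε : ℂ) • (Complex.I • toC v) := by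
    ext1 ε
    simp only [cpt, toC, Prod.smul_fst, Prod.smul_snd, smul_eq_mul, Prod.smul_mk, Prod.mk_add_mk]
    push_cast
    ext <;> simp <;> ring
  rw [e]
  simpa using ((Complex.ofRealCLM.hasDerivAt (x := ε)).smul_const (Complex.I • toC v)).const_add (toC q)

/-- If `s Im G` increases along the segment from the real point `q` to `q + i v`, then
`s Im G(q + i v) > 0`, for a function that is real at real points. -/
lemma im_pos_of_deriv_pos {G : ℂ × ℂ → ℂ} (hG : Differentiable ℂ G)
    (hreal : ∀ q, (G (toC q)).im = 0) {s : ℝ} {q v : ℝ × ℝ}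
    (h : ∀ ε ∈ Icc (0 : ℝ) 1, 0 < s * (fderiv ℂ G (cpt q (ε • v)) (toC v)).re) :
    0 < s * (G (cpt q v)).im := by
  have hd : ∀ ε : ℝ, HasDerivAt (fun ε : ℝ => s * (G (cpt q (ε • v))).im)
      (s * (fderiv ℂ G (cpt q (ε • v)) (toC v)).re) ε := by
    intro ε
    have h1 := ((hG (cpt q (ε • v))).hasFDerivAt.restrictScalars ℝ).comp_hasDerivAt ε
      (hasDerivAt_cpt_smul q v ε)
    have h2 := (Complex.imCLM.hasFDerivAt.comp_hasDerivAt ε h1).const_mul s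
    refine h2.congr_deriv ?_
    simp
  obtain ⟨c, hc, hc'⟩ := exists_hasDerivAt_eq_slope (fun ε : ℝ => s * (G (cpt q (ε • v))).im)
    (fun ε => s * (fderiv ℂ G (cpt q (ε • v)) (toC v)).re) zero_lt_one
    (fun ε _ => (hd ε).continuousAt.continuousWithinAt) (fun ε _ => hd ε)
  have := h c ⟨hc.1.le, hc.2.le⟩
  rw [hc'] at this
  simpa [cpt_zero, hreal] using this

lemma not_mem_cut_of_im_pos {s : ℝ} {z : ℂ} (h : 0 < s * z.im) : z ∉ cut s := fun hz =>
  absurd hz.2 (not_le.mpr h)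

lemma not_mem_cut_of_re_ne {s : ℝ} {z : ℂ} (h : z.re ≠ 0) : z ∉ cut s := fun hz => h hz.1

/-- The model field, of size `l` and height `k`, for `g ≈ w - σ a z²` with `σ = ± 1`, `a > 0`. The
coordinate `z` is turned in the direction `1 - i l s σ`, along which `e^{-i s ρ σ a z²}` decays for
`l = 1`. In the second component, `s Im w = k - l (a t₁² + |t₂| / 4)`: the surface passes the saddle
at height `k`, and `e^{-i s ρ w}` decays along it away from the saddle. The field is linear in
`(l, k)`, so that flattenings and convex combinations of model fields are model fields. -/
def model (s σ a l k : ℝ) (t : ℝ × ℝ) : ℝ × ℝ :=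
  (-(l * s * σ * t.1), s * (k - l * (a * t.1 ^ 2 + |t.2| / 4)))

/-- The value of `w - α z²` on the model surface, `α = σ a`. -/
def modelValue (s σ a l k : ℝ) (t : ℝ × ℝ) : ℂ :=
  (((t.2 - σ * a * t.1 ^ 2 * (1 - l ^ 2) : ℝ)) : ℂ)
    + Complex.I * ((s * (k + l * (a * t.1 ^ 2 - |t.2| / 4)) : ℝ) : ℂ)

lemma norm_ofReal_add_I_mul_le (x y : ℝ) : ‖(x : ℂ) + Complex.I * (y : ℂ)‖ ≤ |x| + |y| := by
  refine (norm_add_le _ _).trans ?_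
  simp

lemma norm_fst_cpt_model_le {s σ a l k : ℝ} (hs : |s| = 1) (hσ : |σ| = 1) (hl : 0 ≤ l) (hl1 : l ≤ 1)
    (t : ℝ × ℝ) {ε : ℝ} (hε : ε ∈ Icc (0 : ℝ) 1) :
    ‖(cpt t (ε • model s σ a l k t)).1‖ ≤ 2 * |t.1| := by
  refine (norm_ofReal_add_I_mul_le _ _).trans ?_
  have : |(ε • model s σ a l k t).1| = ε * l * |t.1| := by
    simp only [model, Prod.smul_fst, smul_eq_mul, abs_mul, abs_neg, hs, hσ, abs_of_nonneg hl,
      abs_of_nonneg hε.1]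
    ring
  rw [this]
  have : ε * l ≤ 1 := mul_le_one₀ hε.2 hl hl1
  nlinarith [abs_nonneg t.1]

lemma abs_snd_model_le {s σ a l k : ℝ} (hs : |s| = 1) (ha : 0 < a) (hl : 0 ≤ l) (hk : 0 ≤ k)
    (t : ℝ × ℝ) : |(model s σ a l k t).2| ≤ k + l * (a * t.1 ^ 2 + |t.2| / 4) := by
  simp only [model, abs_mul, hs, one_mul]
  have h : 0 ≤ l * (a * t.1 ^ 2 + |t.2| / 4) := by positivity
  rw [abs_le]
  constructor <;> linarith

lemma norm_snd_cpt_model_le {s σ a l k : ℝ} (hs : |s| = 1) (ha : 0 < a) (hl : 0 ≤ l)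
    (hl1 : l ≤ 1) (hk : 0 ≤ k) (t : ℝ × ℝ) {ε : ℝ} (hε : ε ∈ Icc (0 : ℝ) 1) :
    ‖(cpt t (ε • model s σ a l k t)).2‖ ≤ 2 * (|t.2| + a * t.1 ^ 2 + k) := by
  refine (norm_ofReal_add_I_mul_le _ _).trans ?_
  have h1 : |(ε • model s σ a l k t).2| ≤ |(model s σ a l k t).2| := by
    rw [Prod.smul_snd, smul_eq_mul, abs_mul, abs_of_nonneg hε.1]
    exact mul_le_of_le_one_left (abs_nonneg _) hε.2
  have h2 := abs_snd_model_le (σ := σ) hs ha hl hk t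
  have h3 : 0 ≤ a * t.1 ^ 2 + |t.2| / 4 := by positivity
  have h4 : l * (a * t.1 ^ 2 + |t.2| / 4) ≤ a * t.1 ^ 2 + |t.2| / 4 := mul_le_of_le_one_left h3 hl1
  have := abs_nonneg t.2
  have : 0 ≤ a * t.1 ^ 2 := by positivity
  linarith

lemma model_sub_sq {s σ a l k : ℝ} (hs : s ^ 2 = 1) (hσ : σ ^ 2 = 1) (t : ℝ × ℝ) :
    (cpt t (model s σ a l k t)).2 - ((σ * a : ℝ) : ℂ) * (cpt t (model s σ a l k t)).1 ^ 2
      = modelValue s σ a l k t := by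
  have hs' : (s : ℂ) ^ 2 = 1 := by exact_mod_cast hs
  have hσ' : (σ : ℂ) ^ 2 = 1 := by exact_mod_cast hσ
  simp only [cpt, model, modelValue]
  push_cast
  have hI := Complex.I_sq
  linear_combination (-(σ * a * t.1 ^ 2 * l ^ 2 * s ^ 2 * σ ^ 2 : ℂ)) * hI
    + (σ * a * t.1 ^ 2 * l ^ 2 * σ ^ 2 : ℂ) * hs' + (σ * a * t.1 ^ 2 * l ^ 2
      + 2 * Complex.I * s * a * l * t.1 ^ 2 : ℂ) * hσ'

set_option maxHeartbeats 1000000 in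
/-- Along the flattenings of the model surface, `s Im G` has derivative close to
`k + l (a t₁² - |t₂| / 4)`, and `G` is close to its quadratic model. -/
lemma exists_model_bounds {G : ℂ × ℂ → ℂ} {σ a C δ : ℝ} (hC : 0 < C) (hδ : 0 < δ)
    (hn : NormalFormBound G (σ * a) C δ) (ha : 0 < a) (hσ : σ = 1 ∨ σ = -1) :
    ∃ C' δ' : ℝ, 0 < C' ∧ 0 < δ' ∧ ∀ (s : ℝ), (s = 1 ∨ s = -1) → ∀ (t : ℝ × ℝ) (l k : ℝ), |t.1| ≤ δ' →
      |t.2| ≤ δ' → 0 ≤ l → l ≤ 1 → 0 < k → k ≤ δ' →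
      (‖G (cpt t (model s σ a l k t)) - modelValue s σ a l k t‖
        ≤ C' * (|t.1| + |t.2| + k) * (|t.2| + a * t.1 ^ 2 + k)) ∧
      ∀ ε ∈ Icc (0 : ℝ) 1,
        |s * (fderiv ℂ G (cpt t (ε • model s σ a l k t)) (toC (model s σ a l k t))).re
          - (k + l * (a * t.1 ^ 2 - |t.2| / 4))|
        ≤ C' * (|t.1| + |t.2| + k) * (k + l * (a * t.1 ^ 2 + |t.2|)) := by
  have hσ1 : |σ| = 1 := by rcases hσ with rfl | rfl <;> simp
  have hσ2 : σ ^ 2 = 1 := by rcases hσ with rfl | rfl <;> simp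
  refine ⟨C * (10 + 4 * a + 8 / a), min 1 (δ / (4 + 2 * a)), by positivity, by positivity, ?_⟩
  intro s hs t l k h1 h2 hl hl1 hk hk1
  have hs1 : |s| = 1 := by rcases hs with rfl | rfl <;> simp
  have hs2 : s ^ 2 = 1 := by rcases hs with rfl | rfl <;> simp
  have a1 := abs_nonneg t.1
  have a2 := abs_nonneg t.2
  have b1 : |t.1| ≤ 1 := h1.trans (min_le_left _ _)
  have hm := min_le_right 1 (δ / (4 + 2 * a))
  have hmul : (4 + 2 * a) * min 1 (δ / (4 + 2 * a)) ≤ δ := by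
    calc _ ≤ (4 + 2 * a) * (δ / (4 + 2 * a)) := by gcongr
      _ = δ := by field_simp
  set d := min 1 (δ / (4 + 2 * a)) with hd
  have hsq : t.1 ^ 2 = |t.1| * |t.1| := by rw [← sq, sq_abs]
  have hat : a * t.1 ^ 2 ≤ a * |t.1| := by
    rw [hsq]; exact mul_le_mul_of_nonneg_left (mul_le_of_le_one_left a1 b1) ha.le
  have hd0 : 0 < d := by positivity
  have had : a * |t.1| ≤ a * d := by gcongr
  set T := model s σ a l k t with hT
  set m := |t.1| + |t.2| + k with hm'
  have hz : ∀ ε ∈ Icc (0 : ℝ) 1, ‖(cpt t (ε • T)).1‖ ≤ 2 * |t.1| := fun ε hε =>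
    norm_fst_cpt_model_le hs1 hσ1 hl hl1 t hε
  have hw : ∀ ε ∈ Icc (0 : ℝ) 1, ‖(cpt t (ε • T)).2‖ ≤ 2 * (|t.2| + a * t.1 ^ 2 + k) := fun ε hε =>
    norm_snd_cpt_model_le hs1 ha hl hl1 hk.le t hε
  have hzδ : 2 * |t.1| ≤ δ := by nlinarith
  have hwδ : 2 * (|t.2| + a * t.1 ^ 2 + k) ≤ δ := by nlinarith
  have hNm : |t.2| + a * t.1 ^ 2 + k ≤ (1 + a) * m := by rw [hm']; nlinarith
  have hN0 : 0 ≤ |t.2| + a * t.1 ^ 2 + k := by positivity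
  have hm0 : 0 ≤ m := by positivity
  have htm : |t.1| ≤ m := by rw [hm']; linarith
  constructor
  · have h1m : (1 : ℝ) ∈ Icc (0 : ℝ) 1 := ⟨zero_le_one, le_rfl⟩
    have hz1 := hz 1 h1m
    have hw1 := hw 1 h1m
    rw [one_smul] at hz1 hw1
    have hv := hn.value _ _ (hz1.trans hzδ) (hw1.trans hwδ)
    rw [hT, model_sub_sq hs2 hσ2] at hv
    refine hv.trans ?_
    rw [← hT]
    set z := ‖(cpt t T).1‖
    set w := ‖(cpt t T).2‖
    set N := |t.2| + a * t.1 ^ 2 + k with hN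
    have z0 : 0 ≤ z := norm_nonneg _
    have w0 : 0 ≤ w := norm_nonneg _
    have e1 : w * (z + w) ≤ (2 * N) * (2 * m + 2 * ((1 + a) * m)) := by
      refine mul_le_mul hw1 ?_ (by positivity) (by positivity)
      linarith
    have e2 : z ^ 3 ≤ (2 * |t.1|) ^ 3 := pow_le_pow_left₀ z0 hz1 3
    have e3 : (2 * |t.1|) ^ 3 ≤ 8 / a * (m * N) := by
      have : (2 * |t.1|) ^ 3 = 8 / a * (|t.1| * (a * t.1 ^ 2)) := by
        rw [hsq]; field_simp; ring
      rw [this]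
      have : a * t.1 ^ 2 ≤ N := by rw [hN]; linarith
      gcongr
    calc C * (w * (z + w) + z ^ 3)
        ≤ C * ((2 * N) * (2 * m + 2 * ((1 + a) * m)) + 8 / a * (m * N)) := by gcongr; linarith
      _ ≤ C * (10 + 4 * a + 8 / a) * m * N := by
        have : 0 ≤ m * N := by positivity
        have : 0 ≤ C * (m * N) := by positivity
        nlinarith
  · intro ε hε
    have hz1 := hz ε hε
    have hw1 := hw ε hε
    have hd2 := hn.deriv_snd _ _ (hz1.trans hzδ) (hw1.trans hwδ)
    have hd1 := hn.deriv_fst _ _ (hz1.trans hzδ) (hw1.trans hwδ)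
    change ‖fderiv ℂ G (cpt t (ε • T)) (0, 1) - 1‖ ≤ _ at hd2
    change ‖fderiv ℂ G (cpt t (ε • T)) (1, 0) + _‖ ≤ _ at hd1
    rw [fderiv_prod_apply]
    set D1 := fderiv ℂ G (cpt t (ε • T)) (1, 0)
    set D2 := fderiv ℂ G (cpt t (ε • T)) (0, 1)
    have hre : (2 * ((σ * a : ℝ) : ℂ) * (cpt t (ε • T)).1).re = 2 * σ * a * t.1 := by
      simp [cpt]
      left; ring
    have hid : s * ((toC T).1 * D1 + (toC T).2 * D2).re - (k + l * (a * t.1 ^ 2 - |t.2| / 4))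
        = s * T.1 * (D1 + 2 * ((σ * a : ℝ) : ℂ) * (cpt t (ε • T)).1).re
          + s * T.2 * (D2 - 1).re := by
      rw [Complex.add_re D1, hre]
      simp only [toC, Complex.add_re, Complex.re_ofReal_mul, Complex.sub_re, Complex.one_re]
      simp only [hT, model]
      have hs3 : s * s = 1 := by rw [← sq]; exact hs2
      linear_combination (2 * l * σ * a * t.1 ^ 2 * σ
        + (k - l * (a * t.1 ^ 2 + |t.2| / 4))) * hs3 + 2 * l * a * t.1 ^ 2 * hσ2
    rw [hid]
    have f1 : |s * T.1 * (D1 + 2 * ((σ * a : ℝ) : ℂ) * (cpt t (ε • T)).1).re|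
        ≤ l * |t.1| * (C * (2 * (|t.2| + a * t.1 ^ 2 + k) + (2 * |t.1|) ^ 2)) := by
      rw [abs_mul]
      have : |s * T.1| = l * |t.1| := by
        simp only [hT, model, abs_mul, abs_neg, hs1, hσ1, abs_of_nonneg hl]; ring
      rw [this]
      refine mul_le_mul_of_nonneg_left ?_ (by positivity)
      refine (Complex.abs_re_le_norm _).trans (hd1.trans ?_)
      gcongr
    have f2 : |s * T.2 * (D2 - 1).re| ≤ (k + l * (a * t.1 ^ 2 + |t.2|))
        * (C * (2 * m + 2 * ((1 + a) * m))) := by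
      rw [abs_mul, abs_mul, hs1, one_mul]
      refine mul_le_mul ?_ ?_ (abs_nonneg _) (by positivity)
      · refine (abs_snd_model_le hs1 ha hl hk.le t).trans ?_
        gcongr
        linarith
      · refine (Complex.abs_re_le_norm _).trans (hd2.trans ?_)
        refine mul_le_mul_of_nonneg_left ?_ hC.le
        linarith
    refine (abs_add_le _ _).trans ((add_le_add f1 f2).trans ?_)
    set Q := k + l * (a * t.1 ^ 2 + |t.2|) with hQ
    have g1 : l * |t.1| * (C * (2 * (|t.2| + a * t.1 ^ 2 + k) + (2 * |t.1|) ^ 2))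
        ≤ m * (C * ((2 + 4 / a) * Q)) := by
      have : l * |t.1| * (C * (2 * (|t.2| + a * t.1 ^ 2 + k) + (2 * |t.1|) ^ 2))
        = |t.1| * (C * (l * (2 * (|t.2| + a * t.1 ^ 2 + k) + (2 * |t.1|) ^ 2))) := by ring
      rw [this]
      have hq : l * (2 * (|t.2| + a * t.1 ^ 2 + k) + (2 * |t.1|) ^ 2) ≤ (2 + 4 / a) * Q := by
        have e : (2 * |t.1|) ^ 2 = 4 / a * (a * t.1 ^ 2) := by rw [hsq]; field_simp; ring
        rw [e, hQ]
        have u1 : l * k ≤ k := mul_le_of_le_one_left hk.le hl1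
        have u2 : 0 ≤ 4 / a * (k + l * |t.2|) := by positivity
        nlinarith
      have hq0 : 0 ≤ l * (2 * (|t.2| + a * t.1 ^ 2 + k) + (2 * |t.1|) ^ 2) := by positivity
      gcongr
    have hQ0 : 0 ≤ Q := by positivity
    have : 0 ≤ C * m * Q := by positivity
    have h8 : C * (10 + 4 * a + 8 / a) * m * Q = m * (C * ((2 + 4 / a) * Q))
        + Q * (C * (2 * m + 2 * ((1 + a) * m))) + (4 + 2 * a + 4 / a) * (C * m * Q) := by ring
    rw [h8]
    have : 0 ≤ (4 + 2 * a + 4 / a) * (C * m * Q) := by positivity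
    linarith

/-- The properties of the model surfaces over the square `|t₁|, |t₂| ≤ δ` that the deformation
argument uses. Where `l |t₂| ≤ 2 (k + l a t₁²)`, which includes the real trace of `{G = 0}`, `s Im G`
increases along the flattenings; elsewhere `Re G` does not vanish. In both cases `G` avoids the cut.
The other fields compare `G` on the full-size surface with the quadratic model. -/
structure ModelRegion (G : ℂ × ℂ → ℂ) (s σ a C δ : ℝ) : Prop where
  deriv_pos : ∀ (t : ℝ × ℝ) (l k : ℝ), |t.1| ≤ δ → |t.2| ≤ δ → 0 ≤ l → l ≤ 1 → 0 < k → k ≤ δ →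
    l * |t.2| ≤ 2 * (k + l * (a * t.1 ^ 2)) → ∀ ε ∈ Icc (0 : ℝ) 1,
    0 < s * (fderiv ℂ G (cpt t (ε • model s σ a l k t)) (toC (model s σ a l k t))).re
  not_mem_cut : ∀ (t : ℝ × ℝ) (l k : ℝ), |t.1| ≤ δ → |t.2| ≤ δ → 0 ≤ l → l ≤ 1 → 0 < k → k ≤ δ →
    G (cpt t (model s σ a l k t)) ∉ cut s
  norm_sub_le : ∀ (t : ℝ × ℝ) (k : ℝ), |t.1| ≤ δ → |t.2| ≤ δ → 0 < k → k ≤ δ →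
    ‖G (cpt t (model s σ a 1 k t)) - modelValue s σ a 1 k t‖
      ≤ C * (|t.1| + |t.2| + k) * (|t.2| + a * t.1 ^ 2 + k)
  le_norm : ∀ (t : ℝ × ℝ) (k : ℝ), |t.1| ≤ δ → |t.2| ≤ δ → 0 < k → k ≤ δ →
    (|t.2| + a * t.1 ^ 2 + k) / 3 ≤ ‖G (cpt t (model s σ a 1 k t))‖
  norm_le : ∀ (t : ℝ × ℝ) (k : ℝ), |t.1| ≤ δ → |t.2| ≤ δ → 0 < k → k ≤ δ →
    ‖G (cpt t (model s σ a 1 k t))‖ ≤ 2 * (|t.2| + a * t.1 ^ 2 + k)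
  trace : ∀ t : ℝ × ℝ, |t.1| ≤ δ → |t.2| ≤ δ → G (toC t) = 0 → |t.2| ≤ 2 * (a * t.1 ^ 2)

lemma modelValue_re (s σ a l k : ℝ) (t : ℝ × ℝ) :
    (modelValue s σ a l k t).re = t.2 - σ * a * t.1 ^ 2 * (1 - l ^ 2) := by
  simp only [modelValue, Complex.add_re, Complex.ofReal_re, Complex.re_mul_ofReal, Complex.I_re,
    zero_mul, add_zero]

lemma modelValue_im (s σ a l k : ℝ) (t : ℝ × ℝ) :
    (modelValue s σ a l k t).im = s * (k + l * (a * t.1 ^ 2 - |t.2| / 4)) := by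
  simp only [modelValue, Complex.add_im, Complex.ofReal_im, Complex.im_mul_ofReal, Complex.I_im,
    one_mul, zero_add]

set_option maxHeartbeats 1000000 in
/-- On a small square all errors in the normal form are a small fraction of the main terms. -/
lemma exists_modelRegion {G : ℂ × ℂ → ℂ} (hG : Differentiable ℂ G)
    (hreal : ∀ q, (G (toC q)).im = 0) {σ a C δ : ℝ} (hC : 0 < C) (hδ : 0 < δ)
    (hn : NormalFormBound G (σ * a) C δ) (ha : 0 < a) (hσ : σ = 1 ∨ σ = -1) {s : ℝ}
    (hs : s = 1 ∨ s = -1) : ∃ C' δ' : ℝ, 0 < C' ∧ 0 < δ' ∧ ModelRegion G s σ a C' δ' := by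
  obtain ⟨C', δ', hC', hδ', H⟩ := exists_model_bounds hC hδ hn ha hσ
  have hs1 : |s| = 1 := by rcases hs with rfl | rfl <;> simp
  have hσ1 : |σ| = 1 := by rcases hσ with rfl | rfl <;> simp
  set d := min (min δ' δ) (min (1 / (36 * C' + 1)) (1 / (8 * C * (1 + 1 / a) + 1))) with hd
  have hdδ' : d ≤ δ' := (min_le_left _ _).trans (min_le_left _ _)
  have hdδ : d ≤ δ := (min_le_left _ _).trans (min_le_right _ _)
  have hdC : d * (36 * C' + 1) ≤ 1 := by
    have : d ≤ 1 / (36 * C' + 1) := (min_le_right _ _).trans (min_le_left _ _)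
    rwa [le_div_iff₀ (by positivity)] at this
  have hdC2 : d * (8 * C * (1 + 1 / a) + 1) ≤ 1 := by
    have : d ≤ 1 / (8 * C * (1 + 1 / a) + 1) := (min_le_right _ _).trans (min_le_right _ _)
    rwa [le_div_iff₀ (by positivity)] at this
  have hd0 : 0 < d := by positivity
  -- the relative error is at most `1 / 12`
  have hm : ∀ (t : ℝ × ℝ) (k : ℝ), |t.1| ≤ d → |t.2| ≤ d → k ≤ d →
      C' * (|t.1| + |t.2| + k) < 1 / 12 := by
    intro t k h1 h2 h3
    have : C' * (|t.1| + |t.2| + k) ≤ C' * (3 * d) := by gcongr; linarith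
    nlinarith
  have hpos : ∀ (t : ℝ × ℝ) (l k : ℝ), |t.1| ≤ d → |t.2| ≤ d → 0 ≤ l → l ≤ 1 → 0 < k → k ≤ d →
      l * |t.2| ≤ 2 * (k + l * (a * t.1 ^ 2)) → ∀ ε ∈ Icc (0 : ℝ) 1,
      0 < s * (fderiv ℂ G (cpt t (ε • model s σ a l k t)) (toC (model s σ a l k t))).re := by
    intro t l k h1 h2 hl hl1 hk hk1 hc ε hε
    have e := (H s hs t l k (h1.trans hdδ') (h2.trans hdδ') hl hl1 hk (hk1.trans hdδ')).2 ε hε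
    have e1 := hm t k h1 h2 hk1
    have hla : 0 ≤ l * (a * t.1 ^ 2) := by positivity
    have hl2 : 0 ≤ l * |t.2| := by positivity
    have e2 : C' * (|t.1| + |t.2| + k) * (k + l * (a * t.1 ^ 2 + |t.2|))
        ≤ 1 / 12 * (k + l * (a * t.1 ^ 2 + |t.2|)) :=
      mul_le_mul_of_nonneg_right e1.le (by positivity)
    have e3 := (abs_le.mp (e.trans e2)).1
    nlinarith
  have hmv : ∀ t : ℝ × ℝ, ∀ k : ℝ, (modelValue s σ a 1 k t).re = t.2 ∧
      |(modelValue s σ a 1 k t).im| = |k + (a * t.1 ^ 2 - |t.2| / 4)| := by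
    intro t k
    constructor
    · rw [modelValue_re]; ring
    · rw [modelValue_im, one_mul, abs_mul, hs1, one_mul]
  refine ⟨C', d, hC', hd0, hpos, ?_, ?_, ?_, ?_, ?_⟩
  · intro t l k h1 h2 hl hl1 hk hk1
    rcases le_or_gt (l * |t.2|) (2 * (k + l * (a * t.1 ^ 2))) with hc | hc
    · exact not_mem_cut_of_im_pos
        (im_pos_of_deriv_pos hG hreal (hpos t l k h1 h2 hl hl1 hk hk1 hc))
    · -- here `|t₂|` dominates `a t₁²` and `k`, so `Re G`, which is close to `t₂ - σ a t₁² (1 - l²)`,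
      -- does not vanish
      refine not_mem_cut_of_re_ne fun hre => ?_
      have e := (H s hs t l k (h1.trans hdδ') (h2.trans hdδ') hl hl1 hk (hk1.trans hdδ')).1
      have e1 := hm t k h1 h2 hk1
      have hat : 0 ≤ a * t.1 ^ 2 := by positivity
      have hl0 : 0 < l := by
        rcases hl.eq_or_lt with rfl | h
        · simp at hc; linarith
        · exact h
      have g1 : 2 * (a * t.1 ^ 2) ≤ |t.2| := by
        by_contra hcon
        push Not at hcon
        nlinarith
      have g2 : 2 * k ≤ |t.2| := by nlinarith [abs_nonneg t.2]
      have e2 : C' * (|t.1| + |t.2| + k) * (|t.2| + a * t.1 ^ 2 + k)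
          ≤ 1 / 12 * (|t.2| + a * t.1 ^ 2 + k) :=
        mul_le_mul_of_nonneg_right e1.le (by positivity)
      have e3 := (Complex.abs_re_le_norm _).trans (e.trans e2)
      rw [Complex.sub_re, hre, modelValue_re, zero_sub, abs_neg] at e3
      have e5 : |σ * a * t.1 ^ 2 * (1 - l ^ 2)| ≤ a * t.1 ^ 2 := by
        rw [abs_mul, mul_assoc σ, abs_mul, hσ1, one_mul, abs_of_nonneg hat]
        refine mul_le_of_le_one_right hat ?_
        rw [abs_le]; constructor <;> nlinarith
      have e6 := abs_sub_abs_le_abs_sub t.2 (σ * a * t.1 ^ 2 * (1 - l ^ 2))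
      have : 0 < |t.2| := by nlinarith
      linarith
  · intro t k h1 h2 hk hk1
    exact (H s hs t 1 k (h1.trans hdδ') (h2.trans hdδ') zero_le_one le_rfl hk (hk1.trans hdδ')).1
  · intro t k h1 h2 hk hk1
    have e := (H s hs t 1 k (h1.trans hdδ') (h2.trans hdδ') zero_le_one le_rfl hk (hk1.trans hdδ')).1
    have e1 := hm t k h1 h2 hk1
    have e2 : C' * (|t.1| + |t.2| + k) * (|t.2| + a * t.1 ^ 2 + k)
        ≤ 1 / 12 * (|t.2| + a * t.1 ^ 2 + k) :=
      mul_le_mul_of_nonneg_right e1.le (by positivity)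
    have e3 := norm_sub_norm_le (modelValue s σ a 1 k t) (G (cpt t (model s σ a 1 k t)))
    rw [norm_sub_rev] at e3
    have e4 := Complex.abs_re_le_norm (modelValue s σ a 1 k t)
    have e5 := Complex.abs_im_le_norm (modelValue s σ a 1 k t)
    rw [(hmv t k).1] at e4
    rw [(hmv t k).2] at e5
    have e6 := le_abs_self (k + (a * t.1 ^ 2 - |t.2| / 4))
    have := abs_nonneg t.2
    linarith
  · intro t k h1 h2 hk hk1
    have e := (H s hs t 1 k (h1.trans hdδ') (h2.trans hdδ') zero_le_one le_rfl hk (hk1.trans hdδ')).1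
    have e1 := hm t k h1 h2 hk1
    have e2 : C' * (|t.1| + |t.2| + k) * (|t.2| + a * t.1 ^ 2 + k)
        ≤ 1 / 12 * (|t.2| + a * t.1 ^ 2 + k) :=
      mul_le_mul_of_nonneg_right e1.le (by positivity)
    have e3 := norm_sub_norm_le (G (cpt t (model s σ a 1 k t))) (modelValue s σ a 1 k t)
    have e4 := Complex.norm_le_abs_re_add_abs_im (modelValue s σ a 1 k t)
    rw [(hmv t k).1, (hmv t k).2] at e4
    have hat : 0 ≤ a * t.1 ^ 2 := by positivity
    have := abs_nonneg t.2
    have e6 : |k + (a * t.1 ^ 2 - |t.2| / 4)| ≤ k + a * t.1 ^ 2 + |t.2| / 4 := by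
      rw [abs_le]; constructor <;> linarith
    linarith
  · intro t h1 h2 h0
    have hv := hn.value (t.1 : ℂ) (t.2 : ℂ) (by simpa using h1.trans hdδ) (by simpa using h2.trans hdδ)
    change ‖G (toC t) - _‖ ≤ _ at hv
    rw [h0, zero_sub, norm_neg] at hv
    simp only [Complex.norm_real, Real.norm_eq_abs] at hv
    have e : (t.2 : ℂ) - ((σ * a : ℝ) : ℂ) * (t.1 : ℂ) ^ 2 = ((t.2 - σ * a * t.1 ^ 2 : ℝ) : ℂ) := by
      push_cast; ring
    rw [e, Complex.norm_real, Real.norm_eq_abs] at hv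
    have e6 := abs_sub_abs_le_abs_sub t.2 (σ * a * t.1 ^ 2)
    have hat : 0 ≤ a * t.1 ^ 2 := by positivity
    have e5 : |σ * a * t.1 ^ 2| = a * t.1 ^ 2 := by
      rw [mul_assoc σ, abs_mul, hσ1, one_mul, abs_of_nonneg hat]
    have hsq : |t.1| ^ 3 = |t.1| / a * (a * t.1 ^ 2) := by
      rw [← sq_abs]; field_simp
    have a1 := abs_nonneg t.1
    have a2 := abs_nonneg t.2
    have f1 : |t.2| * (|t.1| + |t.2|) ≤ |t.2| * (2 * d) := by gcongr; linarith
    have f2 : |t.1| / a * (a * t.1 ^ 2) ≤ d / a * (a * t.1 ^ 2) := by gcongr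
    have f3 : C * (|t.2| * (|t.1| + |t.2|) + |t.1| ^ 3)
        ≤ C * (|t.2| * (2 * d) + d / a * (a * t.1 ^ 2)) := by
      rw [hsq]; gcongr
    have g1 : C * d ≤ 1 / 8 := by
      have : 0 ≤ d * (C * (1 / a)) := by positivity
      nlinarith
    have g2 : C * (d / a) ≤ 1 / 8 := by
      have e : C * (d / a) = d * (C * (1 / a)) := by ring
      rw [e]
      have : 0 ≤ d * C := by positivity
      nlinarith
    have f4 : C * (|t.2| * (2 * d) + d / a * (a * t.1 ^ 2))
        = 2 * (C * d) * |t.2| + C * (d / a) * (a * t.1 ^ 2) := by ring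
    have g3 : 2 * (C * d) * |t.2| ≤ 2 * (1 / 8) * |t.2| := by gcongr
    have g4 : C * (d / a) * (a * t.1 ^ 2) ≤ 1 / 8 * (a * t.1 ^ 2) := by gcongr
    linarith

/-! ### Flattening and cutoffs -/

lemma isClosed_cut (s : ℝ) : IsClosed (cut s) := by
  have e : cut s = {z : ℂ | z.re = 0} ∩ {z : ℂ | s * z.im ≤ 0} := rfl
  rw [e]
  exact (isClosed_eq Complex.continuous_re continuous_const).inter
    (isClosed_le (continuous_const.mul Complex.continuous_im) continuous_const)

lemma isOpen_slitDomain {G : ℂ × ℂ → ℂ} (hG : Continuous G) (s : ℝ) {U : Set (ℂ × ℂ)}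
    (hU : IsOpen U) : IsOpen (slitDomain G s U) := by
  have e : slitDomain G s U = U ∩ G ⁻¹' (cut s)ᶜ := rfl
  rw [e]
  exact hU.inter ((isClosed_cut s).isOpen_compl.preimage hG)

lemma toC_smul (ε : ℝ) (v : ℝ × ℝ) : toC (ε • v) = (ε : ℂ) • toC v := by
  simp [toC]

/-- Two fields that cross the trace of `{G = 0}` in the same direction can be joined by convex
combinations, once both have been flattened sufficiently. -/
lemma exists_flat_segment_mem {G : ℂ × ℂ → ℂ} (hG : Differentiable ℂ G)
    (hreal : ∀ q, (G (toC q)).im = 0) {s : ℝ} {U : Set (ℂ × ℂ)} (hU : IsOpen U)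
    {B : Set (ℝ × ℝ)} (hB : IsCompact B) (hBU : ∀ q ∈ B, toC q ∈ U) {η X : ℝ × ℝ → ℝ × ℝ}
    (hη : Continuous η) (hX : Continuous X)
    (hη' : ∀ q ∈ B, G (toC q) = 0 → 0 < s * (fderiv ℂ G (toC q) (toC (η q))).re)
    (hX' : ∀ q ∈ B, G (toC q) = 0 → 0 < s * (fderiv ℂ G (toC q) (toC (X q))).re) :
    ∃ ε₀ : ℝ, 0 < ε₀ ∧ ∀ ε, 0 < ε → ε ≤ ε₀ → ∀ q ∈ B, ∀ τ ∈ Icc (0 : ℝ) 1,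
      cpt q (ε • (η q + τ • (X q - η q))) ∈ slitDomain G s U := by
  set V : (ℝ × ℝ) × ℝ → ℝ × ℝ := fun z => η z.1 + z.2 • (X z.1 - η z.1) with hV
  have hVc : Continuous V := by rw [hV]; fun_prop
  have hc1 : Continuous fun y : ℝ × ((ℝ × ℝ) × ℝ) => cpt y.2.1 (y.1 • V y.2) :=
    continuous_cpt.comp ((continuous_fst.comp continuous_snd).prodMk
      (continuous_fst.smul (hVc.comp continuous_snd)))
  have hc2 : Continuous fun y : ℝ × ((ℝ × ℝ) × ℝ) => G (cpt y.2.1 (y.1 • V y.2)) := hG.continuous.comp hc1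
  have hfd : Continuous (fderiv ℂ G) := by
    have := (differentiableOn_fderiv_prod isOpen_univ hG.differentiableOn).continuousOn
    rwa [continuousOn_univ] at this
  have htoC : Continuous toC := by unfold toC; fun_prop
  have hc3 : Continuous fun y : ℝ × ((ℝ × ℝ) × ℝ) =>
      s * (fderiv ℂ G (cpt y.2.1 (y.1 • V y.2)) (toC (V y.2))).re :=
    continuous_const.mul (Complex.continuous_re.comp
      ((hfd.comp hc1).clm_apply (htoC.comp (hVc.comp continuous_snd))))
  have key : ∀ᶠ ε in 𝓝 (0 : ℝ), ∀ z ∈ B ×ˢ Icc (0 : ℝ) 1, 0 < ε →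
      cpt z.1 (ε • V z) ∈ slitDomain G s U := by
    refine (hB.prod isCompact_Icc).eventually_forall_of_forall_eventually ?_
    rintro ⟨q, τ⟩ ⟨hq, hτ⟩
    have h0 : cpt q ((0 : ℝ) • V (q, τ)) = toC q := by rw [zero_smul, cpt_zero]
    have hUe : ∀ᶠ y in 𝓝 ((0 : ℝ), (q, τ)), cpt y.2.1 (y.1 • V y.2) ∈ U := by
      refine hc1.continuousAt.eventually_mem (hU.mem_nhds ?_)
      simpa [cpt_zero] using hBU q hq
    -- on the trace, the derivative of `s Im G` in the direction of the field stays positive under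
    -- convex combinations; off the trace, `Re G ≠ 0`
    by_cases hz : G (toC q) = 0
    · have hpos : 0 < s * (fderiv ℂ G (toC q) (toC (V (q, τ)))).re := by
        have e : toC (V (q, τ)) = ((1 - τ : ℝ) : ℂ) • toC (η q) + (τ : ℂ) • toC (X q) := by
          simp only [hV, toC, Prod.fst_add, Prod.snd_add, Prod.smul_fst, Prod.smul_snd, smul_eq_mul,
            Prod.fst_sub, Prod.snd_sub, Prod.smul_mk, Prod.mk_add_mk]
          push_cast
          ext <;> simp <;> ring
        rw [e, map_add, map_smul, map_smul, Complex.add_re, smul_eq_mul, smul_eq_mul,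
          Complex.re_ofReal_mul, Complex.re_ofReal_mul]
        have h1 := hη' q hq hz
        have h2 := hX' q hq hz
        obtain ⟨t1, t2⟩ := hτ
        have e2 : s * ((1 - τ) * (fderiv ℂ G (toC q) (toC (η q))).re
            + τ * (fderiv ℂ G (toC q) (toC (X q))).re)
            = (1 - τ) * (s * (fderiv ℂ G (toC q) (toC (η q))).re)
            + τ * (s * (fderiv ℂ G (toC q) (toC (X q))).re) := by ring
        rw [e2]
        rcases t1.eq_or_lt with rfl | t1'
        · simpa using h1
        · have := mul_pos t1' h2
          have := mul_nonneg (sub_nonneg.mpr t2) h1.le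
          linarith
      have hev : ∀ᶠ y in 𝓝 ((0 : ℝ), (q, τ)),
          0 < s * (fderiv ℂ G (cpt y.2.1 (y.1 • V y.2)) (toC (V y.2))).re := by
        refine hc3.continuousAt.eventually_const_lt ?_
        simpa [cpt_zero] using hpos
      rw [nhds_prod_eq] at hev ⊢
      rw [nhds_prod_eq] at hUe
      obtain ⟨pa, ha, pb, hb, hab⟩ := Filter.eventually_prod_iff.mp hev
      obtain ⟨r, hr, hball⟩ := Metric.eventually_nhds_iff.mp ha
      have hra : ∀ᶠ ε in 𝓝 (0 : ℝ), |ε| < r := by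
        have : ∀ᶠ ε in 𝓝 (0 : ℝ), ε ∈ Metric.ball (0 : ℝ) r := Metric.ball_mem_nhds _ hr
        filter_upwards [this] with ε hε
        simpa using hε
      filter_upwards [hUe, hra.prod_mk hb] with y hy1 hy2 hy3
      refine ⟨hy1, not_mem_cut_of_im_pos (im_pos_of_deriv_pos hG hreal fun ε hε => ?_)⟩
      rw [smul_smul, toC_smul, map_smul, smul_eq_mul, Complex.re_ofReal_mul, mul_left_comm]
      refine mul_pos hy3 (hab (x := ε * y.1) (hball ?_) hy2.2)
      rw [dist_zero_right, Real.norm_eq_abs, abs_mul, abs_of_nonneg hε.1]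
      exact (mul_le_of_le_one_left (abs_nonneg _) hε.2).trans_lt hy2.1
    · have hre : (G (toC q)).re ≠ 0 := fun h => hz (Complex.ext h (hreal q))
      have hev : ∀ᶠ y in 𝓝 ((0 : ℝ), (q, τ)), (G (cpt y.2.1 (y.1 • V y.2))).re ≠ 0 := by
        refine (Complex.continuous_re.comp hc2).continuousAt.eventually_ne ?_
        simpa [cpt_zero] using hre
      filter_upwards [hUe, hev] with y hy1 hy2 _
      exact ⟨hy1, not_mem_cut_of_re_ne hy2⟩
  obtain ⟨r, hr, hball⟩ := Metric.eventually_nhds_iff.mp key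
  refine ⟨r / 2, by positivity, fun ε hε hεr q hq τ hτ => ?_⟩
  refine hball (y := ε) ?_ (q, τ) ⟨hq, hτ⟩ hε
  rw [dist_zero_right, Real.norm_eq_abs, abs_of_pos hε]
  linarith

/-- The cutoff that is `1` where `d ≤ u` and `0` where `d ≥ v`, and interpolates linearly in `d`. -/
def cutoff (d : ℝ × ℝ → ℝ) (u v : ℝ) (q : ℝ × ℝ) : ℝ := max 0 (min 1 ((v - d q) / (v - u)))

lemma cutoff_nonneg (d : ℝ × ℝ → ℝ) (u v : ℝ) (q : ℝ × ℝ) : 0 ≤ cutoff d u v q := le_max_left _ _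

lemma cutoff_le_one (d : ℝ × ℝ → ℝ) (u v : ℝ) (q : ℝ × ℝ) : cutoff d u v q ≤ 1 :=
  max_le zero_le_one (min_le_left _ _)

lemma cutoff_eq_one {d : ℝ × ℝ → ℝ} {u v : ℝ} (h : u < v) {q : ℝ × ℝ} (hq : d q ≤ u) :
    cutoff d u v q = 1 := by
  have : 1 ≤ (v - d q) / (v - u) := by rw [le_div_iff₀ (by linarith)]; linarith
  rw [cutoff, min_eq_left this]; simp

lemma cutoff_eq_zero {d : ℝ × ℝ → ℝ} {u v : ℝ} (h : u < v) {q : ℝ × ℝ} (hq : v ≤ d q) :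
    cutoff d u v q = 0 := by
  have : (v - d q) / (v - u) ≤ 0 := div_nonpos_of_nonpos_of_nonneg (by linarith) (by linarith)
  rw [cutoff]
  exact max_eq_left ((min_le_right _ _).trans this)

lemma exists_lipschitzWith_cutoff {d : ℝ × ℝ → ℝ} {K : NNReal} (hd : LipschitzWith K d) (u v : ℝ) :
    ∃ K' : NNReal, LipschitzWith K' (cutoff d u v) := by
  have h : LipschitzWith (‖(v - u)⁻¹‖₊) fun x : ℝ => (v - x) / (v - u) := by
    refine LipschitzWith.of_dist_le_mul fun x y => ?_
    rw [Real.dist_eq, Real.dist_eq, ← sub_div, div_eq_mul_inv, abs_mul]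
    have : v - x - (v - y) = -(x - y) := by ring
    rw [this, abs_neg, mul_comm]
    simp
  exact ⟨_, ((h.comp hd).const_min 1).const_max 0⟩

lemma locallyLipschitz_cutoff {d : ℝ × ℝ → ℝ} {K : NNReal} (hd : LipschitzWith K d) (u v : ℝ) :
    LocallyLipschitz (cutoff d u v) :=
  (exists_lipschitzWith_cutoff hd u v).choose_spec.locallyLipschitz

lemma tsupport_cutoff_subset {d : ℝ × ℝ → ℝ} (hd : Continuous d) {u v : ℝ} (h : u < v) :
    tsupport (cutoff d u v) ⊆ {q | d q ≤ v} := by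
  refine closure_minimal (fun q hq => ?_) (isClosed_le hd continuous_const)
  by_contra hcon
  exact hq (cutoff_eq_zero h (le_of_not_ge hcon))

/-- The field that moves `ζ` towards `X` by the proportion `χ`. -/
def blend (χ : ℝ × ℝ → ℝ) (ζ X : ℝ × ℝ → ℝ × ℝ) (q : ℝ × ℝ) : ℝ × ℝ := ζ q + χ q • (X q - ζ q)

lemma locallyLipschitz_blend_aux {χ : ℝ × ℝ → ℝ} {ζ X : ℝ × ℝ → ℝ × ℝ} (hχ : LocallyLipschitz χ)
    (hζ : LocallyLipschitz ζ) (hX : LocallyLipschitz X) :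
    LocallyLipschitz fun q => χ q • (X q - ζ q) :=
  (ContDiff.locallyLipschitz (𝕂 := ℝ) (f := fun p : ℝ × ((ℝ × ℝ) × (ℝ × ℝ)) => p.1 • (p.2.1 - p.2.2))
    (contDiff_fst.smul ((contDiff_fst.comp contDiff_snd).sub (contDiff_snd.comp contDiff_snd)))).comp
    (hχ.prodMk (hX.prodMk hζ))

lemma locallyLipschitz_blend {χ : ℝ × ℝ → ℝ} {ζ X : ℝ × ℝ → ℝ × ℝ} (hχ : LocallyLipschitz χ)
    (hζ : LocallyLipschitz ζ) (hX : LocallyLipschitz X) : LocallyLipschitz (blend χ ζ X) :=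
  (ContDiff.locallyLipschitz (𝕂 := ℝ) (f := fun p : (ℝ × ℝ) × (ℝ × ℝ) => p.1 + p.2)
    (contDiff_fst.add contDiff_snd)).comp (hζ.prodMk (locallyLipschitz_blend_aux hχ hζ hX))

/-- Moving a surface along straight segments inside the domain of holomorphy, over a set on which a
cutoff is supported, does not change the integral. -/
lemma setIntegral_blend {O : Set (ℂ × ℂ)} (hO : IsOpen O) {f : ℂ × ℂ → ℂ}
    (hf : DifferentiableOn ℂ f O) {χ : ℝ × ℝ → ℝ} {ζ X : ℝ × ℝ → ℝ × ℝ} (hχ : LocallyLipschitz χ)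
    (hζ : LocallyLipschitz ζ) (hX : LocallyLipschitz X) (h0 : ∀ q, 0 ≤ χ q) (h1 : ∀ q, χ q ≤ 1)
    {B : Set (ℝ × ℝ)} (hB : IsCompact B) (hsupp : tsupport χ ⊆ B)
    (hseg : ∀ q ∈ tsupport χ, ∀ τ ∈ Icc (0 : ℝ) 1, cpt q (ζ q + τ • (X q - ζ q)) ∈ O)
    (hmem : ∀ q ∈ B, surf ζ q ∈ O) :
    ∫ q in B, f (surf (blend χ ζ X) q) * surfJac (blend χ ζ X) q
      = ∫ q in B, f (surf ζ q) * surfJac ζ q := by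
  have hsub : tsupport (fun q => χ q • (X q - ζ q)) ⊆ tsupport χ :=
    closure_mono (Function.support_smul_subset_left χ fun q => X q - ζ q)
  refine setIntegral_surf_add_eq hO hf hζ (locallyLipschitz_blend_aux hχ hζ hX) hB
    (hsub.trans hsupp) (fun t ht q hq => ?_) hmem
  have := hseg q (hsub hq) (t * χ q) ⟨mul_nonneg ht.1 (h0 q), mul_le_one₀ ht.2 (h0 q) (h1 q)⟩
  rw [surf_eq_cpt]
  simpa [smul_smul] using this

lemma blend_mem {O : Set (ℂ × ℂ)} {χ : ℝ × ℝ → ℝ} {ζ X : ℝ × ℝ → ℝ × ℝ} (h0 : ∀ q, 0 ≤ χ q)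
    (h1 : ∀ q, χ q ≤ 1) {B : Set (ℝ × ℝ)}
    (hseg : ∀ q ∈ tsupport χ, ∀ τ ∈ Icc (0 : ℝ) 1, cpt q (ζ q + τ • (X q - ζ q)) ∈ O)
    (hmem : ∀ q ∈ B, surf ζ q ∈ O) {q : ℝ × ℝ} (hq : q ∈ B) : surf (blend χ ζ X) q ∈ O := by
  by_cases h : q ∈ tsupport χ
  · exact hseg q h (χ q) ⟨h0 q, h1 q⟩
  · have : χ q = 0 := image_eq_zero_of_notMem_tsupport h
    have e : surf (blend χ ζ X) q = surf ζ q := by simp [surf_eq_cpt, blend, this]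
    rw [e]; exact hmem q hq

/-! ### Deformation to the model surface -/

lemma model_segment (s σ a l k l' k' τ : ℝ) (t : ℝ × ℝ) :
    model s σ a l k t + τ • (model s σ a l' k' t - model s σ a l k t)
      = model s σ a (l + τ * (l' - l)) (k + τ * (k' - k)) t := by
  ext <;> simp [model] <;> ring

lemma smul_model (s σ a l k ε : ℝ) (t : ℝ × ℝ) :
    ε • model s σ a l k t = model s σ a (ε * l) (ε * k) t := by
  ext <;> simp [model] <;> ring

lemma model_zero (s σ a : ℝ) (t : ℝ × ℝ) : model s σ a 0 0 t = 0 := by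
  ext <;> simp [model]

lemma locallyLipschitz_model (s σ a l k : ℝ) : LocallyLipschitz (model s σ a l k) := by
  have h1 : LocallyLipschitz fun t : ℝ × ℝ => (t.1, t.2, |t.2|) := by
    have ha : LipschitzWith 1 fun x : ℝ => |x| := lipschitzWith_one_norm (E := ℝ)
    exact (LipschitzWith.prod_fst.locallyLipschitz).prodMk
      ((LipschitzWith.prod_snd.locallyLipschitz).prodMk
        ((ha.comp LipschitzWith.prod_snd).locallyLipschitz))
  refine (ContDiff.locallyLipschitz (𝕂 := ℝ) (f := fun p : ℝ × ℝ × ℝ =>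
    (-(l * s * σ * p.1), s * (k - l * (a * p.1 ^ 2 + p.2.2 / 4)))) ?_).comp h1
  fun_prop

lemma locallyLipschitz_const_smul {ζ : ℝ × ℝ → ℝ × ℝ} (hζ : LocallyLipschitz ζ) (ε : ℝ) :
    LocallyLipschitz (ε • ζ) :=
  (ContDiff.locallyLipschitz (𝕂 := ℝ) (f := fun p : ℝ × ℝ => ε • p)
    (by fun_prop)).comp hζ

lemma norm_le_of_abs_le {q : ℝ × ℝ} {e : ℝ} (h1 : |q.1| ≤ e) (h2 : |q.2| ≤ e) : ‖q‖ ≤ e := by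
  rw [Prod.norm_def]; exact max_le h1 h2

/-- The first part of the deformation: a local surface can be moved, away from the saddle only
within `Re (-i w) < 0`, to one that coincides with the model surface near the saddle. Here `d` is the
distance to the set where the original field does not point into the region of decay. The surface is
first flattened over the interior of `B`, then joined to a flattened model surface by convex
combinations, and the model surface is finally expanded to its full size. -/
theorem exists_deformation_to_model {G : ℂ × ℂ → ℂ} (hG : Differentiable ℂ G)
    (hreal : ∀ q, (G (toC q)).im = 0) {s σ a C δ : ℝ} (hs : s = 1 ∨ s = -1) (ha : 0 < a) (hδ : 0 < δ)
    (hM : ModelRegion G s σ a C δ) {U : Set (ℂ × ℂ)} (hU : IsOpen U)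
    (hUm : ∀ (t : ℝ × ℝ) (l k : ℝ), |t.1| ≤ δ → |t.2| ≤ δ → 0 ≤ l → l ≤ 1 → |k| ≤ δ →
      cpt t (model s σ a l k t) ∈ U)
    {B : Set (ℝ × ℝ)} (hB : IsCompact B) (hB0 : (0 : ℝ × ℝ) ∈ interior B)
    (hBδ : ∀ q ∈ B, |q.1| ≤ δ ∧ |q.2| ≤ δ) {η : ℝ × ℝ → ℝ × ℝ} (hη : LocallyLipschitz η)
    (hηΩ : ∀ ε : ℝ, 0 < ε → ε ≤ 1 → ∀ q ∈ B, surf (ε • η) q ∈ slitDomain G s U)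
    (hη' : ∀ q ∈ B, G (toC q) = 0 → 0 < s * (fderiv ℂ G (toC q) (toC (η q))).re)
    (hbd : ∀ q ∈ frontier B, s * (η q).2 < 0) :
    ∃ (ζ : ℝ × ℝ → ℝ × ℝ) (e k : ℝ) (d : ℝ × ℝ → ℝ), 0 < e ∧ 0 < k ∧ k ≤ δ ∧ LipschitzWith 1 d ∧
      (∀ q, d q ≤ ‖q‖) ∧ (∀ q, d q ≤ 2 * e → q ∈ interior B) ∧ LocallyLipschitz ζ ∧
      (∀ q, d q ≤ 2 * e → ζ q = model s σ a 1 k q) ∧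
      (∀ q ∈ B, surf ζ q ∈ slitDomain G s U) ∧
      (∀ q ∈ B, e ≤ d q → s * (ζ q).2 < 0) ∧
      (∀ q, e ≤ d q → 2 * k ≤ a * q.1 ^ 2 + |q.2| / 4) ∧
      ∀ f : ℂ × ℂ → ℂ, DifferentiableOn ℂ f (slitDomain G s U) →
        ∫ q in B, f (surf η q) * surfJac η q = ∫ q in B, f (surf ζ q) * surfJac ζ q := by
  set O := slitDomain G s U with hO
  have hOo : IsOpen O := isOpen_slitDomain hG.continuous s hU
  have hss : s * s = 1 := by rcases hs with rfl | rfl <;> norm_num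
  -- where `η` does not point into the region of decay, together with the saddle; by the boundary
  -- condition, this compact set is contained in the interior of `B`
  set M : Set (ℝ × ℝ) := (B ∩ {q | 0 ≤ s * (η q).2}) ∪ {0} with hMdef
  have hMc : IsCompact M := by
    refine IsCompact.union (hB.inter_right ?_) isCompact_singleton
    exact isClosed_le continuous_const (continuous_const.mul (continuous_snd.comp hη.continuous))
  have hMi : M ⊆ interior B := by
    rintro q (⟨h1, h2⟩ | rfl)
    · by_contra hcon
      have : q ∈ frontier B := ⟨subset_closure h1, hcon⟩
      exact absurd (hbd q this) (not_lt.mpr h2)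
    · exact hB0
  have hM0 : (0 : ℝ × ℝ) ∈ M := Or.inr rfl
  obtain ⟨E, hE, hEsub⟩ := hMc.exists_cthickening_subset_open isOpen_interior hMi
  set d : ℝ × ℝ → ℝ := fun q => Metric.infDist q M with hd
  have hdL : LipschitzWith 1 d := Metric.lipschitz_infDist_pt M
  have hdn : ∀ q, d q ≤ ‖q‖ := fun q => by
    simpa using Metric.infDist_le_dist_of_mem (x := q) hM0
  have hdE : ∀ q, d q ≤ E → q ∈ interior B := fun q hq => by
    obtain ⟨y, hy, hyd⟩ := hMc.exists_infDist_eq_dist ⟨0, hM0⟩ q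
    exact hEsub (Metric.mem_cthickening_of_dist_le q y E M hy (by rw [← hyd]; exact hq))
  set e := E / 5 with he
  have he0 : 0 < e := by positivity
  -- the height is so small that the model field points into the region of decay where `d ≥ e`
  set k := min δ (min (a * e ^ 2) (e / 4) / 2) with hk
  have hk0 : 0 < k := by positivity
  have hkδ : k ≤ δ := min_le_left _ _
  have hk2 : ∀ q, e ≤ d q → 2 * k ≤ a * q.1 ^ 2 + |q.2| / 4 := by
    intro q hq
    have h1 : 2 * k ≤ min (a * e ^ 2) (e / 4) := by
      have := min_le_right δ (min (a * e ^ 2) (e / 4) / 2); linarith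
    have h2 := hq.trans (hdn q)
    rw [Prod.norm_def, le_max_iff] at h2
    rcases h2 with h | h
    · have h3 : e ^ 2 ≤ q.1 ^ 2 := by
        rw [← sq_abs q.1]; exact pow_le_pow_left₀ he0.le h 2
      have h4 : a * e ^ 2 ≤ a * q.1 ^ 2 := by gcongr
      have := min_le_left (a * e ^ 2) (e / 4)
      have := abs_nonneg q.2
      linarith
    · rw [Real.norm_eq_abs] at h
      have := min_le_right (a * e ^ 2) (e / 4)
      have : 0 ≤ a * q.1 ^ 2 := by positivity
      linarith
  set T := model s σ a 1 k with hT
  have hTL : LocallyLipschitz T := locallyLipschitz_model _ _ _ _ _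
  have hT2 : ∀ q, s * (T q).2 = k - (a * q.1 ^ 2 + |q.2| / 4) := fun q => by
    simp only [hT, model, one_mul, ← mul_assoc, hss]
  have hBU : ∀ q ∈ B, toC q ∈ U := fun q hq => by
    have := hUm q 0 0 (hBδ q hq).1 (hBδ q hq).2 le_rfl zero_le_one (by simpa using hδ.le)
    rwa [model_zero, cpt_zero] at this
  have hT' : ∀ q ∈ B, G (toC q) = 0 → 0 < s * (fderiv ℂ G (toC q) (toC (T q))).re := by
    intro q hq h0
    obtain ⟨b1, b2⟩ := hBδ q hq
    have h1 := hM.trace q b1 b2 h0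
    have h2 := hM.deriv_pos q 1 k b1 b2 zero_le_one le_rfl hk0 hkδ (by linarith) 0
      ⟨le_rfl, zero_le_one⟩
    rwa [zero_smul, cpt_zero] at h2
  obtain ⟨ε₀, hε₀, hflat⟩ := exists_flat_segment_mem hG hreal (s := s) hU hB hBU hη.continuous
    hTL.continuous hη' hT'
  set ε := min ε₀ 1 with hε
  have hεp : 0 < ε := by positivity
  have hε1 : ε ≤ 1 := min_le_right _ _
  have hdc := hdL.continuous
  have hcut : ∀ u v, LocallyLipschitz (cutoff d u v) := fun u v => locallyLipschitz_cutoff hdL u v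
  -- flattening of `η` by the factor `ε` where `d ≤ 4 e`
  have hsupp : ∀ u v, u < v → v ≤ 5 * e → tsupport (cutoff d u v) ⊆ B := fun u v h hv q hq =>
    interior_subset (hdE q ((tsupport_cutoff_subset hdc h hq).trans (by rw [he] at hv; linarith)))
  set ζ₁ := blend (cutoff d (4 * e) (5 * e)) η (ε • η) with hζ₁
  have hζ₁L : LocallyLipschitz ζ₁ :=
    locallyLipschitz_blend (hcut _ _) hη (locallyLipschitz_const_smul hη ε)
  have hseg₁ : ∀ q ∈ tsupport (cutoff d (4 * e) (5 * e)), ∀ τ ∈ Icc (0 : ℝ) 1,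
      cpt q (η q + τ • ((ε • η) q - η q)) ∈ O := by
    intro q hq τ hτ
    have h1 : η q + τ • ((ε • η) q - η q) = (1 - τ * (1 - ε)) • η q := by
      rw [Pi.smul_apply]; module
    rw [h1]
    have h2 : τ * (1 - ε) < 1 := by nlinarith [hτ.1, hτ.2]
    have h3 : 0 ≤ τ * (1 - ε) := mul_nonneg hτ.1 (by linarith)
    exact hηΩ (1 - τ * (1 - ε)) (by linarith) (by linarith) q (hsupp _ _ (by linarith) le_rfl hq)
  have hηO : ∀ q ∈ B, surf η q ∈ O := fun q hq => by
    simpa using hηΩ 1 one_pos le_rfl q hq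
  have hζ₁O : ∀ q ∈ B, surf ζ₁ q ∈ O := fun q hq =>
    blend_mem (cutoff_nonneg d _ _) (cutoff_le_one d _ _) hseg₁ hηO hq
  have hζ₁e : ∀ q, d q ≤ 4 * e → ζ₁ q = ε • η q := fun q hq => by
    rw [hζ₁, blend, cutoff_eq_one (by linarith) hq]; simp
  -- joining to the flattened model surface where `d ≤ 3 e`
  set ζ₂ := blend (cutoff d (3 * e) (4 * e)) ζ₁ (ε • T) with hζ₂
  have hζ₂L : LocallyLipschitz ζ₂ :=
    locallyLipschitz_blend (hcut _ _) hζ₁L (locallyLipschitz_const_smul hTL ε)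
  have hseg₂ : ∀ q ∈ tsupport (cutoff d (3 * e) (4 * e)), ∀ τ ∈ Icc (0 : ℝ) 1,
      cpt q (ζ₁ q + τ • ((ε • T) q - ζ₁ q)) ∈ O := by
    intro q hq τ hτ
    have h0 : d q ≤ 4 * e := tsupport_cutoff_subset hdc (by linarith) hq
    have h1 : ζ₁ q + τ • ((ε • T) q - ζ₁ q) = ε • (η q + τ • (T q - η q)) := by
      rw [hζ₁e q h0, Pi.smul_apply]; module
    rw [h1]
    exact hflat ε hεp (min_le_left _ _) q (hsupp _ _ (by linarith) (by linarith) hq) τ hτ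
  have hζ₂O : ∀ q ∈ B, surf ζ₂ q ∈ O := fun q hq =>
    blend_mem (cutoff_nonneg d _ _) (cutoff_le_one d _ _) hseg₂ hζ₁O hq
  have hζ₂e : ∀ q, d q ≤ 3 * e → ζ₂ q = model s σ a ε (ε * k) q := fun q hq => by
    rw [hζ₂, blend, cutoff_eq_one (by linarith) hq, Pi.smul_apply, hT, smul_model]; simp
  -- expansion of the model surface where `d ≤ 2 e`
  set ζ₃ := blend (cutoff d (2 * e) (3 * e)) ζ₂ T with hζ₃
  have hζ₃L : LocallyLipschitz ζ₃ := locallyLipschitz_blend (hcut _ _) hζ₂L hTL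
  have hseg₃ : ∀ q ∈ tsupport (cutoff d (2 * e) (3 * e)), ∀ τ ∈ Icc (0 : ℝ) 1,
      cpt q (ζ₂ q + τ • (T q - ζ₂ q)) ∈ O := by
    intro q hq τ hτ
    have h0 : d q ≤ 3 * e := tsupport_cutoff_subset hdc (by linarith) hq
    rw [hζ₂e q h0, hT, model_segment]
    have h1 : ε * k + τ * (k - ε * k) = (ε + τ * (1 - ε)) * k := by ring
    have h2 : 0 < ε + τ * (1 - ε) := by nlinarith [hτ.1]
    have h3 : ε + τ * (1 - ε) ≤ 1 := by nlinarith [hτ.2]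
    rw [h1]
    obtain ⟨b1, b2⟩ := hBδ q (hsupp _ _ (by linarith) (by linarith) hq)
    have h4 : (ε + τ * (1 - ε)) * k ≤ δ := (mul_le_of_le_one_left hk0.le h3).trans hkδ
    have h5 : 0 < (ε + τ * (1 - ε)) * k := by positivity
    exact ⟨hUm q _ _ b1 b2 h2.le h3 (by rwa [abs_of_pos h5]),
      hM.not_mem_cut q _ _ b1 b2 h2.le h3 h5 h4⟩
  have hζ₃O : ∀ q ∈ B, surf ζ₃ q ∈ O := fun q hq =>
    blend_mem (cutoff_nonneg d _ _) (cutoff_le_one d _ _) hseg₃ hζ₂O hq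
  -- the sign of the second component persists
  have hneg : ∀ (χ : ℝ × ℝ → ℝ) (ζ X : ℝ × ℝ → ℝ × ℝ) (q : ℝ × ℝ), 0 ≤ χ q → χ q ≤ 1 →
      s * (ζ q).2 < 0 → s * (X q).2 < 0 → s * (blend χ ζ X q).2 < 0 := by
    intro χ ζ X q h0 h1 h2 h3
    have e1 : s * (blend χ ζ X q).2 = (1 - χ q) * (s * (ζ q).2) + χ q * (s * (X q).2) := by
      simp [blend]; ring
    rw [e1]
    rcases h0.eq_or_lt with h | h
    · rw [← h]; simpa using h2
    · have := mul_neg_of_pos_of_neg h h3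
      have := mul_nonpos_of_nonneg_of_nonpos (sub_nonneg.mpr h1) h2.le
      linarith
  have hηneg : ∀ q ∈ B, e ≤ d q → s * (η q).2 < 0 := by
    intro q hq hde
    by_contra hcon
    have : q ∈ M := Or.inl ⟨hq, not_lt.mp hcon⟩
    have h0 : d q = 0 := Metric.infDist_zero_of_mem this
    linarith
  have hTneg : ∀ q, e ≤ d q → s * (T q).2 < 0 := fun q hq => by
    rw [hT2]; have := hk2 q hq; linarith
  have hsmul : ∀ (ζ : ℝ × ℝ → ℝ × ℝ) q, s * (ζ q).2 < 0 → s * ((ε • ζ) q).2 < 0 := by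
    intro ζ q h
    have : s * ((ε • ζ) q).2 = ε * (s * (ζ q).2) := by simp; ring
    rw [this]; exact mul_neg_of_pos_of_neg hεp h
  refine ⟨ζ₃, e, k, d, he0, hk0, hkδ, hdL, hdn, fun q hq => hdE q (by linarith), hζ₃L, ?_, hζ₃O, ?_,
    hk2, ?_⟩
  · intro q hq
    rw [hζ₃, blend, cutoff_eq_one (by linarith) hq, hT]; simp
  · intro q hq hde
    have c0 := cutoff_nonneg d
    have c1 := cutoff_le_one d
    refine hneg _ _ _ q (c0 _ _ q) (c1 _ _ q) ?_ (hTneg q hde)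
    refine hneg _ _ _ q (c0 _ _ q) (c1 _ _ q) ?_ (hsmul _ q (hTneg q hde))
    exact hneg _ _ _ q (c0 _ _ q) (c1 _ _ q) (hηneg q hq hde) (hsmul _ q (hηneg q hq hde))
  · intro f hf
    have c0 := cutoff_nonneg d
    have c1 := cutoff_le_one d
    rw [hζ₃, setIntegral_blend hOo hf (hcut _ _) hζ₂L hTL (c0 _ _) (c1 _ _) hB
      (hsupp _ _ (by linarith) (by linarith)) hseg₃ hζ₂O]
    rw [hζ₂, setIntegral_blend hOo hf (hcut _ _) hζ₁L (locallyLipschitz_const_smul hTL ε) (c0 _ _)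
      (c1 _ _) hB (hsupp _ _ (by linarith) (by linarith)) hseg₂ hζ₁O]
    rw [hζ₁, setIntegral_blend hOo hf (hcut _ _) hη (locallyLipschitz_const_smul hη ε) (c0 _ _)
      (c1 _ _) hB (hsupp _ _ (by linarith) le_rfl) hseg₁ hηO]

/-! ### Exponentially small contributions -/

lemma norm_exp_surf_snd (s ρ : ℝ) (ζ : ℝ × ℝ → ℝ × ℝ) (q : ℝ × ℝ) :
    ‖Complex.exp (-(Complex.I * s * ρ * (surf ζ q).2))‖ = Real.exp (ρ * (s * (ζ q).2)) := by
  rw [Complex.norm_exp]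
  congr 1
  simp [surf]
  ring

/-- The part of the integral over which `s Im w ≤ -c` decays like `e^{-cρ}`. -/
lemma norm_setIntegral_exp_le {O : Set (ℂ × ℂ)} {f : ℂ × ℂ → ℂ} (hf : ContinuousOn f O)
    {ζ : ℝ × ℝ → ℝ × ℝ} (hζ : LocallyLipschitz ζ) {B S : Set (ℝ × ℝ)} (hB : IsCompact B)
    (hS : MeasurableSet S) (hSB : S ⊆ B) (hmem : ∀ q ∈ B, surf ζ q ∈ O) {s c ρ : ℝ} (hρ : 0 ≤ ρ)
    (hc : ∀ q ∈ S, s * (ζ q).2 ≤ -c) :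
    ‖∫ q in S, f (surf ζ q) * Complex.exp (-(Complex.I * s * ρ * (surf ζ q).2)) * surfJac ζ q‖
      ≤ (∫ q in B, ‖f (surf ζ q) * surfJac ζ q‖) * Real.exp (-(c * ρ)) := by
  have hi := integrableOn_surf hf hζ hB hmem
  have h1 : ‖∫ q in S, f (surf ζ q) * Complex.exp (-(Complex.I * s * ρ * (surf ζ q).2)) * surfJac ζ q‖
      ≤ ∫ q in S, ‖f (surf ζ q) * surfJac ζ q‖ * Real.exp (-(c * ρ)) := by
    refine norm_integral_le_of_norm_le ((hi.mono_set hSB).norm.mul_const _) ?_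
    filter_upwards [ae_restrict_mem hS] with q hq
    have e : ‖f (surf ζ q) * Complex.exp (-(Complex.I * s * ρ * (surf ζ q).2)) * surfJac ζ q‖
        = ‖f (surf ζ q) * surfJac ζ q‖ * Real.exp (ρ * (s * (ζ q).2)) := by
      rw [norm_mul, norm_mul, norm_mul, norm_exp_surf_snd]; ring
    rw [e]
    refine mul_le_mul_of_nonneg_left (Real.exp_le_exp.mpr ?_) (norm_nonneg _)
    have := mul_le_mul_of_nonneg_left (hc q hq) hρ
    linarith
  refine h1.trans ?_
  rw [integral_mul_const]
  refine mul_le_mul_of_nonneg_right ?_ (Real.exp_pos _).le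
  exact setIntegral_mono_set hi.norm (Eventually.of_forall fun _ => norm_nonneg _)
    (Eventually.of_forall hSB)

lemma IsCompact.exists_le_neg {B : Set (ℝ × ℝ)} (hB : IsCompact B) {φ : ℝ × ℝ → ℝ}
    (hφ : Continuous φ) (h : ∀ q ∈ B, φ q < 0) : ∃ c > 0, ∀ q ∈ B, φ q ≤ -c := by
  rcases B.eq_empty_or_nonempty with rfl | hne
  · exact ⟨1, one_pos, by simp⟩
  · obtain ⟨q0, hq0, hmax⟩ := hB.exists_isMaxOn hne hφ.continuousOn
    exact ⟨-φ q0, by linarith [h q0 hq0], fun q hq => by simpa using hmax hq⟩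

lemma differentiable_exp_snd (s ρ : ℝ) :
    Differentiable ℂ fun ξ : ℂ × ℂ => Complex.exp (-(Complex.I * s * ρ * ξ.2)) := by
  fun_prop

/-- For a function that is holomorphic across the singularity, the model surface can be pushed to the
other side of the saddle, so that the integral decays exponentially. -/
theorem exists_regular_bound {s σ a δ : ℝ} (hs : s = 1 ∨ s = -1) (ha : 0 < a)
    {U : Set (ℂ × ℂ)} (hU : IsOpen U)
    (hUm : ∀ (t : ℝ × ℝ) (l k : ℝ), |t.1| ≤ δ → |t.2| ≤ δ → 0 ≤ l → l ≤ 1 → |k| ≤ δ →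
      cpt t (model s σ a l k t) ∈ U)
    {B : Set (ℝ × ℝ)} (hB : IsCompact B) (hBδ : ∀ q ∈ B, |q.1| ≤ δ ∧ |q.2| ≤ δ)
    {ζ : ℝ × ℝ → ℝ × ℝ} {e k : ℝ} {d : ℝ × ℝ → ℝ} (he : 0 < e) (hk : 0 < k) (hkδ : k ≤ δ)
    (hd : LipschitzWith 1 d) (hdB : ∀ q, d q ≤ 2 * e → q ∈ interior B) (hζ : LocallyLipschitz ζ)
    (hζm : ∀ q, d q ≤ 2 * e → ζ q = model s σ a 1 k q) (hζU : ∀ q ∈ B, surf ζ q ∈ U)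
    (hζneg : ∀ q ∈ B, e ≤ d q → s * (ζ q).2 < 0)
    {f : ℂ × ℂ → ℂ} (hf : DifferentiableOn ℂ f U) :
    ∃ K c : ℝ, 0 < c ∧ ∀ ρ : ℝ, 0 ≤ ρ →
      ‖∫ q in B, f (surf ζ q) * Complex.exp (-(Complex.I * s * ρ * (surf ζ q).2)) * surfJac ζ q‖
        ≤ K * Real.exp (-(c * ρ)) := by
  have hss : s * s = 1 := by rcases hs with rfl | rfl <;> norm_num
  -- the target is the model surface of height `-k`, on which the exponential decays everywhere
  set χ := cutoff d e (2 * e)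
  set X := model s σ a 1 (-k)
  have hXL : LocallyLipschitz X := locallyLipschitz_model _ _ _ _ _
  have hχL : LocallyLipschitz χ := locallyLipschitz_cutoff hd _ _
  have hts : ∀ q ∈ tsupport χ, d q ≤ 2 * e := fun q hq =>
    tsupport_cutoff_subset hd.continuous (by linarith) hq
  have hseg : ∀ q ∈ tsupport χ, ∀ τ ∈ Icc (0 : ℝ) 1, cpt q (ζ q + τ • (X q - ζ q)) ∈ U := by
    intro q hq τ hτ
    rw [hζm q (hts q hq), model_segment]
    obtain ⟨b1, b2⟩ := hBδ q (interior_subset (hdB q (hts q hq)))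
    refine hUm q _ _ b1 b2 (by simp) (by simp) ?_
    rw [abs_le]
    obtain ⟨t1, t2⟩ := hτ
    constructor <;> nlinarith
  have hX2 : ∀ q, s * (X q).2 = -k - (a * q.1 ^ 2 + |q.2| / 4) := fun q => by
    simp only [X, model, one_mul, ← mul_assoc, hss]
  have hXneg : ∀ q, s * (X q).2 < 0 := fun q => by
    rw [hX2]
    have : 0 ≤ a * q.1 ^ 2 + |q.2| / 4 := by positivity
    linarith
  set Z := blend χ ζ X with hZ
  have hZL : LocallyLipschitz Z := locallyLipschitz_blend hχL hζ hXL
  have c0 : ∀ q, 0 ≤ χ q := cutoff_nonneg d _ _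
  have c1 : ∀ q, χ q ≤ 1 := cutoff_le_one d _ _
  have hZneg : ∀ q ∈ B, s * (Z q).2 < 0 := by
    intro q hq
    have e1 : s * (Z q).2 = (1 - χ q) * (s * (ζ q).2) + χ q * (s * (X q).2) := by
      simp [hZ, blend]; ring
    rcases le_or_gt (d q) e with h | h
    · have : χ q = 1 := cutoff_eq_one (by linarith) h
      rw [e1, this]; simpa using hXneg q
    · rw [e1]
      have h2 := hζneg q hq h.le
      rcases (c0 q).eq_or_lt with h' | h'
      · rw [← h']; simpa using h2
      · have := mul_neg_of_pos_of_neg h' (hXneg q)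
        have := mul_nonpos_of_nonneg_of_nonpos (sub_nonneg.mpr (c1 q)) h2.le
        linarith
  obtain ⟨c, hc, hcB⟩ := hB.exists_le_neg (φ := fun q => s * (Z q).2)
    (continuous_const.mul (continuous_snd.comp hZL.continuous)) hZneg
  have hZU : ∀ q ∈ B, surf Z q ∈ U := fun q hq => blend_mem c0 c1 hseg hζU hq
  refine ⟨∫ q in B, ‖f (surf Z q) * surfJac Z q‖, c, hc, fun ρ hρ => ?_⟩
  have h1 := setIntegral_blend hU (hf.mul (differentiable_exp_snd s ρ).differentiableOn) hχL hζ hXL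
    c0 c1 hB (fun q hq => interior_subset (hdB q (hts q hq))) hseg hζU
  simp only [Pi.mul_apply] at h1
  rw [← h1]
  exact norm_setIntegral_exp_le hf.continuousOn hZL hB hB.measurableSet subset_rfl hZU hρ hcB

/-! ### The limit integral -/

lemma det_toLin_finTwoProd (a b c d : ℝ) : LinearMap.det
    (Matrix.toLin (Module.Basis.finTwoProd ℝ) (Module.Basis.finTwoProd ℝ) !![a, b; c, d])
      = a * d - b * c := by
  rw [LinearMap.det_toLin, Matrix.det_fin_two_of]

lemma toLin_finTwoProd_eq (a b c d : ℝ) (y : ℝ × ℝ) :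
    Matrix.toLin (Module.Basis.finTwoProd ℝ) (Module.Basis.finTwoProd ℝ) !![a, b; c, d] y
      = (a * y.1 + b * y.2, c * y.1 + d * y.2) := by
  rw [Matrix.toLin_finTwoProd_apply]

lemma integral_comp_linear {a b c d : ℝ} (h : a * d - b * c ≠ 0) (f : ℝ × ℝ → ℂ) :
    ∫ y : ℝ × ℝ, f (a * y.1 + b * y.2, c * y.1 + d * y.2)
      = ((|a * d - b * c|⁻¹ : ℝ) : ℂ) * ∫ q, f q := by
  set A := Matrix.toLin (Module.Basis.finTwoProd ℝ) (Module.Basis.finTwoProd ℝ) !![a, b; c, d]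
  have hdet : LinearMap.det A ≠ 0 := by rw [det_toLin_finTwoProd]; exact h
  set L := (LinearMap.equivOfDetNeZero A hdet).toContinuousLinearEquiv
  have hL : ∀ y, L y = (a * y.1 + b * y.2, c * y.1 + d * y.2) := fun y => toLin_finTwoProd_eq a b c d y
  have h1 := Measure.map_linearMap_addHaar_eq_smul_addHaar (volume : Measure (ℝ × ℝ)) hdet
  have h2 : Measure.map L volume = Measure.map A (volume : Measure (ℝ × ℝ)) := rfl
  have h3 := L.toHomeomorph.measurableEmbedding.integral_map (μ := (volume : Measure (ℝ × ℝ))) f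
  have h4 : ∀ y, L.toHomeomorph y = (a * y.1 + b * y.2, c * y.1 + d * y.2) := hL
  simp only [h4] at h3
  rw [← h3]
  change ∫ q, f q ∂(Measure.map L volume) = _
  rw [h2, h1, integral_smul_measure, det_toLin_finTwoProd, abs_inv, ENNReal.toReal_ofReal (by positivity)]
  rw [Complex.real_smul]

lemma integrable_comp_linear {a b c d : ℝ} (h : a * d - b * c ≠ 0) {f : ℝ × ℝ → ℂ}
    (hf : Integrable f) : Integrable fun y : ℝ × ℝ => f (a * y.1 + b * y.2, c * y.1 + d * y.2) := by
  set A := Matrix.toLin (Module.Basis.finTwoProd ℝ) (Module.Basis.finTwoProd ℝ) !![a, b; c, d]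
  have hdet : LinearMap.det A ≠ 0 := by rw [det_toLin_finTwoProd]; exact h
  set L := (LinearMap.equivOfDetNeZero A hdet).toContinuousLinearEquiv
  have h1 := Measure.map_linearMap_addHaar_eq_smul_addHaar (volume : Measure (ℝ × ℝ)) hdet
  have h2 : Measure.map L volume = Measure.map A (volume : Measure (ℝ × ℝ)) := rfl
  have h4 : (fun y : ℝ × ℝ => f (a * y.1 + b * y.2, c * y.1 + d * y.2)) = f ∘ L.toHomeomorph := by
    ext1 y
    exact congrArg f (toLin_finTwoProd_eq a b c d y).symm
  rw [h4, ← L.toHomeomorph.measurableEmbedding.integrable_map_iff]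
  change Integrable f (Measure.map L volume)
  rw [h2, h1]
  exact hf.smul_measure ENNReal.ofReal_ne_top

/-- The exponential factor accounts for the argument of `z / (i s)` when `ν` is not real. -/
lemma norm_branchPow_le {s : ℝ} (hs : s = 1 ∨ s = -1) (z ν : ℂ) :
    ‖branchPow s z (-ν)‖ ≤ Real.exp (2 * (Real.pi * |ν.im|)) * ‖z‖ ^ (-ν.re) := by
  have hs1 : ‖(s : ℂ)‖ = 1 := by rcases hs with rfl | rfl <;> simp
  rw [branchPow_eq, norm_mul, Complex.norm_exp]
  have h1 := norm_cpow_le_rpow_mul_exp (z / (Complex.I * s)) (-ν)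
  rw [norm_div, norm_mul, Complex.norm_I, hs1, one_mul, div_one, Complex.neg_re, Complex.neg_im,
    abs_neg] at h1
  have h2 : (-(Complex.I * s * ν * Real.pi / 2)).re ≤ Real.pi * |ν.im| := by
    have e : (-(Complex.I * s * ν * Real.pi / 2)).re = s * ν.im * Real.pi / 2 := by
      simp; ring
    rw [e]
    have : s * ν.im ≤ |ν.im| := by
      refine (le_abs_self _).trans ?_
      rw [abs_mul]; rcases hs with rfl | rfl <;> simp
    have := mul_le_mul_of_nonneg_right this Real.pi_pos.le
    have := mul_nonneg (abs_nonneg ν.im) Real.pi_pos.le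
    nlinarith
  have h3 := Real.exp_le_exp.mpr h2
  calc _ ≤ Real.exp (Real.pi * |ν.im|) * (‖z‖ ^ (-ν.re) * Real.exp (Real.pi * |ν.im|)) := by gcongr
    _ = _ := by rw [two_mul, Real.exp_add]; ring

lemma branchPow_mul_ofReal {s : ℝ} {ρ : ℝ} (hρ : 0 < ρ) (z ν : ℂ) :
    branchPow s ((ρ : ℂ) * z) ν = (ρ : ℂ) ^ ν * branchPow s z ν := by
  unfold branchPow
  have hρ0 : (ρ : ℂ) ≠ 0 := by exact_mod_cast hρ.ne'
  have key : ∀ w : ℂ, ((ρ : ℂ) * w) ^ ν = (ρ : ℂ) ^ ν * w ^ ν := by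
    intro w
    rcases eq_or_ne w 0 with rfl | hw
    · rcases eq_or_ne ν 0 with rfl | hν
      · simp
      · simp [Complex.zero_cpow hν]
    · rw [Complex.cpow_def_of_ne_zero (mul_ne_zero hρ0 hw), Complex.cpow_def_of_ne_zero hρ0,
        Complex.cpow_def_of_ne_zero hw, Complex.log_ofReal_mul hρ hw, ← Complex.ofReal_log hρ.le,
        ← Complex.exp_add]
      ring_nf
  rw [mul_div_assoc, key]
  ring

/-- The limit of the rescaled integrand: the integrand of the model integral, with
`g = w - α z²`, on the surface on which `z` is rotated by `π / 4` and `w` runs over a wedge. -/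
def limitDensity (s σ a : ℝ) (A μ : ℂ) (y : ℝ × ℝ) : ℂ :=
  A * branchPow s (modelValue s σ a 1 1 y) (-μ)
    * Complex.exp (-(Complex.I * s * (cpt y (model s σ a 1 1 y)).2))
    * ((1 - Complex.I * s * σ) * (1 - Complex.I * s * (1 / 4 : ℝ) * ((SignType.sign y.2 : ℝ) : ℂ)))

/-- For fixed `y₁` the integral in `y₂` is Hankel's integral on the broken line through
`i s (1 + a y₁²)`; what remains is a Gaussian in `y₁`. -/
lemma integral_limitDensity {s σ a : ℝ} (hs : s = 1 ∨ s = -1) (ha : 0 < a) (A μ : ℂ)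
    (hi : Integrable (limitDensity s σ a A μ)) :
    ∫ y, limitDensity s σ a A μ y
      = A * (1 - Complex.I * s * σ) * (Real.sqrt (Real.pi / (2 * a)) : ℂ) * closedJ μ 1 s := by
  have hss : (s : ℂ) * s = 1 := by rcases hs with rfl | rfl <;> norm_num
  rw [Measure.volume_eq_prod] at hi ⊢
  rw [integral_prod _ hi]
  have h1 : ∀ x : ℝ, ∫ y : ℝ, limitDensity s σ a A μ (x, y)
      = (A * (1 - Complex.I * s * σ) * closedJ μ 1 s) * ((Real.exp (-(2 * a) * x ^ 2) : ℝ) : ℂ) := by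
    intro x
    have hc : 0 < 1 + a * x ^ 2 := by positivity
    rw [← integral_hankel hs (κ := 1 / 4) (by norm_num) (by norm_num) hc μ]
    rw [← integral_const_mul, ← integral_mul_const]
    congr 1
    ext1 y
    unfold limitDensity
    have e1 : modelValue s σ a 1 1 (x, y)
        = (y : ℂ) + Complex.I * s * ((1 + a * x ^ 2 - 1 / 4 * |y| : ℝ) : ℂ) := by
      simp only [modelValue]
      push_cast
      ring
    have e2 : Complex.exp (-(Complex.I * s * (cpt (x, y) (model s σ a 1 1 (x, y))).2))
        = Complex.exp (-(Complex.I * s * ((y : ℂ) + Complex.I * s * ((1 + a * x ^ 2 - 1 / 4 * |y| : ℝ) : ℂ))))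
          * ((Real.exp (-(2 * a) * x ^ 2) : ℝ) : ℂ) := by
      rw [Complex.ofReal_exp, ← Complex.exp_add]
      congr 1
      simp only [cpt, model]
      push_cast
      linear_combination (2 * a * x ^ 2 * Complex.I ^ 2 : ℂ) * hss + (2 * a * x ^ 2 : ℂ) * Complex.I_sq
    rw [e1, e2]
    ring
  simp only [h1]
  rw [integral_const_mul, integral_complex_ofReal, integral_gaussian]
  ring

lemma integrable_exp_mul_abs_of_neg {b : ℝ} (hb : b < 0) :
    Integrable fun x : ℝ => Real.exp (b * |x|) := by
  rw [← integrableOn_univ, ← Iic_union_Ioi (a := (0 : ℝ)), integrableOn_union]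
  constructor
  · refine (integrableOn_exp_mul_Iic (a := -b) (by linarith) 0).congr_fun (fun x hx => ?_)
      measurableSet_Iic
    rw [abs_of_nonpos hx]
    ring_nf
  · refine (integrableOn_exp_mul_Ioi hb 0).congr_fun (fun x hx => ?_) measurableSet_Ioi
    rw [abs_of_pos hx]

/-- A Gaussian times an exponential dominates every polynomial weight. -/
lemma integrable_weight (p : ℝ) {a : ℝ} (ha : 0 < a) :
    Integrable fun y : ℝ × ℝ => (1 + y.1 ^ 2 + |y.2|) ^ p * Real.exp (-(a * y.1 ^ 2 + |y.2| / 4) / 2) := by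
  set b := min a (1 / 4) / 2 with hb
  have hb0 : 0 < b := by positivity
  obtain ⟨C, hC⟩ : ∃ C : ℝ, ∀ t : ℝ, 0 ≤ t → (1 + t) ^ p * Real.exp (-(b / 2 * t)) ≤ C := by
    have h1 : Tendsto (fun t : ℝ => (1 + t) ^ p * Real.exp (-(b / 2 * t))) atTop (𝓝 0) := by
      refine (isBigO_rpow_mul_exp p (half_pos hb0)).trans_tendsto ?_
      refine Real.tendsto_exp_atBot.comp ?_
      exact tendsto_id.const_mul_atTop_of_neg (by linarith)
    have hc : ContinuousOn (fun t : ℝ => (1 + t) ^ p * Real.exp (-(b / 2 * t))) (Ici 0) := by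
      refine ContinuousOn.mul ?_ (by fun_prop)
      refine ContinuousOn.rpow_const (by fun_prop) fun t ht => Or.inl ?_
      have : (0 : ℝ) ≤ t := ht
      linarith
    obtain ⟨N, hN⟩ := eventually_atTop.mp (h1.eventually_le_const one_pos)
    obtain ⟨C, hC⟩ := isCompact_Icc.bddAbove_image (hc.mono (Icc_subset_Ici_self : Icc 0 (max N 0) ⊆ Ici 0))
    refine ⟨max C 1, fun t ht => ?_⟩
    rcases le_total t (max N 0) with h | h
    · exact (hC ⟨t, ⟨ht, h⟩, rfl⟩).trans (le_max_left _ _)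
    · exact (hN t ((le_max_left _ _).trans h)).trans (le_max_right _ _)
  have hi : Integrable (fun y : ℝ × ℝ => Real.exp (-(b / 2) * y.1 ^ 2) * Real.exp (-(b / 2) * |y.2|)) := by
    refine Integrable.mul_prod (f := fun x => Real.exp (-(b / 2) * x ^ 2))
      (g := fun x => Real.exp (-(b / 2) * |x|)) (integrable_exp_neg_mul_sq (by positivity)) ?_
    exact integrable_exp_mul_abs_of_neg (by linarith)
  refine (hi.const_mul C).mono' ?_ (Eventually.of_forall fun y => ?_)
  · refine Measurable.aestronglyMeasurable ?_
    fun_prop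
  · have hy : 0 ≤ y.1 ^ 2 + |y.2| := by positivity
    rw [Real.norm_of_nonneg (by positivity)]
    have h1 := hC _ hy
    have h2 : -(a * y.1 ^ 2 + |y.2| / 4) / 2 ≤ -(b * (y.1 ^ 2 + |y.2|)) := by
      have m1 := min_le_left a (1 / 4)
      have m2 := min_le_right a (1 / 4)
      have e1 : b ≤ a / 2 := by rw [hb]; linarith
      have e2 : b ≤ 1 / 8 := by rw [hb]; linarith
      have := mul_le_mul_of_nonneg_right e1 (sq_nonneg y.1)
      have := mul_le_mul_of_nonneg_right e2 (abs_nonneg y.2)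
      linarith
    calc (1 + y.1 ^ 2 + |y.2|) ^ p * Real.exp (-(a * y.1 ^ 2 + |y.2| / 4) / 2)
        ≤ (1 + y.1 ^ 2 + |y.2|) ^ p * Real.exp (-(b * (y.1 ^ 2 + |y.2|))) := by gcongr
      _ = ((1 + (y.1 ^ 2 + |y.2|)) ^ p * Real.exp (-(b / 2 * (y.1 ^ 2 + |y.2|))))
          * (Real.exp (-(b / 2) * y.1 ^ 2) * Real.exp (-(b / 2) * |y.2|)) := by
        rw [mul_assoc, ← Real.exp_add, ← Real.exp_add, ← add_assoc]
        congr 2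
        ring
      _ ≤ _ := by gcongr

/-! ### Scaling and surfaces of variable height -/

/-- The scaling `(y₁, y₂) ↦ (ρ^{-1/2} y₁, ρ^{-1} y₂)` that balances `ρ z²` and `ρ w`. -/
def scale (ρ : ℝ) (y : ℝ × ℝ) : ℝ × ℝ := ((√ρ)⁻¹ * y.1, ρ⁻¹ * y.2)

lemma scale_fst_sq {ρ : ℝ} (hρ : 0 < ρ) (y : ℝ × ℝ) : ρ * (scale ρ y).1 ^ 2 = y.1 ^ 2 := by
  simp only [scale, mul_pow, inv_pow, Real.sq_sqrt hρ.le]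
  field_simp

lemma scale_snd {ρ : ℝ} (hρ : 0 < ρ) (y : ℝ × ℝ) : ρ * (scale ρ y).2 = y.2 := by
  simp only [scale]
  field_simp

lemma abs_scale_snd {ρ : ℝ} (hρ : 0 < ρ) (y : ℝ × ℝ) : ρ * |(scale ρ y).2| = |y.2| := by
  conv_rhs => rw [← scale_snd hρ y, abs_mul, abs_of_pos hρ]

lemma tendsto_scale (y : ℝ × ℝ) : Tendsto (fun ρ => scale ρ y) atTop (𝓝 0) := by
  have h1 : Tendsto (fun ρ : ℝ => (√ρ)⁻¹ * y.1) atTop (𝓝 (0 * y.1)) :=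
    (tendsto_inv_atTop_zero.comp Real.tendsto_sqrt_atTop).mul_const _
  have h2 : Tendsto (fun ρ : ℝ => ρ⁻¹ * y.2) atTop (𝓝 (0 * y.2)) :=
    tendsto_inv_atTop_zero.mul_const _
  rw [zero_mul] at h1 h2
  exact h1.prodMk_nhds h2

lemma integral_scale {ρ : ℝ} (hρ : 0 < ρ) (f : ℝ × ℝ → ℂ) :
    ∫ y, f (scale ρ y) = ((√ρ * ρ : ℝ) : ℂ) * ∫ q, f q := by
  have hs : 0 < √ρ := Real.sqrt_pos.mpr hρ
  have h := integral_comp_linear (a := (√ρ)⁻¹) (b := 0) (c := 0) (d := ρ⁻¹) (by simp [hs.ne', hρ.ne']) f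
  simp only [zero_mul, add_zero, zero_add, sub_zero] at h
  have e : |(√ρ)⁻¹ * ρ⁻¹|⁻¹ = √ρ * ρ := by
    rw [abs_of_pos (by positivity)]; simp [mul_comm]
  rw [e] at h
  exact h

lemma integrable_scale {ρ : ℝ} (hρ : 0 < ρ) {f : ℝ × ℝ → ℂ} (hf : Integrable f) :
    Integrable fun y => f (scale ρ y) := by
  have hs : 0 < √ρ := Real.sqrt_pos.mpr hρ
  have h := integrable_comp_linear (a := (√ρ)⁻¹) (b := 0) (c := 0) (d := ρ⁻¹)
    (by simp [hs.ne', hρ.ne']) hf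
  simp only [zero_mul, add_zero, zero_add] at h
  exact h

lemma hasFDerivAt_model {s σ a l k : ℝ} {t : ℝ × ℝ} (ht : t.2 ≠ 0) :
    ∃ A : ℝ × ℝ →L[ℝ] ℝ × ℝ, HasFDerivAt (model s σ a l k) A t ∧
      A (1, 0) = (-(l * s * σ), -(s * l * (2 * a * t.1))) ∧
      A (0, 1) = (0, -(s * l * ((SignType.sign t.2 : ℝ) / 4))) := by
  have h1 : HasFDerivAt (fun t : ℝ × ℝ => t.1) (ContinuousLinearMap.fst ℝ ℝ ℝ) t := hasFDerivAt_fst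
  have h2 : HasFDerivAt (fun t : ℝ × ℝ => |t.2|)
      (((SignType.sign t.2 : ℝ)) • ContinuousLinearMap.snd ℝ ℝ ℝ) t :=
    (hasDerivAt_abs ht).comp_hasFDerivAt t hasFDerivAt_snd
  have h3 := ((h1.const_mul (l * s * σ)).neg).prodMk
    (((((h1.pow 2).const_mul a).add (h2.mul_const (4 : ℝ)⁻¹)).const_mul l).const_sub k |>.const_mul s)
  have e : model s σ a l k = fun t : ℝ × ℝ => (-(l * s * σ * t.1),
      s * (k - l * (a * t.1 ^ 2 + |t.2| * (4 : ℝ)⁻¹))) := by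
    ext1 t; simp only [model]; rw [div_eq_mul_inv]
  refine ⟨_, by rw [e]; exact h3, ?_, ?_⟩
  · ext
    · simp
    · simp; ring
  · ext
    · simp
    · simp; ring

lemma surfJac_model {s σ a k : ℝ} {t : ℝ × ℝ} (ht : t.2 ≠ 0) :
    surfJac (model s σ a 1 k) t = (1 - Complex.I * s * σ)
      * (1 - Complex.I * s * (1 / 4 : ℝ) * ((SignType.sign t.2 : ℝ) : ℂ)) := by
  obtain ⟨A, hA, h1, h2⟩ := hasFDerivAt_model (s := s) (σ := σ) (a := a) (l := 1) (k := k) ht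
  rw [surfJac, hA.fderiv, h1, h2]
  push_cast
  ring

section Inner

variable {G : ℂ × ℂ → ℂ} {s σ a C δ : ℝ} {U : Set (ℂ × ℂ)} {e k : ℝ} {d : ℝ × ℝ → ℝ}

/-- The height of the surface used at the parameter `ρ`: `1 / ρ` near the saddle and `k` at some
distance from it. -/
def height (d : ℝ × ℝ → ℝ) (e k ρ : ℝ) (q : ℝ × ℝ) : ℝ :=
  k + cutoff d e (3 * e / 2) q * (ρ⁻¹ - k)

lemma height_mem {ρ : ℝ} (hρk : ρ⁻¹ ≤ k) (q : ℝ × ℝ) :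
    ρ⁻¹ ≤ height d e k ρ q ∧ height d e k ρ q ≤ k := by
  have c0 := cutoff_nonneg d e (3 * e / 2) q
  have c1 := cutoff_le_one d e (3 * e / 2) q
  unfold height
  constructor <;> nlinarith

/-- In the exponent, `ρ` times the height costs at most a constant and half of the decay. -/
lemma height_mul_le (ha : 0 < a) {ρ : ℝ} (he : 0 < e) (hρ : 0 < ρ) (hρk : ρ⁻¹ ≤ k)
    (hk2 : ∀ q, e ≤ d q → 2 * k ≤ a * q.1 ^ 2 + |q.2| / 4) (q : ℝ × ℝ) :
    ρ * height d e k ρ q ≤ 1 + ρ * (a * q.1 ^ 2 + |q.2| / 4) / 2 := by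
  have hA : 0 ≤ a * q.1 ^ 2 + |q.2| / 4 := by positivity
  rcases le_total (d q) e with h | h
  · have : height d e k ρ q = ρ⁻¹ := by
      rw [height, cutoff_eq_one (by linarith) h]; ring
    rw [this, mul_inv_cancel₀ hρ.ne']
    have := mul_nonneg hρ.le hA
    linarith
  · have h1 := hk2 q h
    have h2 := (height_mem (d := d) (e := e) hρk q).2
    have := mul_le_mul_of_nonneg_left (h2.trans (by linarith : k ≤ (a * q.1 ^ 2 + |q.2| / 4) / 2)) hρ.le
    linarith

/-- The Jacobian of the surface is bounded uniformly in `ρ`: the fields have a common Lipschitz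
constant. -/
lemma exists_norm_surfJac_inner_le (hs : s = 1 ∨ s = -1) (hσ : σ = 1 ∨ σ = -1) (ha : 0 < a)
    (hk : 0 < k) (hd : LipschitzWith 1 d)
    (hdδ : ∀ q, d q < 2 * e → |q.1| ≤ δ ∧ |q.2| ≤ δ) :
    ∃ J : ℝ, ∀ ρ : ℝ, 0 < ρ → ρ⁻¹ ≤ k → ∀ q, d q < 2 * e →
      ‖surfJac (fun q => model s σ a 1 (height d e k ρ q) q) q‖ ≤ J := by
  have hs1 : |s| = 1 := by rcases hs with rfl | rfl <;> simp
  have hσ1 : |σ| = 1 := by rcases hσ with rfl | rfl <;> simp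
  obtain ⟨K, hK⟩ := exists_lipschitzWith_cutoff hd e (3 * e / 2)
  set C0 : ℝ := 1 + (k * K + a * (2 * δ + 1) + 1) with hC0
  refine ⟨(1 + C0) * (1 + C0) + C0 * C0, fun ρ hρ hρk q hq => norm_surfJac_le ?_⟩
  obtain ⟨b1, b2⟩ := hdδ q hq
  have hδ0 : 0 ≤ δ := (abs_nonneg _).trans b1
  have hKn : (0 : ℝ) ≤ K := K.2
  refine norm_fderiv_le_of_lip' ℝ (by positivity) ?_
  filter_upwards [Metric.ball_mem_nhds q one_pos] with x hx
  rw [Metric.mem_ball, dist_eq_norm] at hx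
  have x1 := abs_fst_le_norm (x - q)
  have x2 := abs_snd_le_norm (x - q)
  rw [Prod.fst_sub] at x1
  rw [Prod.snd_sub] at x2
  have f1 : |cutoff d e (3 * e / 2) x - cutoff d e (3 * e / 2) q| ≤ K * ‖x - q‖ := by
    have := hK.norm_sub_le x q; rwa [Real.norm_eq_abs] at this
  have f2 : |x.1 ^ 2 - q.1 ^ 2| ≤ (2 * δ + 1) * ‖x - q‖ := by
    have e1 : x.1 ^ 2 - q.1 ^ 2 = (x.1 - q.1 + 2 * q.1) * (x.1 - q.1) := by ring
    rw [e1, abs_mul]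
    have : |x.1 - q.1 + 2 * q.1| ≤ 2 * δ + 1 := by
      refine (abs_add_le _ _).trans ?_
      rw [abs_mul, abs_two]; linarith
    gcongr
  have f3 : |(|x.2| - |q.2|)| ≤ ‖x - q‖ := (abs_abs_sub_abs_le_abs_sub _ _).trans x2
  have f4 : |ρ⁻¹ - k| ≤ k := by
    rw [abs_le]; have := inv_pos.mpr hρ; constructor <;> linarith
  refine norm_le_of_abs_le ?_ ?_
  · have e1 : (model s σ a 1 (height d e k ρ x) x - model s σ a 1 (height d e k ρ q) q).1
        = -(s * σ * (x.1 - q.1)) := by simp [model]; ring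
    rw [e1, abs_neg, abs_mul, abs_mul, hs1, hσ1, one_mul, one_mul]
    refine x1.trans (le_mul_of_one_le_left (norm_nonneg _) ?_)
    have : 0 ≤ k * K + a * (2 * δ + 1) + 1 := by positivity
    rw [hC0]; linarith
  · have e1 : (model s σ a 1 (height d e k ρ x) x - model s σ a 1 (height d e k ρ q) q).2
        = s * ((cutoff d e (3 * e / 2) x - cutoff d e (3 * e / 2) q) * (ρ⁻¹ - k)
          - a * (x.1 ^ 2 - q.1 ^ 2) - (|x.2| - |q.2|) / 4) := by simp [model, height]; ring
    rw [e1, abs_mul, hs1, one_mul]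
    have g1 : |(cutoff d e (3 * e / 2) x - cutoff d e (3 * e / 2) q) * (ρ⁻¹ - k)|
        ≤ K * ‖x - q‖ * k := by rw [abs_mul]; gcongr
    have g2 : |a * (x.1 ^ 2 - q.1 ^ 2)| ≤ a * ((2 * δ + 1) * ‖x - q‖) := by
      rw [abs_mul, abs_of_pos ha]; gcongr
    have g3 : |(|x.2| - |q.2|) / 4| ≤ ‖x - q‖ / 4 := by
      rw [abs_div, abs_of_pos (by norm_num : (0 : ℝ) < 4)]; gcongr
    refine (abs_sub _ _).trans ((add_le_add (abs_sub _ _) le_rfl).trans ?_)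
    have := norm_nonneg (x - q)
    have e2 : C0 * ‖x - q‖ = ‖x - q‖ + (K * ‖x - q‖ * k + a * ((2 * δ + 1) * ‖x - q‖) + ‖x - q‖) := by
      rw [hC0]; ring
    rw [e2]
    linarith

end Inner

/-! ### The rescaled integral -/

/-- The integrand near the saddle, on the surface of height `height d e k ρ`. -/
def innerIntegrand (Fs : ℂ × ℂ → ℂ) (s σ a e k : ℝ) (d : ℝ × ℝ → ℝ) (ρ : ℝ) : ℝ × ℝ → ℂ :=
  {q | d q < 2 * e}.indicator fun q =>
    Fs (surf (fun q => model s σ a 1 (height d e k ρ q) q) q)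
      * Complex.exp (-(Complex.I * s * ρ * (surf (fun q => model s σ a 1 (height d e k ρ q) q) q).2))
      * surfJac (fun q => model s σ a 1 (height d e k ρ q) q) q

section Inner

variable {G : ℂ × ℂ → ℂ} {s σ a C δ : ℝ} {U : Set (ℂ × ℂ)} {e k : ℝ} {d : ℝ × ℝ → ℝ}

lemma cpt_model_scale {ρ : ℝ} (hρ : 0 < ρ) (y : ℝ × ℝ) :
    (ρ : ℂ) * (cpt (scale ρ y) (model s σ a 1 ρ⁻¹ (scale ρ y))).2 = (cpt y (model s σ a 1 1 y)).2 := by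
  have h1 := scale_fst_sq hρ y
  have h2 := scale_snd hρ y
  have h3 := abs_scale_snd hρ y
  have h4 := mul_inv_cancel₀ hρ.ne'
  have e1 : ρ * (model s σ a 1 ρ⁻¹ (scale ρ y)).2 = (model s σ a 1 1 y).2 := by
    simp only [model]
    linear_combination s * h4 - s * a * h1 - s / 4 * h3
  simp only [cpt]
  rw [← e1, ← h2]
  push_cast
  ring

lemma modelValue_scale {ρ : ℝ} (hρ : 0 < ρ) (y : ℝ × ℝ) :
    (ρ : ℂ) * modelValue s σ a 1 ρ⁻¹ (scale ρ y) = modelValue s σ a 1 1 y := by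
  have h1 := scale_fst_sq hρ y
  have h2 := scale_snd hρ y
  have h3 := abs_scale_snd hρ y
  have h4 := mul_inv_cancel₀ hρ.ne'
  apply Complex.ext
  · rw [Complex.re_ofReal_mul, modelValue_re, modelValue_re]
    linear_combination h2
  · rw [Complex.im_ofReal_mul, modelValue_im, modelValue_im]
    linear_combination s * h4 + s * a * h1 - s / 4 * h3

lemma continuousAt_branchPow_modelValue (hs : s = 1 ∨ s = -1) (μ : ℂ) {y : ℝ × ℝ} (hy : y.2 ≠ 0) :
    ContinuousAt (fun z => branchPow s z (-μ)) (modelValue s σ a 1 1 y) := by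
  have hss : (s : ℂ) * s = 1 := by rcases hs with rfl | rfl <;> norm_num
  have hs0 : s ≠ 0 := by rcases hs with rfl | rfl <;> norm_num
  unfold branchPow
  refine continuousAt_const.mul (ContinuousAt.cpow (continuousAt_id.div_const _) continuousAt_const ?_)
  have e1 : ∀ z : ℂ, z / (Complex.I * s) = -(Complex.I * s) * z := by
    intro z
    have : Complex.I * (s : ℂ) ≠ 0 := mul_ne_zero Complex.I_ne_zero (by exact_mod_cast hs0)
    rw [div_eq_iff this]
    linear_combination z * (Complex.I ^ 2 * hss + Complex.I_sq)
  rw [Complex.mem_slitPlane_iff]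
  right
  rw [e1]
  have : (-(Complex.I * s) * modelValue s σ a 1 1 y).im = -(s * (modelValue s σ a 1 1 y).re) := by
    simp
  rw [this, modelValue_re]
  simp [hs0, hy]

/-- Domination of the rescaled integrand: `ρ |g|` lies between `1 / 3` and a multiple of
`1 + y₁² + |y₂|`, and the exponential decays in `a y₁² + |y₂| / 4`. -/
lemma exists_norm_innerIntegrand_le (hs : s = 1 ∨ s = -1) (hσ : σ = 1 ∨ σ = -1) (ha : 0 < a)
    (hM : ModelRegion G s σ a C δ) (he : 0 < e) (hk : 0 < k) (hkδ : k ≤ δ) (hd : LipschitzWith 1 d)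
    (hdδ : ∀ q, d q < 2 * e → |q.1| ≤ δ ∧ |q.2| ≤ δ)
    (hk2 : ∀ q, e ≤ d q → 2 * k ≤ a * q.1 ^ 2 + |q.2| / 4) {Fs : ℂ × ℂ → ℂ} {μ : ℂ} {K : ℝ}
    (hF1 : ∀ (t : ℝ × ℝ) (l : ℝ), |t.1| ≤ δ → |t.2| ≤ δ → 0 < l → l ≤ δ →
      ‖Fs (cpt t (model s σ a 1 l t))‖ ≤ K * ‖branchPow s (G (cpt t (model s σ a 1 l t))) (-μ)‖) :
    ∃ N : ℝ, ∀ ρ : ℝ, 0 < ρ → ρ⁻¹ ≤ k → ∀ y,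
      ‖(ρ : ℂ) ^ (-μ) * innerIntegrand Fs s σ a e k d ρ (scale ρ y)‖
        ≤ N * ((1 + y.1 ^ 2 + |y.2|) ^ |(-μ.re)| * Real.exp (-(a * y.1 ^ 2 + |y.2| / 4) / 2)) := by
  have hss : s * s = 1 := by rcases hs with rfl | rfl <;> norm_num
  obtain ⟨J, hJ⟩ := exists_norm_surfJac_inner_le hs hσ ha hk hd hdδ
  set E := Real.exp (2 * (Real.pi * |μ.im|)) with hE
  set P := ((1 / 3 : ℝ) ^ (-μ.re) + (4 + 4 * a) ^ |(-μ.re)|) with hP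
  have hP0 : 0 ≤ P := by positivity
  refine ⟨|K| * E * P * Real.exp 1 * |J|, fun ρ hρ hρk y => ?_⟩
  set q := scale ρ y with hq
  have h1 := scale_fst_sq hρ y
  have h3 := abs_scale_snd hρ y
  rw [← hq] at h1 h3
  by_cases hdq : d q < 2 * e
  · obtain ⟨b1, b2⟩ := hdδ q hdq
    rw [innerIntegrand, indicator_of_mem (by exact hdq)]
    obtain ⟨m1, m2⟩ := height_mem (d := d) (e := e) hρk q
    have hh0 : 0 < height d e k ρ q := (inv_pos.mpr hρ).trans_le m1
    have hhl := height_mul_le ha he hρ hρk hk2 q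
    have hh1 : 1 ≤ ρ * height d e k ρ q := by
      have := mul_le_mul_of_nonneg_left m1 hρ.le
      rwa [mul_inv_cancel₀ hρ.ne'] at this
    set ξ := cpt q (model s σ a 1 (height d e k ρ q) q) with hξ
    have hsurf : surf (fun q => model s σ a 1 (height d e k ρ q) q) q = ξ := rfl
    rw [hsurf]
    have hA : ρ * (a * q.1 ^ 2 + |q.2| / 4) = a * y.1 ^ 2 + |y.2| / 4 := by
      linear_combination a * h1 + h3 / 4
    rw [hA] at hhl
    -- the size of `ρ g`
    have g1 := hM.le_norm q _ b1 b2 hh0 (m2.trans hkδ)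
    have g2 := hM.norm_le q _ b1 b2 hh0 (m2.trans hkδ)
    rw [← hξ] at g1 g2
    have hN : ρ * (|q.2| + a * q.1 ^ 2 + height d e k ρ q)
        = |y.2| + a * y.1 ^ 2 + ρ * height d e k ρ q := by linear_combination a * h1 + h3
    have hay : 0 ≤ a * y.1 ^ 2 := by positivity
    have hX1 : 1 / 3 ≤ ρ * ‖G ξ‖ := by
      have := mul_le_mul_of_nonneg_left g1 hρ.le
      have e1 : ρ * ((|q.2| + a * q.1 ^ 2 + height d e k ρ q) / 3)
        = (ρ * (|q.2| + a * q.1 ^ 2 + height d e k ρ q)) / 3 := by ring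
      rw [e1, hN] at this
      have := abs_nonneg y.2
      linarith
    have hX2 : ρ * ‖G ξ‖ ≤ (4 + 4 * a) * (1 + y.1 ^ 2 + |y.2|) := by
      have := mul_le_mul_of_nonneg_left g2 hρ.le
      have e1 : ρ * (2 * (|q.2| + a * q.1 ^ 2 + height d e k ρ q))
        = 2 * (ρ * (|q.2| + a * q.1 ^ 2 + height d e k ρ q)) := by ring
      rw [e1, hN] at this
      have := abs_nonneg y.2
      have := mul_nonneg ha.le this
      nlinarith [sq_nonneg y.1]
    have hX := rpow_le_mul_rpow_abs (p := -μ.re) (by norm_num : (0 : ℝ) < 1 / 3) (by positivity) hX1 hX2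
      (by have := abs_nonneg y.2; nlinarith [sq_nonneg y.1])
    have hF : ‖(ρ : ℂ) ^ (-μ)‖ * ‖Fs ξ‖ ≤ |K| * E * (P * (1 + y.1 ^ 2 + |y.2|) ^ |(-μ.re)|) := by
      have f1 := hF1 q _ b1 b2 hh0 (m2.trans hkδ)
      rw [← hξ] at f1
      have f2 := norm_branchPow_le hs (G ξ) μ
      rw [Complex.norm_cpow_eq_rpow_re_of_pos hρ, Complex.neg_re]
      calc ρ ^ (-μ.re) * ‖Fs ξ‖ ≤ ρ ^ (-μ.re) * (|K| * (E * ‖G ξ‖ ^ (-μ.re))) := by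
            gcongr
            refine f1.trans ?_
            gcongr
            exact le_abs_self K
        _ = |K| * E * (ρ * ‖G ξ‖) ^ (-μ.re) := by
            rw [Real.mul_rpow hρ.le (norm_nonneg _)]; ring
        _ ≤ _ := by gcongr
    have hexp : ‖Complex.exp (-(Complex.I * s * ρ * ξ.2))‖
        ≤ Real.exp 1 * Real.exp (-(a * y.1 ^ 2 + |y.2| / 4) / 2) := by
      rw [← hsurf, norm_exp_surf_snd, ← Real.exp_add, Real.exp_le_exp]
      simp only [model, one_mul, ← mul_assoc, hss]
      rw [mul_sub, hA]
      linarith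
    have hJ' := (hJ ρ hρ hρk q hdq).trans (le_abs_self J)
    rw [← mul_assoc, ← mul_assoc, norm_mul, norm_mul, norm_mul]
    calc _ ≤ |K| * E * (P * (1 + y.1 ^ 2 + |y.2|) ^ |(-μ.re)|)
          * (Real.exp 1 * Real.exp (-(a * y.1 ^ 2 + |y.2| / 4) / 2)) * |J| := by gcongr
      _ = _ := by ring
  · rw [innerIntegrand, indicator_of_notMem (by exact hdq), mul_zero, norm_zero]
    positivity

/-- Pointwise convergence of the rescaled integrand. -/
lemma tendsto_innerIntegrand (hs : s = 1 ∨ s = -1)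
    (hM : ModelRegion G s σ a C δ) (hδ : 0 < δ)
    (hUm : ∀ (t : ℝ × ℝ) (l k : ℝ), |t.1| ≤ δ → |t.2| ≤ δ → 0 ≤ l → l ≤ 1 → |k| ≤ δ →
      cpt t (model s σ a l k t) ∈ U)
    (he : 0 < e) (hd : LipschitzWith 1 d) (hd0 : ∀ q, d q ≤ ‖q‖)
    {Fs : ℂ × ℂ → ℂ} {A μ : ℂ}
    (hF2 : (fun ξ => Fs ξ - A * branchPow s (G ξ) (-μ)) =o[𝓝[slitDomain G s U] 0]
      fun ξ => branchPow s (G ξ) (-μ)) {y : ℝ × ℝ} (hy : y.2 ≠ 0) :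
    Tendsto (fun ρ : ℝ => (ρ : ℂ) ^ (-μ) * innerIntegrand Fs s σ a e k d ρ (scale ρ y)) atTop
      (𝓝 (limitDensity s σ a A μ y)) := by
  set ξ : ℝ → ℂ × ℂ := fun ρ => cpt (scale ρ y) (model s σ a 1 ρ⁻¹ (scale ρ y)) with hξ
  have hsc := tendsto_scale y
  have hinv : Tendsto (fun ρ : ℝ => ρ⁻¹) atTop (𝓝 0) := tendsto_inv_atTop_zero
  have hsmall : ∀ r : ℝ, 0 < r → ∀ᶠ ρ in atTop, ‖scale ρ y‖ < r := fun r hr =>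
    (by simpa using hsc.norm : Tendsto (fun ρ => ‖scale ρ y‖) atTop (𝓝 0)).eventually_lt_const hr
  have hbase : ∀ᶠ ρ : ℝ in atTop, 0 < ρ ∧ ρ⁻¹ ≤ δ ∧ |(scale ρ y).1| ≤ δ ∧ |(scale ρ y).2| ≤ δ := by
    filter_upwards [eventually_gt_atTop 0, hinv.eventually_le_const hδ, hsmall δ hδ] with ρ h1 h2 h3
    exact ⟨h1, h2, (abs_fst_le_norm _).trans h3.le, (abs_snd_le_norm _).trans h3.le⟩
  -- the points approach the saddle inside the slit domain
  have hξ0 : Tendsto ξ atTop (𝓝[slitDomain G s U] 0) := by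
    refine tendsto_nhdsWithin_iff.mpr ⟨?_, ?_⟩
    · have hc : Continuous fun z : (ℝ × ℝ) × ℝ => cpt z.1 (model s σ a 1 z.2 z.1) := by
        unfold cpt model; fun_prop
      have h := (hc.tendsto (0, 0)).comp (hsc.prodMk_nhds hinv)
      have h0 : cpt 0 (model s σ a 1 0 0) = 0 := by simp [cpt, model]
      simp only [h0] at h
      exact h
    · filter_upwards [hbase] with ρ ⟨h1, h2, h3, h4⟩
      have hp := inv_pos.mpr h1
      exact ⟨hUm _ _ _ h3 h4 zero_le_one le_rfl (by rwa [abs_of_pos hp]),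
        hM.not_mem_cut _ _ _ h3 h4 zero_le_one le_rfl hp h2⟩
  -- `ρ g` converges to the value of the model
  have hρG : Tendsto (fun ρ : ℝ => (ρ : ℂ) * G (ξ ρ)) atTop (𝓝 (modelValue s σ a 1 1 y)) := by
    rw [tendsto_iff_norm_sub_tendsto_zero]
    have hlim : Tendsto (fun ρ : ℝ => C * (|(scale ρ y).1| + |(scale ρ y).2| + ρ⁻¹)
        * (|y.2| + a * y.1 ^ 2 + 1)) atTop (𝓝 0) := by
      have h1 : Tendsto (fun ρ => |(scale ρ y).1|) atTop (𝓝 0) := by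
        simpa using ((continuous_fst.tendsto _).comp hsc).abs
      have h2 : Tendsto (fun ρ => |(scale ρ y).2|) atTop (𝓝 0) := by
        simpa using ((continuous_snd.tendsto _).comp hsc).abs
      simpa using (((h1.add h2).add hinv).const_mul C).mul_const (|y.2| + a * y.1 ^ 2 + 1)
    refine squeeze_zero' (Eventually.of_forall fun _ => norm_nonneg _) ?_ hlim
    filter_upwards [hbase] with ρ ⟨h1, h2, h3, h4⟩
    have hp := inv_pos.mpr h1
    have h := hM.norm_sub_le _ _ h3 h4 hp h2
    rw [← modelValue_scale h1 y, ← mul_sub, norm_mul, Complex.norm_real, Real.norm_of_nonneg h1.le]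
    refine (mul_le_mul_of_nonneg_left h h1.le).trans (le_of_eq ?_)
    have hN : ρ * (|(scale ρ y).2| + a * (scale ρ y).1 ^ 2 + ρ⁻¹) = |y.2| + a * y.1 ^ 2 + 1 := by
      linear_combination a * scale_fst_sq h1 y + abs_scale_snd h1 y + mul_inv_cancel₀ h1.ne'
    rw [← hN]
    ring
  have hbp := (continuousAt_branchPow_modelValue (σ := σ) (a := a) hs μ hy).tendsto.comp hρG
  have hbp' : Tendsto (fun ρ : ℝ => (ρ : ℂ) ^ (-μ) * branchPow s (G (ξ ρ)) (-μ)) atTop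
      (𝓝 (branchPow s (modelValue s σ a 1 1 y) (-μ))) := by
    refine hbp.congr' ?_
    filter_upwards [eventually_gt_atTop 0] with ρ hρ
    exact branchPow_mul_ofReal hρ _ _
  have hrem : Tendsto (fun ρ : ℝ => (ρ : ℂ) ^ (-μ) * (Fs (ξ ρ) - A * branchPow s (G (ξ ρ)) (-μ))) atTop
      (𝓝 0) := by
    have h1 := hF2.comp_tendsto hξ0
    have h2 := (isBigO_refl (fun ρ : ℝ => (ρ : ℂ) ^ (-μ)) atTop).mul_isLittleO h1
    exact (isLittleO_one_iff ℝ).mp (h2.trans_isBigO (hbp'.isBigO_one ℝ))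
  have hFs : Tendsto (fun ρ : ℝ => (ρ : ℂ) ^ (-μ) * Fs (ξ ρ)) atTop
      (𝓝 (A * branchPow s (modelValue s σ a 1 1 y) (-μ))) := by
    have := (hbp'.const_mul A).add hrem
    rw [add_zero] at this
    refine this.congr fun ρ => ?_
    ring
  refine ((hFs.mul_const (Complex.exp (-(Complex.I * s * (cpt y (model s σ a 1 1 y)).2)))).mul_const
    ((1 - Complex.I * s * σ)
      * (1 - Complex.I * s * (1 / 4 : ℝ) * ((SignType.sign y.2 : ℝ) : ℂ)))).congr' ?_
  -- for large `ρ` the rescaled point lies where the height is `1 / ρ`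
  filter_upwards [hbase, hsmall e he] with ρ ⟨h1, h2, h3, h4⟩ h5
  have hdq : d (scale ρ y) < e := (hd0 _).trans_lt h5
  rw [innerIntegrand, indicator_of_mem (show scale ρ y ∈ {q | d q < 2 * e} by
    exact hdq.trans (by linarith))]
  have hloc : (fun q => model s σ a 1 (height d e k ρ q) q) =ᶠ[𝓝 (scale ρ y)] model s σ a 1 ρ⁻¹ := by
    filter_upwards [hd.continuous.continuousAt.eventually_lt_const hdq] with q hq
    rw [height, cutoff_eq_one (by linarith) hq.le]
    congr 1
    ring
  have hsurf : surf (fun q => model s σ a 1 (height d e k ρ q) q) (scale ρ y) = ξ ρ := by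
    exact congrArg (cpt (scale ρ y)) hloc.self_of_nhds
  have hjac : surfJac (fun q => model s σ a 1 (height d e k ρ q) q) (scale ρ y)
      = surfJac (model s σ a 1 ρ⁻¹) (scale ρ y) := by
    simp only [surfJac, hloc.fderiv_eq]
  have h2' : (scale ρ y).2 = ρ⁻¹ * y.2 := rfl
  have hne : (scale ρ y).2 ≠ 0 := by rw [h2']; exact mul_ne_zero (inv_ne_zero h1.ne') hy
  have hsign : SignType.sign (scale ρ y).2 = SignType.sign y.2 := by
    rw [h2', sign_mul, sign_pos (inv_pos.mpr h1), one_mul]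
  rw [hsurf, hjac, surfJac_model hne, hsign, ← cpt_model_scale h1 y, ← mul_assoc (_ * (s : ℂ))]
  ring

/-- The contribution of a neighbourhood of the saddle, after rescaling. -/
theorem tendsto_integral_innerIntegrand (hs : s = 1 ∨ s = -1) (hσ : σ = 1 ∨ σ = -1) (ha : 0 < a)
    (hM : ModelRegion G s σ a C δ) (hδ : 0 < δ)
    (hUm : ∀ (t : ℝ × ℝ) (l k : ℝ), |t.1| ≤ δ → |t.2| ≤ δ → 0 ≤ l → l ≤ 1 → |k| ≤ δ →
      cpt t (model s σ a l k t) ∈ U)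
    (he : 0 < e) (hk : 0 < k) (hkδ : k ≤ δ) (hd : LipschitzWith 1 d) (hd0 : ∀ q, d q ≤ ‖q‖)
    (hdδ : ∀ q, d q < 2 * e → |q.1| ≤ δ ∧ |q.2| ≤ δ)
    (hk2 : ∀ q, e ≤ d q → 2 * k ≤ a * q.1 ^ 2 + |q.2| / 4) {Fs : ℂ × ℂ → ℂ} {A μ : ℂ} {K : ℝ}
    (hF1 : ∀ (t : ℝ × ℝ) (l : ℝ), |t.1| ≤ δ → |t.2| ≤ δ → 0 < l → l ≤ δ →
      ‖Fs (cpt t (model s σ a 1 l t))‖ ≤ K * ‖branchPow s (G (cpt t (model s σ a 1 l t))) (-μ)‖)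
    (hF2 : (fun ξ => Fs ξ - A * branchPow s (G ξ) (-μ)) =o[𝓝[slitDomain G s U] 0]
      fun ξ => branchPow s (G ξ) (-μ))
    (hint : ∀ ρ : ℝ, 0 < ρ → ρ⁻¹ ≤ k → Integrable (innerIntegrand Fs s σ a e k d ρ)) :
    Tendsto (fun ρ : ℝ => (ρ : ℂ) ^ (-μ) * ((√ρ * ρ : ℝ) : ℂ)
        * ∫ q, innerIntegrand Fs s σ a e k d ρ q) atTop
      (𝓝 (A * (1 - Complex.I * s * σ) * (Real.sqrt (Real.pi / (2 * a)) : ℂ) * closedJ μ 1 s)) := by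
  obtain ⟨N, hN⟩ := exists_norm_innerIntegrand_le hs hσ ha hM he hk hkδ hd hdδ hk2 hF1
  have hbig : ∀ᶠ ρ : ℝ in atTop, 0 < ρ ∧ ρ⁻¹ ≤ k := by
    filter_upwards [eventually_gt_atTop 0, tendsto_inv_atTop_zero.eventually_le_const hk] with ρ h1 h2
    exact ⟨h1, h2⟩
  have hmeas : ∀ᶠ ρ : ℝ in atTop, AEStronglyMeasurable (fun y =>
      (ρ : ℂ) ^ (-μ) * innerIntegrand Fs s σ a e k d ρ (scale ρ y)) := by
    filter_upwards [hbig] with ρ ⟨h1, h2⟩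
    exact ((integrable_scale h1 (hint ρ h1 h2)).const_mul _).aestronglyMeasurable
  have hw := (integrable_weight |(-μ.re)| ha).const_mul N
  have hbound : ∀ᶠ ρ : ℝ in atTop, ∀ᵐ y, ‖(ρ : ℂ) ^ (-μ) * innerIntegrand Fs s σ a e k d ρ (scale ρ y)‖
      ≤ N * ((1 + y.1 ^ 2 + |y.2|) ^ |(-μ.re)| * Real.exp (-(a * y.1 ^ 2 + |y.2| / 4) / 2)) := by
    filter_upwards [hbig] with ρ ⟨h1, h2⟩
    exact Eventually.of_forall (hN ρ h1 h2)
  have hae : ∀ᵐ y : ℝ × ℝ, y.2 ≠ 0 := by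
    rw [Measure.volume_eq_prod]
    have h0 : ∀ᵐ x : ℝ, x ≠ 0 := by simp [ae_iff]
    exact Measure.quasiMeasurePreserving_snd.ae h0
  have hlim : ∀ᵐ y : ℝ × ℝ, Tendsto (fun ρ : ℝ => (ρ : ℂ) ^ (-μ)
      * innerIntegrand Fs s σ a e k d ρ (scale ρ y)) atTop (𝓝 (limitDensity s σ a A μ y)) := by
    filter_upwards [hae] with y hy
    exact tendsto_innerIntegrand hs hM hδ hUm he hd hd0 hF2 hy
  have hi : Integrable (limitDensity s σ a A μ) := by
    refine hw.mono' (aestronglyMeasurable_of_tendsto_ae atTop (f := fun (n : ℕ) y =>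
      if 0 < (n : ℝ) ∧ (n : ℝ)⁻¹ ≤ k then ((n : ℝ) : ℂ) ^ (-μ)
        * innerIntegrand Fs s σ a e k d n (scale n y) else 0) ?_ ?_) ?_
    · intro n
      by_cases hn : 0 < (n : ℝ) ∧ (n : ℝ)⁻¹ ≤ k
      · simp only [if_pos hn]
        exact ((integrable_scale hn.1 (hint n hn.1 hn.2)).const_mul _).aestronglyMeasurable
      · simp only [if_neg hn]
        exact aestronglyMeasurable_const
    · filter_upwards [hlim] with y hy
      refine (hy.comp tendsto_natCast_atTop_atTop).congr' ?_
      filter_upwards [tendsto_natCast_atTop_atTop.eventually hbig] with n hn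
      rw [if_pos hn]; rfl
    · filter_upwards [hlim] with y hy
      refine le_of_tendsto hy.norm ?_
      filter_upwards [hbig] with ρ ⟨h1, h2⟩ using hN ρ h1 h2 y
  rw [← integral_limitDensity hs ha A μ hi]
  refine (tendsto_integral_filter_of_dominated_convergence _ hmeas hbound hw hlim).congr' ?_
  filter_upwards [eventually_gt_atTop 0] with ρ hρ
  rw [integral_const_mul, integral_scale hρ, mul_assoc]

end Inner

/-! ### The contribution of the saddle -/

lemma tendsto_cpow_mul_of_exp_bound {u : ℝ → ℂ} {K c : ℝ} (hc : 0 < c) (μ : ℂ)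
    (hu : ∀ᶠ ρ in atTop, ‖u ρ‖ ≤ K * Real.exp (-(c * ρ))) :
    Tendsto (fun ρ : ℝ => (ρ : ℂ) ^ (-μ) * ((√ρ * ρ : ℝ) : ℂ) * u ρ) atTop (𝓝 0) := by
  have h1 := (tendsto_rpow_mul_exp_neg_mul_atTop_nhds_zero (3 / 2 - μ.re) c hc).const_mul K
  rw [mul_zero] at h1
  refine squeeze_zero_norm' ?_ h1
  filter_upwards [hu, eventually_gt_atTop 0] with ρ h2 h3
  rw [norm_mul, norm_mul, Complex.norm_cpow_eq_rpow_re_of_pos h3, Complex.neg_re, Complex.norm_real,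
    Real.norm_of_nonneg (by positivity)]
  have e : ρ ^ (-μ.re) * (√ρ * ρ) = ρ ^ (3 / 2 - μ.re) := by
    rw [Real.sqrt_eq_rpow]
    nth_rw 3 [← Real.rpow_one ρ]
    rw [← Real.rpow_add h3, ← Real.rpow_add h3]
    congr 1; ring
  rw [e]
  calc ρ ^ (3 / 2 - μ.re) * ‖u ρ‖ ≤ ρ ^ (3 / 2 - μ.re) * (K * Real.exp (-(c * ρ))) := by gcongr
    _ = _ := by ring_nf

/-- **The contribution of the saddle** in normal coordinates. After the deformation to the model
surface, the part of the integral away from the saddle and the regular part of the integrand are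
exponentially small, and the rest converges after rescaling. -/
theorem tendsto_integral_localSurface {G : ℂ × ℂ → ℂ} (hG : Differentiable ℂ G)
    (hreal : ∀ q, (G (toC q)).im = 0) {s σ a C δ : ℝ} (hs : s = 1 ∨ s = -1) (hσ : σ = 1 ∨ σ = -1)
    (ha : 0 < a) (hδ : 0 < δ) (hM : ModelRegion G s σ a C δ) {U : Set (ℂ × ℂ)} (hU : IsOpen U)
    (hUm : ∀ (t : ℝ × ℝ) (l k : ℝ), |t.1| ≤ δ → |t.2| ≤ δ → 0 ≤ l → l ≤ 1 → |k| ≤ δ →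
      cpt t (model s σ a l k t) ∈ U)
    {F Fs Fr : ℂ × ℂ → ℂ} (hF : ∀ ξ ∈ slitDomain G s U, F ξ = Fs ξ + Fr ξ)
    (hFs : DifferentiableOn ℂ Fs (slitDomain G s U)) (hFr : DifferentiableOn ℂ Fr U)
    {A μ : ℂ} {K : ℝ}
    (hF1 : ∀ (t : ℝ × ℝ) (l : ℝ), |t.1| ≤ δ → |t.2| ≤ δ → 0 < l → l ≤ δ →
      ‖Fs (cpt t (model s σ a 1 l t))‖ ≤ K * ‖branchPow s (G (cpt t (model s σ a 1 l t))) (-μ)‖)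
    (hF2 : (fun ξ => Fs ξ - A * branchPow s (G ξ) (-μ)) =o[𝓝[slitDomain G s U] 0]
      fun ξ => branchPow s (G ξ) (-μ))
    {B : Set (ℝ × ℝ)} (hB : IsCompact B) (hB0 : (0 : ℝ × ℝ) ∈ interior B)
    (hBδ : ∀ q ∈ B, |q.1| ≤ δ ∧ |q.2| ≤ δ) {η : ℝ × ℝ → ℝ × ℝ} (hη : LocallyLipschitz η)
    (hηΩ : ∀ ε : ℝ, 0 < ε → ε ≤ 1 → ∀ q ∈ B, surf (ε • η) q ∈ slitDomain G s U)
    (hη' : ∀ q ∈ B, G (toC q) = 0 → 0 < s * (fderiv ℂ G (toC q) (toC (η q))).re)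
    (hbd : ∀ q ∈ frontier B, s * (η q).2 < 0) :
    Tendsto (fun ρ : ℝ => (ρ : ℂ) ^ (-μ) * ((√ρ * ρ : ℝ) : ℂ)
      * ∫ q in B, F (surf η q) * Complex.exp (-(Complex.I * s * ρ * (surf η q).2)) * surfJac η q) atTop
      (𝓝 (A * (1 - Complex.I * s * σ) * (Real.sqrt (Real.pi / (2 * a)) : ℂ) * closedJ μ 1 s)) := by
  obtain ⟨ζ, e, k, d, he, hk, hkδ, hd, hd0, hdB, hζ, hζm, hζO, hζneg, hk2, hdef⟩ :=
    exists_deformation_to_model hG hreal hs ha hδ hM hU hUm hB hB0 hBδ hη hηΩ hη' hbd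
  set O := slitDomain G s U with hO
  have hOo : IsOpen O := isOpen_slitDomain hG.continuous s hU
  have hOU : O ⊆ U := fun ξ hξ => hξ.1
  have hdiff : ∀ (f : ℂ × ℂ → ℂ) (ρ : ℝ), DifferentiableOn ℂ f O →
      DifferentiableOn ℂ (fun ξ => f ξ * Complex.exp (-(Complex.I * s * ρ * ξ.2))) O := fun f ρ hf =>
    hf.mul (differentiable_exp_snd s ρ).differentiableOn
  have hηO : ∀ q ∈ B, surf η q ∈ O := fun q hq => by
    simpa using hηΩ 1 one_pos le_rfl q hq
  have hdδ : ∀ q, d q < 2 * e → |q.1| ≤ δ ∧ |q.2| ≤ δ := fun q hq =>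
    hBδ q (interior_subset (hdB q hq.le))
  set R : Set (ℝ × ℝ) := {q | d q < 2 * e} with hR
  have hRo : IsOpen R := isOpen_lt hd.continuous continuous_const
  have hRB : R ⊆ B := fun q hq => interior_subset (hdB q (le_of_lt hq))
  -- the surface adapted to `ρ`: near the saddle its height is lowered from `k` to `1 / ρ`
  set Z : ℝ → ℝ × ℝ → ℝ × ℝ := fun ρ => blend (cutoff d e (3 * e / 2)) ζ (model s σ a 1 ρ⁻¹) with hZ
  have hχL : LocallyLipschitz (cutoff d e (3 * e / 2)) := locallyLipschitz_cutoff hd _ _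
  have hZL : ∀ ρ, LocallyLipschitz (Z ρ) := fun ρ =>
    locallyLipschitz_blend hχL hζ (locallyLipschitz_model _ _ _ _ _)
  have hts : tsupport (cutoff d e (3 * e / 2)) ⊆ {q | d q ≤ 3 * e / 2} :=
    tsupport_cutoff_subset hd.continuous (by linarith)
  have hseg : ∀ ρ : ℝ, 0 < ρ → ρ⁻¹ ≤ k → ∀ q ∈ tsupport (cutoff d e (3 * e / 2)), ∀ τ ∈ Icc (0 : ℝ) 1,
      cpt q (ζ q + τ • (model s σ a 1 ρ⁻¹ q - ζ q)) ∈ O := by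
    intro ρ hρ hρk q hq τ hτ
    have h0 : d q ≤ 2 * e := by have h1 : d q ≤ 3 * e / 2 := hts hq; linarith
    rw [hζm q h0, model_segment]
    obtain ⟨b1, b2⟩ := hBδ q (interior_subset (hdB q h0))
    have hp := inv_pos.mpr hρ
    obtain ⟨t1, t2⟩ := hτ
    have k1 : k + τ * (ρ⁻¹ - k) ≤ k := by nlinarith
    have k2 : ρ⁻¹ ≤ k + τ * (ρ⁻¹ - k) := by nlinarith
    have h1 : (1 : ℝ) + τ * (1 - 1) = 1 := by ring
    rw [h1]
    exact ⟨hUm q _ _ b1 b2 zero_le_one le_rfl (by rw [abs_of_pos (by linarith)]; linarith),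
      hM.not_mem_cut q _ _ b1 b2 zero_le_one le_rfl (by linarith) (by linarith)⟩
  have hZO : ∀ ρ : ℝ, 0 < ρ → ρ⁻¹ ≤ k → ∀ q ∈ B, surf (Z ρ) q ∈ O := fun ρ hρ hρk q hq =>
    blend_mem (cutoff_nonneg d _ _) (cutoff_le_one d _ _) (hseg ρ hρ hρk) hζO hq
  set I : ℝ → (ℝ × ℝ → ℝ × ℝ) → (ℂ × ℂ → ℂ) → ℝ × ℝ → ℂ := fun ρ ζ f q =>
    f (surf ζ q) * Complex.exp (-(Complex.I * s * ρ * (surf ζ q).2)) * surfJac ζ q with hI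
  have hIint : ∀ (ρ : ℝ) (ζ : ℝ × ℝ → ℝ × ℝ) (f : ℂ × ℂ → ℂ), LocallyLipschitz ζ →
      (∀ q ∈ B, surf ζ q ∈ O) → DifferentiableOn ℂ f O → IntegrableOn (I ρ ζ f) B :=
    fun ρ ζ f h1 h2 h3 => integrableOn_surf (hdiff f ρ h3).continuousOn h1 hB h2
  have hZR : ∀ ρ, ∀ q ∈ R, I ρ (Z ρ) Fs q = I ρ (fun q => model s σ a 1 (height d e k ρ q) q) Fs q := by
    intro ρ q hq
    have hloc : Z ρ =ᶠ[𝓝 q] fun q => model s σ a 1 (height d e k ρ q) q := by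
      filter_upwards [hRo.mem_nhds hq] with x hx
      simp only [hZ, blend]
      rw [hζm x (le_of_lt hx), model_segment, height]
      congr 1; ring
    have h1 : surf (Z ρ) q = surf (fun q => model s σ a 1 (height d e k ρ q) q) q :=
      congrArg (cpt q) hloc.self_of_nhds
    have h2 : surfJac (Z ρ) q = surfJac (fun q => model s σ a 1 (height d e k ρ q) q) q := by
      simp only [surfJac, hloc.fderiv_eq]
    simp only [hI, h1, h2]
  have hZS : ∀ ρ, ∀ q, q ∉ R → I ρ (Z ρ) Fs q = I ρ ζ Fs q := by
    intro ρ q hq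
    have hq' : 2 * e ≤ d q := not_lt.mp hq
    have hloc : Z ρ =ᶠ[𝓝 q] ζ := by
      have : 3 * e / 2 < d q := by linarith
      filter_upwards [hd.continuous.continuousAt.eventually_const_lt this] with x hx
      simp only [hZ, blend]
      rw [cutoff_eq_zero (by linarith) hx.le]; simp
    have h1 : surf (Z ρ) q = surf ζ q := congrArg (cpt q) hloc.self_of_nhds
    have h2 : surfJac (Z ρ) q = surfJac ζ q := by simp only [surfJac, hloc.fderiv_eq]
    simp only [hI, h1, h2]
  have hinner : ∀ ρ, innerIntegrand Fs s σ a e k d ρ = R.indicator (I ρ (Z ρ) Fs) := by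
    intro ρ
    ext q
    by_cases hq : q ∈ R
    · rw [indicator_of_mem hq, innerIntegrand, indicator_of_mem hq, hZR ρ q hq]
    · rw [indicator_of_notMem hq, innerIntegrand, indicator_of_notMem hq]
  have hint : ∀ ρ : ℝ, 0 < ρ → ρ⁻¹ ≤ k → Integrable (innerIntegrand Fs s σ a e k d ρ) := by
    intro ρ hρ hρk
    rw [hinner, integrable_indicator_iff hRo.measurableSet]
    exact (hIint ρ _ Fs (hZL ρ) (hZO ρ hρ hρk) hFs).mono_set hRB
  have hmain := tendsto_integral_innerIntegrand hs hσ ha hM hδ hUm he hk hkδ hd hd0 hdδ hk2 hF1 hF2 hint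
  -- the exponentially small parts
  obtain ⟨K1, c1, hc1, hreg⟩ := exists_regular_bound hs ha hU hUm hB hBδ he hk hkδ hd hdB hζ hζm
    (fun q hq => hOU (hζO q hq)) hζneg hFr
  have hSc : IsCompact (B \ R) := hB.diff hRo
  obtain ⟨c2, hc2, hneg⟩ := hSc.exists_le_neg (φ := fun q => s * (ζ q).2)
    (continuous_const.mul (continuous_snd.comp hζ.continuous)) (fun q hq =>
      hζneg q hq.1 (by have : 2 * e ≤ d q := not_lt.mp hq.2; linarith))
  have hout : ∀ ρ : ℝ, 0 ≤ ρ → ‖∫ q in B \ R, I ρ ζ Fs q‖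
      ≤ (∫ q in B, ‖Fs (surf ζ q) * surfJac ζ q‖) * Real.exp (-(c2 * ρ)) := fun ρ hρ =>
    norm_setIntegral_exp_le hFs.continuousOn hζ hB hSc.measurableSet sdiff_subset hζO hρ hneg
  have t1 := tendsto_cpow_mul_of_exp_bound hc1 μ (u := fun ρ : ℝ => ∫ q in B, I ρ ζ Fr q)
    ((eventually_ge_atTop 0).mono hreg)
  have t2 := tendsto_cpow_mul_of_exp_bound hc2 μ (u := fun ρ : ℝ => ∫ q in B \ R, I ρ ζ Fs q)
    ((eventually_ge_atTop 0).mono hout)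
  have hsum := (hmain.add t1).add t2
  rw [add_zero, add_zero] at hsum
  refine hsum.congr' ?_
  filter_upwards [eventually_gt_atTop 0, tendsto_inv_atTop_zero.eventually_le_const hk] with ρ hρ hρk
  have s1 : ∫ q in B, F (surf η q) * Complex.exp (-(Complex.I * s * ρ * (surf η q).2)) * surfJac η q
      = (∫ q in B, I ρ η Fs q) + ∫ q in B, I ρ η Fr q := by
    rw [← integral_add (hIint ρ η Fs hη hηO hFs) (hIint ρ η Fr hη hηO (hFr.mono hOU))]
    refine setIntegral_congr_fun hB.measurableSet fun q hq => ?_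
    simp only [hI]
    rw [hF _ (hηO q hq)]; ring
  have s2 : ∫ q in B, I ρ η Fs q = ∫ q in B, I ρ ζ Fs q := hdef _ (hdiff Fs ρ hFs)
  have s3 : ∫ q in B, I ρ η Fr q = ∫ q in B, I ρ ζ Fr q := hdef _ (hdiff Fr ρ (hFr.mono hOU))
  have s4 : ∫ q in B, I ρ (Z ρ) Fs q = ∫ q in B, I ρ ζ Fs q :=
    setIntegral_blend hOo (hdiff Fs ρ hFs) hχL hζ (locallyLipschitz_model _ _ _ _ _)
      (cutoff_nonneg d _ _) (cutoff_le_one d _ _) hB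
      (fun q hq => interior_subset (hdB q (by have h1 : d q ≤ 3 * e / 2 := hts hq; linarith)))
      (hseg ρ hρ hρk) hζO
  have s5 : ∫ q in B, I ρ (Z ρ) Fs q = (∫ q, innerIntegrand Fs s σ a e k d ρ q)
      + ∫ q in B \ R, I ρ ζ Fs q := by
    have hi := hIint ρ _ Fs (hZL ρ) (hZO ρ hρ hρk) hFs
    rw [hinner, integral_indicator hRo.measurableSet]
    rw [← setIntegral_congr_fun (f := I ρ (Z ρ) Fs) hSc.measurableSet fun q hq => hZS ρ q hq.2]
    rw [← setIntegral_union disjoint_sdiff_right hSc.measurableSet (hi.mono_set hRB)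
      (hi.mono_set sdiff_subset), union_sdiff_self, union_eq_self_of_subset_left hRB]
  rw [s1, s2, s3, ← s4, s5]
  ring

/-! ### Normal coordinates -/

/-- The linear part `v ↦ (b v₁ - a v₂, a v₁ + b v₂)` of the change to normal coordinates. -/
def rot (a b : ℝ) (v : ℝ × ℝ) : ℝ × ℝ := (b * v.1 - a * v.2, a * v.1 + b * v.2)

/-- The inverse of `rot a b`. -/
def unrot (a b : ℝ) (v : ℝ × ℝ) : ℝ × ℝ :=
  ((b * v.1 + a * v.2) / (a ^ 2 + b ^ 2), (b * v.2 - a * v.1) / (a ^ 2 + b ^ 2))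

/-- The complexification of `unrot a b`. -/
def unrotC (a b : ℝ) : ℂ × ℂ →L[ℂ] ℂ × ℂ :=
  (((b / (a ^ 2 + b ^ 2) : ℝ) : ℂ) • ContinuousLinearMap.fst ℂ ℂ ℂ
    + ((a / (a ^ 2 + b ^ 2) : ℝ) : ℂ) • ContinuousLinearMap.snd ℂ ℂ ℂ).prod
  (((b / (a ^ 2 + b ^ 2) : ℝ) : ℂ) • ContinuousLinearMap.snd ℂ ℂ ℂ
    - ((a / (a ^ 2 + b ^ 2) : ℝ) : ℂ) • ContinuousLinearMap.fst ℂ ℂ ℂ)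

/-- The passage from the normal coordinates `(ζ₁, Λ)` at `p` to `(ξ₁, ξ₂)`. -/
def fromNormal (a b : ℝ) (p : ℝ × ℝ) (ξ : ℂ × ℂ) : ℂ × ℂ := toC p + unrotC a b ξ

lemma rot_unrot {a b : ℝ} (hD : 0 < a ^ 2 + b ^ 2) (v : ℝ × ℝ) : rot a b (unrot a b v) = v := by
  ext <;> simp only [rot, unrot] <;> field_simp <;> ring

lemma unrot_rot {a b : ℝ} (hD : 0 < a ^ 2 + b ^ 2) (v : ℝ × ℝ) : unrot a b (rot a b v) = v := by
  ext <;> simp only [rot, unrot] <;> field_simp <;> ring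

lemma unrotC_apply (a b : ℝ) (v : ℂ × ℂ) : unrotC a b v =
    (((b / (a ^ 2 + b ^ 2) : ℝ) : ℂ) * v.1 + ((a / (a ^ 2 + b ^ 2) : ℝ) : ℂ) * v.2,
      ((b / (a ^ 2 + b ^ 2) : ℝ) : ℂ) * v.2 - ((a / (a ^ 2 + b ^ 2) : ℝ) : ℂ) * v.1) := by
  simp [unrotC]

lemma unrotC_toC (a b : ℝ) (v : ℝ × ℝ) : unrotC a b (toC v) = toC (unrot a b v) := by
  rw [unrotC_apply]
  simp only [toC, unrot]
  push_cast
  ext <;> simp only <;> ring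

lemma fromNormal_cpt (a b : ℝ) (p t v : ℝ × ℝ) :
    fromNormal a b p (cpt t v) = cpt (p + unrot a b t) (unrot a b v) := by
  rw [fromNormal, unrotC_apply]
  simp only [toC, unrot, cpt, Prod.mk_add_mk, Prod.fst_add, Prod.snd_add]
  push_cast
  ext <;> simp only <;> ring

lemma fromNormal_toC (a b : ℝ) (p t : ℝ × ℝ) :
    fromNormal a b p (toC t) = toC (p + unrot a b t) := by
  rw [← cpt_zero, fromNormal_cpt]
  have : unrot a b 0 = 0 := by simp [unrot]
  rw [this, cpt_zero]

lemma fromNormal_zero (a b : ℝ) (p : ℝ × ℝ) : fromNormal a b p 0 = toC p := by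
  simp [fromNormal]

lemma differentiable_fromNormal (a b : ℝ) (p : ℝ × ℝ) : Differentiable ℂ (fromNormal a b p) := by
  unfold fromNormal; fun_prop

lemma fderiv_comp_fromNormal {g : ℂ × ℂ → ℂ} (hg : Differentiable ℂ g) (a b : ℝ) (p : ℝ × ℝ)
    (ξ v : ℂ × ℂ) : fderiv ℂ (fun ξ => g (fromNormal a b p ξ)) ξ v
      = fderiv ℂ g (fromNormal a b p ξ) (unrotC a b v) := by
  have h1 : HasFDerivAt (fromNormal a b p) (unrotC a b) ξ := (unrotC a b).hasFDerivAt.const_add _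
  have h2 := ((hg (fromNormal a b p ξ)).hasFDerivAt.comp ξ h1).fderiv
  simp only [Function.comp_def] at h2
  rw [h2]; rfl

/-- The derivatives at real points of a function that is real on the real plane are real. -/
lemma fderiv_toC_im {g : ℂ × ℂ → ℂ} (hg : Differentiable ℂ g) (hr : ∀ q, (g (toC q)).im = 0)
    (q v : ℝ × ℝ) : (fderiv ℂ g (toC q) (toC v)).im = 0 := by
  have hline : HasDerivAt (fun ε : ℝ => toC (q + ε • v)) (toC v) 0 := by
    have e : (fun ε : ℝ => toC (q + ε • v)) = fun ε : ℝ => toC q + (ε : ℂ) • toC v := by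
      ext1 ε; simp [toC]
    rw [e]
    simpa using ((Complex.ofRealCLM.hasDerivAt (x := 0)).smul_const (toC v)).const_add (toC q)
  have h0 : toC (q + (0 : ℝ) • v) = toC q := by simp
  have h1 : HasFDerivAt g ((fderiv ℂ g (toC q)).restrictScalars ℝ) (toC (q + (0 : ℝ) • v)) := by
    rw [h0]; exact (hg (toC q)).hasFDerivAt.restrictScalars ℝ
  have h2 := Complex.imCLM.hasFDerivAt.comp_hasDerivAt (0 : ℝ) (h1.comp_hasDerivAt (0 : ℝ) hline)
  have h3 : (⇑Complex.imCLM ∘ (g ∘ fun ε : ℝ => toC (q + ε • v))) = fun _ => (0 : ℝ) := by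
    ext1 ε; exact hr _
  rw [h3] at h2
  exact h2.unique (hasDerivAt_const _ _)

lemma fderiv_toC_eq {g : ℂ × ℂ → ℂ} (hg : Differentiable ℂ g) (hr : ∀ q, (g (toC q)).im = 0)
    (q v : ℝ × ℝ) : fderiv ℂ g (toC q) (toC v) = ((dotR (realGrad g q) v : ℝ) : ℂ) := by
  apply Complex.ext
  · rw [fderiv_prod_apply]
    simp [toC, dotR, realGrad, mul_comm]
  · rw [fderiv_toC_im hg hr, Complex.ofReal_im]

lemma fderiv_basis_eq {g : ℂ × ℂ → ℂ} (hg : Differentiable ℂ g) (hr : ∀ q, (g (toC q)).im = 0)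
    (q : ℝ × ℝ) : fderiv ℂ g (toC q) (1, 0) = ((realGrad g q).1 : ℂ) ∧
      fderiv ℂ g (toC q) (0, 1) = ((realGrad g q).2 : ℂ) := by
  have h1 := fderiv_toC_eq hg hr q (1, 0)
  have h2 := fderiv_toC_eq hg hr q (0, 1)
  simp only [toC, dotR, Complex.ofReal_one, Complex.ofReal_zero, mul_one, mul_zero, add_zero,
    zero_add] at h1 h2
  exact ⟨h1, h2⟩

lemma gradSq_pos {g : ℂ × ℂ → ℂ} (hg : HasRealProperty g) {p : ℝ × ℝ} (hp : g (toC p) = 0) :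
    0 < gradSq g p := by
  obtain ⟨h1, h2⟩ := fderiv_basis_eq hg.entire hg.real p
  by_contra hcon
  have h3 : (realGrad g p).1 = 0 ∧ (realGrad g p).2 = 0 := by
    unfold gradSq at hcon
    constructor <;> nlinarith [sq_nonneg (realGrad g p).1, sq_nonneg (realGrad g p).2]
  refine hg.regular _ hp (ContinuousLinearMap.ext fun v => ?_)
  rw [fderiv_prod_apply, h1, h2, h3.1, h3.2]
  simp

/-- The Jacobian is invariant under a real affine change of coordinates, applied to the base points
and to the field. -/
lemma surfJac_rot {a b : ℝ} (hD : 0 < a ^ 2 + b ^ 2) (p : ℝ × ℝ) {η : ℝ × ℝ → ℝ × ℝ} {t : ℝ × ℝ}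
    (hη : DifferentiableAt ℝ (fun t => rot a b (η (p + unrot a b t))) t) :
    surfJac η (p + unrot a b t) = surfJac (fun t => rot a b (η (p + unrot a b t))) t := by
  set θ := fun t => rot a b (η (p + unrot a b t)) with hθ
  have e : η = fun q => unrot a b (θ (rot a b (q - p))) := by
    ext1 q
    rw [hθ]
    simp only [unrot_rot hD]
    congr 1; abel
  -- the linear maps
  set R : ℝ × ℝ →L[ℝ] ℝ × ℝ := (b • ContinuousLinearMap.fst ℝ ℝ ℝ - a • ContinuousLinearMap.snd ℝ ℝ ℝ).prod
    (a • ContinuousLinearMap.fst ℝ ℝ ℝ + b • ContinuousLinearMap.snd ℝ ℝ ℝ)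
  have hR : ∀ v, R v = rot a b v := fun v => by simp [R, rot]
  set S : ℝ × ℝ →L[ℝ] ℝ × ℝ :=
    ((b / (a ^ 2 + b ^ 2)) • ContinuousLinearMap.fst ℝ ℝ ℝ
      + (a / (a ^ 2 + b ^ 2)) • ContinuousLinearMap.snd ℝ ℝ ℝ).prod
    ((b / (a ^ 2 + b ^ 2)) • ContinuousLinearMap.snd ℝ ℝ ℝ
      - (a / (a ^ 2 + b ^ 2)) • ContinuousLinearMap.fst ℝ ℝ ℝ)
  have hS : ∀ v, S v = unrot a b v := fun v => by
    ext <;> simp [S, unrot] <;> ring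
  have hin : HasFDerivAt (fun q => rot a b (q - p)) R (p + unrot a b t) := by
    have : (fun q => rot a b (q - p)) = fun q => R (q - p) := by ext1 q; rw [hR]
    rw [this]
    exact R.hasFDerivAt.comp (p + unrot a b t) ((hasFDerivAt_id _).sub_const p)
  have hpt : rot a b (p + unrot a b t - p) = t := by rw [add_sub_cancel_left, rot_unrot hD]
  have hθ' : HasFDerivAt θ (fderiv ℝ θ t) (rot a b (p + unrot a b t - p)) := by
    rw [hpt]; exact hη.hasFDerivAt
  have hout : HasFDerivAt (fun q => unrot a b (θ (rot a b (q - p))))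
      (S.comp ((fderiv ℝ θ t).comp R)) (p + unrot a b t) := by
    have : (fun q => unrot a b (θ (rot a b (q - p)))) = fun q => S (θ (rot a b (q - p))) := by
      ext1 q; rw [hS]
    rw [this]
    exact S.hasFDerivAt.comp (p + unrot a b t)
      (HasFDerivAt.comp (g := θ) (f := fun q => rot a b (q - p)) _ hθ' hin)
  have hf : ∀ v, fderiv ℝ η (p + unrot a b t) v = unrot a b (fderiv ℝ θ t (rot a b v)) := by
    intro v
    rw [e, hout.fderiv]
    simp only [ContinuousLinearMap.comp_apply, hS, hR]
  have hlin : ∀ v : ℝ × ℝ, fderiv ℝ θ t v = v.1 • fderiv ℝ θ t (1, 0) + v.2 • fderiv ℝ θ t (0, 1) := by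
    intro v
    rw [← map_smul, ← map_smul, ← map_add]
    congr 1
    ext <;> simp
  have hDC : ((a : ℂ) ^ 2 + (b : ℂ) ^ 2) ≠ 0 := by exact_mod_cast hD.ne'
  unfold surfJac
  rw [hf, hf, hlin (rot a b (1, 0)), hlin (rot a b (0, 1))]
  simp only [rot, unrot, Prod.fst_add, Prod.snd_add, Prod.smul_fst, Prod.smul_snd, smul_eq_mul]
  push_cast
  field_simp
  ring

lemma setIntegral_unrot {a b : ℝ} (hD : 0 < a ^ 2 + b ^ 2) (p : ℝ × ℝ) {B : Set (ℝ × ℝ)}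
    (hB : MeasurableSet B) (h : ℝ × ℝ → ℂ) :
    ∫ q in B, h q = (((a ^ 2 + b ^ 2 : ℝ) : ℂ))⁻¹
      * ∫ t in (fun t => p + unrot a b t) ⁻¹' B, h (p + unrot a b t) := by
  have hm : Measurable fun t : ℝ × ℝ => p + unrot a b t := by unfold unrot; fun_prop
  rw [← integral_indicator hB, ← integral_indicator (hm hB)]
  set D := a ^ 2 + b ^ 2 with hDdef
  have hdet : b / D * (b / D) - a / D * (-(a / D)) = D⁻¹ := by
    field_simp; rw [hDdef]; ring
  have h1 := integral_comp_linear (a := b / D) (b := a / D) (c := -(a / D)) (d := b / D)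
    (by rw [hdet]; positivity) (fun q => B.indicator h (p + q))
  rw [hdet, abs_of_pos (by positivity), inv_inv, integral_add_left_eq_self (fun q => B.indicator h q)] at h1
  have e : (fun t => ((fun t => p + unrot a b t) ⁻¹' B).indicator (fun t => h (p + unrot a b t)) t)
      = fun y : ℝ × ℝ => B.indicator h (p + (b / D * y.1 + a / D * y.2, -(a / D) * y.1 + b / D * y.2)) := by
    ext1 t
    have : unrot a b t = (b / D * t.1 + a / D * t.2, -(a / D) * t.1 + b / D * t.2) := by
      simp only [unrot, ← hDdef]; ext <;> simp only <;> ring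
    rw [← this]
    rfl
  rw [e, h1, ← mul_assoc, inv_mul_cancel₀ (by exact_mod_cast hD.ne'), one_mul]

/-! ### The defining function and the observation direction in normal coordinates -/

/-- A defining function in the normal coordinates at `p`. -/
def normalFn (g : ℂ × ℂ → ℂ) (p : ℝ × ℝ) (ξ : ℂ × ℂ) : ℂ :=
  g (fromNormal (realGrad g p).1 (realGrad g p).2 p ξ)

lemma differentiable_normalFn {g : ℂ × ℂ → ℂ} (hg : Differentiable ℂ g) (p : ℝ × ℝ) :
    Differentiable ℂ (normalFn g p) :=
  hg.comp (differentiable_fromNormal _ _ _)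

lemma normalFn_toC_im {g : ℂ × ℂ → ℂ} (hg : HasRealProperty g) (p q : ℝ × ℝ) :
    (normalFn g p (toC q)).im = 0 := by
  rw [normalFn, fromNormal_toC]; exact hg.real _

lemma isBigO_normalFn {g : ℂ × ℂ → ℂ} {p : ℝ × ℝ} (hD : 0 < gradSq g p) {α : ℝ}
    (hα : IsCurvatureCoeff g p α) :
    (fun ξ : ℂ × ℂ => normalFn g p ξ - (ξ.2 - (α : ℂ) * ξ.1 ^ 2)) =O[𝓝 0]
      (fun ξ : ℂ × ℂ => ‖normalFn g p ξ‖ ^ 2 + ‖ξ.1‖ * ‖normalFn g p ξ‖ + ‖ξ‖ ^ 3) := by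
  set a := (realGrad g p).1 with ha
  set b := (realGrad g p).2 with hb
  have hDC : ((a : ℂ) ^ 2 + (b : ℂ) ^ 2) ≠ 0 := by exact_mod_cast hD.ne'
  have htend : Tendsto (fromNormal a b p) (𝓝 0) (𝓝 (toC p)) := by
    have := (differentiable_fromNormal a b p).continuous.tendsto 0
    rwa [fromNormal_zero] at this
  have h1 := hα.comp_tendsto htend
  have hl : ∀ ξ, linPart g p (fromNormal a b p ξ) = ξ.2 := fun ξ => by
    simp only [linPart, fromNormal, unrotC_apply, toC, Prod.fst_add, Prod.snd_add, ← ha, ← hb]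
    push_cast
    field_simp
    ring
  have hz : ∀ ξ, zetaOne g p (fromNormal a b p ξ) = ξ.1 := fun ξ => by
    simp only [zetaOne, fromNormal, unrotC_apply, toC, Prod.fst_add, Prod.snd_add, ← ha, ← hb]
    push_cast
    field_simp
    ring
  have hn : ∀ ξ, fromNormal a b p ξ - toC p = unrotC a b ξ := fun ξ => by
    simp [fromNormal]
  simp only [Function.comp_def, hl, hz, hn] at h1
  refine h1.trans (IsBigO.of_bound (1 + ‖unrotC a b‖ ^ 3) (Eventually.of_forall fun ξ => ?_))
  rw [Real.norm_of_nonneg (by positivity), Real.norm_of_nonneg (by positivity)]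
  have h2 : ‖unrotC a b ξ‖ ^ 3 ≤ ‖unrotC a b‖ ^ 3 * ‖ξ‖ ^ 3 := by
    rw [← mul_pow]
    exact pow_le_pow_left₀ (norm_nonneg _) ((unrotC a b).le_opNorm ξ) 3
  have h3 : 0 ≤ ‖normalFn g p ξ‖ ^ 2 + ‖ξ.1‖ * ‖normalFn g p ξ‖ := by positivity
  have h4 : 0 ≤ ‖unrotC a b‖ ^ 3 := by positivity
  have h5 : 0 ≤ ‖ξ‖ ^ 3 := by positivity
  change ‖normalFn g p ξ‖ ^ 2 + ‖ξ.1‖ * ‖normalFn g p ξ‖ + ‖unrotC a b ξ‖ ^ 3 ≤ _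
  nlinarith

lemma fderiv_normalFn {g : ℂ × ℂ → ℂ} (hg : HasRealProperty g) (p t v : ℝ × ℝ) :
    fderiv ℂ (normalFn g p) (toC t) (toC v)
      = ((dotR (realGrad g (p + unrot (realGrad g p).1 (realGrad g p).2 t))
        (unrot (realGrad g p).1 (realGrad g p).2 v) : ℝ) : ℂ) := by
  have h := fderiv_comp_fromNormal hg.entire (realGrad g p).1 (realGrad g p).2 p (toC t) (toC v)
  rw [fromNormal_toC, unrotC_toC, fderiv_toC_eq hg.entire hg.real] at h
  exact h

lemma ModelRegion.mono {G : ℂ × ℂ → ℂ} {s σ a C δ δ' : ℝ} (h : ModelRegion G s σ a C δ)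
    (hδ : δ' ≤ δ) : ModelRegion G s σ a C δ' where
  deriv_pos t l k h1 h2 h3 h4 h5 h6 :=
    h.deriv_pos t l k (h1.trans hδ) (h2.trans hδ) h3 h4 h5 (h6.trans hδ)
  not_mem_cut t l k h1 h2 h3 h4 h5 h6 :=
    h.not_mem_cut t l k (h1.trans hδ) (h2.trans hδ) h3 h4 h5 (h6.trans hδ)
  norm_sub_le t k h1 h2 h3 h4 := h.norm_sub_le t k (h1.trans hδ) (h2.trans hδ) h3 (h4.trans hδ)
  le_norm t k h1 h2 h3 h4 := h.le_norm t k (h1.trans hδ) (h2.trans hδ) h3 (h4.trans hδ)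
  norm_le t k h1 h2 h3 h4 := h.norm_le t k (h1.trans hδ) (h2.trans hδ) h3 (h4.trans hδ)
  trace t h1 h2 := h.trace t (h1.trans hδ) (h2.trans hδ)

/-- The model region of a defining function in normal coordinates at a point of non-zero curvature. -/
lemma exists_modelRegion_normalFn {g : ℂ × ℂ → ℂ} (hg : HasRealProperty g) {p : ℝ × ℝ}
    (hp : g (toC p) = 0) {σ a : ℝ} (hα : IsCurvatureCoeff g p (σ * a)) (ha : 0 < a)
    (hσ : σ = 1 ∨ σ = -1) {s : ℝ} (hs : s = 1 ∨ s = -1) :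
    ∃ C δ : ℝ, 0 < C ∧ 0 < δ ∧ ModelRegion (normalFn g p) s σ a C δ := by
  have hD := gradSq_pos hg hp
  have hd := differentiable_normalFn hg.entire p
  have hD' : (realGrad g p).1 ^ 2 + (realGrad g p).2 ^ 2 ≠ 0 := hD.ne'
  have h0 : toC (0 : ℝ × ℝ) = 0 := by simp [toC]
  have hun : unrot (realGrad g p).1 (realGrad g p).2 0 = 0 := by simp [unrot]
  have key := fderiv_normalFn hg p 0
  rw [h0, hun, add_zero] at key
  have hz0 : fderiv ℂ (normalFn g p) 0 (1, 0) = 0 := by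
    have h := key (1, 0)
    have e : toC (1, 0) = (1, 0) := by simp [toC]
    rw [e] at h
    rw [h]
    simp only [dotR, unrot]
    norm_cast
    field_simp
    ring
  have hw0 : fderiv ℂ (normalFn g p) 0 (0, 1) = 1 := by
    have h := key (0, 1)
    have e : toC (0, 1) = (0, 1) := by simp [toC]
    rw [e] at h
    rw [h]
    simp only [dotR, unrot]
    norm_cast
    field_simp
    ring
  obtain ⟨C, δ, hC, hδ, hn⟩ := exists_normalFormBound hd
    (by rw [normalFn, fromNormal_zero, hp]) hz0 hw0 (isBigO_normalFn hD hα)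
  exact exists_modelRegion hd (normalFn_toC_im hg p) hC hδ hn ha hσ hs

/-- The model surfaces over small squares are close to the saddle. -/
lemma exists_forall_model_mem {N : Set (ℂ × ℂ)} (hN : N ∈ 𝓝 0) {s σ a : ℝ} (hs : |s| = 1)
    (hσ : |σ| = 1) (ha : 0 < a) :
    ∃ δ₀ : ℝ, 0 < δ₀ ∧ ∀ (t : ℝ × ℝ) (l k : ℝ), |t.1| ≤ δ₀ → |t.2| ≤ δ₀ → 0 ≤ l → l ≤ 1 → |k| ≤ δ₀ →
      cpt t (model s σ a l k t) ∈ N := by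
  obtain ⟨r, hr, hball⟩ := Metric.mem_nhds_iff.mp hN
  refine ⟨min 1 (r / (2 * (4 + a))), by positivity, fun t l k h1 h2 hl hl1 hk => hball ?_⟩
  set d := min 1 (r / (2 * (4 + a)))
  have hd1 : d ≤ 1 := min_le_left _ _
  have hd0 : 0 < d := by positivity
  have hdr : d * (2 * (4 + a)) ≤ r := by
    have : d ≤ r / (2 * (4 + a)) := min_le_right _ _
    rwa [le_div_iff₀ (by positivity)] at this
  have a1 := abs_nonneg t.1
  have hsq : t.1 ^ 2 ≤ d := by rw [← sq_abs]; nlinarith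
  have had : a * t.1 ^ 2 ≤ a * d := by gcongr
  rw [mem_ball_zero_iff, Prod.norm_def, max_lt_iff]
  have h1m : (1 : ℝ) ∈ Icc (0 : ℝ) 1 := ⟨zero_le_one, le_rfl⟩
  constructor
  · have := norm_fst_cpt_model_le (k := k) (a := a) hs hσ hl hl1 t h1m
    rw [one_smul] at this
    nlinarith [mul_pos ha hd0]
  · refine (norm_ofReal_add_I_mul_le _ _).trans_lt ?_
    have h3 : |(model s σ a l k t).2| ≤ |k| + (a * t.1 ^ 2 + |t.2| / 4) := by
      simp only [model, abs_mul, hs, one_mul]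
      refine (abs_sub _ _).trans ?_
      have h0 : 0 ≤ a * t.1 ^ 2 + |t.2| / 4 := by positivity
      rw [abs_mul, abs_of_nonneg hl, abs_of_nonneg h0]
      have := mul_le_of_le_one_left h0 hl1
      linarith
    nlinarith [mul_pos ha hd0]

/-- At an SOS, the observation direction is a multiple of the normal. -/
lemma IsSOS.parallel {g : ℂ × ℂ → ℂ} (hg : HasRealProperty g) {x p : ℝ × ℝ} (h : IsSOS g x p) :
    (realGrad g p).1 * x.2 = (realGrad g p).2 * x.1 := by
  obtain ⟨φ, z, hφ, hz, hφ', hev, hder⟩ := h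
  have hd := hφ.differentiableAt.hasDerivAt
  obtain ⟨g1, g2⟩ := fderiv_basis_eq hg.entire hg.real p
  have e1 : ((realGrad g p).1 : ℂ) * (deriv φ z).1 + (realGrad g p).2 * (deriv φ z).2 = 0 := by
    have h1 : HasDerivAt (fun w => g (φ w)) (fderiv ℂ g (φ z) (deriv φ z)) z :=
      (hg.entire (φ z)).hasFDerivAt.comp_hasDerivAt z hd
    have h2 : (fun w => g (φ w)) =ᶠ[𝓝 z] fun _ => 0 := hev
    have h3 := h1.unique ((hasDerivAt_const z (0 : ℂ)).congr_of_eventuallyEq h2)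
    rw [hz, fderiv_prod_apply, g1, g2] at h3
    rw [← h3]; ring
  have e2 : (x.1 : ℂ) * (deriv φ z).1 + x.2 * (deriv φ z).2 = 0 := by
    have h0 := hder 1 one_pos
    have k1 : HasDerivAt (fun w => (φ w).1) (deriv φ z).1 z :=
      (ContinuousLinearMap.fst ℂ ℂ ℂ).hasFDerivAt.comp_hasDerivAt z hd
    have k2 : HasDerivAt (fun w => (φ w).2) (deriv φ z).2 z :=
      (ContinuousLinearMap.snd ℂ ℂ ℂ).hasFDerivAt.comp_hasDerivAt z hd
    have k3 := ((((k1.const_mul (x.1 : ℂ)).add (k2.const_mul (x.2 : ℂ))).const_mul Complex.I).fun_neg).cexp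
    have e : (fun w => Complex.exp (-(Complex.I * dotC ((1 : ℝ) • x) (φ w))))
        = fun w => Complex.exp (-(Complex.I * ((x.1 : ℂ) * (φ w).1 + (x.2 : ℂ) * (φ w).2))) := by
      ext1 w; simp [dotC]
    rw [e] at h0
    have k4 := k3.deriv
    simp only [Pi.add_apply] at k4
    rw [h0] at k4
    rcases mul_eq_zero.mp k4.symm with h | h
    · exact absurd h (Complex.exp_ne_zero _)
    · simpa using h
  have e3 : ((realGrad g p).1 : ℂ) * x.2 = (realGrad g p).2 * x.1 := by
    by_contra hne
    have hne' : ((realGrad g p).1 : ℂ) * x.2 - (realGrad g p).2 * x.1 ≠ 0 := sub_ne_zero.mpr hne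
    apply hφ'
    ext
    · refine (mul_eq_zero.mp (?_ : (((realGrad g p).1 : ℂ) * x.2 - (realGrad g p).2 * x.1)
        * (deriv φ z).1 = 0)).resolve_left hne'
      linear_combination (x.2 : ℂ) * e1 - ((realGrad g p).2 : ℂ) * e2
    · refine (mul_eq_zero.mp (?_ : (((realGrad g p).1 : ℂ) * x.2 - (realGrad g p).2 * x.1)
        * (deriv φ z).2 = 0)).resolve_left hne'
      linear_combination (-(x.1 : ℂ)) * e1 + ((realGrad g p).1 : ℂ) * e2
  exact_mod_cast e3

/-- At an active point the field does not point into the half-plane of decay: otherwise the constant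
deformation would show that the point is inactive. -/
lemma IsActive.dotR_nonneg {ι : Type*} {g : ι → ℂ × ℂ → ℂ} {η : ℝ × ℝ → ℝ × ℝ} {x p : ℝ × ℝ}
    (hη : IsAdmissible g univ η) (h : IsActive g η x p) : 0 ≤ dotR x (η p) := by
  by_contra hcon
  refine h ⟨univ, univ_mem, fun _ => η, ?_, fun _ _ => rfl, fun _ _ => hη, not_le.mp hcon⟩
  exact (hη.lipschitz.continuous.comp continuous_snd).continuousOn

lemma bridgeSign_eq {g : ℂ × ℂ → ℂ} {η : ℝ × ℝ → ℝ × ℝ} {p : ℝ × ℝ}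
    (h : dotR (realGrad g p) (η p) ≠ 0) : bridgeSign g η p = 1 ∨ bridgeSign g η p = -1 := by
  unfold bridgeSign
  rcases lt_or_gt_of_ne h with h | h
  · right; exact Real.sign_of_neg h
  · left; exact Real.sign_of_pos h

/-- The observation direction is the normal on the side from which the surface passes. -/
lemma eq_bridgeSign_smul_unitNormal {ι : Type*} {g : ι → ℂ × ℂ → ℂ} (hg : ∀ k, HasRealProperty (g k))
    {η : ℝ × ℝ → ℝ × ℝ} (hη : IsAdmissible g univ η) {x : ℝ × ℝ} (hx : x.1 ^ 2 + x.2 ^ 2 = 1) {j : ι}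
    {p : ℝ × ℝ} (hp : g j (toC p) = 0) (hsos : IsSOS (g j) x p) (hact : IsActive g η x p) :
    x = bridgeSign (g j) η p • unitNormal (g j) p := by
  have hD := gradSq_pos (hg j) hp
  have hpar := hsos.parallel (hg j)
  have h0 := hact.dotR_nonneg hη
  have hne := hη.nontangent j p (mem_univ _) hp
  set a := (realGrad (g j) p).1 with ha
  set b := (realGrad (g j) p).2 with hb
  set D := gradSq (g j) p with hDd
  have hDe : D = a ^ 2 + b ^ 2 := rfl
  have hq : 0 < √D := Real.sqrt_pos.mpr hD
  have hqq : √D ^ 2 = D := Real.sq_sqrt hD.le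
  set τ := (a * x.1 + b * x.2) / √D with hτ
  have hτ2 : τ ^ 2 = 1 := by
    rw [hτ, div_pow, hqq, div_eq_one_iff_eq hD.ne', hDe]
    linear_combination (a ^ 2 + b ^ 2) * hx - (a * x.2 - b * x.1) * hpar
  have hx1 : x.1 = τ * ((√D)⁻¹ * a) := by
    rw [hτ]; field_simp; rw [hqq, hDe]; linear_combination (-b) * hpar
  have hx2 : x.2 = τ * ((√D)⁻¹ * b) := by
    rw [hτ]; field_simp; rw [hqq, hDe]; linear_combination a * hpar
  have hτs : τ = bridgeSign (g j) η p := by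
    have e : dotR x (η p) = τ * ((√D)⁻¹ * dotR (realGrad (g j) p) (η p)) := by
      simp only [dotR]; rw [hx1, hx2]; ring
    rw [e] at h0
    have hi : 0 < (√D)⁻¹ := inv_pos.mpr hq
    have hτ1 : τ = 1 ∨ τ = -1 := sq_eq_one_iff.mp hτ2
    unfold bridgeSign
    rcases lt_or_gt_of_ne hne with h | h
    · rw [Real.sign_of_neg h]
      rcases hτ1 with h1 | h1
      · rw [h1, one_mul] at h0
        have := mul_neg_of_pos_of_neg hi h
        linarith
      · exact h1
    · rw [Real.sign_of_pos h]
      rcases hτ1 with h1 | h1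
      · exact h1
      · rw [h1] at h0
        have := mul_pos hi h
        linarith
  rw [← hτs]
  ext
  · simpa [unitNormal] using hx1
  · simpa [unitNormal] using hx2

/-! ### The local integral in normal coordinates -/

lemma continuous_rot (a b : ℝ) : Continuous (rot a b) := by unfold rot; fun_prop

lemma continuous_unrot (a b : ℝ) : Continuous (unrot a b) := by unfold unrot; fun_prop

lemma unrot_smul (a b ε : ℝ) (v : ℝ × ℝ) : unrot a b (ε • v) = ε • unrot a b v := by
  ext <;> simp [unrot] <;> ring

/-- The real change of coordinates as a homeomorphism. -/
def normalHomeo {a b : ℝ} (hD : 0 < a ^ 2 + b ^ 2) (p : ℝ × ℝ) : (ℝ × ℝ) ≃ₜ (ℝ × ℝ) where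
  toFun t := p + unrot a b t
  invFun q := rot a b (q - p)
  left_inv t := by
    change rot a b (p + unrot a b t - p) = t
    rw [add_sub_cancel_left, rot_unrot hD]
  right_inv q := by
    change p + unrot a b (rot a b (q - p)) = q
    rw [unrot_rot hD]; abel
  continuous_toFun := continuous_const.add (continuous_unrot a b)
  continuous_invFun := (continuous_rot a b).comp (continuous_id.sub continuous_const)

/-- A field in normal coordinates. -/
def normalField (a b : ℝ) (p : ℝ × ℝ) (η : ℝ × ℝ → ℝ × ℝ) (t : ℝ × ℝ) : ℝ × ℝ :=
  rot a b (η (p + unrot a b t))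

lemma locallyLipschitz_normalField (a b : ℝ) (p : ℝ × ℝ) {η : ℝ × ℝ → ℝ × ℝ} (hη : LocallyLipschitz η) :
    LocallyLipschitz (normalField a b p η) := by
  have h1 : LocallyLipschitz (rot a b) := ContDiff.locallyLipschitz (𝕂 := ℝ) (by unfold rot; fun_prop)
  have h2 : LocallyLipschitz fun t => p + unrot a b t :=
    ContDiff.locallyLipschitz (𝕂 := ℝ) (by unfold unrot; fun_prop)
  exact h1.comp (hη.comp h2)

lemma fromNormal_surf {a b : ℝ} (hD : 0 < a ^ 2 + b ^ 2) (p : ℝ × ℝ) (η : ℝ × ℝ → ℝ × ℝ) (ε : ℝ)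
    (t : ℝ × ℝ) : fromNormal a b p (surf (ε • normalField a b p η) t)
      = surf (ε • η) (p + unrot a b t) := by
  rw [surf_eq_cpt, fromNormal_cpt, Pi.smul_apply, unrot_smul, normalField, unrot_rot hD]
  rfl

lemma fromNormal_surf_one {a b : ℝ} (hD : 0 < a ^ 2 + b ^ 2) (p : ℝ × ℝ) (η : ℝ × ℝ → ℝ × ℝ)
    (t : ℝ × ℝ) : fromNormal a b p (surf (normalField a b p η) t) = surf η (p + unrot a b t) := by
  simpa using fromNormal_surf hD p η 1 t

/-- When the observation direction is normal, the phase depends on the second coordinate only. -/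
lemma dotC_fromNormal {g : ℂ × ℂ → ℂ} {p x : ℝ × ℝ} {s : ℝ} (hD : 0 < gradSq g p)
    (hx : x = s • unitNormal g p) (r : ℝ) (ξ : ℂ × ℂ) :
    dotC (r • x) (fromNormal (realGrad g p).1 (realGrad g p).2 p ξ)
      = dotC (r • x) (toC p) + s * rStar g p r * ξ.2 := by
  have hq : 0 < √(gradSq g p) := Real.sqrt_pos.mpr hD
  have hqC : (√(gradSq g p) : ℂ) ≠ 0 := by exact_mod_cast hq.ne'
  have hDC : ((realGrad g p).1 : ℂ) ^ 2 + ((realGrad g p).2 : ℂ) ^ 2 ≠ 0 := by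
    exact_mod_cast hD.ne'
  rw [hx]
  simp only [dotC, fromNormal, unrotC_apply, toC, unitNormal, rStar, Prod.smul_fst, Prod.smul_snd,
    smul_eq_mul, Prod.fst_add, Prod.snd_add]
  push_cast
  field_simp
  ring

/-- The local integral in normal coordinates. -/
lemma uLoc_eq {g : ℂ × ℂ → ℂ} {p x : ℝ × ℝ} {s : ℝ} (hD : 0 < gradSq g p)
    (hx : x = s • unitNormal g p) (F : ℂ × ℂ → ℂ) {B : Set (ℝ × ℝ)} (hB : MeasurableSet B)
    {η : ℝ × ℝ → ℝ × ℝ} (hη : LocallyLipschitz η) (r : ℝ) :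
    uLoc F B η (r • x) = Complex.exp (-(Complex.I * dotC (r • x) (toC p))) * ((gradSq g p : ℂ))⁻¹
      * ∫ t in normalHomeo hD p ⁻¹' B,
        F (fromNormal (realGrad g p).1 (realGrad g p).2 p
            (surf (normalField (realGrad g p).1 (realGrad g p).2 p η) t))
          * Complex.exp (-(Complex.I * s * rStar g p r
            * (surf (normalField (realGrad g p).1 (realGrad g p).2 p η) t).2))
          * surfJac (normalField (realGrad g p).1 (realGrad g p).2 p η) t := by
  have hD' : 0 < (realGrad g p).1 ^ 2 + (realGrad g p).2 ^ 2 := hD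
  set a := (realGrad g p).1
  set b := (realGrad g p).2
  rw [uLoc, setIntegral_unrot hD' p hB]
  have e : ((a ^ 2 + b ^ 2 : ℝ) : ℂ) = (gradSq g p : ℂ) := rfl
  rw [e, mul_assoc, mul_left_comm]
  refine congrArg (fun z : ℂ => (gradSq g p : ℂ)⁻¹ * z) ?_
  rw [← integral_const_mul]
  refine integral_congr_ae (ae_restrict_of_ae ?_)
  filter_upwards [(locallyLipschitz_normalField a b p hη).ae_differentiableAt volume] with t ht
  rw [localIntegrand, surfJac_rot hD' p ht, ← fromNormal_surf_one hD', dotC_fromNormal hD hx]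
  have e2 : -(Complex.I * (dotC (r • x) (toC p)
        + s * rStar g p r * (surf (normalField a b p η) t).2))
      = -(Complex.I * dotC (r • x) (toC p))
        + -(Complex.I * s * rStar g p r * (surf (normalField a b p η) t).2) := by ring
  rw [e2, Complex.exp_add]
  exact (by intros; ring : ∀ X Y Z J : ℂ, X * (Y * Z) * J = Y * (X * Z * J)) _ _ _ _

lemma continuous_realGrad {g : ℂ × ℂ → ℂ} (hg : Differentiable ℂ g) : Continuous (realGrad g) := by
  have hfd : Continuous (fderiv ℂ g) := by
    have := (differentiableOn_fderiv_prod isOpen_univ hg.differentiableOn).continuousOn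
    rwa [continuousOn_univ] at this
  have htoC : Continuous toC := by unfold toC; fun_prop
  have h := hfd.comp htoC
  exact (Complex.continuous_re.comp (h.clm_apply continuous_const)).prodMk
    (Complex.continuous_re.comp (h.clm_apply continuous_const))

lemma continuous_dotR {u v : ℝ × ℝ → ℝ × ℝ} (hu : Continuous u) (hv : Continuous v) :
    Continuous fun q => dotR (u q) (v q) := by
  unfold dotR; fun_prop

/-- Near a point of the trace, the surface passes on the same side. -/
lemma eventually_bridge_pos {g : ℂ × ℂ → ℂ} (hg : Differentiable ℂ g) {η : ℝ × ℝ → ℝ × ℝ}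
    (hη : Continuous η) {p : ℝ × ℝ} (h : dotR (realGrad g p) (η p) ≠ 0) :
    ∀ᶠ q in 𝓝 p, 0 < bridgeSign g η p * dotR (realGrad g q) (η q) := by
  have hc : Continuous fun q => bridgeSign g η p * dotR (realGrad g q) (η q) :=
    continuous_const.mul (continuous_dotR (continuous_realGrad hg) hη)
  refine hc.continuousAt.eventually_const_lt ?_
  unfold bridgeSign
  rcases lt_or_gt_of_ne h with h | h
  · rw [Real.sign_of_neg h]; linarith
  · rw [Real.sign_of_pos h]; linarith

lemma bridgeSign_eq_of_pos {g : ℂ × ℂ → ℂ} {η : ℝ × ℝ → ℝ × ℝ} {s : ℝ} (hs : s = 1 ∨ s = -1)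
    {q : ℝ × ℝ} (h : 0 < s * dotR (realGrad g q) (η q)) : bridgeSign g η q = s := by
  unfold bridgeSign
  rcases hs with rfl | rfl
  · exact Real.sign_of_pos (by linarith)
  · exact Real.sign_of_neg (by linarith)

lemma pos_of_bridgeSign_eq {g : ℂ × ℂ → ℂ} {η : ℝ × ℝ → ℝ × ℝ} {s : ℝ} (hs : s = 1 ∨ s = -1)
    {q : ℝ × ℝ} (h : bridgeSign g η q = s) : 0 < s * dotR (realGrad g q) (η q) := by
  unfold bridgeSign at h
  rcases lt_trichotomy (dotR (realGrad g q) (η q)) 0 with h1 | h1 | h1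
  · rw [Real.sign_of_neg h1] at h; rw [← h]; linarith
  · rw [h1, Real.sign_zero] at h; rcases hs with rfl | rfl <;> norm_num at h
  · rw [Real.sign_of_pos h1] at h; rw [← h]; linarith

/-- The scalar product with the observation direction is the second component in normal
coordinates. -/
lemma dotR_eq_snd {g : ℂ × ℂ → ℂ} {p x : ℝ × ℝ} {s : ℝ} (hx : x = s • unitNormal g p) (v : ℝ × ℝ) :
    dotR v x = (√(gradSq g p))⁻¹ * (s * (rot (realGrad g p).1 (realGrad g p).2 v).2) := by
  rw [hx]
  simp only [dotR, unitNormal, rot, Prod.smul_fst, Prod.smul_snd, smul_eq_mul]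
  ring

section Local

variable {ι : Type*} {g : ι → ℂ × ℂ → ℂ} {η : ℝ × ℝ → ℝ × ℝ} {x : ℝ × ℝ} {j : ι} {p : ℝ × ℝ}
  {s σ a : ℝ} {U : Set (ℂ × ℂ)}

/-- The limit of the local integral, for all local deformed surfaces over small neighbourhoods. -/
theorem exists_nhds_tendsto_uLoc (hg : ∀ k, HasRealProperty (g k)) (hη : IsAdmissible g univ η)
    (hp : g j (toC p) = 0)
    (hs : s = 1 ∨ s = -1) (hsb : s = bridgeSign (g j) η p) (hxs : x = s • unitNormal (g j) p)
    (hσ : σ = 1 ∨ σ = -1) (ha : 0 < a) (hα : IsCurvatureCoeff (g j) p (σ * a))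
    (hU : IsOpen U) (hpU : toC p ∈ U) {F Fs Fr : ℂ × ℂ → ℂ}
    (hF : ∀ ξ ∈ slitDomain (g j) s U, F ξ = Fs ξ + Fr ξ)
    (hFs : DifferentiableOn ℂ Fs (slitDomain (g j) s U)) (hFr : DifferentiableOn ℂ Fr U) {A μ : ℂ}
    (hlead : (fun ξ => Fs ξ - A * branchPow s (g j ξ) (-μ)) =o[𝓝[slitDomain (g j) s U] (toC p)]
      fun ξ => branchPow s (g j ξ) (-μ)) :
    ∃ V ∈ 𝓝 p, ∀ B ⊆ V, ∀ η', IsLocalSurface g η (slitDomain (g j) s U) x p B η' →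
      Tendsto (fun r : ℝ => ((rStar (g j) p r : ℝ) : ℂ) ^ (-μ)
          * ((√(rStar (g j) p r) * rStar (g j) p r : ℝ) : ℂ)
          * (Complex.exp (Complex.I * dotC (r • x) (toC p)) * (gradSq (g j) p : ℂ)
            * uLoc F B η' (r • x))) atTop
        (𝓝 (A * (1 - Complex.I * s * σ) * (Real.sqrt (Real.pi / (2 * a)) : ℂ) * closedJ μ 1 s)) := by
  have hD := gradSq_pos (hg j) hp
  have hDC : (gradSq (g j) p : ℂ) ≠ 0 := by exact_mod_cast hD.ne'
  have hD' : 0 < (realGrad (g j) p).1 ^ 2 + (realGrad (g j) p).2 ^ 2 := hD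
  have hs1 : |s| = 1 := by rcases hs with rfl | rfl <;> simp
  have hσ1 : |σ| = 1 := by rcases hσ with rfl | rfl <;> simp
  set ψ := fromNormal (realGrad (g j) p).1 (realGrad (g j) p).2 p with hψ
  set G := normalFn (g j) p with hG
  have hψc : Continuous ψ := (differentiable_fromNormal _ _ _).continuous
  have hψ0 : ψ 0 = toC p := fromNormal_zero _ _ _
  have hslit : slitDomain G s (ψ ⁻¹' U) = ψ ⁻¹' slitDomain (g j) s U := rfl
  have htend : Tendsto ψ (𝓝[slitDomain G s (ψ ⁻¹' U)] 0) (𝓝[slitDomain (g j) s U] (toC p)) := by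
    refine tendsto_nhdsWithin_iff.mpr ⟨?_, ?_⟩
    · rw [← hψ0]; exact (hψc.tendsto 0).mono_left nhdsWithin_le_nhds
    · exact eventually_mem_nhdsWithin
  have hF2 : (fun ξ => Fs (ψ ξ) - A * branchPow s (G ξ) (-μ)) =o[𝓝[slitDomain G s (ψ ⁻¹' U)] 0]
      fun ξ => branchPow s (G ξ) (-μ) := hlead.comp_tendsto htend
  obtain ⟨C, δ₁, hC, hδ₁, hM₁⟩ := exists_modelRegion_normalFn (hg j) hp hα ha hσ hs
  -- a neighbourhood of the saddle on which the leading term controls the integrand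
  have hN : ∀ᶠ ξ in 𝓝 (0 : ℂ × ℂ), ξ ∈ ψ ⁻¹' U ∧ (ξ ∈ slitDomain G s (ψ ⁻¹' U) →
      ‖Fs (ψ ξ) - A * branchPow s (G ξ) (-μ)‖ ≤ 1 * ‖branchPow s (G ξ) (-μ)‖) := by
    refine Filter.Eventually.and ?_ (eventually_nhdsWithin_iff.mp (hF2.bound one_pos))
    exact hψc.continuousAt.eventually_mem (hU.mem_nhds (by rw [hψ0]; exact hpU))
  obtain ⟨δ₂, hδ₂, hmod⟩ := exists_forall_model_mem hN hs1 hσ1 ha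
  set δ := min δ₁ δ₂ with hδd
  have hδ : 0 < δ := lt_min hδ₁ hδ₂
  have hM := hM₁.mono (min_le_left δ₁ δ₂)
  have hmod' : ∀ (t : ℝ × ℝ) (l k : ℝ), |t.1| ≤ δ → |t.2| ≤ δ → 0 ≤ l → l ≤ 1 → |k| ≤ δ →
      cpt t (model s σ a l k t) ∈ ψ ⁻¹' U ∧ (cpt t (model s σ a l k t) ∈ slitDomain G s (ψ ⁻¹' U) →
      ‖Fs (ψ (cpt t (model s σ a l k t))) - A * branchPow s (G (cpt t (model s σ a l k t))) (-μ)‖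
        ≤ 1 * ‖branchPow s (G (cpt t (model s σ a l k t))) (-μ)‖) := fun t l k h1 h2 h3 h4 h5 =>
    hmod t l k (h1.trans (min_le_right _ _)) (h2.trans (min_le_right _ _)) h3 h4
      (h5.trans (min_le_right _ _))
  have hF1 : ∀ (t : ℝ × ℝ) (l : ℝ), |t.1| ≤ δ → |t.2| ≤ δ → 0 < l → l ≤ δ →
      ‖Fs (ψ (cpt t (model s σ a 1 l t)))‖
        ≤ (‖A‖ + 1) * ‖branchPow s (G (cpt t (model s σ a 1 l t))) (-μ)‖ := by
    intro t l h1 h2 h3 h4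
    obtain ⟨u1, u2⟩ := hmod' t 1 l h1 h2 zero_le_one le_rfl (by rwa [abs_of_pos h3])
    have h := u2 ⟨u1, hM.not_mem_cut t 1 l h1 h2 zero_le_one le_rfl h3 h4⟩
    have h' := norm_le_norm_add_norm_sub (A * branchPow s (G (cpt t (model s σ a 1 l t))) (-μ))
      (Fs (ψ (cpt t (model s σ a 1 l t))))
    rw [norm_mul, norm_sub_rev] at h'
    linarith
  set H := normalHomeo hD' p with hH
  have hV1 : H.symm ⁻¹' {t | |t.1| ≤ δ ∧ |t.2| ≤ δ} ∈ 𝓝 p := by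
    refine H.symm.continuous.continuousAt.preimage_mem_nhds ?_
    have : H.symm p = 0 := by change rot _ _ (p - p) = 0; simp [rot]
    rw [this]
    filter_upwards [Metric.ball_mem_nhds (0 : ℝ × ℝ) hδ] with t ht
    rw [mem_ball_zero_iff] at ht
    exact ⟨(abs_fst_le_norm t).trans ht.le, (abs_snd_le_norm t).trans ht.le⟩
  have hV2 := eventually_bridge_pos (hg j).entire hη.lipschitz.continuous
    (hη.nontangent j p (mem_univ _) hp)
  rw [← hsb] at hV2
  refine ⟨_, inter_mem hV1 hV2, fun B hBV η' hloc => ?_⟩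
  set θ := normalField (realGrad (g j) p).1 (realGrad (g j) p).2 p η' with hθ
  have hBm := hloc.compact.measurableSet
  have hHt : ∀ t, H t = p + unrot (realGrad (g j) p).1 (realGrad (g j) p).2 t := fun t => rfl
  have hcore := tendsto_integral_localSurface (differentiable_normalFn (hg j).entire p)
    (normalFn_toC_im (hg j) p) hs hσ ha hδ hM (hU.preimage hψc)
    (fun t l k h1 h2 h3 h4 h5 => (hmod' t l k h1 h2 h3 h4 h5).1)
    (F := fun ξ => F (ψ ξ)) (Fs := fun ξ => Fs (ψ ξ)) (Fr := fun ξ => Fr (ψ ξ))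
    (fun ξ hξ => hF _ hξ)
    (hFs.comp (differentiable_fromNormal _ _ _).differentiableOn fun ξ hξ => hξ)
    (hFr.comp (differentiable_fromNormal _ _ _).differentiableOn fun ξ hξ => hξ) hF1 hF2
    (B := H ⁻¹' B) (H.isCompact_preimage.mpr hloc.compact)
    (by
      rw [← H.preimage_interior, mem_preimage]
      have : H 0 = p := by rw [hHt]; simp [unrot]
      rw [this]; exact hloc.mem_interior)
    (fun t ht => by
      have h1 := (hBV ht).1
      rw [mem_preimage, H.symm_apply_apply] at h1
      exact h1)
    (η := θ) (locallyLipschitz_normalField _ _ _ hloc.admissible.lipschitz)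
    (fun ε h1 h2 t ht => by
      rw [hslit, mem_preimage, hψ, hθ, fromNormal_surf hD']
      exact hloc.in_domain ε h1 h2 _ ht)
    (fun t ht h0 => by
      rw [fderiv_normalFn (hg j), Complex.ofReal_re, hθ, normalField, unrot_rot hD']
      have h0' : g j (toC (p + unrot (realGrad (g j) p).1 (realGrad (g j) p).2 t)) = 0 := by
        rw [← fromNormal_toC]; exact h0
      refine pos_of_bridgeSign_eq hs ?_
      exact (hloc.same_bridge j _ ht h0').trans (bridgeSign_eq_of_pos hs (hBV ht).2))
    (fun t ht => by
      rw [← H.preimage_frontier, mem_preimage] at ht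
      have h1 := hloc.boundary _ ht
      rw [dotR_eq_snd hxs] at h1
      by_contra hcon
      have := mul_nonneg (inv_nonneg.mpr (Real.sqrt_nonneg (gradSq (g j) p))) (not_lt.mp hcon)
      exact absurd h1 (not_lt.mpr this))
  have hq : 0 < √(gradSq (g j) p) := Real.sqrt_pos.mpr hD
  have hr : Tendsto (fun r : ℝ => rStar (g j) p r) atTop atTop :=
    tendsto_id.atTop_div_const hq
  refine (hcore.comp hr).congr fun r => ?_
  simp only [Function.comp_def]
  rw [uLoc_eq hD hxs F hBm hloc.admissible.lipschitz r]
  have e1 : Complex.exp (Complex.I * dotC (r • x) (toC p))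
      * Complex.exp (-(Complex.I * dotC (r • x) (toC p))) = 1 := by
    rw [← Complex.exp_add]; simp
  have e2 : ∀ X : ℂ, Complex.exp (Complex.I * dotC (r • x) (toC p)) * (gradSq (g j) p : ℂ)
      * (Complex.exp (-(Complex.I * dotC (r • x) (toC p))) * (gradSq (g j) p : ℂ)⁻¹ * X) = X := by
    intro X
    calc _ = (Complex.exp (Complex.I * dotC (r • x) (toC p))
      * Complex.exp (-(Complex.I * dotC (r • x) (toC p))))
      * ((gradSq (g j) p : ℂ) * (gradSq (g j) p : ℂ)⁻¹) * X := by ring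
      _ = X := by rw [e1, mul_inv_cancel₀ hDC, one_mul, one_mul]
  rw [e2]

end Local

/-! ### Existence of local deformed surfaces -/

lemma surf_smul_model {a b : ℝ} (p : ℝ × ℝ) (s σ c k ε : ℝ) {q : ℝ × ℝ} (hD : 0 < a ^ 2 + b ^ 2) :
    surf (ε • fun q => unrot a b (model s σ c 1 k (rot a b (q - p)))) q
      = fromNormal a b p (cpt (rot a b (q - p)) (model s σ c ε (ε * k) (rot a b (q - p)))) := by
  rw [fromNormal_cpt, unrot_rot hD, add_sub_cancel, surf_eq_cpt, Pi.smul_apply, ← unrot_smul,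
    smul_model, mul_one]

/-- Local deformed surfaces exist over arbitrarily small neighbourhoods: the model surface over a
square in normal coordinates. -/
theorem exists_isLocalSurface {ι : Type*} [Finite ι] {g : ι → ℂ × ℂ → ℂ} {η : ℝ × ℝ → ℝ × ℝ}
    {x : ℝ × ℝ} {j : ι} {p : ℝ × ℝ} {s σ a : ℝ} {U : Set (ℂ × ℂ)}
    (hg : ∀ k, HasRealProperty (g k)) (hη : IsAdmissible g univ η)
    (hp : g j (toC p) = 0) (hpk : ∀ k, k ≠ j → g k (toC p) ≠ 0)
    (hiso : ∀ᶠ q in 𝓝[≠] p, ¬ IsActive g η x q)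
    (hs : s = 1 ∨ s = -1) (hsb : s = bridgeSign (g j) η p) (hxs : x = s • unitNormal (g j) p)
    (hσ : σ = 1 ∨ σ = -1) (ha : 0 < a) (hα : IsCurvatureCoeff (g j) p (σ * a))
    (hU : IsOpen U) (hpU : toC p ∈ U) {W : Set (ℝ × ℝ)} (hW : W ∈ 𝓝 p) :
    ∃ B ⊆ W, ∃ η', IsLocalSurface g η (slitDomain (g j) s U) x p B η' := by
  have hD := gradSq_pos (hg j) hp
  have hD' : 0 < (realGrad (g j) p).1 ^ 2 + (realGrad (g j) p).2 ^ 2 := hD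
  have hs1 : |s| = 1 := by rcases hs with rfl | rfl <;> simp
  have hσ1 : |σ| = 1 := by rcases hσ with rfl | rfl <;> simp
  have hss : s * s = 1 := by rcases hs with rfl | rfl <;> norm_num
  obtain ⟨C, δ₁, hC, hδ₁, hM⟩ := exists_modelRegion_normalFn (hg j) hp hα ha hσ hs
  set ψ := fromNormal (realGrad (g j) p).1 (realGrad (g j) p).2 p with hψ
  have hψc : Continuous ψ := (differentiable_fromNormal _ _ _).continuous
  have hψ0 : ψ 0 = toC p := fromNormal_zero _ _ _
  -- near the saddle no other component of the singularity set is met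
  have hN : ∀ᶠ ξ in 𝓝 (0 : ℂ × ℂ), ψ ξ ∈ U ∧ ∀ i, i ≠ j → g i (ψ ξ) ≠ 0 := by
    refine Filter.Eventually.and ?_ ?_
    · exact hψc.continuousAt.eventually_mem (hU.mem_nhds (by rw [hψ0]; exact hpU))
    · refine eventually_all.mpr fun i => ?_
      by_cases hi : i = j
      · exact Eventually.of_forall fun ξ h => absurd hi h
      · have hc : Continuous fun ξ => g i (ψ ξ) := (hg i).entire.continuous.comp hψc
        have h0 : g i (ψ 0) ≠ 0 := by rw [hψ0]; exact hpk i hi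
        filter_upwards [hc.continuousAt.eventually_ne h0] with ξ hξ _ using hξ
  obtain ⟨δ₂, hδ₂, hmod⟩ := exists_forall_model_mem hN hs1 hσ1 ha
  set H := normalHomeo hD' p with hH
  have hH0 : H 0 = p := by change p + unrot _ _ 0 = p; simp [unrot]
  have hHs : ∀ q, H.symm q = rot (realGrad (g j) p).1 (realGrad (g j) p).2 (q - p) := fun q => rfl
  have hHs0 : H.symm p = 0 := by rw [← hH0, H.symm_apply_apply]
  have hbr := eventually_bridge_pos (hg j).entire hη.lipschitz.continuous
    (hη.nontangent j p (mem_univ _) hp)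
  rw [← hsb] at hbr
  have hiso' := eventually_nhdsWithin_iff.mp hiso
  have hE : ∀ᶠ q in 𝓝 (H 0), q ∈ W ∧ 0 < s * dotR (realGrad (g j) q) (η q)
      ∧ (q ∈ ({p}ᶜ : Set (ℝ × ℝ)) → ¬ IsActive g η x q) := by
    rw [hH0]
    exact (eventually_mem_set.mpr hW).and (hbr.and hiso')
  obtain ⟨ρ, hρ, hball⟩ := Metric.eventually_nhds_iff_ball.mp (H.continuous.continuousAt.eventually hE)
  -- half the side of the square, and a height so small that the model field points into the region
  -- of decay over the boundary of the square
  set R := min (ρ / 2) (min δ₁ δ₂) with hR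
  have hR0 : 0 < R := by positivity
  have hRρ : R < ρ := (min_le_left _ _).trans_lt (half_lt_self hρ)
  have hR1 : R ≤ δ₁ := (min_le_right _ _).trans (min_le_left _ _)
  have hR2 : R ≤ δ₂ := (min_le_right _ _).trans (min_le_right _ _)
  set k := min (min δ₁ δ₂) (min (a * R ^ 2) (R / 4)) / 2 with hk
  have hm0 : 0 < min (min δ₁ δ₂) (min (a * R ^ 2) (R / 4)) := by positivity
  have hk0 : 0 < k := half_pos hm0
  have hkm : k < min (min δ₁ δ₂) (min (a * R ^ 2) (R / 4)) := half_lt_self hm0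
  have hk1 : k ≤ δ₁ := (hkm.trans_le ((min_le_left _ _).trans (min_le_left _ _))).le
  have hk2 : k ≤ δ₂ := (hkm.trans_le ((min_le_left _ _).trans (min_le_right _ _))).le
  have hka : k < a * R ^ 2 := hkm.trans_le ((min_le_right _ _).trans (min_le_left _ _))
  have hkR : k < R / 4 := hkm.trans_le ((min_le_right _ _).trans (min_le_right _ _))
  set Q : Set (ℝ × ℝ) := Icc (-R) R ×ˢ Icc (-R) R with hQ
  have hQmem : ∀ t ∈ Q, |t.1| ≤ R ∧ |t.2| ≤ R := fun t ht => ⟨abs_le.mpr ht.1, abs_le.mpr ht.2⟩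
  have hQball : ∀ t ∈ Q, t ∈ Metric.ball (0 : ℝ × ℝ) ρ := fun t ht => by
    rw [mem_ball_zero_iff, Prod.norm_def]
    exact (max_le (hQmem t ht).1 (hQmem t ht).2).trans_lt hRρ
  have hQint : Ioo (-R) R ×ˢ Ioo (-R) R ⊆ interior Q :=
    interior_maximal (prod_mono Ioo_subset_Icc_self Ioo_subset_Icc_self) (isOpen_Ioo.prod isOpen_Ioo)
  have hBall : ∀ q ∈ H.symm ⁻¹' Q, q ∈ W ∧ 0 < s * dotR (realGrad (g j) q) (η q)
      ∧ (q ∈ ({p}ᶜ : Set (ℝ × ℝ)) → ¬ IsActive g η x q) := fun q hq => by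
    have := hball _ (hQball _ hq)
    rwa [H.apply_symm_apply] at this
  set η' : ℝ × ℝ → ℝ × ℝ := fun q => unrot (realGrad (g j) p).1 (realGrad (g j) p).2
    (model s σ a 1 k (rot (realGrad (g j) p).1 (realGrad (g j) p).2 (q - p))) with hη'
  have hsurf : ∀ ε q, surf (ε • η') q = ψ (cpt (H.symm q) (model s σ a ε (ε * k) (H.symm q))) :=
    fun ε q => surf_smul_model p s σ a k ε hD'
  have hmem : ∀ ε : ℝ, 0 ≤ ε → ε ≤ 1 → ∀ q ∈ H.symm ⁻¹' Q, surf (ε • η') q ∈ U ∧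
      ∀ i, i ≠ j → g i (surf (ε • η') q) ≠ 0 := by
    intro ε h0 h1 q hq
    rw [hsurf]
    refine hmod _ _ _ ((hQmem _ hq).1.trans hR2) ((hQmem _ hq).2.trans hR2) h0 h1 ?_
    rw [abs_of_nonneg (by positivity)]
    exact (mul_le_of_le_one_left hk0.le h1).trans hk2
  have hcut : ∀ ε : ℝ, 0 < ε → ε ≤ 1 → ∀ q ∈ H.symm ⁻¹' Q, g j (surf (ε • η') q) ∉ cut s := by
    intro ε h0 h1 q hq
    rw [hsurf]
    exact hM.not_mem_cut _ _ _ ((hQmem _ hq).1.trans hR1) ((hQmem _ hq).2.trans hR1) h0.le h1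
      (by positivity) ((mul_le_of_le_one_left hk0.le h1).trans hk1)
  have hother : ∀ i, i ≠ j → ∀ q ∈ H.symm ⁻¹' Q, g i (toC q) ≠ 0 := by
    intro i hi q hq
    have := (hmem 0 le_rfl zero_le_one q hq).2 i hi
    rwa [surf_eq_cpt, zero_smul, Pi.zero_apply, cpt_zero] at this
  have hpos : ∀ q ∈ H.symm ⁻¹' Q, g j (toC q) = 0 → 0 < s * dotR (realGrad (g j) q) (η' q) := by
    intro q hq h0
    have ht1 := (hQmem _ hq).1.trans hR1
    have ht2 := (hQmem _ hq).2.trans hR1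
    have hq' : p + unrot (realGrad (g j) p).1 (realGrad (g j) p).2 (H.symm q) = q :=
      H.apply_symm_apply q
    have htr := hM.trace (H.symm q) ht1 ht2 (by rw [normalFn, fromNormal_toC, hq', h0])
    have h := hM.deriv_pos (H.symm q) 1 k ht1 ht2 zero_le_one le_rfl hk0 hk1 (by linarith) 0
      ⟨le_rfl, zero_le_one⟩
    rw [zero_smul, cpt_zero, fderiv_normalFn (hg j), Complex.ofReal_re, hq'] at h
    exact h
  have hzero : (0 : ℂ) ∈ cut s := by simp [cut]
  refine ⟨H.symm ⁻¹' Q, fun q hq => (hBall q hq).1, η', ?_, ?_, ⟨?_, ?_, ?_⟩, ?_, ?_, ?_, ?_⟩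
  · exact H.symm.isCompact_preimage.mpr (isCompact_Icc.prod isCompact_Icc)
  · rw [← H.symm.preimage_interior, mem_preimage, hHs0]
    exact hQint ⟨⟨by simpa using hR0, hR0⟩, ⟨by simpa using hR0, hR0⟩⟩
  · have h1 : LocallyLipschitz (unrot (realGrad (g j) p).1 (realGrad (g j) p).2) :=
      ContDiff.locallyLipschitz (𝕂 := ℝ) (by unfold unrot; fun_prop)
    have h2 : LocallyLipschitz fun q => rot (realGrad (g j) p).1 (realGrad (g j) p).2 (q - p) :=
      ContDiff.locallyLipschitz (𝕂 := ℝ) (by unfold rot; fun_prop)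
    exact h1.comp ((locallyLipschitz_model s σ a 1 k).comp h2)
  · rintro ε h0 h1 q hq ⟨i, hi⟩
    by_cases hij : i = j
    · subst hij
      exact hcut ε h0 h1 q hq (by rw [hi]; exact hzero)
    · exact (hmem ε h0.le h1 q hq).2 i hij hi
  · intro i q hq h0 hcon
    by_cases hij : i = j
    · subst hij
      have := hpos q hq h0
      rw [hcon, mul_zero] at this
      exact lt_irrefl _ this
    · exact hother i hij q hq h0
  · intro i q hq h0
    by_cases hij : i = j
    · subst hij
      rw [bridgeSign_eq_of_pos hs (hpos q hq h0), bridgeSign_eq_of_pos hs (hBall q hq).2.1]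
    · exact absurd h0 (hother i hij q hq)
  · exact fun ε h0 h1 q hq => ⟨(hmem ε h0.le h1 q hq).1, hcut ε h0 h1 q hq⟩
  · exact fun q hq hqp => (hBall q hq).2.2 hqp
  · intro q hq
    rw [← H.symm.preimage_frontier, mem_preimage] at hq
    have hQc : IsClosed Q := isClosed_Icc.prod isClosed_Icc
    have hqQ : H.symm q ∈ Q := hQc.frontier_subset hq
    rw [dotR_eq_snd hxs, hη']
    simp only []
    rw [rot_unrot hD', ← hHs]
    refine mul_neg_of_pos_of_neg (inv_pos.mpr (Real.sqrt_pos.mpr hD)) ?_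
    have e : s * (model s σ a 1 k (H.symm q)).2
        = k - (a * (H.symm q).1 ^ 2 + |(H.symm q).2| / 4) := by
      simp only [model]
      rw [← mul_assoc, hss]; ring
    rw [e]
    have hnot : ¬ (|(H.symm q).1| < R ∧ |(H.symm q).2| < R) := fun h =>
      hq.2 (hQint ⟨abs_lt.mp h.1, abs_lt.mp h.2⟩)
    have n1 : 0 ≤ a * (H.symm q).1 ^ 2 := by positivity
    have n2 := abs_nonneg (H.symm q).2
    by_cases h1 : |(H.symm q).1| < R
    · have h2 : R ≤ |(H.symm q).2| := not_lt.mp fun h => hnot ⟨h1, h⟩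
      linarith
    · have h2 : R ^ 2 ≤ (H.symm q).1 ^ 2 := by
        rw [← sq_abs (H.symm q).1]
        exact pow_le_pow_left₀ hR0.le (not_lt.mp h1) 2
      have := mul_le_mul_of_nonneg_left h2 ha.le
      linarith

/-! ### The leading term -/

/-- Homogeneity of the Fresnel integral. -/
lemma closedI_mul {ρ : ℝ} (hρ : 0 < ρ) (s α : ℝ) :
    closedI (s * ρ * α) = closedI (s * α) / (√ρ : ℂ) := by
  have e : s * ρ * α = s * α * ρ := by ring
  unfold closedI
  rw [e]
  simp only [mul_pos_iff_of_pos_right hρ, ← div_div]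
  split_ifs
  · rw [Real.sqrt_div' _ hρ.le, Complex.ofReal_div]; ring
  · rw [Real.sqrt_div' _ hρ.le, Complex.ofReal_div]; ring

lemma closedI_eq_sqrt_pi_mul (c : ℝ) :
    closedI c = (√Real.pi : ℂ) * (if 0 < c then Complex.exp (-(Complex.I * Real.pi / 4)) / (√c : ℂ)
      else Complex.exp (Complex.I * Real.pi / 4) / (√(-c) : ℂ)) := by
  unfold closedI
  split_ifs
  · rw [Real.sqrt_div Real.pi_pos.le, Complex.ofReal_div]; ring
  · rw [neg_div, ← div_neg, Real.sqrt_div Real.pi_pos.le, Complex.ofReal_div]; ring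

lemma closedJ_eq_cpow_mul {ρ : ℝ} (hρ : 0 < ρ) (μ : ℂ) (s : ℝ) :
    closedJ μ ρ s = (ρ : ℂ) ^ (μ - 1) * closedJ μ 1 s := by
  simp only [closedJ, hρ, one_pos, if_true, Complex.ofReal_one, Complex.one_cpow]
  ring

lemma closedJ_one_ne_zero {μ : ℂ} (hμ : ∀ n : ℕ, μ ≠ -(n : ℂ)) (s : ℝ) : closedJ μ 1 s ≠ 0 := by
  simp only [closedJ, one_pos, if_true, Complex.ofReal_one, Complex.one_cpow, mul_one]
  refine div_ne_zero (mul_ne_zero ?_ (Complex.exp_ne_zero _)) (Complex.Gamma_ne_zero hμ)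
  exact mul_ne_zero two_ne_zero (by exact_mod_cast Real.pi_ne_zero)

lemma closedI_ne_zero {c : ℝ} (hc : c ≠ 0) : closedI c ≠ 0 := by
  unfold closedI
  have hpi := Real.pi_pos
  split_ifs with h
  · refine mul_ne_zero (Complex.exp_ne_zero _) ?_
    exact_mod_cast (Real.sqrt_pos.mpr (div_pos hpi h)).ne'
  · refine mul_ne_zero (Complex.exp_ne_zero _) ?_
    have h' : c < 0 := lt_of_le_of_ne (not_lt.mp h) hc
    exact_mod_cast (Real.sqrt_pos.mpr (div_pos_of_neg_of_neg (neg_lt_zero.mpr hpi) h')).ne'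

lemma cpow_sub_three_halves {ρ : ℝ} (hρ : 0 < ρ) (μ : ℂ) :
    (ρ : ℂ) ^ (μ - 3 / 2) = (ρ : ℂ) ^ (μ - 1) / (√ρ : ℂ) := by
  have hρC : (ρ : ℂ) ≠ 0 := by exact_mod_cast hρ.ne'
  have e : μ - 3 / 2 = (μ - 1) - ((1 / 2 : ℝ) : ℂ) := by push_cast; ring
  rw [e, Complex.cpow_sub _ _ hρC, ← Complex.ofReal_cpow hρ.le, ← Real.sqrt_eq_rpow]

lemma rStar_pos {g : ℂ × ℂ → ℂ} {p : ℝ × ℝ} (hD : 0 < gradSq g p) {r : ℝ} (hr : 0 < r) :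
    0 < rStar g p r := div_pos hr (Real.sqrt_pos.mpr hD)

lemma leadingIJ_eq_leadingExplicit {g : ℂ × ℂ → ℂ} {p : ℝ × ℝ} (hD : 0 < gradSq g p) (x : ℝ × ℝ)
    (A μ : ℂ) (α s : ℝ) {r : ℝ} (hr : 0 < r) :
    leadingIJ g x p A μ α s r = leadingExplicit g x p A μ α s r := by
  have hρ := rStar_pos hD hr
  unfold leadingIJ leadingExplicit
  change _ = _ * ((rStar g p r : ℝ) : ℂ) ^ (μ - 3 / 2) * _
  rw [closedI_mul hρ, closedI_eq_sqrt_pi_mul, cpow_sub_three_halves hρ]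
  simp only [closedJ, hρ, if_true]
  ring

/-- The factor by which the leading term becomes the constant `A 𝓘(s α) 𝓙(μ, 1; s)`; it is of exact
order `r ^ (3 / 2 - Re μ)`. -/
def normalizer (g : ℂ × ℂ → ℂ) (x p : ℝ × ℝ) (μ : ℂ) (r : ℝ) : ℂ :=
  ((rStar g p r : ℝ) : ℂ) ^ (-μ) * ((√(rStar g p r) * rStar g p r : ℝ) : ℂ)
    * (Complex.exp (Complex.I * dotC (r • x) (toC p)) * (gradSq g p : ℂ))

lemma normalizer_mul_leadingIJ {g : ℂ × ℂ → ℂ} {p : ℝ × ℝ} (hD : 0 < gradSq g p) (x : ℝ × ℝ)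
    (A μ : ℂ) (α s : ℝ) {r : ℝ} (hr : 0 < r) :
    normalizer g x p μ r * leadingIJ g x p A μ α s r = A * closedI (s * α) * closedJ μ 1 s := by
  have hρ := rStar_pos hD hr
  have hρC : (rStar g p r : ℂ) ≠ 0 := by exact_mod_cast hρ.ne'
  have hqC : (√(rStar g p r) : ℂ) ≠ 0 := by exact_mod_cast (Real.sqrt_pos.mpr hρ).ne'
  have hDC : (gradSq g p : ℂ) ≠ 0 := by exact_mod_cast hD.ne'
  have hμ : (rStar g p r : ℂ) ^ μ ≠ 0 := by simp [Complex.cpow_eq_zero_iff, hρC]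
  unfold leadingIJ normalizer
  rw [closedI_mul hρ, closedJ_eq_cpow_mul hρ, Complex.cpow_neg, Complex.cpow_sub _ _ hρC,
    Complex.cpow_one, Complex.exp_neg, Complex.ofReal_mul]
  field_simp [Complex.exp_ne_zero]

lemma norm_normalizer {g : ℂ × ℂ → ℂ} {p : ℝ × ℝ} (hD : 0 < gradSq g p) (x : ℝ × ℝ)
    (μ : ℂ) {r : ℝ} (hr : 0 < r) :
    ‖normalizer g x p μ r‖ * r ^ (μ.re - 3 / 2) = gradSq g p * √(gradSq g p) ^ (μ.re - 3 / 2) := by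
  have hρ := rStar_pos hD hr
  have hq := Real.sqrt_pos.mpr hD
  have hE : ‖Complex.exp (Complex.I * dotC (r • x) (toC p))‖ = 1 := by
    have e : Complex.I * dotC (r • x) (toC p) = ((dotR (r • x) p : ℝ) : ℂ) * Complex.I := by
      simp only [dotC, dotR, toC]; push_cast; ring
    rw [e, Complex.norm_exp_ofReal_mul_I]
  have hr' : r = rStar g p r * √(gradSq g p) := by rw [rStar]; field_simp
  have e1 : √(rStar g p r) * rStar g p r = rStar g p r ^ (3 / 2 : ℝ) := by
    have : (3 / 2 : ℝ) = 1 / 2 + 1 := by norm_num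
    rw [this, Real.rpow_add_one hρ.ne', Real.sqrt_eq_rpow]
  rw [normalizer, norm_mul, norm_mul, norm_mul, hE, Complex.norm_cpow_eq_rpow_re_of_pos hρ,
    Complex.norm_real, Complex.norm_real, Real.norm_of_nonneg (by positivity),
    Real.norm_of_nonneg hD.le, e1, Complex.neg_re]
  nth_rw 3 [hr']
  rw [Real.mul_rpow hρ.le hq.le]
  have e2 : rStar g p r ^ (-μ.re) * rStar g p r ^ (3 / 2 : ℝ) * rStar g p r ^ (μ.re - 3 / 2) = 1 := by
    rw [← Real.rpow_add hρ, ← Real.rpow_add hρ]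
    have : -μ.re + 3 / 2 + (μ.re - 3 / 2) = 0 := by ring
    rw [this, Real.rpow_zero]
  linear_combination gradSq g p * √(gradSq g p) ^ (μ.re - 3 / 2) * e2

/-- The estimate of the remainder, from the limit of the normalized integral. -/
lemma isLittleO_sub_leadingIJ {g : ℂ × ℂ → ℂ} {p : ℝ × ℝ} (hD : 0 < gradSq g p) {x : ℝ × ℝ}
    {A μ : ℂ} {α s : ℝ} {u : ℝ → ℂ}
    (hu : Tendsto (fun r => normalizer g x p μ r * u r) atTop
      (𝓝 (A * closedI (s * α) * closedJ μ 1 s))) :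
    (fun r => u r - leadingIJ g x p A μ α s r) =o[atTop] fun r : ℝ => r ^ (μ.re - 3 / 2) := by
  set K := gradSq g p * √(gradSq g p) ^ (μ.re - 3 / 2) with hK
  have hK0 : 0 < K := mul_pos hD (Real.rpow_pos_of_pos (Real.sqrt_pos.mpr hD) _)
  refine isLittleO_iff.mpr fun c hc => ?_
  have h1 := (Metric.tendsto_atTop'.mp hu) (c * K) (by positivity)
  obtain ⟨N, hN⟩ := h1
  filter_upwards [eventually_gt_atTop N, eventually_gt_atTop 0] with r hr hr0
  have h2 := hN r hr
  rw [dist_eq_norm, ← normalizer_mul_leadingIJ hD x A μ α s hr0, ← mul_sub, norm_mul, hK,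
    ← norm_normalizer hD x μ hr0] at h2
  have hpos : 0 < ‖normalizer g x p μ r‖ * r ^ (μ.re - 3 / 2) := by
    rw [norm_normalizer hD x μ hr0]; exact hK0
  have hr1 : 0 < r ^ (μ.re - 3 / 2) := Real.rpow_pos_of_pos hr0 _
  have hn : 0 < ‖normalizer g x p μ r‖ := (pos_iff_pos_of_mul_pos hpos).mpr hr1
  rw [Real.norm_of_nonneg hr1.le]
  refine le_of_mul_le_mul_left (h2.le.trans_eq ?_) hn
  ring

lemma isTheta_leadingIJ {g : ℂ × ℂ → ℂ} {p : ℝ × ℝ} (hD : 0 < gradSq g p) (x : ℝ × ℝ)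
    {A μ : ℂ} {α s : ℝ} (hA : A ≠ 0) (hμ : ∀ n : ℕ, μ ≠ -(n : ℂ)) (hsα : s * α ≠ 0) :
    (fun r => leadingIJ g x p A μ α s r) =Θ[atTop] fun r : ℝ => r ^ (μ.re - 3 / 2) := by
  set K := gradSq g p * √(gradSq g p) ^ (μ.re - 3 / 2) with hK
  have hK0 : 0 < K := mul_pos hD (Real.rpow_pos_of_pos (Real.sqrt_pos.mpr hD) _)
  have hL : A * closedI (s * α) * closedJ μ 1 s ≠ 0 :=
    mul_ne_zero (mul_ne_zero hA (closedI_ne_zero hsα)) (closedJ_one_ne_zero hμ s)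
  have key : ∀ r : ℝ, 0 < r → ‖leadingIJ g x p A μ α s r‖
      = ‖A * closedI (s * α) * closedJ μ 1 s‖ / K * ‖r ^ (μ.re - 3 / 2)‖ := by
    intro r hr
    have h1 := congrArg norm (normalizer_mul_leadingIJ hD x A μ α s hr)
    have h2 := norm_normalizer hD x μ hr
    have hr1 : 0 < r ^ (μ.re - 3 / 2) := Real.rpow_pos_of_pos hr _
    rw [norm_mul] at h1
    rw [Real.norm_of_nonneg hr1.le, ← h1, hK, ← h2]
    have hn : ‖normalizer g x p μ r‖ ≠ 0 := fun h => by
      rw [h, zero_mul] at h2; exact hK0.ne h2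
    field_simp
  have hnL := norm_pos_iff.mpr hL
  constructor
  · refine IsBigO.of_bound (‖A * closedI (s * α) * closedJ μ 1 s‖ / K) ?_
    filter_upwards [eventually_gt_atTop 0] with r hr using (key r hr).le
  · refine IsBigO.of_bound (K / ‖A * closedI (s * α) * closedJ μ 1 s‖) ?_
    filter_upwards [eventually_gt_atTop 0] with r hr
    rw [key r hr]
    refine le_of_eq ?_
    field_simp

lemma not_isExpSmall_of_isTheta {u : ℝ → ℂ} {b : ℝ} (h : u =Θ[atTop] fun r : ℝ => r ^ b) :
    ¬ IsExpSmall u := by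
  rintro ⟨c, hc, hu⟩
  have h1 : (fun r : ℝ => r ^ b) =O[atTop] fun r => Real.exp (-(c * r)) := h.2.trans hu
  have h2 : (fun r : ℝ => Real.exp (-(c * r))) =o[atTop] fun r : ℝ => r ^ b := by
    simpa [neg_mul] using isLittleO_exp_neg_mul_rpow_atTop hc b
  refine isLittleO_irrefl' ?_ (h1.trans_isLittleO h2)
  refine Eventually.frequently ?_
  filter_upwards [eventually_gt_atTop 0] with r hr
  exact (norm_pos_iff.mpr (Real.rpow_pos_of_pos hr _).ne').ne'

lemma integrableOn_localIntegrand {F : ℂ × ℂ → ℂ} {O : Set (ℂ × ℂ)} (hF : ContinuousOn F O)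
    {η : ℝ × ℝ → ℝ × ℝ} (hη : LocallyLipschitz η) {B : Set (ℝ × ℝ)} (hB : IsCompact B)
    (hmem : ∀ q ∈ B, surf η q ∈ O) (x : ℝ × ℝ) : IntegrableOn (localIntegrand F η x) B := by
  refine integrableOn_surf (f := fun ξ => F ξ * Complex.exp (-(Complex.I * dotC x ξ)))
    (hF.mul ?_) hη hB hmem
  refine Continuous.continuousOn ?_
  unfold dotC
  fun_prop

end

theorem mainTheorem2 {ι : Type*} [Finite ι] (g : ι → ℂ × ℂ → ℂ)
    (hg : ∀ k, HasRealProperty (g k))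
    -- the initial integration surface
    (η : ℝ × ℝ → ℝ × ℝ) (hη : IsAdmissible g Set.univ η)
    -- the observation direction
    (x : ℝ × ℝ) (hx : x.1 ^ 2 + x.2 ^ 2 = 1)
    -- the point, on exactly one singularity component, an isolated active SOS
    (j : ι) (p : ℝ × ℝ) (hp : g j (toC p) = 0) (hpk : ∀ k, k ≠ j → g k (toC p) ≠ 0)
    (hsos : IsSOS (g j) x p) (hact : IsActive g η x p)
    (hiso : ∀ᶠ q in 𝓝[≠] p, ¬ IsActive g η x q)
    (α : ℝ) (hα : IsCurvatureCoeff (g j) p α) (hα0 : α ≠ 0)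
    -- the branch of the integrand near the point: a singular component with the prescribed
    -- leading behaviour, plus a holomorphic one
    (U : Set (ℂ × ℂ)) (hU : IsOpen U) (hpU : toC p ∈ U)
    (Ω : Set (ℂ × ℂ)) (hΩ : Ω = slitDomain (g j) (bridgeSign (g j) η p) U)
    (F Fsing Freg : ℂ × ℂ → ℂ) (hF : ∀ ξ ∈ Ω, F ξ = Fsing ξ + Freg ξ)
    (hsing : DifferentiableOn ℂ Fsing Ω) (hreg : DifferentiableOn ℂ Freg U)
    (A μ : ℂ)
    (hlead : (fun ξ => Fsing ξ - A * branchPow (bridgeSign (g j) η p) (g j ξ) (-μ))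
      =o[𝓝[Ω] (toC p)] fun ξ => branchPow (bridgeSign (g j) η p) (g j ξ) (-μ)) :
    -- values of the integrals; `closedJ` is also the analytic continuation in the exponent
    (∀ a : ℝ, a ≠ 0 → HasIntegralI a (closedI a)) ∧
    (∀ a s : ℝ, a ≠ 0 → (s = 1 ∨ s = -1) →
      (∀ ν : ℂ, 0 < ν.re → ∀ ε : ℝ, 0 < ε → HasIntegralJ ν a s ε (closedJ ν a s)) ∧
      Differentiable ℂ (fun ν => closedJ ν a s)) ∧
    ∃ s : ℝ, (s = 1 ∨ s = -1) ∧ x = s • unitNormal (g j) p ∧ s = bridgeSign (g j) η p ∧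
      -- local deformed surfaces exist over arbitrarily small neighbourhoods
      (∀ W ∈ 𝓝 p, ∃ B ⊆ W, ∃ η', IsLocalSurface g η Ω x p B η') ∧
      -- the two forms of the leading term agree
      (∀ r : ℝ, 0 < r → leadingIJ (g j) x p A μ α s r = leadingExplicit (g j) x p A μ α s r) ∧
      -- the estimate, for all local deformed surfaces over small neighbourhoods
      ∃ V ∈ 𝓝 p, ∀ B ⊆ V, ∀ η', IsLocalSurface g η Ω x p B η' →
        (∀ r : ℝ, MeasureTheory.IntegrableOn (localIntegrand F η' (r • x)) B) ∧
        (fun r : ℝ => uLoc F B η' (r • x) - leadingIJ (g j) x p A μ α s r)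
          =o[atTop] (fun r : ℝ => r ^ (μ.re - 3 / 2)) ∧
        (A ≠ 0 → (∀ n : ℕ, μ ≠ -(n : ℂ)) →
          (fun r : ℝ => uLoc F B η' (r • x)) ~[atTop] (fun r => leadingIJ (g j) x p A μ α s r) ∧
          (fun r : ℝ => uLoc F B η' (r • x)) =Θ[atTop] (fun r : ℝ => r ^ (μ.re - 3 / 2)) ∧
          ¬ IsExpSmall (fun r : ℝ => uLoc F B η' (r • x))) := by
  have hD := gradSq_pos (hg j) hp
  have hnt := hη.nontangent j p (mem_univ _) hp
  have hs := bridgeSign_eq hnt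
  have hxs := eq_bridgeSign_smul_unitNormal hg hη hx hp hsos hact
  refine ⟨fun a ha => hasIntegralI_closedI ha,
    fun a s ha hs => ⟨fun ν hν ε hε => hasIntegralJ_closedJ ha hs hν hε, differentiable_closedJ s⟩,
    bridgeSign (g j) η p, hs, hxs, rfl, ?_⟩
  -- `bridgeSign` is replaced by a variable `s` throughout
  generalize hsb : bridgeSign (g j) η p = s at hs hxs hΩ hlead ⊢
  subst hΩ
  -- the sign of `α` determines the direction in which `z` is turned
  obtain ⟨σ, hσ, hασ⟩ : ∃ σ : ℝ, (σ = 1 ∨ σ = -1) ∧ α = σ * |α| := by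
    rcases lt_or_gt_of_ne hα0 with h | h
    · exact ⟨-1, Or.inr rfl, by rw [abs_of_neg h]; ring⟩
    · exact ⟨1, Or.inl rfl, by rw [abs_of_pos h]; ring⟩
  have ha : 0 < |α| := abs_pos.mpr hα0
  have hα' : IsCurvatureCoeff (g j) p (σ * |α|) := by rwa [← hασ]
  have hτ : s * σ = 1 ∨ s * σ = -1 := by
    rcases hs with rfl | rfl <;> rcases hσ with rfl | rfl <;> norm_num
  have hsσ : s * σ * (s * α) = |α| := by
    have h1 : s * s = 1 := by rcases hs with rfl | rfl <;> norm_num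
    have h2 : σ * σ = 1 := by rcases hσ with rfl | rfl <;> norm_num
    rw [hασ, abs_mul, abs_abs]
    have h3 : |σ| = 1 := by rcases hσ with rfl | rfl <;> norm_num
    rw [h3, one_mul]
    linear_combination |α| * σ * σ * h1 + |α| * h2
  have hsα : s * α ≠ 0 := fun h => by rw [h, mul_zero] at hsσ; exact ha.ne hsσ
  have hI : closedI (s * α) = (1 - Complex.I * s * σ) * (√(Real.pi / (2 * |α|)) : ℂ) := by
    rw [closedI_eq hτ (by rw [hsσ]; exact ha), hsσ, Complex.ofReal_mul, mul_assoc]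
  refine ⟨fun W hW => exists_isLocalSurface hg hη hp hpk hiso hs hsb.symm hxs hσ ha hα' hU hpU hW,
    fun r hr => leadingIJ_eq_leadingExplicit hD x A μ α s hr, ?_⟩
  obtain ⟨V, hV, hlim⟩ := exists_nhds_tendsto_uLoc hg hη hp hs hsb.symm hxs hσ ha hα' hU hpU hF
    hsing hreg hlead
  refine ⟨V, hV, fun B hB η' hloc => ?_⟩
  have hu : Tendsto (fun r => normalizer (g j) x p μ r * uLoc F B η' (r • x)) atTop
      (𝓝 (A * closedI (s * α) * closedJ μ 1 s)) := by
    rw [hI, ← mul_assoc]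
    refine (hlim B hB η' hloc).congr fun r => ?_
    rw [normalizer, mul_assoc, mul_assoc, mul_assoc, mul_assoc, mul_assoc]
  have ho := isLittleO_sub_leadingIJ hD hu
  have hcont : ContinuousOn F (slitDomain (g j) s U) :=
    (hsing.continuousOn.add (hreg.mono fun ξ hξ => hξ.1).continuousOn).congr hF
  refine ⟨fun r => integrableOn_localIntegrand hcont hloc.admissible.lipschitz hloc.compact
    (fun q hq => by simpa using hloc.in_domain 1 one_pos le_rfl q hq) _, ho, fun hA hμ => ?_⟩
  have hΘ := isTheta_leadingIJ hD x hA hμ hsα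
  have heq : (fun r : ℝ => uLoc F B η' (r • x)) ~[atTop]
      fun r => leadingIJ (g j) x p A μ α s r := ho.trans_isBigO hΘ.2
  have hΘu := heq.isTheta.trans hΘ
  exact ⟨heq, hΘu, not_isExpSmall_of_isTheta hΘu⟩
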